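/- Let $k$ be a perfect field of characteristic $p>0$ and let $A$ be a $k$-algebra with étale coordinates $T_1,\dots,T_n$, i.e. $k[T_1,\dots,T_n]\to A$ is étale. Let $m\in\mathbb Z$. **Witt-differential operators.** A Hasse–Schmidt derivation $D=(D_0=\mathrm{id},D_1,\dots)$ of $A$ over $k$ lifts to a Hasse–Schmidt derivation of any flat lift $\mathcal A_{r+1}$ of $A$ over $W_{r+1}(k)$. Any such lift preserves the image of the embedding $W_{r+1}(A)\to\mathcal A_{r+1}$, $(f_0,\dots,f_r)\mapsto\sum_i p^i\tilde f_i^{\,p^{r-i}}$, and its restriction $\tilde D$ to $W_{r+1}(A)$ is independent of choices (the canonical lift of $D$). For $s\ge0$ put $F^{-s}(a)\cdot V^s(b)=V^s(ab)$. Let $\mathcal EW^{(m)}_{r+1}(A)$ (for $r\ge -m$) be the $W_{r+1}(A)$-module of operators on $W_{r+1}(A)$ generated by the $F^{\mathrm{val}(i)-r}(a)\cdot\tilde D_i$ with $a\in W_{r+1}(A)$, $0<i\le p^{r+m}$ and $D$ a Hasse–Schmidt derivation of length $i$. Let $\mathcal EW^{(m)}(A)=\varprojlim_r\mathcal EW^{(m)}_{r+1}(A)$,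 a set of $W(k)$-linear endomorphisms of $W(A)$ preserving all $V^i(W(A))$. Let $\mathcal D^{(m)}_{W(A)}$ be the ring of endomorphisms of $W(A)$ generated by $W(A)$ and $\mathcal EW^{(m)}(A)$, and let $I^{(r)}$ be its two-sided ideal generated by $V^r(W(A))$ and the $\varphi\in\mathcal EW^{(m)}(A)$ with $\varphi(W(A))\subseteq V^r(W(A))$. Finally $\widehat{\mathcal D}^{(m)}_{W(A)}=\varprojlim_r\mathcal D^{(m)}_{W(A)}/I^{(r)}$ with the inverse limit topology; it acts on $W(A)$. **Coordinates.** Let $\partial_l^{[i]}$ be the Hasse–Schmidt derivations of $A$ with $\partial_l^{[i]}(T_l^j)=\binom jiT_l^{j-i}$ and $\partial_l^{[i]}(T_{l'}^j)=0$ for $l'\ne l$, $i>0$. For $q\in\mathbb Z[1/p]_{\ge0}$ let $\{\partial_l\}_q$ be the operator on $W(A)$ that acts on $W_{r+1}(A)$ as the canonical lift of $\partial_l^{[qp^r]}$ if $qp^r\in\mathbb N$ and as $0$ otherwise. Put $\{\partial\}_{J/p^r}=\prod_l\{\partial_l\}_{j_l/p^r}$ and $\{\partial\}^I_{p^m}=\prod_l\{\partial_l\}_{p^m}^{i_l}$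 for $J,I\in\mathbb N^n$. **Theorem.** (1) Every $Q\in\widehat{\mathcal D}^{(m)}_{W(A)}$ can be written as a convergent sum $$Q=\sum_{I\in\mathbb N^n}\Big(\big(B_I+F^{-\rho(I)}(a_I)\big)\{\partial\}_{p^m}^I\Big),\qquad B_I=\sum_{r\ge1}\sum_{J}F^{-r}(\alpha_{I,r,J})\{\partial\}_{J/p^r}+\sum_K\alpha_{I,K}\{\partial\}_K,$$ where $a_I,\alpha_{I,r,J},\alpha_{I,K}\in W(A)$; $J=(j_1,\dots,j_n)$ runs over the multi-indices with $0\le j_l<p^{r+m}$ for all $l$ and $p\nmid j_l$ for at least one $l$; $K\neq0$ runs over the multi-indices with $0\le k_l<p^m$ for all $l$ (no such $K$ if $m\le0$); $\rho(I)=0$ if $m\ge0$ or $I=0$, and $\rho(I)=-m$ if $m<0$ and $I\ne0$; and $B_I\to0$ in $\widehat{\mathcal D}^{(m)}_{W(A)}$ and $a_I\to0$ in the $V$-adic topology of $W(A)$ as $I\to\infty$. All terms $F^{-r}(\alpha)\{\partial\}_{J/p^r}$, $\alpha\{\partial\}_K$, $F^{-\rho(I)}(a)\{\partial\}^I_{p^m}$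 lie in $\mathcal D^{(m)}_{W(A)}$. The coefficients $a_I$, $\alpha_{I,r,J}$, $\alpha_{I,K}$ are uniquely determined by $Q$ (even among all convergent expressions of this form, without the requirement that $B_I\to 0$ and $a_I\to0$). (2) The action of $\widehat{\mathcal D}^{(m)}_{W(A)}$ on $W(A)$ is faithful. (3) Let $m\ge0$. There is an étale $W(k)[S_1,\dots,S_n]$-algebra $\mathcal A$ with $\mathcal A/p\cong A$, $S_l\mapsto T_l$. For each such $\mathcal A$ let $\mathcal D^{(m)}_{\mathcal A}\subseteq\mathrm{End}_{W(k)}(\mathcal A)$ be the subalgebra generated by $\mathcal A$ and the $\partial_l^{[i]}$, $0\le i\le p^m$ (the operators with respect to the coordinates $S$), and let $\mathcal D^{(m)}_A=\mathcal D^{(m)}_{\mathcal A}/p$ (Berthelot's ring of differential operators of level $m$). Let $\widehat I^{(1)}$ be the completion of $I^{(1)}$, i.e. the kernel of $\widehat{\mathcal D}^{(m)}_{W(A)}\to\mathcal D^{(m)}_{W(A)}/I^{(1)}$. Then there is a ring isomorphism $$\widehat{\mathcal D}^{(m)}_{W(A)}/\widehat I^{(1)}\;\xrightarrow{\ \sim\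 }\;\mathcal D_A^{(m)}$$ which sends $c\in W(A)$ to its first component $c_0\in A$, and $\{\partial_l\}_i$ to $\partial_l^{[i]}$ for $0\le i\le p^m$. -/

import Mathlib

open Filter Topology

universe u

noncomputable section

namespace WittDiff

/-! ### Hasse-Schmidt derivations -/

/-- `D = (D 0, D 1, …)` is a Hasse-Schmidt derivation of `B` over `R` of length `N`
(`N = ⊤` is allowed); only the entries of index `≤ N` matter. -/
def IsHasseSchmidt (R : Type*) {B : Type*} [CommRing R] [CommRing B] [Algebra R B]
    (N : ℕ∞) (D : ℕ → Module.End R B) : Prop :=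
  D 0 = LinearMap.id ∧
    ∀ l : ℕ, (l : ℕ∞) ≤ N → ∀ x y : B,
      D l (x * y) = ∑ ij ∈ Finset.HasAntidiagonal.antidiagonal l, D ij.1 x * D ij.2 y

/-- The operators `∂ l i = ∂_l^{[i]}` attached to coordinates `T`: Hasse-Schmidt derivations of
infinite length with `∂_l^{[i]}(T_l^j) = (j choose i) T_l^{j-i}` and `∂_l^{[i]}(T_{l'}^j) = 0`
for `l' ≠ l`, `i > 0`. They are unique when `T` is a system of étale coordinates. -/
def IsCoordinateHS (R : Type*) {B : Type*} [CommRing R] [CommRing B] [Algebra R B] {n : ℕ}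
    (T : Fin n → B) (del : Fin n → ℕ → Module.End R B) : Prop :=
  (∀ l, IsHasseSchmidt R ⊤ (del l)) ∧
  (∀ l i j, del l i (T l ^ j) = (j.choose i : B) * T l ^ (j - i)) ∧
  (∀ l l' i j, l' ≠ l → 0 < i → del l i (T l' ^ j) = 0)

/-- `T` is a system of étale coordinates of the `R`-algebra `B`: the map `R[T_1, …, T_n] → B` is
étale. -/
def IsEtaleCoordinates (R : Type*) {B : Type*} [CommRing R] [CommRing B] [Algebra R B] {n : ℕ}
    (T : Fin n → B) : Prop :=
  (MvPolynomial.aeval T : MvPolynomial (Fin n) R →ₐ[R] B).toRingHom.Etale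

section

variable (p : ℕ) [Fact p.Prime] (k : Type u) [Field k] (A : Type u) [CommRing A] [Algebra k A]

/-! ### Canonical lifts to truncated Witt vectors -/

/-- `L` is a flat lift of `A` over `W_{r+1}(k)`: `L` is flat, and `π` induces `L / p ≃ A`. -/
def IsFlatLift (r : ℕ) (L : Type u) [CommRing L] [Algebra (TruncatedWittVector p (r + 1) k) L]
    (π : L →+* A) : Prop :=
  Module.Flat (TruncatedWittVector p (r + 1) k) L ∧ Function.Surjective π ∧
    RingHom.ker π = Ideal.span {(p : L)} ∧
    ∀ c : TruncatedWittVector p (r + 1) k, π (algebraMap _ L c) = algebraMap k A (c.coeff 0)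

/-- `E` is the `j`-th component, on `W_{r+1}(A)`, of the canonical lift of the Hasse-Schmidt
derivation `D` of length `N` of `A` over `k`. There are a flat lift `L` of `A` over `W_{r+1}(k)` and
a lift `D'` of `D` to a Hasse-Schmidt derivation of `L` over `W_{r+1}(k)` such that `E` is the
restriction of `D' j` along the embedding
`W_{r+1}(A) → L`, `(f_0, …, f_r) ↦ ∑ i, p ^ i * f̃_i ^ (p ^ (r - i))` (`f̃_i ∈ L` any lift of `f_i`).
-/
def IsCanonicalLift (r : ℕ) (N : ℕ∞) (D : ℕ → Module.End k A) (j : ℕ)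
    (E : TruncatedWittVector p (r + 1) A →+ TruncatedWittVector p (r + 1) A) : Prop :=
  ∃ (L : Type u) (_ : CommRing L) (_ : Algebra (TruncatedWittVector p (r + 1) k) L)
    (π : L →+* A) (D' : ℕ → Module.End (TruncatedWittVector p (r + 1) k) L),
    IsFlatLift p k A r L π ∧
    IsHasseSchmidt (TruncatedWittVector p (r + 1) k) N D' ∧
    (∀ i : ℕ, (i : ℕ∞) ≤ N → ∀ b : L, π (D' i b) = D i (π b)) ∧
    ∀ (x : TruncatedWittVector p (r + 1) A) (y z : Fin (r + 1) → L),
      (∀ i, π (y i) = x.coeff i) → (∀ i, π (z i) = (E x).coeff i) →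
      ∑ i : Fin (r + 1), (p : L) ^ (i : ℕ) * z i ^ p ^ (r - i) =
        D' j (∑ i : Fin (r + 1), (p : L) ^ (i : ℕ) * y i ^ p ^ (r - i))

/-! ### Witt-differential operators -/

/-- The ideal `V^r(W(A))` of `W(A)`; see `mem_filV_iff`. -/
def filV (r : ℕ) : Ideal (WittVector p A) := RingHom.ker (WittVector.truncate (p := p) (R := A) r)

variable {A} in
theorem mem_filV_iff (r : ℕ) (x : WittVector p A) :
    x ∈ filV p A r ↔ ∃ y : WittVector p A, x = WittVector.verschiebung^[r] y := by
  rw [filV, WittVector.mem_ker_truncate]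
  constructor
  · intro h
    exact ⟨_, WittVector.eq_iterate_verschiebung h⟩
  · rintro ⟨y, rfl⟩ i hi
    exact WittVector.iterate_verschiebung_coeff_eq_zero y hi

/-- `φ = F^{v - r}(a) · ψ` on `W_{r+1}(A)`. For `r ≤ v` this is multiplication by the Witt vector
`F^{v-r}(a)`. For `v < r` the operator `ψ` has values in `V^{r-v}(W_{r+1}(A))`, and the
multiplication is `F^{-s}(a) · V^s(b) = V^s(a b)`, `s = r - v`. -/
def IsFrobMulTrunc (r v : ℕ) (a : WittVector p A)
    (ψ φ : TruncatedWittVector p (r + 1) A →+ TruncatedWittVector p (r + 1) A) : Prop :=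
  (r ≤ v → ∀ x, φ x =
    WittVector.truncate (r + 1) (WittVector.frobenius^[v - r] a) * ψ x) ∧
  (v < r → ∀ x, ∃ b : WittVector p A,
    ψ x = WittVector.truncate (r + 1) (WittVector.verschiebung^[r - v] b) ∧
    φ x = WittVector.truncate (r + 1) (WittVector.verschiebung^[r - v] (a * b)))

/-- Elementary Witt-differential operators of level `≤ m` on `W_{r+1}(A)`: the operators
`F^{val(i) - r}(a) · D̃_i`, where `D̃` is the canonical lift of a Hasse-Schmidt derivation of `A` over
`k` of length `i`, `0 < i ≤ p^{r+m}`. -/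
def IsElementary (m : ℤ) (r : ℕ)
    (φ : TruncatedWittVector p (r + 1) A →+ TruncatedWittVector p (r + 1) A) : Prop :=
  ∃ (i : ℕ) (D : ℕ → Module.End k A)
    (E : TruncatedWittVector p (r + 1) A →+ TruncatedWittVector p (r + 1) A)
    (a : WittVector p A),
    0 < i ∧ (i : ℚ) ≤ (p : ℚ) ^ ((r : ℤ) + m) ∧ IsHasseSchmidt k (i : ℕ∞) D ∧
    IsCanonicalLift p k A r (i : ℕ∞) D i E ∧ IsFrobMulTrunc p A r (padicValNat p i) a E φ

/-- The `W_{r+1}(A)`-module `EW_{r+1}^{(m)}(A)`. -/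
def EWTrunc (m : ℤ) (r : ℕ) : Submodule (TruncatedWittVector p (r + 1) A)
    (TruncatedWittVector p (r + 1) A →+ TruncatedWittVector p (r + 1) A) :=
  Submodule.span _ {φ | IsElementary p k A m r φ}

/-- `EW^{(m)}(A) = lim_r EW_{r+1}^{(m)}(A)` (limit over `r ≥ -m`), as a set of `W(k)`-linear
endomorphisms of `W(A)` that preserve all `V^i(W(A))`. -/
def EW (m : ℤ) : Set (AddMonoid.End (WittVector p A)) :=
  {φ | (∀ (c : WittVector p k) (x : WittVector p A),
          φ (WittVector.map (algebraMap k A) c * x) =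
            WittVector.map (algebraMap k A) c * φ x) ∧
       (∀ (i : ℕ) (x : WittVector p A), x ∈ filV p A i → φ x ∈ filV p A i) ∧
       ∀ r : ℕ, -m ≤ (r : ℤ) → ∃ ψ ∈ EWTrunc p k A m r, ∀ x : WittVector p A,
          WittVector.truncate (r + 1) (φ x) = ψ (WittVector.truncate (r + 1) x)}

/-- Multiplication operators on `W(A)`. -/
def mulOp : WittVector p A →+* AddMonoid.End (WittVector p A) :=
  Module.toAddMonoidEnd (WittVector p A) (WittVector p A)

/-- The ring `D_{W(A)}^{(m)}` of uncompleted Witt-differential operators of level `≤ m`. -/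
def DW (m : ℤ) : Subring (AddMonoid.End (WittVector p A)) :=
  Subring.closure (Set.range (mulOp p A) ∪ EW p k A m)

variable {A} in
/-- Multiplication by `a ∈ W(A)` as an element of `D_{W(A)}^{(m)}`. -/
def DW.mul (m : ℤ) (a : WittVector p A) : DW p k A m :=
  ⟨mulOp p A a, Subring.subset_closure (Or.inl ⟨a, rfl⟩)⟩

/-- The two-sided ideal `I^{(r)} = (V^r(W(A)), EW^{(m),r}(A))` of `D_{W(A)}^{(m)}`, where
`EW^{(m),r}(A)` consists of the `φ ∈ EW^{(m)}(A)` with `φ(W(A)) ⊆ V^r(W(A))`. -/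
def idealI (m : ℤ) (r : ℕ) : TwoSidedIdeal (DW p k A m) :=
  TwoSidedIdeal.span
    {P | (∃ a ∈ filV p A r, P.1 = mulOp p A a) ∨
         (P.1 ∈ EW p k A m ∧ ∀ x, P.1 x ∈ filV p A r)}

/-- The completion `D̂_{W(A)}^{(m)} = lim_r D_{W(A)}^{(m)} / I^{(r)}`: the families of classes such
that any finite number of them come from one element of `D_{W(A)}^{(m)}`. -/
def DHat (m : ℤ) : Subring (∀ r : ℕ, (idealI p k A m r).ringCon.Quotient) where
  carrier := {f | ∀ r, ∃ P : DW p k A m, ∀ s ≤ r, f s = (idealI p k A m s).ringCon.mk' P}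
  mul_mem' := by
    intro f g hf hg r
    obtain ⟨P, hP⟩ := hf r
    obtain ⟨Q, hQ⟩ := hg r
    exact ⟨P * Q, fun s hs => by rw [Pi.mul_apply, hP s hs, hQ s hs, map_mul]⟩
  one_mem' := fun r => ⟨1, fun s _ => by rw [Pi.one_apply, map_one]⟩
  add_mem' := by
    intro f g hf hg r
    obtain ⟨P, hP⟩ := hf r
    obtain ⟨Q, hQ⟩ := hg r
    exact ⟨P + Q, fun s hs => by rw [Pi.add_apply, hP s hs, hQ s hs, map_add]⟩
  zero_mem' := fun r => ⟨0, fun s _ => by rw [Pi.zero_apply, map_zero]⟩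
  neg_mem' := by
    intro f hf r
    obtain ⟨P, hP⟩ := hf r
    exact ⟨-P, fun s hs => by rw [Pi.neg_apply, hP s hs, map_neg]⟩

/-- The inverse limit topology on `D̂_{W(A)}^{(m)}`, every `D_{W(A)}^{(m)} / I^{(r)}` being
discrete. -/
instance DHat.instTopologicalSpace (m : ℤ) : TopologicalSpace (DHat p k A m) :=
  TopologicalSpace.induced
    (fun f : DHat p k A m => (f : ∀ r : ℕ, (idealI p k A m r).ringCon.Quotient))
    (@Pi.topologicalSpace ℕ _ fun _ => ⊥)

/-- The canonical map `D_{W(A)}^{(m)} → D̂_{W(A)}^{(m)}`. -/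
def DHat.of (m : ℤ) : DW p k A m →+* DHat p k A m where
  toFun P := ⟨fun r => (idealI p k A m r).ringCon.mk' P, fun _ => ⟨P, fun _ _ => rfl⟩⟩
  map_one' := Subtype.ext (funext fun _ => map_one _)
  map_mul' _ _ := Subtype.ext (funext fun _ => map_mul _ _ _)
  map_zero' := Subtype.ext (funext fun _ => map_zero _)
  map_add' _ _ := Subtype.ext (funext fun _ => map_add _ _ _)

/-- The projection `D̂_{W(A)}^{(m)} → D_{W(A)}^{(m)} / I^{(r)}`. -/
def DHat.proj (m : ℤ) (r : ℕ) : DHat p k A m →+* (idealI p k A m r).ringCon.Quotient :=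
  (Pi.evalRingHom _ r).comp (DHat p k A m).subtype

/-- The ideal of `D̂_{W(A)}^{(m)}` that is the completion of `I^{(r)}`: the kernel of the projection
to `D_{W(A)}^{(m)} / I^{(r)}`, which is the closure of the image of `I^{(r)}`. -/
def DHat.ideal (m : ℤ) (r : ℕ) : TwoSidedIdeal (DHat p k A m) :=
  TwoSidedIdeal.ker (DHat.proj p k A m r)

/-! ### The action of the completion on `W(A)` -/

theorem DW.map_filV (m : ℤ) (P : DW p k A m) (i : ℕ) (x : WittVector p A) (hx : x ∈ filV p A i) :
    P.1 x ∈ filV p A i := by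
  obtain ⟨P, hP⟩ := P
  change P x ∈ filV p A i
  induction hP using Subring.closure_induction generalizing x with
  | mem P h =>
    rcases h with ⟨a, rfl⟩ | h
    · exact Ideal.mul_mem_left _ a hx
    · exact h.2.1 i x hx
  | zero => exact zero_mem _
  | one => exact hx
  | add P Q _ _ hP hQ => exact add_mem (hP x hx) (hQ x hx)
  | neg P _ hP => exact neg_mem (hP x hx)
  | mul P Q _ _ hP hQ => exact hP _ (hQ x hx)

theorem idealI_apply_mem (m : ℤ) (r : ℕ) (P : DW p k A m) (hP : P ∈ idealI p k A m r)
    (x : WittVector p A) : P.1 x ∈ filV p A r := by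
  let J : TwoSidedIdeal (DW p k A m) := TwoSidedIdeal.mk'
    {P | ∀ x, P.1 x ∈ filV p A r}
    (fun x => zero_mem _) (fun hP hQ x => add_mem (hP x) (hQ x)) (fun hP x => neg_mem (hP x))
    (fun {P Q} hQ x => DW.map_filV p k A m P r _ (hQ x)) (fun {P Q} hP x => hP (Q.1 x))
  have hJ : idealI p k A m r ≤ J := by
    refine TwoSidedIdeal.span_le.2 ?_
    rintro P (⟨a, ha, h⟩ | ⟨-, h⟩)
    · refine (TwoSidedIdeal.mem_mk' _ _ _ _ _ _ _).2 fun x => ?_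
      rw [h]
      exact Ideal.mul_mem_right x _ ha
    · exact (TwoSidedIdeal.mem_mk' _ _ _ _ _ _ _).2 h
  exact (TwoSidedIdeal.mem_mk' _ _ _ _ _ _ _).1 (hJ hP) x

theorem truncate_eq_of_mk_eq (m : ℤ) (r : ℕ) (P Q : DW p k A m)
    (h : (idealI p k A m r).ringCon.mk' P = (idealI p k A m r).ringCon.mk' Q)
    (x : WittVector p A) :
    WittVector.truncate r (P.1 x) = WittVector.truncate r (Q.1 x) := by
  have h1 : P - Q ∈ idealI p k A m r := by
    rw [← TwoSidedIdeal.ker_ringCon_mk' (idealI p k A m r), TwoSidedIdeal.mem_ker, map_sub, h,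
      sub_self]
  have h2 : P.1 x - Q.1 x ∈ filV p A r := idealI_apply_mem p k A m r _ h1 x
  rwa [filV, RingHom.mem_ker, map_sub, sub_eq_zero] at h2

/-- The result of the action of `f` on `x`: its class modulo `V^{i+1}(W(A))` is that of `P x` for
any `P ∈ D_{W(A)}^{(m)}` which is congruent to `f` modulo `I^{(i+1)}`; see `DHat.truncate_act`. -/
def DHat.act (m : ℤ) (f : DHat p k A m) (x : WittVector p A) : WittVector p A :=
  WittVector.mk p fun i => ((f.2 (i + 1)).choose.1 x).coeff i

theorem DHat.truncate_act (m : ℤ) (f : DHat p k A m) (x : WittVector p A) (r : ℕ)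
    (P : DW p k A m) (hP : f.1 r = (idealI p k A m r).ringCon.mk' P) :
    WittVector.truncate r (DHat.act p k A m f x) = WittVector.truncate r (P.1 x) := by
  ext i
  rw [WittVector.coeff_truncate, WittVector.coeff_truncate]
  obtain ⟨Q, hQ⟩ := f.2 r
  have h1 := (f.2 (i + 1)).choose_spec (i + 1) le_rfl
  have h2 := truncate_eq_of_mk_eq p k A m (i + 1) _ _ (h1.symm.trans (hQ (i + 1) i.2)) x
  have h3 := truncate_eq_of_mk_eq p k A m r _ _ ((hQ r le_rfl).symm.trans hP) x
  have h4 := congrArg (TruncatedWittVector.coeff (Fin.last (i : ℕ))) h2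
  have h5 := congrArg (TruncatedWittVector.coeff i) h3
  rw [WittVector.coeff_truncate, WittVector.coeff_truncate] at h4 h5
  exact h4.trans h5

theorem eq_of_truncate_eq (x y : WittVector p A)
    (h : ∀ r, WittVector.truncate r x = WittVector.truncate r y) : x = y := by
  ext i
  have h1 := congrArg (TruncatedWittVector.coeff (Fin.last i)) (h (i + 1))
  rwa [WittVector.coeff_truncate, WittVector.coeff_truncate] at h1

theorem DHat.act_add_right (m : ℤ) (f : DHat p k A m) (x y : WittVector p A) :
    DHat.act p k A m f (x + y) = DHat.act p k A m f x + DHat.act p k A m f y := by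
  refine eq_of_truncate_eq p A _ _ fun r => ?_
  obtain ⟨P, hP⟩ := f.2 r
  rw [map_add, DHat.truncate_act p k A m f _ r P (hP r le_rfl),
    DHat.truncate_act p k A m f _ r P (hP r le_rfl),
    DHat.truncate_act p k A m f _ r P (hP r le_rfl), map_add, map_add]

theorem DHat.act_of (m : ℤ) (P : DW p k A m) (x : WittVector p A) :
    DHat.act p k A m (DHat.of p k A m P) x = P.1 x :=
  eq_of_truncate_eq p A _ _ fun r => DHat.truncate_act p k A m _ x r P rfl

theorem DHat.act_add (m : ℤ) (f g : DHat p k A m) (x : WittVector p A) :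
    DHat.act p k A m (f + g) x = DHat.act p k A m f x + DHat.act p k A m g x := by
  refine eq_of_truncate_eq p A _ _ fun r => ?_
  obtain ⟨P, hP⟩ := f.2 r
  obtain ⟨Q, hQ⟩ := g.2 r
  have h0 : (f + g).1 r = (idealI p k A m r).ringCon.mk' (P + Q) := by
    rw [map_add, ← hP r le_rfl, ← hQ r le_rfl]
    rfl
  rw [DHat.truncate_act p k A m (f + g) x r (P + Q) h0, map_add,
    DHat.truncate_act p k A m f x r P (hP r le_rfl),
    DHat.truncate_act p k A m g x r Q (hQ r le_rfl), ← map_add]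
  rfl

theorem DHat.act_mul (m : ℤ) (f g : DHat p k A m) (x : WittVector p A) :
    DHat.act p k A m (f * g) x = DHat.act p k A m f (DHat.act p k A m g x) := by
  refine eq_of_truncate_eq p A _ _ fun r => ?_
  obtain ⟨P, hP⟩ := f.2 r
  obtain ⟨Q, hQ⟩ := g.2 r
  have h0 : (f * g).1 r = (idealI p k A m r).ringCon.mk' (P * Q) := by
    rw [map_mul, ← hP r le_rfl, ← hQ r le_rfl]
    rfl
  have h3 := DHat.truncate_act p k A m g x r Q (hQ r le_rfl)
  rw [DHat.truncate_act p k A m (f * g) x r (P * Q) h0,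
    DHat.truncate_act p k A m f _ r P (hP r le_rfl)]
  have h4 : P.1 (DHat.act p k A m g x - Q.1 x) ∈ filV p A r := by
    refine DW.map_filV p k A m P r _ ?_
    rw [filV, RingHom.mem_ker, map_sub, h3, sub_self]
  rw [map_sub, filV, RingHom.mem_ker, map_sub, sub_eq_zero] at h4
  rw [h4]
  rfl

/-- The action of `D̂_{W(A)}^{(m)}` on `W(A)`. -/
def DHat.toEnd (m : ℤ) : DHat p k A m →+* AddMonoid.End (WittVector p A) where
  toFun f := AddMonoidHom.mk' (DHat.act p k A m f) (DHat.act_add_right p k A m f)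
  map_zero' := AddMonoidHom.ext fun x => by
    have h := DHat.act_of p k A m 0 x
    rw [map_zero] at h
    exact h
  map_one' := AddMonoidHom.ext fun x => by
    have h := DHat.act_of p k A m 1 x
    rw [map_one] at h
    exact h
  map_add' f g := AddMonoidHom.ext fun x => DHat.act_add p k A m f g x
  map_mul' f g := AddMonoidHom.ext fun x => DHat.act_mul p k A m f g x

/-! ### Operators in local coordinates -/

/-- `P` is the operator `{D}_q` on `W(A)`, `q ∈ ℚ`, attached to a Hasse-Schmidt derivation `D` of
infinite length: on `W_{r+1}(A)` it is the canonical lift of `D_{q p^r}` if `q p^r` is a natural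
number, and zero otherwise. (For `q = j p^s` this is `{D}_{j p^s}`.) -/
def IsWittHasse (D : ℕ → Module.End k A) (q : ℚ) (P : AddMonoid.End (WittVector p A)) : Prop :=
  ∀ r : ℕ, ∃ E : TruncatedWittVector p (r + 1) A →+ TruncatedWittVector p (r + 1) A,
    (∀ x, WittVector.truncate (r + 1) (P x) = E (WittVector.truncate (r + 1) x)) ∧
    (∀ i : ℕ, (i : ℚ) = q * (p : ℚ) ^ r → IsCanonicalLift p k A r ⊤ D i E) ∧
    ((¬ ∃ i : ℕ, (i : ℚ) = q * (p : ℚ) ^ r) → E = 0)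

/-- `Q = F^{-s}(a) · P`: the operator `P` has values in `V^s(W(A))`, and
`F^{-s}(a) · V^s(b) = V^s(a b)`. -/
def IsFrobMul (s : ℕ) (a : WittVector p A) (P Q : AddMonoid.End (WittVector p A)) : Prop :=
  ∀ x, ∃ b : WittVector p A,
    P x = WittVector.verschiebung^[s] b ∧ Q x = WittVector.verschiebung^[s] (a * b)

end

/-- The nonzero multi-indices `num / p ^ den` with entries in `[0, p^m)`: either `den = r ≥ 1` and
`num = J` has an entry prime to `p`, or `den = 0` and `num = K`. -/
structure BasisIndex (p n : ℕ) (m : ℤ) where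
  den : ℕ
  num : Fin n → ℕ
  lt : ∀ l, (num l : ℚ) / (p : ℚ) ^ den < (p : ℚ) ^ m
  ne_zero : num ≠ 0
  reduced : den = 0 ∨ ∃ l, ¬ p ∣ num l

section

variable (p : ℕ) [Fact p.Prime] (k : Type u) [Field k] {A : Type u} [CommRing A] [Algebra k A]
  {n : ℕ}

/-- `{∂}_{J/p^r} = {∂_1}_{j_1/p^r} ⋯ {∂_n}_{j_n/p^r}`. -/
def fracOp (op : Fin n → ℚ → AddMonoid.End (WittVector p A)) {m : ℤ} (i : BasisIndex p n m) :
    AddMonoid.End (WittVector p A) :=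
  (List.ofFn fun l => op l ((i.num l : ℚ) / (p : ℚ) ^ i.den)).prod

/-- `{∂}_{p^m}^I = {∂_1}_{p^m}^{i_1} ⋯ {∂_n}_{p^m}^{i_n}`. -/
def powOp (op : Fin n → ℚ → AddMonoid.End (WittVector p A)) (m : ℤ) (I : Fin n → ℕ) :
    AddMonoid.End (WittVector p A) :=
  (List.ofFn fun l => op l ((p : ℚ) ^ m) ^ I l).prod

/-- The basic operators of level `≤ m` attached to the coordinates `T`:
`op l q = {∂_l}_q`; `frac i α = F^{-r}(α) {∂}_{J/p^r}` (and `α {∂}_K`, for `r = 0`);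
`pow I = {∂}_{p^m}^I`; and `head I α = F^{-ρ}(α) {∂}_{p^m}^I`, where `ρ = 0` if `I = 0` or `m ≥ 0`,
so that `head I α = α {∂}_{p^m}^I` in this case, and `ρ = -m` otherwise. -/
structure IsBasicOperators (T : Fin n → A) (m : ℤ)
    (op : Fin n → ℚ → AddMonoid.End (WittVector p A))
    (frac : BasisIndex p n m → WittVector p A → DW p k A m)
    (pow : (Fin n → ℕ) → DW p k A m)
    (head : (Fin n → ℕ) → WittVector p A → DW p k A m) : Prop where
  op_spec : ∃ del : Fin n → ℕ → Module.End k A, IsCoordinateHS k T del ∧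
    ∀ l q, IsWittHasse p k A (del l) q (op l q)
  frac_spec : ∀ i α, IsFrobMul p A i.den α (fracOp p op i) (frac i α).1
  pow_spec : ∀ I, (pow I).1 = powOp p op m I
  head_spec : ∀ I α,
    IsFrobMul p A (if I = 0 then 0 else (-m).toNat) α (powOp p op m I) (head I α).1

/-- `Q = ∑_I (B_I {∂}_{p^m}^I + F^{-ρ(I)}(a_I) {∂}_{p^m}^I)` with
`B_I = ∑_r ∑_J F^{-r}(α_{I,J}) {∂}_{J/p^r} + ∑_K α_{I,K} {∂}_K`, both sums convergent in
`D̂_{W(A)}^{(m)}`. -/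
def IsExpansion {m : ℤ}
    (frac : BasisIndex p n m → WittVector p A → DW p k A m)
    (pow : (Fin n → ℕ) → DW p k A m)
    (head : (Fin n → ℕ) → WittVector p A → DW p k A m)
    (Q : DHat p k A m)
    (a : (Fin n → ℕ) → WittVector p A)
    (α : (Fin n → ℕ) → BasisIndex p n m → WittVector p A)
    (B : (Fin n → ℕ) → DHat p k A m) : Prop :=
  (∀ I, HasSum (fun i => DHat.of p k A m (frac i (α I i))) (B I)) ∧
  HasSum (fun I => B I * DHat.of p k A m (pow I) + DHat.of p k A m (head I (a I))) Q

/-! ### Arithmetic differential operators of level `m` -/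

/-- `L` is an étale algebra over `W(k)[S_1, …, S_n]` and `π` induces an isomorphism `L / p ≃ A` of
`k`-algebras that sends the coordinates `S` to `T`. -/
def IsEtaleLift (T : Fin n → A) (L : Type u) [CommRing L] [Algebra (WittVector p k) L]
    (S : Fin n → L) (π : L →+* A) : Prop :=
  IsEtaleCoordinates (WittVector p k) S ∧ Function.Surjective π ∧
    RingHom.ker π = Ideal.span {(p : L)} ∧
    (∀ c : WittVector p k, π (algebraMap _ L c) = algebraMap k A (c.coeff 0)) ∧
    ∀ l, π (S l) = T l

/-- Berthelot's ring of differential operators of level `m` of the lift `L` with étale coordinates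
`S`: the subalgebra of `End_{W(k)}(L)` generated by `L` and the `∂_l^{[i]}` with `i ≤ p^m`. -/
def BerthelotD {L : Type u} [CommRing L] [Algebra (WittVector p k) L] (S : Fin n → L) (m : ℕ) :
    Subalgebra (WittVector p k) (Module.End (WittVector p k) L) :=
  Algebra.adjoin (WittVector p k)
    (Set.range (Algebra.lmul (WittVector p k) L) ∪
      {P | ∃ del, IsCoordinateHS (WittVector p k) S del ∧ ∃ l, ∃ i ≤ p ^ m, P = del l i})

/-- The two-sided ideal `(p)`; the quotient by it is `D_A^{(m)}`, `A = L / p`. -/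
def BerthelotD.idealP {L : Type u} [CommRing L] [Algebra (WittVector p k) L] (S : Fin n → L)
    (m : ℕ) : TwoSidedIdeal (BerthelotD p k S m) :=
  TwoSidedIdeal.span {(p : BerthelotD p k S m)}

end

end WittDiff

end

set_option linter.unusedSectionVars false

noncomputable section

namespace WittDiff

open Finset.HasAntidiagonal (antidiagonal mem_antidiagonal)
open AddMonoid (End)
open AddSubgroup (closure_induction)
open Finsupp (single single_eq_same single_zero single_add single_apply equivFunOnFinite)
open TwoSidedIdeal (subset_span ker_ringCon_mk')
open Function (update update_self update_of_ne Injective Surjective)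
open Subsingleton (elim)
open WittVector (coeff_mk zero_coeff)
open Algebra (smul_def)
open List (ofFn ofFn_succ)
open Finset (sum_sub_distrib single_le_sum sum_insert sum_cons mul_prod_erase prod_eq_one add_sum_erase sum_add_distrib sum_le_sum mem_product ne_of_mem_erase mem_erase sum_div sum_singleton)
open Nat (exists_eq_add_of_le choose_eq_zero_of_lt cast_pow cast_zero)
open WittVector (truncate ghostComponent teichmuller map_coeff verschiebung coeff_truncate truncate_surjective mem_ker_truncate teichmuller_coeff_zero ghostComponent_teichmuller iterate_verschiebung_coeff_eq_zero eq_iterate_verschiebung)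
open Finset (sum_congr mem_univ mem_filter mul_sum prod_congr dvd_sum sum_eq_zero prod_eq_zero sum_map sum_eq_single sum_mul mem_insert_self mem_insert_of_mem prod_mul_distrib mem_range)

section

section Etale

variable {R₀ : Type*} {B : Type*} [CommRing R₀] [CommRing B] [Algebra R₀ B] {n : ℕ} {S : Fin n → B}

theorem IsEtaleCoordinates.exists_lift (hS : IsEtaleCoordinates R₀ S) {C : Type*} [CommRing C]
    [Algebra R₀ C] (I : Ideal C) [IsAdicComplete I C] (f : B →+* C ⧸ I)
    (hf : ∀ r, f (algebraMap R₀ B r) = Ideal.Quotient.mk I (algebraMap R₀ C r))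
    (g : Fin n → C) (hg : ∀ l, Ideal.Quotient.mk I (g l) = f (S l)) :
    ∃ F : B →ₐ[R₀] C, (∀ x, Ideal.Quotient.mk I (F x) = f x) ∧ ∀ l, F (S l) = g l := by
  let a1 : Algebra (MvPolynomial (Fin n) R₀) B := (MvPolynomial.aeval S).toRingHom.toAlgebra
  let a2 : Algebra (MvPolynomial (Fin n) R₀) C := (MvPolynomial.aeval g).toRingHom.toAlgebra
  have : Algebra.Etale (MvPolynomial (Fin n) R₀) B := hS
  have key : ∀ q : MvPolynomial (Fin n) R₀, f (MvPolynomial.aeval S q) =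
      Ideal.Quotient.mk I (MvPolynomial.aeval g q) := by
    intro q; induction q using MvPolynomial.induction_on with
    | C r => simp [hf]
    | add a b ha hb => rw [map_add, map_add, map_add, map_add, ha, hb]
    | mul_X a l ha => rw [map_mul, map_mul, map_mul, map_mul, ha, MvPolynomial.aeval_X, MvPolynomial.aeval_X, hg]
  let f' : B →ₐ[MvPolynomial (Fin n) R₀] C ⧸ I := { f with commutes' := key }
  obtain ⟨F, hF⟩ := Algebra.FormallySmooth.exists_mkₐ_comp_eq_of_isAdicComplete f'
  refine ⟨{ F.toRingHom with commutes' := fun r => ?_ }, fun x => ?_, fun l => ?_⟩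
  · simp
  · exact AlgHom.congr_fun hF x
  · have := F.commutes (MvPolynomial.X l)
    have h1 : algebraMap (MvPolynomial (Fin n) R₀) B (MvPolynomial.X l) = S l := MvPolynomial.aeval_X _ _
    have h2 : algebraMap (MvPolynomial (Fin n) R₀) C (MvPolynomial.X l) = g l := MvPolynomial.aeval_X _ _
    rw [h1, h2] at this; exact this

theorem IsEtaleCoordinates.hom_ext (hS : IsEtaleCoordinates R₀ S) {C : Type*} [CommRing C]
    [Algebra R₀ C] (I : Ideal C) [hI : IsHausdorff I C] (F G : B →ₐ[R₀] C)
    (h : ∀ x, Ideal.Quotient.mk I (F x) = Ideal.Quotient.mk I (G x))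
    (hl : ∀ l, F (S l) = G (S l)) : F = G := by
  let a1 : Algebra (MvPolynomial (Fin n) R₀) B := (MvPolynomial.aeval S).toRingHom.toAlgebra
  let a2 : Algebra (MvPolynomial (Fin n) R₀) C := (F.comp (MvPolynomial.aeval S)).toRingHom.toAlgebra
  have : Algebra.Etale (MvPolynomial (Fin n) R₀) B := hS
  have key : G.comp (MvPolynomial.aeval S) = F.comp (MvPolynomial.aeval S) := by
    ext l; simp [hl]
  let F' : B →ₐ[MvPolynomial (Fin n) R₀] C := { F with commutes' := fun q => rfl }
  let G' : B →ₐ[MvPolynomial (Fin n) R₀] C := { G with commutes' := fun q => AlgHom.congr_fun key q }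
  have hI' : ⨅ i, I ^ i = ⊥ := by simpa using hI.iInf_pow_smul
  have := Algebra.FormallyUnramified.ext_of_iInf (I := I) hI' (g₁ := F') (g₂ := G') h
  exact AlgHom.ext fun x => AlgHom.congr_fun this x

theorem IsEtaleCoordinates.derivation_eq_zero (hS : IsEtaleCoordinates R₀ S) {M : Type*}
    [AddCommGroup M] [Module R₀ M] [Module B M] [IsScalarTower R₀ B M] (d : Derivation R₀ B M)
    (h : ∀ l, d (S l) = 0) : d = 0 := by
  let a1 : Algebra (MvPolynomial (Fin n) R₀) B := (MvPolynomial.aeval S).toRingHom.toAlgebra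
  let m1 : Module (MvPolynomial (Fin n) R₀) M := Module.compHom M
    (MvPolynomial.aeval S).toRingHom
  have : IsScalarTower (MvPolynomial (Fin n) R₀) B M := ⟨fun q b x => mul_smul (MvPolynomial.aeval S q) b x⟩
  have : Algebra.Etale (MvPolynomial (Fin n) R₀) B := hS
  have key : ∀ q : MvPolynomial (Fin n) R₀, d (MvPolynomial.aeval S q) = 0 := by
    intro q; induction q using MvPolynomial.induction_on with
    | C r => simp
    | add a b ha hb => rw [map_add, map_add, ha, hb, add_zero]
    | mul_X a l ha => rw [map_mul, Derivation.leibniz, ha, MvPolynomial.aeval_X, h, smul_zero, smul_zero, add_zero]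
  let d' : Derivation (MvPolynomial (Fin n) R₀) B M :=
    { toFun := d
      map_add' := map_add d
      map_smul' := fun q b => by
        change d (MvPolynomial.aeval S q * b) = MvPolynomial.aeval S q • d b
        rw [Derivation.leibniz, key, smul_zero, add_zero]
      map_one_eq_zero' := d.map_one_eq_zero
      leibniz' := d.leibniz }
  have : d' = 0 := by
    have h1 : d'.liftKaehlerDifferential = 0 := LinearMap.ext fun x => by rw [elim x 0, map_zero, map_zero]
    ext b; rw [← d'.liftKaehlerDifferential_comp_D, h1]
    rfl
  ext b
  exact DFunLike.congr_fun this b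

theorem IsEtaleCoordinates.eq_zero_of_leibniz (hS : IsEtaleCoordinates R₀ S) {C : Type*}
    [CommRing C] [Algebra R₀ C] (Θ : B →ₐ[R₀] C) (d : B →ₗ[R₀] C)
    (hd : ∀ x y, d (x * y) = Θ x * d y + Θ y * d x) (h : ∀ l, d (S l) = 0) : d = 0 := by
  let m : Module B C := Module.compHom _ Θ.toRingHom
  have hsm : ∀ (b : B) (f : C), b • f = Θ b * f := fun _ _ => rfl
  have : IsScalarTower R₀ B C := ⟨fun r b f => by rw [hsm, hsm, map_smul, smul_mul_assoc]⟩
  have := hS.derivation_eq_zero (Derivation.mk' d fun x y => by rw [hsm, hsm, hd]) h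
  ext x
  exact DFunLike.congr_fun this x

end Etale

section HasseSchmidt

variable {R₀ : Type*} {B : Type*} [CommRing R₀] [CommRing B] [Algebra R₀ B] {n : ℕ} {S : Fin n → B}
  {κ : Type*}

open MvPowerSeries

theorem mem_span_range_X_iff [Finite κ] (f : MvPowerSeries κ B) :
    f ∈ Ideal.span (Set.range (X : κ → MvPowerSeries κ B)) ↔ constantCoeff f = 0 := by
  classical
  have := Fintype.ofFinite κ
  constructor
  · intro h; have h1 : Ideal.span (Set.range (X : κ → MvPowerSeries κ B)) ≤
        RingHom.ker (constantCoeff) := by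
      rw [Ideal.span_le]
      rintro _ ⟨k, rfl⟩
      exact constantCoeff_X k
    exact h1 h
  · intro h; have hc : ∀ K : κ →₀ ℕ, K ≠ 0 → ∃ k, K k ≠ 0 := fun K hK => by grind
    rcases isEmpty_or_nonempty κ with hκ | hκ
    · have : f = 0 := by
        ext K; rw [elim K 0]; exact h
      rw [this]; exact zero_mem _
    choose! c hc using hc
    let part : κ → MvPowerSeries κ B := fun k K => if K = 0 then 0 else if c K = k then coeff K f else 0
    have hpart : ∀ k K, coeff K (part k) = if K = 0 then 0 else if c K = k then coeff K f else 0 := fun _ _ => rfl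
    have hf : f = ∑ k, part k := by
      ext K; rw [map_sum]; simp only [hpart]; by_cases hK : K = 0
      · simp [hK, h]
      · simp [hK]
    rw [hf]; refine Ideal.sum_mem _ fun k _ => Ideal.mem_of_dvd _ ?_ (Ideal.subset_span ⟨k, rfl⟩)
    rw [X_dvd_iff]; intro K hK; rw [hpart]
    split_ifs with h1 h2
    · rfl
    · exact absurd (h2 ▸ hK) (hc K h1)
    · rfl

theorem mk_span_range_X_eq_iff [Finite κ] (f g : MvPowerSeries κ B) :
    Ideal.Quotient.mk (Ideal.span (Set.range X)) f = Ideal.Quotient.mk (Ideal.span (Set.range X)) g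
      ↔ constantCoeff f = constantCoeff g := by
  rw [Ideal.Quotient.eq, mem_span_range_X_iff, map_sub, sub_eq_zero]

theorem IsEtaleCoordinates.exists_hasseSchmidt [Finite κ] (hS : IsEtaleCoordinates R₀ S)
    (g : Fin n → MvPowerSeries κ B) (hg : ∀ l, constantCoeff (g l) = S l) :
    ∃ Θ : B →ₐ[R₀] MvPowerSeries κ B, (∀ x, constantCoeff (Θ x) = x) ∧ ∀ l, Θ (S l) = g l := by
  obtain ⟨F, hF, h⟩ := hS.exists_lift (Ideal.span (Set.range (X : κ → MvPowerSeries κ B)))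
    ((Ideal.Quotient.mk _).comp (C)) (fun r => by rw [RingHom.comp_apply, MvPowerSeries.algebraMap_apply]) g
    (fun l => (mk_span_range_X_eq_iff _ _).2 (by simp [hg]))
  exact ⟨F, fun x => by simpa using (mk_span_range_X_eq_iff _ _).1 (hF x), h⟩

theorem IsEtaleCoordinates.hasseSchmidt_ext [Finite κ] (hS : IsEtaleCoordinates R₀ S)
    (Θ Θ' : B →ₐ[R₀] MvPowerSeries κ B) (h : ∀ x, constantCoeff (Θ x) = x)
    (h' : ∀ x, constantCoeff (Θ' x) = x) (hl : ∀ l, Θ (S l) = Θ' (S l)) : Θ = Θ' := hS.hom_ext (Ideal.span (Set.range (X : κ → MvPowerSeries κ B))) Θ Θ'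
    (fun x => (mk_span_range_X_eq_iff _ _).2 (by rw [h, h'])) hl

/-- The component of index `K` of a multi-variable Hasse-Schmidt derivation. -/
def hsCoeff (Θ : B →ₐ[R₀] MvPowerSeries κ B) (K : κ →₀ ℕ) : Module.End R₀ B where
  toFun x := coeff K (Θ x)
  map_add' x y := by rw [map_add, map_add]
  map_smul' r x := by rw [map_smul, RingHom.id_apply]; rfl

theorem hsCoeff_apply (Θ : B →ₐ[R₀] MvPowerSeries κ B) (K : κ →₀ ℕ) (x : B) :
    hsCoeff Θ K x = coeff K (Θ x) := rfl

theorem hsCoeff_mul [DecidableEq κ] (Θ : B →ₐ[R₀] MvPowerSeries κ B) (K : κ →₀ ℕ) (x y : B) :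
    hsCoeff Θ K (x * y) = ∑ ij ∈ antidiagonal K, hsCoeff Θ ij.1 x * hsCoeff Θ ij.2 y := by
  rw [hsCoeff_apply, map_mul, coeff_mul]
  rfl

/-- `Θ` is the Taylor expansion along the directions `lam`. -/
def IsTaylor (S : Fin n → B) (lam : κ → Fin n) (Θ : B →ₐ[R₀] MvPowerSeries κ B) : Prop :=
  (∀ x, constantCoeff (Θ x) = x) ∧ ∀ l, ∃ s : Finset κ, (∀ k, k ∈ s ↔ lam k = l) ∧ Θ (S l) = C (S l) + ∑ k ∈ s, X k

theorem IsEtaleCoordinates.exists_isTaylor [Finite κ] (hS : IsEtaleCoordinates R₀ S)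
    (lam : κ → Fin n) : ∃ Θ : B →ₐ[R₀] MvPowerSeries κ B, IsTaylor S lam Θ := by
  have := Fintype.ofFinite κ
  obtain ⟨Θ, h1, h2⟩ := hS.exists_hasseSchmidt
    (fun l => C (S l) + ∑ k ∈ Finset.univ.filter (fun k => lam k = l), X k)
    (fun l => by simp)
  exact ⟨Θ, h1, fun l => ⟨_, fun k => by simp, h2 l⟩⟩

theorem IsTaylor.hsCoeff_zero {lam : κ → Fin n} {Θ : B →ₐ[R₀] MvPowerSeries κ B}
    (h : IsTaylor S lam Θ) (x : B) : hsCoeff Θ 0 x = x := h.1 x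

theorem IsTaylor.hsCoeff_single [Finite κ] {lam : κ → Fin n} {Θ : B →ₐ[R₀] MvPowerSeries κ B}
    (hS : IsEtaleCoordinates R₀ S) (h : IsTaylor S lam Θ) (k : κ) (K : κ →₀ ℕ) (x : B) :
    hsCoeff Θ K (hsCoeff Θ (single k 1) x) = (K k + 1) • hsCoeff Θ (K + single k 1) x := by
  classical
  have hmul : ∀ x y, hsCoeff Θ (single k 1) (x * y) =
      x * hsCoeff Θ (single k 1) y + y * hsCoeff Θ (single k 1) x := by
    intro x y; rw [hsCoeff_mul, Finsupp.antidiagonal_single]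
    simp only [sum_map, Finset.Nat.antidiagonal_succ, Finset.Nat.antidiagonal_zero, sum_cons]; simp [h.hsCoeff_zero]
    ring
  let d : B →ₗ[R₀] MvPowerSeries κ B :=
    { toFun := fun x => Θ (hsCoeff Θ (single k 1) x) - pderiv B k (Θ x)
      map_add' := fun x y => by simp; ring
      map_smul' := fun r x => by
        have : pderiv B k (r • Θ x) = r • pderiv B k (Θ x) := by simp
        simp only [map_smul, RingHom.id_apply, this, smul_sub] }
  have hd : d = 0 := by
    refine hS.eq_zero_of_leibniz Θ d (fun x y => ?_) fun l => ?_
    · change Θ (hsCoeff Θ (single k 1) (x * y)) - pderiv B k (Θ (x * y)) =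
        Θ x * (Θ (hsCoeff Θ (single k 1) y) - pderiv B k (Θ y)) +
        Θ y * (Θ (hsCoeff Θ (single k 1) x) - pderiv B k (Θ x))
      rw [hmul, map_mul, Derivation.leibniz, map_add, map_mul, map_mul]; simp; ring
    obtain ⟨s, hs, h2⟩ := h.2 l; change Θ (hsCoeff Θ (single k 1) (S l)) - pderiv B k (Θ (S l)) = 0
    have h3 : pderiv B k (Θ (S l)) = if k ∈ s then 1 else 0 := by
      rw [h2, map_add, pderiv_C, zero_add, map_sum]; simp [pderiv_X, Pi.single_apply]
    have h4 : hsCoeff Θ (single k 1) (S l) = if k ∈ s then 1 else 0 := by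
      rw [hsCoeff_apply, h2, map_add, map_sum, coeff_C]; simp [coeff_X, Finsupp.single_left_inj]
    rw [h3, h4]
    split_ifs <;> simp
  have h5 := congrArg (coeff K) (sub_eq_zero.1 (LinearMap.congr_fun hd x :
    Θ (hsCoeff Θ (single k 1) x) - pderiv B k (Θ x) = 0))
  rw [coeff_pderiv] at h5
  rw [hsCoeff_apply, h5, hsCoeff_apply, nsmul_eq_mul]
  push_cast
  ring

/-- The product of the binomial coefficients `(K choose J)`. -/
def multiChoose (K J : κ →₀ ℕ) [Fintype κ] : ℕ := ∏ k, (K k).choose (J k)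

theorem IsTaylor.hsCoeff_comp [Fintype κ] [IsAddTorsionFree B] {lam : κ → Fin n}
    {Θ : B →ₐ[R₀] MvPowerSeries κ B} (hS : IsEtaleCoordinates R₀ S) (h : IsTaylor S lam Θ)
    (K J : κ →₀ ℕ) (x : B) :
    hsCoeff Θ K (hsCoeff Θ J x) = multiChoose (K + J) K • hsCoeff Θ (K + J) x := by
  classical
  induction hN : J.degree generalizing J x with
  | zero =>
    rw [Finsupp.degree_eq_zero_iff] at hN; simp [hN, multiChoose, h.hsCoeff_zero]
  | succ N ih =>
    have hJ : J ≠ 0 := fun h0 => by simp [h0] at hN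
    obtain ⟨k, hk⟩ : ∃ k, J k ≠ 0 := by grind
    obtain ⟨J', rfl⟩ : ∃ J', J = J' + single k 1 :=
      ⟨J - single k 1, (tsub_add_cancel_of_le (by simpa using Nat.one_le_iff_ne_zero.2 hk)).symm⟩
    have hN' : J'.degree = N := by
      rw [map_add, Finsupp.degree_single] at hN; omega
    have h1 := congrArg (hsCoeff Θ K) (h.hsCoeff_single hS k J' x)
    rw [ih _ _ hN', h.hsCoeff_single hS k, map_nsmul] at h1
    have h2 : (J' k + 1) * multiChoose (K + (J' + single k 1)) K = multiChoose (K + J') K * ((K + J') k + 1) := by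
      rw [multiChoose, multiChoose, ← mul_prod_erase _ _ (mem_univ k),
        ← mul_prod_erase _ _ (mem_univ k), prod_congr rfl
        (g := fun i => ((K + J') i).choose (K i))]
      · have := Nat.choose_mul_succ_eq (K k + J' k) (K k); simp
        rw [show K k + J' k + 1 - K k = J' k + 1 by omega] at this
        rw [← add_assoc, ← mul_assoc, mul_comm (J' k + 1), ← this]; ring
      · intro i hi; rw [mem_erase] at hi; simp [hi.1.symm]
    refine nsmul_right_injective (Nat.succ_ne_zero (J' k)) ?_; change (J' k + 1) • _ = (J' k + 1) • _
    rw [← h1, smul_smul, smul_smul, h2, add_assoc]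

end HasseSchmidt
theorem p_pos (p : ℕ) [Fact p.Prime] : (0 : ℚ) < p := Nat.cast_pos.2 (Fact.out : p.Prime).pos

end

section

section Ghost

variable (p : ℕ) [Fact p.Prime]

local notation "W" => WittVector p

variable {p} in
theorem ghost_eq_sum {C : Type*} [CommRing C] (s : ℕ) (x : W C) :
    ghostComponent s x = ∑ i ∈ Finset.range (s + 1), (p : C) ^ i * x.coeff i ^ p ^ (s - i) := by
  rw [WittVector.ghostComponent_apply, aeval_wittPolynomial]

variable {p} in
theorem ghostComponent_map {C D : Type*} [CommRing C] [CommRing D] (f : C →+* D) (s : ℕ) (x : W C) :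
    ghostComponent s (WittVector.map f x) = f (ghostComponent s x) := by
  simp [ghost_eq_sum, map_sum]

/-- The image of the ghost component `w_s` is a subring. -/
def ghostRange (C : Type*) [CommRing C] (s : ℕ) : Subring C := (ghostComponent s : W C →+* C).range

variable {p} {C : Type*} [CommRing C]

theorem mul_mem_ghostRange_succ {s : ℕ} {y : C} (hy : y ∈ ghostRange p C s) :
    (p : C) * y ∈ ghostRange p C (s + 1) := by
  obtain ⟨x, rfl⟩ := hy
  exact ⟨verschiebung x, WittVector.ghostComponent_verschiebung x s⟩

theorem pow_mul_mem_ghostRange (s : ℕ) (y : C) : (p : C) ^ s * y ∈ ghostRange p C s := by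
  induction s with
  | zero => exact ⟨teichmuller p y, by simp⟩
  | succ s ih => rw [pow_succ', mul_assoc]; exact mul_mem_ghostRange_succ ih

theorem ghostRange_succ_le (s : ℕ) : ghostRange p C (s + 1) ≤ ghostRange p C s := by
  rintro _ ⟨x, rfl⟩
  rw [ghost_eq_sum, Finset.sum_range_succ]
  refine add_mem ?_ ?_
  · refine ⟨WittVector.mk p fun i => x.coeff i ^ p, ?_⟩
    rw [ghost_eq_sum]; refine sum_congr rfl fun i hi => ?_
    rw [coeff_mk, ← pow_mul, ← pow_succ', Nat.succ_sub (by simpa [Nat.lt_succ_iff] using hi)]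
  · rw [pow_succ, mul_assoc]; exact pow_mul_mem_ghostRange s _

theorem ghostComponent_sub_dvd {a b : W C} (e m : ℕ) (h : ∀ i, (p : C) ∣ a.coeff i - b.coeff i ^ p ^ m) :
    (p : C) ^ (e + 1) ∣ ghostComponent e a - ghostComponent (e + m) b := by
  rw [ghost_eq_sum, ghost_eq_sum, show e + m + 1 = e + 1 + m by ring,
    Finset.sum_range_add _ (e + 1) m, ← sub_sub, ← sum_sub_distrib]
  refine dvd_sub (dvd_sum fun i hi => ?_) (dvd_sum fun i _ => ?_)
  · have hi' : i ≤ e := by simpa [Nat.lt_succ_iff] using hi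
    have h1 := dvd_sub_pow_of_dvd_sub (h i) (e - i)
    rw [← pow_mul, ← pow_add, show m + (e - i) = e + m - i by omega] at h1
    rw [← mul_sub, show e + 1 = i + (e - i + 1) by omega, pow_add]
    exact mul_dvd_mul_left _ h1
  · exact Dvd.dvd.mul_right (pow_dvd_pow _ (by omega)) _

open MvPowerSeries in
theorem coeff_ghostComponent_mem {κ : Type*} (K : κ →₀ ℕ) (s : ℕ) (x : W (MvPowerSeries κ C)) :
    coeff K (ghostComponent s x) ∈ ghostRange p C s := by
  classical
  induction s generalizing x with
  | zero => exact ⟨teichmuller p (coeff K (ghostComponent 0 x)), by simp⟩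
  | succ s ih =>
    set G := x.coeff 0; set H : MvPowerSeries κ C := G - ∑ J ∈ Finset.Iic K, monomial J (coeff J G)
    have hH : ∀ J ≤ K, coeff J H = 0 := by
      intro J hJ; simp only [H, map_sub, map_sum, coeff_monomial]; rw [sum_eq_single J]
      · simp
      · grind
      · simp [*]
    have hHm : ∀ f, coeff K (f * H) = 0 := by
      intro f; rw [coeff_mul]; refine sum_eq_zero fun ij hij => ?_
      rw [hH ij.2 (by rw [← mem_antidiagonal.1 hij]; exact le_add_self), mul_zero]
    set y : W (MvPowerSeries κ C) := x - (∑ J ∈ Finset.Iic K,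
      teichmuller p (monomial J (coeff J G)) + teichmuller p H) with hy
    have hy0 : y.coeff 0 = 0 := by
      change WittVector.constantCoeff y = 0; rw [hy, map_sub, map_add, map_sum]
      change G - (∑ J ∈ Finset.Iic K, (teichmuller p (monomial J (coeff J G))).coeff 0
        + (teichmuller p H).coeff 0) = 0
      simp [H]
    obtain ⟨z, hz⟩ : ∃ z, y = verschiebung z := ⟨_, eq_iterate_verschiebung (n := 1) (by simpa using hy0)⟩
    have hx : x = (∑ J ∈ Finset.Iic K, teichmuller p (monomial J (coeff J G))
      + teichmuller p H) + verschiebung z := by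
      rw [← hz, hy]; ring
    rw [hx, map_add, map_add, map_add, map_add, map_sum, map_sum]
    refine add_mem (add_mem (sum_mem fun J _ => ?_) ?_) ?_
    · rw [ghostComponent_teichmuller, monomial_pow, coeff_monomial]
      split_ifs
      · exact ⟨teichmuller p (coeff J G), ghostComponent_teichmuller _ _ _⟩
      · exact zero_mem _
    · rw [ghostComponent_teichmuller, ← Nat.succ_pred (pow_ne_zero (s + 1)
        (Fact.out : p.Prime).ne_zero), pow_succ, hHm]
      exact zero_mem _
    · rw [WittVector.ghostComponent_verschiebung]; have : coeff K ((p : MvPowerSeries κ C) * ghostComponent s z) =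
          (p : C) * coeff K (ghostComponent s z) := by
        rw [← nsmul_eq_mul, map_nsmul, nsmul_eq_mul]
      rw [this]; exact mul_mem_ghostRange_succ (ih z)

theorem hsCoeff_mem_ghostRange {R₀ κ : Type*} [CommRing R₀] [Algebra R₀ C]
    (Θ : C →ₐ[R₀] MvPowerSeries κ C) (K : κ →₀ ℕ) {s : ℕ} {y : C} (hy : y ∈ ghostRange p C s) :
    hsCoeff Θ K y ∈ ghostRange p C s := by
  obtain ⟨x, rfl⟩ := hy
  have := coeff_ghostComponent_mem K s (WittVector.map Θ.toRingHom x)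
  rwa [ghostComponent_map] at this

end Ghost

section Perfect

variable {p : ℕ} [Fact p.Prime] {R : Type*} [CommRing R] [CharP R p] [PerfectRing R p]

local notation "W" => WittVector p

variable (p R) in
/-- The powers of the Frobenius automorphism. -/
def frob (z : ℤ) : W R ≃+* W R := ((WittVector.frobeniusEquiv p R : RingAut (W R)) ^ z : RingAut (W R))

theorem frob_zero (x : W R) : frob p R 0 x = x := by simp [frob]

theorem frob_add (a b : ℤ) (x : W R) : frob p R (a + b) x = frob p R a (frob p R b x) := by rw [frob, zpow_add]; rfl

theorem frob_one (x : W R) : frob p R 1 x = WittVector.frobenius x := by rw [frob, zpow_one]; rfl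

theorem frob_neg_frob (a : ℤ) (x : W R) : frob p R (-a) (frob p R a x) = x := by
  rw [← frob_add, neg_add_cancel, frob_zero]

theorem frob_frob_neg (a : ℤ) (x : W R) : frob p R a (frob p R (-a) x) = x := by
  rw [← frob_add, add_neg_cancel, frob_zero]

theorem coeff_frob (r : ℕ) (x : W R) (i : ℕ) : (frob p R r x).coeff i = x.coeff i ^ p ^ r := by
  induction r with
  | zero => simp [frob_zero]
  | succ r ih =>
    rw [Nat.cast_succ, add_comm, frob_add, frob_one, WittVector.coeff_frobenius_charP, ih, ← pow_mul, pow_succ]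

theorem p_mul_cancel {x y : W R} (h : p * x = p * y) : x = y := by
  rw [← sub_eq_zero, ← mul_sub, mul_comm] at h
  exact sub_eq_zero.1 (WittVector.eq_zero_of_p_mul_eq_zero _ h)

theorem p_pow_mul_cancel (N : ℕ) {x y : W R} (h : p ^ N * x = p ^ N * y) : x = y := by
  induction N with
  | zero => simpa using h
  | succ N ih => rw [pow_succ', mul_assoc, mul_assoc] at h; exact ih (p_mul_cancel h)

theorem truncate_eq_iff_coeff {S : Type*} [CommRing S] {N : ℕ} {x y : W S} :
    truncate N x = truncate N y ↔ ∀ i < N, x.coeff i = y.coeff i := by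
  constructor
  · intro h i hi; have := congrArg (TruncatedWittVector.coeff (⟨i, hi⟩ : Fin N)) h
    rwa [coeff_truncate, coeff_truncate] at this
  · intro h; ext i; rw [coeff_truncate, coeff_truncate, h i i.2]

theorem truncate_eq_zero_iff {N : ℕ} {x : W R} :
    truncate N x = 0 ↔ (p : W R) ^ N ∣ x := by
  rw [← Ideal.mem_span_singleton, WittVector.mem_span_p_pow_iff_le_coeff_eq_zero, ← RingHom.mem_ker, mem_ker_truncate]

theorem truncate_eq_iff {N : ℕ} {x y : W R} :
    truncate N x = truncate N y ↔ (p : W R) ^ N ∣ x - y := by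
  rw [← truncate_eq_zero_iff, map_sub, sub_eq_zero]

theorem truncate_frob_iff {N : ℕ} (z : ℤ) {x y : W R} :
    truncate N (frob p R z x) = truncate N (frob p R z y) ↔ truncate N x = truncate N y := by
  have key : ∀ (z : ℤ) (x y : W R), truncate N x = truncate N y →
      truncate N (frob p R z x) = truncate N (frob p R z y) := by
    intro z x y h; rw [truncate_eq_iff] at h ⊢; rw [← map_sub]; have := map_dvd (frob p R z) h
    rwa [map_pow, map_natCast] at this
  refine ⟨fun h => ?_, key z x y⟩
  have := key (-z) _ _ h
  rwa [frob_neg_frob, frob_neg_frob] at this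

theorem truncate_of_le {S : Type*} [CommRing S] {M N : ℕ} (h : M ≤ N) {x y : W S}
    (hxy : truncate N x = truncate N y) :
    truncate M x = truncate M y :=
  truncate_eq_iff_coeff.2 fun i hi => truncate_eq_iff_coeff.1 hxy i (hi.trans_le h)

theorem iterate_verschiebung_eq (d : ℕ) (x : W R) :
    verschiebung^[d] x = p ^ d * frob p R (-d) x := by
  induction d with
  | zero => simp [frob_zero]
  | succ d ih =>
    rw [Function.iterate_succ_apply', ih]; have h := WittVector.verschiebung_frobenius (frob p R (-1)
      (p ^ d * frob p R (-d) x))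
    rw [← frob_one, frob_frob_neg] at h; rw [h, map_mul, ← frob_add, map_pow, map_natCast, pow_succ]; push_cast
    rw [show (-1 : ℤ) + -d = -(d + 1) by ring]
    ring

theorem exists_limit {S : Type*} [CommRing S] (f : ℕ → W S)
    (h : ∀ N, truncate N (f (N + 1)) = truncate N (f N)) :
    ∃ z, ∀ N, truncate N z = truncate N (f N) := by
  have h1 : ∀ M N, N ≤ M → truncate N (f M) = truncate N (f N) := by
    intro M N hMN; induction M, hMN using Nat.le_induction with
    | base => rfl
    | succ M hM ih => rw [truncate_of_le hM (h M), ih]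
  refine ⟨WittVector.mk p fun i => (f (i + 1)).coeff i, fun N => ?_⟩
  rw [truncate_eq_iff_coeff]
  intro i hi
  rw [coeff_mk]
  exact (truncate_eq_iff_coeff.1 (h1 N (i + 1) hi) i (Nat.lt_succ_self i)).symm

end Perfect

end

section

section GhostFrob

variable {p : ℕ} [Fact p.Prime] {R : Type*} [CommRing R] [CharP R p] [PerfectRing R p]

local notation "W" => WittVector p

theorem dvd_sub_of_coeff_zero_eq {x y : W R} (h : x.coeff 0 = y.coeff 0) : (p : W R) ∣ x - y := by
  have : truncate 1 x = truncate 1 y := truncate_eq_iff_coeff.2 fun i hi => by rw [Nat.lt_one_iff.1 hi, h]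
  simpa using truncate_eq_iff.1 this

theorem truncate_ghostComponent (s : ℕ) (X : W (W R)) :
    truncate (s + 1) (ghostComponent s X) =
      truncate (s + 1) (frob p R s (WittVector.map WittVector.constantCoeff X)) := by
  rw [truncate_eq_iff]
  set z := WittVector.map WittVector.constantCoeff X with hz
  have hzi : ∀ i, z.coeff i = (X.coeff i).coeff 0 := fun i => map_coeff _ _ _
  let X' : W (W R) := WittVector.mk p fun i => teichmuller p (z.coeff i)
  have h1 : (p : W R) ^ (s + 1) ∣ ghostComponent s X - ghostComponent s X' := by
    refine ghostComponent_sub_dvd s 0 fun i => ?_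
    rw [pow_zero, pow_one]; refine dvd_sub_of_coeff_zero_eq ?_; rw [coeff_mk, teichmuller_coeff_zero, hzi]
  have h2 : ghostComponent s X' = ∑ i ∈ Finset.Iic s, teichmuller p
      (((frobeniusEquiv R p).symm ^ i) ((frob p R s z).coeff i)) * p ^ i := by
    rw [ghost_eq_sum, show Finset.Iic s = Finset.range (s + 1) by ext; simp]
    refine sum_congr rfl fun i hi => ?_
    rw [coeff_mk, ← map_pow, mul_comm, coeff_frob]; congr 2
    have h3 : ∀ (i : ℕ) (x : R), ((frobeniusEquiv R p).symm ^ i) (x ^ p ^ i) = x := by simp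
    conv_rhs => rw [← Nat.sub_add_cancel (Nat.lt_succ_iff.1 (mem_range.1 hi)), pow_add, pow_mul, h3]
  have h4 := WittVector.dvd_sub_sum_teichmuller_iterateFrobeniusEquiv_coeff (frob p R s z) s
  rw [← h2] at h4
  have := dvd_sub h1 h4
  rwa [show ghostComponent s X - ghostComponent s X' -
    (frob p R s z - ghostComponent s X') = ghostComponent s X - frob p R s z
    by ring] at this

theorem truncate_hom_ghostComponent {B : Type*} [CommRing B] (f : B →+* W R) (s : ℕ) (x : W B) :
    truncate (s + 1) (f (ghostComponent s x)) = truncate (s + 1)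
        (frob p R s (WittVector.map (WittVector.constantCoeff.comp f) x)) := by
  rw [← ghostComponent_map, truncate_ghostComponent]
  rfl

theorem coeff_natCast_mul {σ B : Type*} [CommRing B] (K : σ →₀ ℕ) (a : ℕ) (g : MvPowerSeries σ B) :
    MvPowerSeries.coeff K ((a : MvPowerSeries σ B) * g) = (a : B) * MvPowerSeries.coeff K g := by
  rw [← nsmul_eq_mul, map_nsmul, nsmul_eq_mul]

open MvPowerSeries in
theorem coeff_ghostComponent_frob_aux {κ : Type*} (a e : ℕ) (x : W (MvPowerSeries κ (W R))) :
    (p : MvPowerSeries κ (W R)) ^ (e + 1) ∣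
      MvPowerSeries.map (frob p R a : W R →+* W R) (expand (p ^ a) (pow_ne_zero a (Fact.out : p.Prime).ne_zero)
        (ghostComponent e x)) - ghostComponent (e + a) x := by
  set hp := pow_ne_zero a (Fact.out : p.Prime).ne_zero
  let Ψ : MvPowerSeries κ (W R) →+* MvPowerSeries κ (W R) :=
    (MvPowerSeries.map (frob p R a : W R →+* W R)).comp (expand (p ^ a) hp).toRingHom
  have hΨ : ∀ f, (p : MvPowerSeries κ (W R)) ∣ Ψ f - f ^ p ^ a := by
    intro f; have key : MvPowerSeries.map (WittVector.constantCoeff) (Ψ f) =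
        MvPowerSeries.map (WittVector.constantCoeff) (f ^ p ^ a) := by
      rw [map_pow, ← map_iterateFrobenius_expand p (Fact.out : p.Prime).ne_zero]
      change MvPowerSeries.map (WittVector.constantCoeff (p := p) (R := R)) (MvPowerSeries.map
        (frob p R a : W R →+* W R) (expand (p ^ a) hp f)) = _
      rw [MvPowerSeries.map_map, ← map_expand, MvPowerSeries.map_map]; congr 2; ext y
      change (frob p R a y).coeff 0 = (iterateFrobenius R p a) (y.coeff 0); rw [coeff_frob, iterateFrobenius_def]
    have h2 : ∀ K, ∃ z, coeff K (Ψ f - f ^ p ^ a) = p * z := fun K => by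
      have h3 := congrArg (coeff K) key; rw [coeff_map, coeff_map] at h3; rw [map_sub]
      exact dvd_sub_of_coeff_zero_eq h3
    choose g hg using h2
    let g' : MvPowerSeries κ (W R) := g; refine ⟨g', ?_⟩
    ext1 K
    rw [hg, coeff_natCast_mul]
    rfl
  have := ghostComponent_sub_dvd (a := WittVector.map Ψ x) (b := x) e a (fun i => by rw [map_coeff]; exact hΨ _)
  rwa [ghostComponent_map] at this

end GhostFrob

variable (p : ℕ) [Fact p.Prime]

local notation "W" => WittVector p

/-- A comparison of a lift `L` of a ring `A` with the Witt vectors of a perfect ring `R` in which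
every element has a power in `A`. -/
structure WittFrame (A R L : Type*) [CommRing A] [CommRing R] [Algebra A R] [CommRing L] where
  inj : Injective (algebraMap A R)
  dense : ∀ x : R, ∃ (n : ℕ) (a : A), algebraMap A R a = x ^ p ^ n
  π : L →+* A
  surj : Surjective π
  ker_π : ∀ y, π y = 0 → ∃ z, y = p * z
  ι : L →+* W R
  ι_coeff : ∀ y, (ι y).coeff 0 = algebraMap A R (π y)

namespace WittFrame

variable {p} {A R L : Type*} [CommRing A] [CommRing R] [Algebra A R] [CommRing L]
  (fr : WittFrame p A R L)

variable (p A R) in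
/-- The embedding of the Witt vectors of `A`. -/
def j : W A →+* W R := WittVector.map (algebraMap A R)

theorem coeff_j (x : W A) (i : ℕ) : (j p A R x).coeff i = algebraMap A R (x.coeff i) := map_coeff _ _ _

include fr in
theorem j_injective : Injective (j p A R) := WittVector.map_injective _ fr.inj

include fr in
theorem truncate_j_iff {N : ℕ} {x y : W A} :
    truncate N (j p A R x) = truncate N (j p A R y) ↔ truncate N x = truncate N y := by
  rw [truncate_eq_iff_coeff, truncate_eq_iff_coeff]
  simp only [coeff_j, fr.inj.eq_iff]

variable [CharP R p] [PerfectRing R p]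

theorem dvd_of_dvd_ι (N : ℕ) {y : L} (h : (p : W R) ^ N ∣ fr.ι y) : ∃ z, y = p ^ N * z := by
  induction N generalizing y with
  | zero => exact ⟨y, by simp⟩
  | succ N ih =>
    have h0 : fr.π y = 0 := by
      apply fr.inj; rw [← fr.ι_coeff, map_zero]; have : (p : W R) ^ 1 ∣ fr.ι y - 0 := by
        rw [sub_zero]; exact (pow_dvd_pow _ (by omega)).trans h
      simpa using truncate_eq_iff_coeff.1 (truncate_eq_iff.2 this) 0 one_pos
    obtain ⟨z, rfl⟩ := fr.ker_π y h0; obtain ⟨w, hw⟩ := h; rw [map_mul, map_natCast, pow_succ', mul_assoc] at hw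
    obtain ⟨z', rfl⟩ := ih ⟨w, p_mul_cancel hw⟩; exact ⟨z', by ring⟩

theorem truncate_ι_ghost (s : ℕ) (x : W L) :
    truncate (s + 1) (fr.ι (ghostComponent s x)) =
      truncate (s + 1) (frob p R s (j p A R (WittVector.map fr.π x))) := by
  rw [truncate_hom_ghostComponent]
  congr 2
  ext i
  rw [coeff_j, map_coeff, map_coeff]
  exact fr.ι_coeff _

/-- `y` represents `F^r z` modulo `p ^ (e + 1)`. -/
def Rep (e r : ℕ) (z : W R) (y : L) : Prop :=
  y ∈ ghostRange p L e ∧ truncate (e + 1) (fr.ι y) = truncate (e + 1) (frob p R r z)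

variable {fr}

theorem Rep.add {e r : ℕ} {z z' : W R} {y y' : L} (h : fr.Rep e r z y) (h' : fr.Rep e r z' y') :
    fr.Rep e r (z + z') (y + y') :=
  ⟨add_mem h.1 h'.1, by rw [map_add, map_add, h.2, h'.2, map_add, map_add]⟩

theorem Rep.mul {e r : ℕ} {z z' : W R} {y y' : L} (h : fr.Rep e r z y) (h' : fr.Rep e r z' y') :
    fr.Rep e r (z * z') (y * y') :=
  ⟨mul_mem h.1 h'.1, by rw [map_mul, map_mul, h.2, h'.2, map_mul, map_mul]⟩

theorem Rep.of_succ {e r : ℕ} {z : W R} {y : L} (h : fr.Rep (e + 1) r z y) : fr.Rep e r z y :=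
  ⟨ghostRange_succ_le e h.1, truncate_of_le (by omega) h.2⟩

theorem rep_frob_iff {e r d : ℕ} {z : W R} {y : L} :
    fr.Rep e r (frob p R d z) y ↔ fr.Rep e (r + d) z y := by
  rw [Rep, Rep, ← frob_add]
  rfl

variable (fr)

theorem rep_map (e : ℕ) (x : W L) :
    fr.Rep e e (j p A R (WittVector.map fr.π x)) (ghostComponent e x) :=
  ⟨⟨x, rfl⟩, fr.truncate_ι_ghost e x⟩

omit [CharP R p] [PerfectRing R p] in
theorem exists_map_eq (w : W A) : ∃ x, WittVector.map fr.π x = w := by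
  choose f hf using fr.surj
  refine ⟨WittVector.mk p fun i => f (w.coeff i), ?_⟩
  ext i
  rw [map_coeff, coeff_mk, hf]

theorem j_frob (d : ℕ) (w : W A) :
    ∃ w', frob p R d (j p A R w) = j p A R w' := by
  refine ⟨WittVector.mk p fun i => w.coeff i ^ p ^ d, ?_⟩
  ext i
  rw [coeff_frob, coeff_j, coeff_j, coeff_mk, map_pow]

theorem exists_rep_of_j {e r : ℕ} (h : e ≤ r) (w : W A) : ∃ y, fr.Rep e r (j p A R w) y := by
  obtain ⟨d, rfl⟩ := exists_eq_add_of_le h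
  obtain ⟨w', hw'⟩ := j_frob (R := R) d w
  obtain ⟨x, rfl⟩ := fr.exists_map_eq w'
  exact ⟨_, rep_frob_iff.1 (hw' ▸ fr.rep_map e x)⟩

include fr in
theorem exists_truncate_frob_eq_j (N : ℕ) (z : W R) :
    ∃ (r0 : ℕ), ∀ r, r0 ≤ r → ∃ w, truncate N (frob p R r z) = truncate N (j p A R w) := by
  choose n a ha using fun i => fr.dense (z.coeff i)
  refine ⟨∑ i ∈ Finset.range N, n i, fun r hr =>
    ⟨WittVector.mk p fun i => a i ^ p ^ (r - n i), truncate_eq_iff_coeff.2 fun i hi => ?_⟩⟩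
  rw [coeff_frob, coeff_j, coeff_mk, map_pow, ha, ← pow_mul, ← pow_add,
    Nat.add_sub_cancel' ((single_le_sum (fun _ _ => Nat.zero_le _) (mem_range.2 hi)).trans hr)]

theorem exists_rep (e : ℕ) (z : W R) : ∃ r0, ∀ r, r0 ≤ r → ∃ y, fr.Rep e r z y := by
  obtain ⟨r0, h⟩ := fr.exists_truncate_frob_eq_j (e + 1) z
  refine ⟨r0 + e, fun r hr => ?_⟩
  obtain ⟨w, hw⟩ := h (r - e) (by omega)
  obtain ⟨x, rfl⟩ := fr.exists_map_eq w
  refine ⟨_, ⟨x, rfl⟩, ?_⟩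
  rw [truncate_ι_ghost, show (r : ℤ) = e + (r - e : ℕ) by omega, frob_add, truncate_frob_iff, hw]

variable {R₀ κ : Type*} [CommRing R₀] [Algebra R₀ L] (Θ : L →ₐ[R₀] MvPowerSeries κ L)

theorem truncate_hsCoeff_congr {N : ℕ} {y y' : L}
    (h : truncate N (fr.ι y) = truncate N (fr.ι y')) (K : κ →₀ ℕ) :
    truncate N (fr.ι (hsCoeff Θ K y)) = truncate N (fr.ι (hsCoeff Θ K y')) := by
  rw [truncate_eq_iff, ← map_sub] at h ⊢
  obtain ⟨z, hz⟩ := fr.dvd_of_dvd_ι N h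
  rw [← map_sub, hz]
  refine ⟨fr.ι (hsCoeff Θ K z), ?_⟩
  rw [← cast_pow, ← nsmul_eq_mul, map_nsmul, map_nsmul, nsmul_eq_mul, cast_pow]

open MvPowerSeries in
theorem Rep.compat {fr : WittFrame p A R L} {e r a : ℕ} {z : W R} {y y' : L} (h : fr.Rep e r z y)
    (h' : fr.Rep e (r + a) z y') :
    (∀ K, truncate (e + 1) (frob p R a (fr.ι (hsCoeff Θ K y))) = truncate (e + 1) (fr.ι (hsCoeff Θ (p ^ a • K) y'))) ∧
    ∀ K, (∃ k, ¬ p ^ a ∣ K k) → truncate (e + 1) (fr.ι (hsCoeff Θ K y')) = 0 := by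
  obtain ⟨⟨x, rfl⟩, hx⟩ := h
  set y1 := ghostComponent (e + a) x
  have h1 : truncate (e + 1) (fr.ι y1) = truncate (e + 1) (fr.ι y') := by
    rw [h'.2, truncate_of_le (by omega) (fr.truncate_ι_ghost (e + a) x)]
    rw [truncate_ι_ghost] at hx; push_cast
    rw [add_comm (e : ℤ), add_comm (r : ℤ), frob_add, frob_add, truncate_frob_iff, hx]
  have h2 := coeff_ghostComponent_frob_aux a e
    (WittVector.map ((MvPowerSeries.map fr.ι).comp Θ.toRingHom) x)
  rw [ghostComponent_map, ghostComponent_map] at h2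
  obtain ⟨g, hg⟩ := h2
  have h3 : ∀ K, (p : W R) ^ (e + 1) ∣ frob p R a (coeff K (expand (p ^ a)
      (pow_ne_zero a (Fact.out : p.Prime).ne_zero) (MvPowerSeries.map fr.ι (Θ (ghostComponent e x)))))
      - fr.ι (hsCoeff Θ K y1) := by
    intro K; refine ⟨coeff K g, ?_⟩; have := congrArg (coeff K) hg
    rw [map_sub, coeff_map, RingHom.comp_apply, RingHom.comp_apply, coeff_map, ← cast_pow,
      coeff_natCast_mul, cast_pow] at this
    exact this
  refine ⟨fun K => ?_, fun K ⟨k, hk⟩ => ?_⟩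
  · rw [← fr.truncate_hsCoeff_congr Θ h1, truncate_eq_iff]; have := h3 (p ^ a • K)
    rwa [coeff_expand_smul, coeff_map] at this
  · rw [← fr.truncate_hsCoeff_congr Θ h1, truncate_eq_zero_iff]; have := h3 K
    rwa [coeff_expand_of_not_dvd _ _ _ hk, map_zero, zero_sub, dvd_neg] at this

end WittFrame

end

section

variable (p : ℕ) [Fact p.Prime]

local notation "W" => WittVector p

/-- `K = p ^ r * A`. -/
def IsScaled {κ : Type*} (r : ℕ) (A : κ → ℚ) (K : κ →₀ ℕ) : Prop := ∀ k, (K k : ℚ) = A k * (p : ℚ) ^ r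

variable {p}

section Scaled

variable {κ : Type*} {r : ℕ} {A B : κ → ℚ} {K J : κ →₀ ℕ}

theorem p_pow_ne_zero (r : ℕ) : (p : ℚ) ^ r ≠ 0 := pow_ne_zero r (Nat.cast_ne_zero.2 (Fact.out : p.Prime).ne_zero)

theorem IsScaled.add_right (h : IsScaled p r A K) (a : ℕ) : IsScaled p (r + a) A (p ^ a • K) := by
  intro k
  rw [Finsupp.smul_apply, smul_eq_mul, Nat.cast_mul, h k]
  push_cast
  ring

theorem IsScaled.unique (h : IsScaled p r A K) (h' : IsScaled p r A J) : K = J := by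
  ext k
  exact_mod_cast (h k).trans (h' k).symm

theorem IsScaled.add (h : IsScaled p r A K) (h' : IsScaled p r B J) :
    IsScaled p r (A + B) (K + J) := by
  intro k
  rw [Finsupp.add_apply, Nat.cast_add, h k, h' k, Pi.add_apply]
  ring

theorem IsScaled.exists_of_dvd {a : ℕ} [Finite κ] (h : IsScaled p (r + a) A K)
    (hd : ∀ k, p ^ a ∣ K k) : ∃ J, IsScaled p r A J := by
  refine ⟨equivFunOnFinite.symm fun k => K k / p ^ a, fun k => ?_⟩
  have h1 := h k
  obtain ⟨c, hc⟩ := hd k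
  simp
  rw [hc, Nat.mul_div_cancel_left _ (pow_pos (Fact.out : p.Prime).pos a)]
  rw [hc, pow_add] at h1
  push_cast at h1
  apply mul_left_cancel₀ (p_pow_ne_zero (p := p) a)
  rw [h1]
  ring

variable (p) in
/-- The multi-index `K / p ^ r`. -/
def scl (r : ℕ) (K : κ →₀ ℕ) : κ → ℚ := fun k => (K k : ℚ) / (p : ℚ) ^ r

theorem isScaled_scl (r : ℕ) (K : κ →₀ ℕ) : IsScaled p r (scl p r K) K := fun k => by
  rw [scl, div_mul_cancel₀ _ (p_pow_ne_zero r)]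

theorem IsScaled.eq_scl (h : IsScaled p r A K) : A = scl p r K := funext fun k => by
  rw [scl, h k, mul_div_cancel_right₀ _ (p_pow_ne_zero r)]

theorem isScaled_mul_iff {d : ℕ} :
    IsScaled p r (fun k => A k * p ^ (d : ℤ)) K ↔ IsScaled p (r + d) A K := by
  refine forall_congr' fun k => ?_
  rw [zpow_natCast, mul_assoc, ← pow_add, add_comm]

end Scaled

theorem eq_of_truncate_succ {S : Type*} [CommRing S] {x y : W S}
    (h : ∀ e, truncate (e + 1) x = truncate (e + 1) y) : x = y :=
  eq_of_truncate_eq p S x y fun r => truncate_of_le (Nat.le_succ r) (h r)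

namespace WittFrame

variable {A R L : Type*} [CommRing A] [CommRing R] [Algebra A R] [CommRing L] [CharP R p]
  [PerfectRing R p] (fr : WittFrame p A R L)
  {R₀ κ : Type*} [CommRing R₀] [Algebra R₀ L] [Finite κ] (Θ : L →ₐ[R₀] MvPowerSeries κ L)

theorem exists_wop (Q : κ → ℚ) (z : W R) : ∃ v, ∀ e r y, fr.Rep e r z y →
    (∀ K, IsScaled p r Q K → truncate (e + 1) v = truncate (e + 1) (frob p R (-r) (fr.ι (hsCoeff Θ K y)))) ∧
    ((¬ ∃ K, IsScaled p r Q K) → truncate (e + 1) v = 0) := by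
  by_cases hQ : ∃ s K, IsScaled p s Q K
  swap
  · exact ⟨0, fun e r y _ => ⟨fun K hK => absurd ⟨r, K, hK⟩ hQ, fun _ => map_zero _⟩⟩
  obtain ⟨s, K0, hK0⟩ := hQ
  have hle : ∀ e r y, fr.Rep e r z y → ∀ a y', fr.Rep e (r + a) z y' →
      ∀ K, IsScaled p r Q K → ∀ K', IsScaled p (r + a) Q K' →
      truncate (e + 1) (frob p R (-r) (fr.ι (hsCoeff Θ K y))) =
      truncate (e + 1) (frob p R (-(r + a : ℕ)) (fr.ι (hsCoeff Θ K' y'))) := by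
    intro e r y h a y' h' K hK K' hK'; rw [hK'.unique (hK.add_right a)]; have h1 := (Rep.compat Θ h h').1 K
    rw [← truncate_frob_iff (-(r + a : ℕ))] at h1; rw [← h1, ← frob_add]; push_cast
    rw [show -((r : ℤ) + a) + a = -r by ring]
  have hgen : ∀ e r y, fr.Rep e r z y → ∀ r' y', fr.Rep e r' z y' → ∀ K, IsScaled p r Q K → ∀ K', IsScaled p r' Q K' →
      truncate (e + 1) (frob p R (-r) (fr.ι (hsCoeff Θ K y))) =
      truncate (e + 1) (frob p R (-r') (fr.ι (hsCoeff Θ K' y'))) := by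
    intro e r y h r' y' h' K hK K' hK'; rcases le_total r r' with hr | hr
    · obtain ⟨a, rfl⟩ := exists_eq_add_of_le hr; exact hle e r y h a y' h' K hK K' hK'
    · obtain ⟨a, rfl⟩ := exists_eq_add_of_le hr; exact (hle e r' y' h' a y h K' hK' K hK).symm
  have hex : ∀ e, ∃ a y, fr.Rep e (s + a) z y := fun e => by
    obtain ⟨r0, h⟩ := fr.exists_rep e z; obtain ⟨y, hy⟩ := h (s + r0) (by omega)
    exact ⟨r0, y, hy⟩
  choose a y hy using hex
  obtain ⟨v, hv⟩ := exists_limit (fun e => frob p R (-(s + a e : ℕ))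
    (fr.ι (hsCoeff Θ (p ^ a e • K0) (y e)))) (fun N => by
      rcases N with _ | N
      · exact truncate_eq_iff_coeff.2 fun i hi => absurd hi (Nat.not_lt_zero i)
      · rw [truncate_of_le (Nat.le_succ (N + 1)) (hgen _ _ _ (hy (N + 1 + 1)).of_succ _ _ (hy (N + 1)) _
          (hK0.add_right _) _ (hK0.add_right _))])
  have hv' : ∀ e, truncate (e + 1) v = truncate (e + 1)
      (frob p R (-(s + a e : ℕ)) (fr.ι (hsCoeff Θ (p ^ a e • K0) (y e)))) := fun e => by
    rw [hv (e + 1)]; exact hgen _ _ _ (hy (e + 1)).of_succ _ _ (hy e) _ (hK0.add_right _) _ (hK0.add_right _)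
  refine ⟨v, fun e r y' h => ⟨fun K hK => ?_, fun hK => ?_⟩⟩
  · rw [hv']; exact hgen _ _ _ (hy e) _ _ h _ (hK0.add_right _) _ hK
  · rw [hv']; have hr : r ≤ s + a e := by
      by_contra hr
      obtain ⟨b, rfl⟩ := exists_eq_add_of_le (not_le.1 hr).le; exact hK ⟨_, (hK0.add_right (a e)).add_right b⟩
    obtain ⟨b, hb⟩ := exists_eq_add_of_le hr; have h2 := hy e; have h3 := hK0.add_right (a e); rw [hb] at h2 h3
    have h4 := (Rep.compat Θ h h2).2 (p ^ a e • K0) (by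
      by_contra! h5
      exact hK (h3.exists_of_dvd h5))
    rw [← map_zero (truncate (e + 1)), truncate_eq_iff, sub_zero] at h4
    rw [← map_zero (truncate (e + 1)), truncate_eq_iff, sub_zero]; have := map_dvd (frob p R (-(s + a e : ℕ))) h4
    rwa [map_pow, map_natCast] at this

theorem eq_of_rep {z : W R} {x x' : W R} (h : ∀ e r y, fr.Rep e r z y →
    truncate (e + 1) x = truncate (e + 1) x') : x = x' := by
  refine eq_of_truncate_succ fun e => ?_
  obtain ⟨r0, hr⟩ := fr.exists_rep e z
  obtain ⟨y, hy⟩ := hr r0 le_rfl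
  exact h e r0 y hy

theorem eq_of_rep₂ {z z' : W R} {x x' : W R} (h : ∀ e r y y', fr.Rep e r z y → fr.Rep e r z' y' →
    truncate (e + 1) x = truncate (e + 1) x') : x = x' := by
  refine eq_of_truncate_succ fun e => ?_
  obtain ⟨r0, hr⟩ := fr.exists_rep e z
  obtain ⟨r1, hr1⟩ := fr.exists_rep e z'
  obtain ⟨y, hy⟩ := hr (max r0 r1) (le_max_left _ _)
  obtain ⟨y', hy'⟩ := hr1 (max r0 r1) (le_max_right _ _)
  exact h e _ y y' hy hy'

/-- The operator of index `Q ∈ ℤ[1/p]_{≥ 0}` on `W(R)` attached to a Hasse-Schmidt derivation of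
`L`. It is zero for other indices. -/
def wop (Q : κ → ℚ) : W R →+ W R :=
  AddMonoidHom.mk' (fun z => (fr.exists_wop Θ Q z).choose) fun z z' => by
    refine fr.eq_of_rep₂ (z := z) (z' := z') fun e r y y' h h' => ?_
    obtain ⟨h1, h2⟩ := (fr.exists_wop Θ Q (z + z')).choose_spec e r _ (h.add h')
    obtain ⟨h3, h4⟩ := (fr.exists_wop Θ Q z).choose_spec e r _ h
    obtain ⟨h5, h6⟩ := (fr.exists_wop Θ Q z').choose_spec e r _ h'; by_cases hK : ∃ K, IsScaled p r Q K
    · grind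
    · grind

variable {fr}

theorem Rep.wop {Q : κ → ℚ} {K : κ →₀ ℕ} {e r : ℕ} {z : W R} {y : L} (h : fr.Rep e r z y)
    (hK : IsScaled p r Q K) : truncate (e + 1) (fr.wop Θ Q z) =
      truncate (e + 1) (frob p R (-r) (fr.ι (hsCoeff Θ K y))) :=
  ((fr.exists_wop Θ Q z).choose_spec e r _ h).1 K hK

theorem Rep.wop_eq_zero {Q : κ → ℚ} {e r : ℕ} {z : W R} {y : L} (h : fr.Rep e r z y)
    (hK : ¬ ∃ K, IsScaled p r Q K) : truncate (e + 1) (fr.wop Θ Q z) = 0 :=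
  ((fr.exists_wop Θ Q z).choose_spec e r _ h).2 hK

theorem Rep.rep_wop {Q : κ → ℚ} {K : κ →₀ ℕ} {e r : ℕ} {z : W R} {y : L} (h : fr.Rep e r z y)
    (hK : IsScaled p r Q K) : fr.Rep e r (fr.wop Θ Q z) (hsCoeff Θ K y) :=
  ⟨hsCoeff_mem_ghostRange Θ K h.1, by rw [← truncate_frob_iff (-r), frob_neg_frob, h.wop Θ hK]⟩

variable (fr)

theorem wop_eq_zero {Q : κ → ℚ} (hQ : ¬ ∃ r K, IsScaled p r Q K) : fr.wop Θ Q = 0 := by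
  ext1 z
  refine fr.eq_of_rep (z := z) fun e r y h => ?_
  rw [h.wop_eq_zero Θ (fun ⟨K, hK⟩ => hQ ⟨r, K, hK⟩)]
  simp

theorem wop_zero (h0 : ∀ x, hsCoeff Θ 0 x = x) (z : W R) : fr.wop Θ 0 z = z := by
  refine fr.eq_of_rep (z := z) fun e r y h => ?_
  rw [h.wop Θ (K := 0) (fun k => by simp), h0, ← truncate_frob_iff r, frob_frob_neg, h.2]

theorem frob_wop_nat (d : ℕ) (Q : κ → ℚ) (z : W R) :
    frob p R d (fr.wop Θ Q z) = fr.wop Θ (fun k => Q k * p ^ (d : ℤ)) (frob p R d z) := by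
  refine fr.eq_of_rep (z := frob p R d z) fun e r y h => ?_
  have h' := rep_frob_iff.1 h
  by_cases hK : ∃ K, IsScaled p (r + d) Q K
  · obtain ⟨K, hK⟩ := hK; rw [h.wop Θ (isScaled_mul_iff.2 hK), ← truncate_frob_iff (-d), frob_neg_frob, h'.wop Θ hK,
      ← frob_add]
    push_cast; rw [show -((r : ℤ) + d) = -d + -r by ring]
  · rw [h.wop_eq_zero Θ (fun ⟨K, h1⟩ => hK ⟨K, isScaled_mul_iff.1 h1⟩),
      ← map_zero (truncate (e + 1)), ← map_zero (frob p R d), truncate_frob_iff,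
      h'.wop_eq_zero Θ hK, map_zero]

theorem frob_wop (d : ℤ) (Q : κ → ℚ) (z : W R) :
    frob p R d (fr.wop Θ Q z) = fr.wop Θ (fun k => Q k * p ^ d) (frob p R d z) := by
  obtain ⟨n, rfl | rfl⟩ := d.eq_nat_or_neg
  · exact fr.frob_wop_nat Θ n Q z
  · have h := fr.frob_wop_nat Θ n (fun k => Q k * p ^ (-n : ℤ)) (frob p R (-n) z)
    rw [frob_frob_neg] at h
    have hQ : (fun k => Q k * (p : ℚ) ^ (-n : ℤ) * (p : ℚ) ^ (n : ℤ)) = Q := funext fun k => by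
      rw [mul_assoc, ← zpow_add₀ (Nat.cast_ne_zero.2 (Fact.out : p.Prime).ne_zero), neg_add_cancel,
        zpow_zero, mul_one]
    rw [hQ] at h; rw [← h, frob_neg_frob]

theorem exists_wop_j (Q : κ → ℚ) (w : W A) : ∃ w', fr.wop Θ Q (j p A R w) = j p A R w' := by
  obtain ⟨x, rfl⟩ := fr.exists_map_eq w
  have key : ∀ e, ∃ w', truncate (e + 1) (fr.wop Θ Q (j p A R (WittVector.map fr.π x))) =
      truncate (e + 1) (j p A R w') := by
    intro e; by_cases hK : ∃ K, IsScaled p e Q K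
    · obtain ⟨K, hK⟩ := hK; have h := (fr.rep_map e x).rep_wop Θ hK; obtain ⟨x', hx'⟩ := h.1
      refine ⟨WittVector.map fr.π x', ?_⟩; have h2 := h.2; rw [← hx', truncate_ι_ghost, truncate_frob_iff] at h2
      exact h2.symm
    · exact ⟨0, by rw [(fr.rep_map e x).wop_eq_zero Θ hK, map_zero, map_zero]⟩
  choose w hw using key
  refine ⟨WittVector.mk p fun i => (w i).coeff i, ?_⟩
  ext i
  rw [coeff_j, coeff_mk, ← coeff_j]
  exact truncate_eq_iff_coeff.1 (hw i) i (Nat.lt_succ_self i)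

theorem wop_j_dvd {Q : κ → ℚ} {e : ℕ} (hK : ¬ ∃ K, IsScaled p e Q K) (w : W A) :
    (p : W R) ^ (e + 1) ∣ fr.wop Θ Q (j p A R w) := by
  obtain ⟨x, rfl⟩ := fr.exists_map_eq w
  exact truncate_eq_zero_iff.1 ((fr.rep_map e x).wop_eq_zero Θ hK)

theorem map_p_pow_mul (f : W R →+ W R) (N : ℕ) (z : W R) :
    f (p ^ N * z) = p ^ N * f z := by
  rw [← cast_pow, ← nsmul_eq_mul, map_nsmul, nsmul_eq_mul]

theorem Rep.wop_mul [DecidableEq κ] {fr : WittFrame p A R L} {Q : κ → ℚ} {K : κ →₀ ℕ} {e r : ℕ}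
    {z z' : W R} {y y' : L} (h : fr.Rep e r z y) (h' : fr.Rep e r z' y') (hK : IsScaled p r Q K) :
    truncate (e + 1) (fr.wop Θ Q (z * z')) = truncate (e + 1)
      (∑ ij ∈ antidiagonal K, fr.wop Θ (scl p r ij.1) z * fr.wop Θ (scl p r ij.2) z') := by
  rw [(h.mul h').wop Θ hK, hsCoeff_mul, map_sum, map_sum, map_sum, map_sum]
  refine sum_congr rfl fun ij _ => ?_
  rw [map_mul, map_mul, map_mul, map_mul, h.wop Θ (isScaled_scl r ij.1), h'.wop Θ (isScaled_scl r ij.2)]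

end WittFrame

theorem exists_padicInt_limit (f : ℕ → ℤ_[p]) (h : ∀ N, (p : ℤ_[p]) ^ N ∣ f (N + 1) - f N) :
    ∃ c, ∀ N, (p : ℤ_[p]) ^ N ∣ c - f N := by
  obtain ⟨z, hz⟩ := exists_limit (fun N => (WittVector.equiv p).symm (f N))
    fun N => by
      rw [truncate_eq_iff, ← map_sub]; have := map_dvd (WittVector.equiv p).symm (h N)
      rwa [map_pow, map_natCast] at this
  refine ⟨WittVector.equiv p z, fun N => ?_⟩
  have := map_dvd (WittVector.equiv p) (truncate_eq_iff.1 (hz N))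
  rwa [map_pow, map_natCast, map_sub, RingEquiv.apply_symm_apply] at this

open Polynomial in
theorem dvd_choose_p_mul_sub (r a b : ℕ) : (p : ℤ) ^ (r + 1) ∣
    ((p * (p ^ r * a)).choose (p * b) : ℤ) - ((p ^ r * a).choose b : ℤ) := by
  have h1 : (p : ℤ[X]) ∣ (1 + X) ^ p - expand ℤ p (1 + X) := by
    rw [← map_natCast (C : ℤ →+* ℤ[X]), C_dvd_iff_dvd_coeff]; intro i
    rw [← CharP.intCast_eq_zero_iff (ZMod p) p, ← eq_intCast (Int.castRingHom (ZMod p)), ← coeff_map]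
    simp [add_pow_char]
  have h3 := (dvd_sub_pow_of_dvd_sub h1 r).trans (sub_dvd_pow_sub_pow _ _ a)
  rw [← pow_mul, ← pow_mul, ← pow_mul, ← map_pow, ← map_natCast (C : ℤ →+* ℤ[X]), ← map_pow,
    C_dvd_iff_dvd_coeff] at h3
  have h4 := h3 (p * b)
  rwa [coeff_sub, coeff_one_add_X_pow, coeff_expand_mul' (Fact.out : p.Prime).pos, coeff_one_add_X_pow] at h4

theorem dvd_multiChoose_sub {κ : Type*} [Fintype κ] (r : ℕ) (K J : κ →₀ ℕ) :
    (p : ℤ) ^ (r + 1) ∣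
      (multiChoose (p ^ (r + 1) • K) (p ^ (r + 1) • J) : ℤ) - multiChoose (p ^ r • K) (p ^ r • J) := by
  rw [← Int.modEq_iff_dvd, multiChoose, multiChoose]
  push_cast
  refine Int.ModEq.prod fun k _ => Int.modEq_iff_dvd.2 ?_
  simpa [pow_succ', mul_assoc] using dvd_choose_p_mul_sub (p := p) r (K k) (p ^ r * J k)

theorem dvd_multiChoose_sub_of_le {κ : Type*} [Fintype κ] {r M : ℕ} (hr : r ≤ M)
    (K J : κ →₀ ℕ) : (p : ℤ_[p]) ^ r ∣
      (multiChoose (p ^ M • K) (p ^ M • J) : ℤ_[p]) - multiChoose (p ^ r • K) (p ^ r • J) := by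
  induction M, hr using Nat.le_induction with
  | base => simp
  | succ M hM ih =>
    have h1 := map_dvd (Int.castRingHom ℤ_[p]) (dvd_multiChoose_sub (p := p) M K J)
    simp only [map_pow, map_sub, eq_intCast, Int.cast_natCast] at h1
    have := dvd_add ((pow_dvd_pow _ (by omega : r ≤ M + 1)).trans h1) ih
    rwa [sub_add_sub_cancel] at this

theorem exists_wbinom {κ : Type*} [Fintype κ] (Q Q' : κ → ℚ) : ∃ c,
    ∀ s K J, IsScaled p s Q K → IsScaled p s Q' J → ∀ r,
      (p : ℤ_[p]) ^ r ∣ c - (multiChoose (p ^ r • (K + J)) (p ^ r • K) : ℤ_[p]) := by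
  by_cases h : ∃ s K J, IsScaled p s Q K ∧ IsScaled p s Q' J
  swap
  · exact ⟨0, fun s K J hK hJ => absurd ⟨s, K, J, hK, hJ⟩ h⟩
  obtain ⟨s0, K0, J0, hK0, hJ0⟩ := h
  obtain ⟨c, hc⟩ := exists_padicInt_limit
    (fun r => (multiChoose (p ^ r • (K0 + J0)) (p ^ r • K0) : ℤ_[p]))
    (fun N => dvd_multiChoose_sub_of_le (Nat.le_succ N) _ _)
  refine ⟨c, fun s K J hK hJ r => ?_⟩
  have hKK := (hK.add_right s0).unique (by rw [add_comm]; exact hK0.add_right s)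
  have hJJ := (hJ.add_right s0).unique (by rw [add_comm]; exact hJ0.add_right s)
  have h1 := (pow_dvd_pow (p : ℤ_[p]) (by omega : r ≤ r + s)).trans (hc (r + s))
  have h2 := dvd_multiChoose_sub_of_le (p := p) (by omega : r ≤ r + s0) (K + J) K
  rw [pow_add p r s0, mul_smul, mul_smul, smul_add (p ^ s0), hKK, hJJ, ← smul_add, smul_smul,
    smul_smul, ← pow_add] at h2
  have := dvd_add h1 h2
  rwa [sub_add_sub_cancel] at this

/-- The limit of the binomial coefficients `(p ^ r (Q + Q') choose p ^ r Q)`. -/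
def wbinom {κ : Type*} [Fintype κ] (Q Q' : κ → ℚ) : ℤ_[p] := (exists_wbinom Q Q').choose

theorem wbinom_spec {κ : Type*} [Fintype κ] {Q Q' : κ → ℚ} {r : ℕ} {K J : κ →₀ ℕ}
    {s : ℕ} (hs : s ≤ r) {K0 J0 : κ →₀ ℕ} (hK0 : IsScaled p s Q K0) (hJ0 : IsScaled p s Q' J0)
    (hK : IsScaled p r Q K) (hJ : IsScaled p r Q' J) :
    (p : ℤ_[p]) ^ (r - s) ∣ wbinom Q Q' - (multiChoose (K + J) K : ℤ_[p]) := by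
  obtain ⟨a, rfl⟩ := exists_eq_add_of_le hs
  have := (exists_wbinom Q Q').choose_spec s K0 J0 hK0 hJ0 a
  rwa [Nat.add_sub_cancel_left, hK.unique (hK0.add_right a), hJ.unique (hJ0.add_right a), ← smul_add]

variable (p) in
/-- The `p`-adic integers as Witt vectors. -/
def zp (S : Type*) [CommRing S] [CharP S p] : ℤ_[p] →+* W S :=
  (WittVector.map (ZMod.castHom (dvd_refl p) S)).comp (WittVector.equiv p).symm.toRingHom

theorem map_zp {S S' : Type*} [CommRing S] [CharP S p] [CommRing S'] [CharP S' p] (f : S →+* S')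
    (c : ℤ_[p]) : WittVector.map f (zp p S c) = zp p S' c := by
  ext i
  rw [zp, zp, RingHom.comp_apply, RingHom.comp_apply, map_coeff, map_coeff, map_coeff, ← RingHom.comp_apply]
  congr 1
  exact RingHom.ext_zmod _ _

theorem zp_dvd {S : Type*} [CommRing S] [CharP S p] {N : ℕ} {c : ℤ_[p]} (h : (p : ℤ_[p]) ^ N ∣ c) :
    (p : W S) ^ N ∣ zp p S c := by
  have := map_dvd (zp p S) h
  rwa [map_pow, map_natCast] at this

namespace WittFrame

section Comp

variable {A R L : Type*} [CommRing A] [CommRing R] [Algebra A R] [CommRing L] [CharP R p]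
  [PerfectRing R p] (fr : WittFrame p A R L) {n : ℕ} {S : Fin n → L}
  {R₀ κ : Type*} [CommRing R₀] [Algebra R₀ L] [Fintype κ] {Θ : L →ₐ[R₀] MvPowerSeries κ L}

theorem exists_rep_ge (e r1 : ℕ) (z : W R) : ∃ r ≥ r1, ∃ y, fr.Rep e r z y := by
  obtain ⟨r0, h⟩ := fr.exists_rep e z
  exact ⟨max r0 r1, le_max_right _ _, h _ (le_max_left _ _)⟩

theorem wop_wop [IsAddTorsionFree L] {lam : κ → Fin n} (hS : IsEtaleCoordinates R₀ S)
    (hΘ : IsTaylor S lam Θ) {s : ℕ} {Q Q' : κ → ℚ} {K0 J0 : κ →₀ ℕ} (hK0 : IsScaled p s Q K0)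
    (hJ0 : IsScaled p s Q' J0) (z : W R) :
    fr.wop Θ Q (fr.wop Θ Q' z) = zp p R (wbinom Q Q') * fr.wop Θ (Q + Q') z := by
  refine eq_of_truncate_succ fun e => ?_
  obtain ⟨r, hr, y, hy⟩ := fr.exists_rep_ge e (s + e + 1) z
  obtain ⟨a, rfl⟩ := exists_eq_add_of_le (show s ≤ r by omega)
  have hK := hK0.add_right a
  have hJ := hJ0.add_right a
  have h2 : truncate (e + 1) (zp p R (wbinom Q Q')) = truncate (e + 1)
      ((multiChoose (p ^ a • K0 + p ^ a • J0) (p ^ a • K0) : ℕ) : W R) := by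
    rw [truncate_eq_iff, ← map_natCast (zp p R) (multiChoose _ _), ← map_sub]
    exact zp_dvd ((pow_dvd_pow _ (by omega)).trans (wbinom_spec (Nat.le_add_right s a) hK0 hJ0 hK hJ))
  rw [map_mul, h2, ← map_mul, (hy.rep_wop Θ hJ).wop Θ hK, hΘ.hsCoeff_comp hS, map_mul,
    hy.wop Θ (hK.add hJ), ← map_mul]
  rw [map_nsmul, map_nsmul, nsmul_eq_mul]

end Comp

section Linear

theorem map_frob_nat {S S' : Type*} [CommRing S] [CharP S p] [PerfectRing S p] [CommRing S']
    [CharP S' p] [PerfectRing S' p] (f : S →+* S') (d : ℕ) (x : W S) :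
    WittVector.map f (frob p S d x) = frob p S' d (WittVector.map f x) := by
  ext i
  rw [map_coeff, coeff_frob, coeff_frob, map_coeff, map_pow]

variable {k A R L : Type*} [Field k] [CharP k p] [PerfectRing k p] [CommRing A] [CommRing R]
  [Algebra k R] [Algebra A R] [CommRing L] [CharP R p] [PerfectRing R p] [Algebra (WittVector p k) L]
  (fr : WittFrame p A R L) {κ : Type*} [Finite κ] (Θ : L →ₐ[WittVector p k] MvPowerSeries κ L)

theorem wop_smul (hι : ∀ c, fr.ι (algebraMap _ L c) = WittVector.map (algebraMap k R) c)
    (Q : κ → ℚ) (c : WittVector p k) (z : WittVector p R) :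
    fr.wop Θ Q (WittVector.map (algebraMap k R) c * z) = WittVector.map (algebraMap k R) c * fr.wop Θ Q z := by
  refine eq_of_truncate_succ fun e => ?_
  obtain ⟨r, hr, y, hy⟩ := fr.exists_rep_ge e e z
  obtain ⟨d, rfl⟩ := exists_eq_add_of_le hr
  let X : WittVector p (WittVector p k) := WittVector.mk p fun i => teichmuller p ((frob p k d c).coeff i)
  have hX : WittVector.map WittVector.constantCoeff X = frob p k d c := by
    ext i; rw [map_coeff]; exact teichmuller_coeff_zero (p := p) ((frob p k d c).coeff i)
  have h1 := truncate_ghostComponent e X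
  rw [hX, ← frob_add] at h1
  set c' := ghostComponent e X
  have h2 : truncate (e + 1) (WittVector.map (algebraMap k R) c') =
      truncate (e + 1) (frob p R (e + d : ℕ) (WittVector.map (algebraMap k R) c)) := by
    rw [← map_frob_nat]; refine truncate_eq_iff_coeff.2 fun i hi => ?_
    rw [map_coeff, map_coeff, truncate_eq_iff_coeff.1 h1 i hi]
    rfl
  have hc : fr.Rep e (e + d) (WittVector.map (algebraMap k R) c) (algebraMap _ L c') := by
    refine ⟨⟨WittVector.map (algebraMap _ L) X, ghostComponent_map _ _ _⟩, ?_⟩; rw [hι, h2]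
  by_cases hK : ∃ K, IsScaled p (e + d) Q K
  · obtain ⟨K, hK⟩ := hK; rw [(hc.mul hy).wop Θ hK, ← smul_def, map_smul, smul_def, map_mul, map_mul,
      map_mul, map_mul, hy.wop Θ hK]
    congr 1; rw [hι, ← truncate_frob_iff (e + d : ℕ), frob_frob_neg, h2]
  · rw [(hc.mul hy).wop_eq_zero Θ hK, map_mul, hy.wop_eq_zero Θ hK, mul_zero]

theorem wop_zp (hι : ∀ c, fr.ι (algebraMap _ L c) = WittVector.map (algebraMap k R) c)
    (Q : κ → ℚ) (c : ℤ_[p]) (z : WittVector p R) :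
    fr.wop Θ Q (zp p R c * z) = zp p R c * fr.wop Θ Q z := by
  rw [← map_zp (algebraMap k R)]
  exact fr.wop_smul Θ hι Q _ z

end Linear

end WittFrame

end

section

variable {p : ℕ} [Fact p.Prime]

local notation "W" => WittVector p

section Den

variable {κ : Type*}

variable (p) in
/-- The multi-index `Q` has entries in `ℤ[1/p]_{≥ 0}`. -/
def Scalable (Q : κ → ℚ) : Prop := ∃ r K, IsScaled p r Q K

variable (p) in
/-- The exponent of the common denominator of `Q`. -/
def den (Q : κ → ℚ) : ℕ := sInf {r | ∃ K, IsScaled p r Q K}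

theorem Scalable.exists_den {Q : κ → ℚ} (h : Scalable p Q) : ∃ K, IsScaled p (den p Q) Q K := Nat.sInf_mem h

theorem IsScaled.den_le {Q : κ → ℚ} {r : ℕ} {K : κ →₀ ℕ} (h : IsScaled p r Q K) : den p Q ≤ r := Nat.sInf_le ⟨K, h⟩

theorem IsScaled.scalable {Q : κ → ℚ} {r : ℕ} {K : κ →₀ ℕ} (h : IsScaled p r Q K) : Scalable p Q := ⟨r, K, h⟩

theorem not_isScaled_of_lt_den {Q : κ → ℚ} {r : ℕ} (h : r < den p Q) : ¬ ∃ K, IsScaled p r Q K :=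
  fun ⟨_, hK⟩ => absurd hK.den_le (not_le.2 h)

theorem Scalable.exists_isScaled {Q : κ → ℚ} (h : Scalable p Q) {r : ℕ} (hr : den p Q ≤ r) :
    ∃ K, IsScaled p r Q K := by
  obtain ⟨K, hK⟩ := h.exists_den
  obtain ⟨a, rfl⟩ := exists_eq_add_of_le hr
  exact ⟨_, hK.add_right a⟩

theorem den_zero : den p (0 : κ → ℚ) = 0 := Nat.le_zero.1 (IsScaled.den_le (K := 0) fun k => by simp)

theorem scalable_zero : Scalable p (0 : κ → ℚ) := ⟨0, 0, fun k => by simp⟩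

theorem scalable_scl (r : ℕ) (K : κ →₀ ℕ) : Scalable p (scl p r K) := ⟨r, K, isScaled_scl r K⟩

theorem den_scl_le (r : ℕ) (K : κ →₀ ℕ) : den p (scl p r K) ≤ r := (isScaled_scl r K).den_le

theorem Scalable.add {Q Q' : κ → ℚ} (h : Scalable p Q) (h' : Scalable p Q') :
    Scalable p (Q + Q') := by
  obtain ⟨K, hK⟩ := h.exists_isScaled (le_max_left (den p Q) (den p Q'))
  obtain ⟨J, hJ⟩ := h'.exists_isScaled (le_max_right (den p Q) (den p Q'))
  exact (hK.add hJ).scalable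

theorem den_add_le {Q Q' : κ → ℚ} (h : Scalable p Q) (h' : Scalable p Q') :
    den p (Q + Q') ≤ max (den p Q) (den p Q') := by
  obtain ⟨K, hK⟩ := h.exists_isScaled (le_max_left (den p Q) (den p Q'))
  obtain ⟨J, hJ⟩ := h'.exists_isScaled (le_max_right (den p Q) (den p Q'))
  exact (hK.add hJ).den_le

theorem Scalable.nonneg {Q : κ → ℚ} (h : Scalable p Q) (k : κ) : 0 ≤ Q k := by
  obtain ⟨r, K, hK⟩ := h
  rw [hK.eq_scl, scl]
  positivity

theorem scalable_mul_iff {Q : κ → ℚ} (d : ℕ) :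
    Scalable p (fun k => Q k * p ^ (d : ℤ)) ↔ Scalable p Q := by
  constructor
  · rintro ⟨r, K, h⟩
    exact ⟨_, K, isScaled_mul_iff.1 h⟩
  · rintro ⟨r, K, h⟩
    exact ⟨r, _, isScaled_mul_iff.2 (h.add_right d)⟩

theorem den_mul {Q : κ → ℚ} (h : Scalable p Q) (d : ℕ) :
    den p (fun k => Q k * p ^ (d : ℤ)) = den p Q - d := by
  apply le_antisymm
  · obtain ⟨K, hK⟩ := h.exists_isScaled (show den p Q ≤ den p Q - d + d by omega)
    exact (isScaled_mul_iff.2 hK).den_le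
  · obtain ⟨K, hK⟩ := ((scalable_mul_iff d).2 h).exists_den; have := (isScaled_mul_iff.1 hK).den_le; omega

theorem Scalable.lt_den_of_lt {Q : κ → ℚ} (h : Scalable p Q) {g : ℕ} {k : κ} (hk : 0 < Q k)
    (hk' : Q k < 1 / p ^ g) : g < den p Q := by
  by_contra hg
  obtain ⟨K, hK⟩ := h.exists_isScaled (not_lt.1 hg)
  have hp := pow_pos (p_pos p) g
  rw [lt_div_iff₀ hp, ← hK k] at hk'
  have h0 : (0 : ℚ) < K k := by
    rw [hK k]; positivity
  have h1 : K k < 1 := by exact_mod_cast hk'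
  have h2 : 0 < K k := by exact_mod_cast h0
  omega

end Den

variable {A R : Type*} [CommRing A] [CommRing R] [Algebra A R] [CharP R p] [PerfectRing R p]

namespace WittFrame

variable (p A R) in
/-- The subring `F ^ (-d) (W(A))` of `W(R)`. -/
def wd (d : ℕ) : Subring (W R) := (j p A R).range.comap (frob p R d : W R →+* W R)

theorem mem_wd {d : ℕ} {z : W R} : z ∈ wd p A R d ↔ ∃ w, j p A R w = frob p R d z := Iff.rfl

theorem mem_wd_zero {z : W R} : z ∈ wd p A R 0 ↔ ∃ w, z = j p A R w := by
  rw [mem_wd, cast_zero]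
  simp only [frob_zero, eq_comm]

theorem j_mem_wd (d : ℕ) (w : W A) : j p A R w ∈ wd p A R d := by
  obtain ⟨w', hw'⟩ := j_frob (R := R) d w
  exact ⟨w', hw'.symm⟩

theorem frob_neg_j_mem_wd (d : ℕ) (w : W A) : frob p R (-d) (j p A R w) ∈ wd p A R d := ⟨w, (frob_frob_neg _ _).symm⟩

theorem wd_mono {d e : ℕ} (h : d ≤ e) : wd p A R d ≤ wd p A R e := by
  rintro z ⟨w, hw⟩
  obtain ⟨a, rfl⟩ := exists_eq_add_of_le h
  obtain ⟨w', hw'⟩ := j_frob (R := R) a w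
  refine ⟨w', ?_⟩
  change j p A R w' = frob p R (d + a : ℕ) z
  rw [← hw', hw]
  rw [add_comm d a, Nat.cast_add, frob_add]
  rfl

theorem zp_mem_wd [CharP A p] (d : ℕ) (c : ℤ_[p]) : zp p R c ∈ wd p A R d := by
  rw [← map_zp (algebraMap A R)]
  exact j_mem_wd d _

theorem exists_frob_neg_mul (hinj : Injective (algebraMap A R)) {t : ℕ}
    {z : W R} (hz : z ∈ wd p A R 0) (h : (p : W R) ^ t ∣ z) :
    ∃ w, z = p ^ t * frob p R (-t) (j p A R w) ∧ z = j p A R (verschiebung^[t] w) := by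
  obtain ⟨x, rfl⟩ := mem_wd_zero.1 hz
  have h1 : ∀ i < t, x.coeff i = 0 := fun i hi => by
    have := truncate_eq_iff_coeff.1 ((truncate_eq_zero_iff.2 h).trans (map_zero _).symm) i hi
    rw [coeff_j, zero_coeff] at this; exact hinj (this.trans (map_zero _).symm)
  have h2 := eq_iterate_verschiebung h1
  refine ⟨x.shift t, ?_, congrArg _ h2⟩
  conv_lhs => rw [h2]
  rw [← iterate_verschiebung_eq]
  have h3 : ∀ (t : ℕ) (y : W A), j p A R (verschiebung^[t] y) = verschiebung^[t] (j p A R y) := by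
    intro t y; induction t with
    | zero => rfl
    | succ t ih =>
      rw [Function.iterate_succ_apply', Function.iterate_succ_apply', ← ih]; exact WittVector.map_verschiebung _ _
  exact h3 _ _

theorem j_verschiebung (t : ℕ) (y : W A) : j p A R (verschiebung^[t] y) =
    p ^ t * frob p R (-t) (j p A R y) := by
  rw [← iterate_verschiebung_eq]
  induction t with
  | zero => rfl
  | succ t ih =>
    rw [Function.iterate_succ_apply', Function.iterate_succ_apply', ← ih]; exact WittVector.map_verschiebung _ _

theorem p_pow_mul_mem_wd {d t : ℕ} {z : W R} (h : z ∈ wd p A R (d + t)) :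
    p ^ t * z ∈ wd p A R d := by
  obtain ⟨w, hw⟩ := h
  have hw' : j p A R w = frob p R (d + t : ℕ) z := hw
  refine ⟨verschiebung^[t] w, ?_⟩
  rw [j_verschiebung, hw']
  change _ = frob p R d ((p : W R) ^ t * z)
  rw [map_mul, map_pow, map_natCast, ← frob_add, show -(t : ℤ) + ((d + t : ℕ) : ℤ) = d by push_cast; ring]

theorem exists_mem_wd_of_dvd (hinj : Injective (algebraMap A R)) {d t : ℕ}
    {z : W R} (hz : z ∈ wd p A R d) (h : (p : W R) ^ t ∣ z) :
    ∃ z' ∈ wd p A R (d + t), z = p ^ t * z' := by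
  obtain ⟨z', rfl⟩ := h
  refine ⟨z', ?_, rfl⟩
  have h1 : p ^ t * frob p R d z' ∈ wd p A R 0 := by
    obtain ⟨w, hw⟩ := mem_wd.1 hz; rw [map_mul, map_pow, map_natCast] at hw; exact mem_wd_zero.2 ⟨w, hw.symm⟩
  obtain ⟨w, hw, -⟩ := exists_frob_neg_mul hinj h1 (dvd_mul_right _ _)
  refine ⟨w, ?_⟩
  change j p A R w = frob p R (d + t : ℕ) z'
  rw [add_comm d t, Nat.cast_add, frob_add, p_pow_mul_cancel t hw, frob_frob_neg]

theorem mul_mem_wd (hinj : Injective (algebraMap A R)) {δ d t : ℕ} {b z : W R}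
    (hb : b ∈ wd p A R δ) (hz : z ∈ wd p A R d) (h : (p : W R) ^ t ∣ z) (hδ : δ ≤ d + t) :
    b * z ∈ wd p A R d := by
  obtain ⟨z', hz', rfl⟩ := exists_mem_wd_of_dvd hinj hz h
  rw [mul_left_comm]
  exact p_pow_mul_mem_wd (mul_mem (wd_mono hδ hb) hz')

variable (p A R) in
/-- Coefficients of level `N` with denominator `d`. -/
def coef (N d : ℕ) : AddSubgroup (W R) where
  carrier := {c | c ∈ wd p A R d ∧ (p : W R) ^ (N - d) ∣ c}
  zero_mem' := ⟨zero_mem _, dvd_zero _⟩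
  add_mem' h h' := ⟨add_mem h.1 h'.1, dvd_add h.2 h'.2⟩
  neg_mem' h := ⟨neg_mem h.1, h.2.neg_right⟩

theorem mem_coef {N d : ℕ} {c : W R} :
    c ∈ coef p A R N d ↔ c ∈ wd p A R d ∧ (p : W R) ^ (N - d) ∣ c := Iff.rfl

theorem mem_coef_zero {d : ℕ} {c : W R} : c ∈ coef p A R 0 d ↔ c ∈ wd p A R d := by
  rw [mem_coef, Nat.zero_sub, pow_zero]
  exact and_iff_left (one_dvd _)

theorem coef_mono {N d e : ℕ} (h : d ≤ e) : coef p A R N d ≤ coef p A R N e := fun _ hc =>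
  ⟨wd_mono h hc.1, (pow_dvd_pow _ (by omega)).trans hc.2⟩

theorem coef_max {N M d : ℕ} {c : W R} (h : c ∈ coef p A R N d) (h' : c ∈ coef p A R M d) :
    c ∈ coef p A R (max N M) d := by grind

theorem p_pow_mul_mem_coef {N d t : ℕ} {c : W R} (hc : c ∈ coef p A R N (d + t)) :
    p ^ t * c ∈ coef p A R N d := by
  refine ⟨p_pow_mul_mem_wd hc.1, ?_⟩
  refine (pow_dvd_pow _ (by omega : N - d ≤ t + (N - (d + t)))).trans ?_
  rw [pow_add]
  exact mul_dvd_mul_left _ hc.2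

theorem zp_mul_mem_coef [CharP A p] {N M d : ℕ} {c : W R} {a : ℤ_[p]} (hc : c ∈ coef p A R N M)
    (ha : (p : ℤ_[p]) ^ (M - d) ∣ a) : zp p R a * c ∈ coef p A R N d := by
  obtain ⟨a', rfl⟩ := ha
  rw [map_mul, map_pow, map_natCast, mul_assoc]
  apply p_pow_mul_mem_coef
  have : c ∈ coef p A R N (d + (M - d)) := coef_mono (by omega) hc
  exact ⟨mul_mem (zp_mem_wd _ _) this.1, Dvd.dvd.mul_left this.2 _⟩

section Wop

variable {L : Type*} [CommRing L] (fr : WittFrame p A R L)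
  {R₀ κ : Type*} [CommRing R₀] [Algebra R₀ L] [Finite κ] (Θ : L →ₐ[R₀] MvPowerSeries κ L)

theorem wop_mem_wd {d : ℕ} {z : W R} (Q : κ → ℚ) (hz : z ∈ wd p A R d) :
    fr.wop Θ Q z ∈ wd p A R d := by
  obtain ⟨w, hw⟩ := mem_wd.1 hz
  obtain ⟨w', hw'⟩ := fr.exists_wop_j Θ (fun k => Q k * p ^ (d : ℤ)) w
  exact mem_wd.2 ⟨w', by rw [frob_wop, ← hw, hw']⟩

theorem p_pow_dvd_frob_iff {N : ℕ} {d : ℤ} {z : W R} :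
    (p : W R) ^ N ∣ frob p R d z ↔ (p : W R) ^ N ∣ z := by
  rw [← truncate_eq_zero_iff, ← truncate_eq_zero_iff, ← map_zero (truncate N),
    ← map_zero (frob p R d), truncate_frob_iff, map_zero (frob p R d)]

theorem dvd_wop_of_mem_wd {d : ℕ} {z : W R} (Q : κ → ℚ) (hz : z ∈ wd p A R d) :
    (p : W R) ^ (den p Q - d) ∣ fr.wop Θ Q z := by
  by_cases hQ : Scalable p Q
  swap
  · rw [fr.wop_eq_zero Θ hQ]; exact dvd_zero _
  obtain ⟨w, hw⟩ := mem_wd.1 hz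
  rw [← p_pow_dvd_frob_iff, frob_wop, ← hw]
  rcases Nat.eq_zero_or_pos (den p Q - d) with h | h
  · rw [h, pow_zero]; exact one_dvd _
  · obtain ⟨e, he⟩ := Nat.exists_eq_succ_of_ne_zero h.ne'; rw [he]
    refine fr.wop_j_dvd Θ (not_isScaled_of_lt_den ?_) w; rw [den_mul hQ]; omega

theorem dvd_wop_of_dvd {N : ℕ} {z : W R} (Q : κ → ℚ) (h : (p : W R) ^ N ∣ z) :
    (p : W R) ^ N ∣ fr.wop Θ Q z := by
  obtain ⟨z, rfl⟩ := h
  rw [map_p_pow_mul]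
  exact dvd_mul_right _ _

theorem mul_wop_mem_coef {N M δ d : ℕ} {b c : W R} (hb : b ∈ coef p A R N δ)
    (hc : c ∈ coef p A R M d) (Q : κ → ℚ) {d' : ℕ} (hδ : δ ≤ max (den p Q) d') :
    b * fr.wop Θ Q c ∈ coef p A R (max N M) (max d d') := by
  have h1 := fr.wop_mem_wd Θ Q hc.1
  have h2 := fr.dvd_wop_of_mem_wd Θ Q hc.1
  have hM : (p : W R) ^ (M - max d d') ∣ b * fr.wop Θ Q c :=
    (pow_dvd_pow _ (by omega)).trans ((fr.dvd_wop_of_dvd Θ Q hc.2).mul_left b)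
  by_cases h : δ ≤ max d d'
  · refine coef_max ⟨mul_mem (wd_mono h hb.1) (wd_mono (le_max_left _ _) h1), ?_⟩
      ⟨mul_mem (wd_mono h hb.1) (wd_mono (le_max_left _ _) h1), hM⟩
    exact ((pow_dvd_pow _ (by omega)).trans hb.2).mul_right _
  · have h4 : b * fr.wop Θ Q c ∈ wd p A R (max d d') :=
      wd_mono (le_max_left _ _) (mul_mem_wd fr.inj hb.1 h1 h2 (by omega))
    refine coef_max ⟨h4, ?_⟩ ⟨h4, hM⟩
    refine (pow_dvd_pow _ (by omega : N - max d d' ≤ (N - δ) + (den p Q - d))).trans ?_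
    rw [pow_add]; exact mul_dvd_mul hb.2 h2

end Wop

end WittFrame

end

section

variable (p : ℕ) [Fact p.Prime]

local notation "W" => WittVector p

/-- A `WittFrame` over the Witt vectors of a perfect field together with étale coordinates of the
lift. -/
structure CoordFrame (k A R L : Type*) [Field k] [CommRing A] [CommRing R] [Algebra k R]
    [Algebra A R] [CommRing L] [Algebra (W k) L] (n : ℕ) extends WittFrame p A R L where
  ι_algebraMap : ∀ c : W k, ι (algebraMap _ L c) = WittVector.map (algebraMap k R) c
  S : Fin n → L
  etale : IsEtaleCoordinates (W k) S

variable {p}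

theorem IsScaled.den_eq {κ : Type*} [Unique κ] {q : ℚ} {r i : ℕ} (hi : i ≠ 0)
    (h : i = q * p ^ r) : den p (fun _ : κ => q) = r - padicValNat p i := by
  have hK : IsScaled p r (fun _ : κ => q) (single default i) := fun k => by
    rw [Unique.eq_default k, single_eq_same, h]
  apply le_antisymm
  · rcases le_total r (padicValNat p i) with hr | hr
    · obtain ⟨J, hJ⟩ := IsScaled.exists_of_dvd (by rwa [zero_add]) fun k => by
        rw [Unique.eq_default k, single_eq_same]; exact (pow_dvd_pow p hr).trans pow_padicValNat_dvd
      exact hJ.den_le.trans (by omega)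
    · obtain ⟨J, hJ⟩ := IsScaled.exists_of_dvd
        (by rwa [Nat.sub_add_cancel hr]) fun k => by
          rw [Unique.eq_default k, single_eq_same]; exact pow_padicValNat_dvd
      exact hJ.den_le
  · obtain ⟨K, hK'⟩ := hK.scalable.exists_den
    by_contra hlt
    have h1 := hK'.add_right (r - den p (fun _ : κ => q))
    rw [Nat.add_sub_cancel' hK.den_le] at h1; have h2 := DFunLike.congr_fun (hK.unique h1) default
    rw [single_eq_same, Finsupp.smul_apply, smul_eq_mul] at h2; have h3 := h2 ▸ dvd_mul_right _ _
    rw [padicValNat_dvd_iff_le hi] at h3; omega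

theorem mem_filV_iff_dvd {A R : Type*} [CommRing A] [CommRing R] [Algebra A R] [CharP R p]
    [PerfectRing R p] (hinj : Injective (algebraMap A R)) {N : ℕ} {x : W A} :
    x ∈ filV p A N ↔ (p : W R) ^ N ∣ WittFrame.j p A R x := by
  rw [filV, mem_ker_truncate, ← truncate_eq_zero_iff, ← map_zero (truncate N), truncate_eq_iff_coeff]
  refine forall₂_congr fun i _ => ?_
  rw [WittFrame.coeff_j, zero_coeff]
  exact ⟨fun h => by rw [h, map_zero], fun h => hinj (h.trans (map_zero _).symm)⟩

theorem isAdicComplete_of_pow_eq_bot {C : Type*} [CommRing C] {I : Ideal C} {N : ℕ}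
    (h : I ^ N = ⊥) : IsAdicComplete I C := by
  have h1 : ∀ x y, x ≡ y [SMOD (I ^ N • ⊤ : Submodule C C)] → x = y := by simp [*]
  exact
    { haus' := fun x hx => h1 _ _ (hx N)
      prec' := fun f hf => ⟨f N, fun n => by
        rcases le_total n N with hn | hn
        · exact hf hn
        · rw [h1 _ _ (hf hn)]⟩ }

end

section

variable {p : ℕ} [Fact p.Prime] {k A R L : Type u} [Field k] [CharP k p] [PerfectRing k p]
  [CommRing A] [Algebra k A] [CommRing R] [Algebra k R] [Algebra A R] [IsScalarTower k A R]
  [CharP R p] [PerfectRing R p] [CommRing L] [Algebra (WittVector p k) L] {n : ℕ}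
  (fr : CoordFrame p k A R L n)

local notation "W" => WittVector p

namespace CoordFrame

open WittFrame MvPowerSeries

theorem π_algebraMap (c : W k) :
    fr.π (algebraMap _ L c) = algebraMap k A (c.coeff 0) := by
  apply fr.inj
  rw [← fr.ι_coeff, fr.ι_algebraMap, map_coeff, ← IsScalarTower.algebraMap_apply]

theorem antidiagonal_unit (t : ℕ) {M : Type*} [AddCommMonoid M]
    (f : (Unit →₀ ℕ) → (Unit →₀ ℕ) → M) :
    ∑ ij ∈ antidiagonal (single () t), f ij.1 ij.2 = ∑ ij ∈ antidiagonal t,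
        f (single () ij.1) (single () ij.2) := by simp

theorem isHasseSchmidt_hsCoeff {R₀ B : Type*} [CommRing R₀] [CommRing B] [Algebra R₀ B]
    (Θ : B →ₐ[R₀] MvPowerSeries Unit B) (h0 : ∀ x, constantCoeff (Θ x) = x) :
    IsHasseSchmidt R₀ ⊤ (fun t => hsCoeff Θ (single () t)) :=
  ⟨LinearMap.ext fun x => by
    change hsCoeff Θ (single () 0) x = x; rw [single_zero]; exact h0 x, fun t _ x y => by
    rw [hsCoeff_mul, antidiagonal_unit t fun a b => hsCoeff Θ a x * hsCoeff Θ b y]⟩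

theorem exists_reduction {Θ : L →ₐ[W k] MvPowerSeries Unit L}
    (h0 : ∀ x, constantCoeff (Θ x) = x) : ∃ D : ℕ → Module.End k A, IsHasseSchmidt k ⊤ D ∧
      ∀ t y, D t (fr.π y) = fr.π (hsCoeff Θ (single () t) y) := by
  have h1 : ∀ t y y', fr.π y = fr.π y' → fr.π (hsCoeff Θ (single () t) y) = fr.π (hsCoeff Θ (single () t) y') := by
    intro t y y' h; obtain ⟨z, hz⟩ := fr.ker_π (y - y') (by rw [map_sub, h, sub_self])
    have hp : fr.π p = 0 := by
      apply fr.inj; rw [map_natCast, map_natCast, map_zero, CharP.cast_eq_zero]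
    rw [← sub_eq_zero, ← map_sub, ← map_sub, hz, ← nsmul_eq_mul, map_nsmul, nsmul_eq_mul, map_mul, hp, zero_mul]
  choose f hf using fr.surj
  have key : ∀ t y, fr.π (hsCoeff Θ (single () t) (f (fr.π y))) =
      fr.π (hsCoeff Θ (single () t) y) := fun t y => h1 t _ _ (hf _)
  let D : ℕ → Module.End k A := fun t =>
    { toFun := fun a => fr.π (hsCoeff Θ (single () t) (f a))
      map_add' := fun a b => by
        rw [← map_add, ← map_add]; exact h1 _ _ _ (by rw [hf, map_add, hf, hf])
      map_smul' := fun c a => by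
        have hc : fr.π (algebraMap _ L (teichmuller p c)) = algebraMap k A c := by
          rw [π_algebraMap, teichmuller_coeff_zero]
        have h2 : fr.π (f (c • a)) = fr.π (teichmuller p c • f a) := by rw [hf, smul_def, smul_def, map_mul, hf, hc]
        rw [h1 _ _ _ h2, map_smul, smul_def, map_mul, hc, RingHom.id_apply, smul_def] }
  refine ⟨D, ⟨LinearMap.ext fun a => ?_, fun t _ a b => ?_⟩, key⟩
  · change fr.π (hsCoeff Θ (single () 0) (f a)) = a; rw [single_zero]; exact (congrArg fr.π (h0 _)).trans (hf a)
  · obtain ⟨x, rfl⟩ := fr.surj a; obtain ⟨y, rfl⟩ := fr.surj b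
    have h2 : ∀ t y, D t (fr.π y) = fr.π (hsCoeff Θ (single () t) y) := key
    rw [← map_mul, h2, (isHasseSchmidt_hsCoeff Θ h0).2 t le_top, map_sum]; simp only [map_mul, h2]

open TensorProduct in
theorem isCanonicalLift_wop [Module.Flat (W k) L]
    {Θ : L →ₐ[W k] MvPowerSeries Unit L} (h0 : ∀ x, constantCoeff (Θ x) = x) {r i : ℕ}
    {q : ℚ} (hq : (i : ℚ) = q * (p : ℚ) ^ r) (N : ℕ∞) {D : ℕ → Module.End k A}
    (hD : ∀ t y, D t (fr.π y) = fr.π (hsCoeff Θ (single () t) y))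
    {E : TruncatedWittVector p (r + 1) A →+ TruncatedWittVector p (r + 1) A}
    (hE : ∀ x x', j p A R x' = fr.wop Θ (fun _ => q) (j p A R x) → E (truncate (r + 1) x) = truncate (r + 1) x') :
    IsCanonicalLift p k A r N D i E := by
  let Wr := TruncatedWittVector p (r + 1) k
  let alg : Algebra (W k) Wr := (truncate (r + 1)).toAlgebra
  have htr : ∀ c, algebraMap (W k) Wr c = truncate (r + 1) c := fun _ => rfl
  have halg : ∀ c, (algebraMap Wr (Wr ⊗[W k] L) (truncate (r + 1) c)) =
      Algebra.TensorProduct.includeRight (algebraMap _ L c) := fun c => by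
    rw [AlgHom.commutes]
    rfl
  let inc : L →+* Wr ⊗[W k] L := (Algebra.TensorProduct.includeRight).toRingHom
  have hinc : ∀ x, ∃ y, inc y = x := by
    intro x; induction x using TensorProduct.induction_on with
    | zero => exact ⟨0, map_zero _⟩
    | tmul c y =>
      obtain ⟨c, rfl⟩ := truncate_surjective p (r + 1) k c; refine ⟨c • y, ?_⟩; change 1 ⊗ₜ[W k] (c • y) = _
      rw [TensorProduct.tmul_smul, TensorProduct.smul_tmul', smul_def, mul_one]
      rfl
    | add x x' hx hx' =>
      obtain ⟨y, rfl⟩ := hx; obtain ⟨y', rfl⟩ := hx'; exact ⟨y + y', map_add _ _ _⟩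
  let cW : Wr →+* k := RingHom.liftOfSurjective (truncate (r + 1))
    (truncate_surjective p (r + 1) k) ⟨WittVector.constantCoeff, fun x hx => by
      rw [RingHom.mem_ker] at hx ⊢; have := truncate_eq_iff_coeff.1 (hx.trans (map_zero _).symm) 0 (Nat.succ_pos r)
      rwa [zero_coeff] at this⟩
  have hcW : ∀ c, cW (truncate (r + 1) c) = c.coeff 0 := fun c => RingHom.liftOfRightInverse_comp_apply _ _ _ _ _
  let algA : Algebra (W k) A := (fr.π.comp (algebraMap _ L)).toAlgebra
  let f1 : Wr →ₐ[W k] A :=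
    { (algebraMap k A).comp cW with
      commutes' := fun c => by
        change algebraMap k A (cW (truncate (r + 1) c)) = fr.π (algebraMap _ L c); rw [hcW, π_algebraMap] }
  let f2 : L →ₐ[W k] A := { fr.π with commutes' := fun c => rfl }
  let π' : Wr ⊗[W k] L →+* A := (Algebra.TensorProduct.productMap f1 f2).toRingHom
  have hπ' : ∀ y, π' (inc y) = fr.π y := fun y => by
    change Algebra.TensorProduct.productMap f1 f2 (1 ⊗ₜ y) = _
    rw [Algebra.TensorProduct.productMap_apply_tmul, map_one, one_mul]
    rfl
  let D' : ℕ → Module.End Wr (Wr ⊗[W k] L) := fun t => (hsCoeff Θ (single () t)).baseChange Wr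
  have hD' : ∀ t y, D' t (inc y) = inc (hsCoeff Θ (single () t) y) := fun t y => LinearMap.baseChange_tmul _ _ _
  have hp : ∀ y, inc (p ^ (r + 1) * y) = 0 := fun y => by
    have h1 : (p : Wr ⊗[W k] L) ^ (r + 1) = algebraMap Wr _ (truncate (r + 1) ((p : W k) ^ (r + 1))) := by
      rw [map_pow, map_pow, map_natCast, map_natCast]
    rw [map_mul, map_pow, map_natCast, h1, truncate_eq_zero_iff.2 (dvd_refl _), map_zero, zero_mul]
  refine ⟨Wr ⊗[W k] L, inferInstance, inferInstance, π', D',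
    ⟨inferInstance, fun a => ?_, ?_, fun c => ?_⟩, ⟨?_, fun t _ x y => ?_⟩, fun t _ b => ?_, ?_⟩
  · obtain ⟨y, rfl⟩ := fr.surj a; exact ⟨inc y, hπ' y⟩
  · ext x; obtain ⟨y, rfl⟩ := hinc x; rw [RingHom.mem_ker, hπ', Ideal.mem_span_singleton]
    constructor
    · intro h; obtain ⟨z, rfl⟩ := fr.ker_π y h; exact ⟨inc z, by rw [map_mul, map_natCast]⟩
    · rintro ⟨z, hz⟩
      obtain ⟨z, rfl⟩ := hinc z; rw [← hπ', hz, map_mul, map_natCast, ← map_natCast fr.π p]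
      have : fr.π (p : L) = 0 := fr.inj (by simp)
      rw [this, zero_mul]
  · obtain ⟨c, rfl⟩ := truncate_surjective p (r + 1) k c; rw [halg]; change π' (inc _) = _
    rw [hπ', π_algebraMap, coeff_truncate]
    rfl
  · ext y; change D' 0 (inc y) = inc y; rw [hD', single_zero]; exact congrArg inc (h0 y)
  · obtain ⟨x, rfl⟩ := hinc x; obtain ⟨y, rfl⟩ := hinc y
    rw [← map_mul, hD', (isHasseSchmidt_hsCoeff Θ h0).2 t le_top, map_sum]; simp only [map_mul, hD']
  · obtain ⟨y, rfl⟩ := hinc b; rw [hD', hπ', hπ', hD]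
  · intro x y z hy hz
    choose y' hy' using fun i => hinc (y i)
    choose z' hz' using fun i => hinc (z i)
    let yy : W L := WittVector.mk p fun i => if h : i < r + 1 then y' ⟨i, h⟩ else 0
    let zz : W L := WittVector.mk p fun i => if h : i < r + 1 then z' ⟨i, h⟩ else 0
    have hsum : ∀ (y' : Fin (r + 1) → L), ∑ i : Fin (r + 1), (p : Wr ⊗[W k] L) ^ (i : ℕ) * inc (y' i) ^ p ^ (r - i) =
        inc (ghostComponent r
          (WittVector.mk p fun i => if h : i < r + 1 then y' ⟨i, h⟩ else 0)) := by
      intro y'; rw [ghost_eq_sum, Finset.sum_range, map_sum]; refine sum_congr rfl fun i _ => ?_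
      rw [coeff_mk, dif_pos i.2, map_mul, map_pow, map_pow, map_natCast]
    simp only [← hy', ← hz', hsum, hD']; obtain ⟨x', hx'⟩ := fr.exists_wop_j Θ (fun _ => q) (WittVector.map fr.π yy)
    have h2 : truncate (r + 1) (WittVector.map fr.π yy) = x := by
      ext i; rw [coeff_truncate, map_coeff, coeff_mk, dif_pos i.2, ← hy, ← hπ', hy']
    have h3 : truncate (r + 1) (WittVector.map fr.π zz) = E x := by
      ext i; rw [coeff_truncate, map_coeff, coeff_mk, dif_pos i.2, ← hz, ← hπ', hz']
    have hK : IsScaled p r (fun _ => q) (single () i) := fun k => by rw [single_eq_same, hq]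
    have h6 : truncate (r + 1) (fr.ι (ghostComponent r zz)) = truncate (r + 1)
          (fr.ι (hsCoeff Θ (single () i) (ghostComponent r yy))) := by
      rw [((fr.rep_map r yy).rep_wop Θ hK).2, (fr.rep_map r zz).2, truncate_frob_iff, hx', fr.truncate_j_iff, h3, ← hE _ _ hx'.symm, h2]
    rw [truncate_eq_iff, ← map_sub] at h6; obtain ⟨w, hw⟩ := fr.dvd_of_dvd_ι _ h6
    rw [← sub_eq_zero, ← map_sub, hw, hp]

end CoordFrame
end

section

variable {p : ℕ} [Fact p.Prime] {k A R L : Type u} [Field k] [CharP k p] [PerfectRing k p]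
  [CommRing A] [Algebra k A] [CommRing R] [Algebra k R] [Algebra A R] [IsScalarTower k A R]
  [CharP R p] [PerfectRing R p] [CommRing L] [Algebra (WittVector p k) L] {n : ℕ}
  {fr : CoordFrame p k A R L n} {m : ℤ} {N : ℕ} {κ : Type*}

local notation "W" => WittVector p
local notation "jA" => WittFrame.j p A R
local notation "Curve" => L →ₐ[WittVector p k] MvPowerSeries Unit L
local notation "cst" q:max => fun _ : Unit => q

namespace CoordFrame

section

open WittFrame MvPowerSeries

variable (fr)

theorem exists_of_p_mul_eq_zero {r : ℕ} {M : Type*} [CommRing M]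
    [Algebra (TruncatedWittVector p (r + 1) k) M] [Module.Flat (TruncatedWittVector p (r + 1) k) M]
    {z : M} (hz : (p : M) * z = 0) : ∃ w, z = (p : M) ^ r * w := by
  have h1 : ∑ i : Unit, (p : TruncatedWittVector p (r + 1) k) • z = 0 := by
    rw [Fintype.sum_unique, smul_def, map_natCast, hz]
  obtain ⟨κ, a, y, h2, h3⟩ := Module.Flat.isTrivialRelation_of_sum_smul_eq_zero
    (R := TruncatedWittVector p (r + 1) k) (f := fun _ => (p : _))
    h1
  have h4 : ∀ c, ∃ b, a () c = (p : _) ^ r * b := by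
    intro c; have h5 := h3 c; rw [Fintype.sum_unique] at h5
    obtain ⟨x, hx⟩ := truncate_surjective p (r + 1) k (a () c)
    have h6 : truncate (r + 1) ((p : W k) * x) = 0 := by simp [*]
    obtain ⟨v, hv⟩ := truncate_eq_zero_iff.1 h6; rw [pow_succ', mul_assoc] at hv; refine ⟨truncate (r + 1) v, ?_⟩
    rw [← hx, p_mul_cancel hv, map_mul, map_pow, map_natCast]
  choose b hb using h4
  refine ⟨∑ c, b c • y c, ?_⟩
  rw [show z = _ from h2 (), mul_sum]
  refine sum_congr rfl fun c _ => ?_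
  rw [hb, smul_def, smul_def, map_mul, map_pow, map_natCast, mul_assoc]

theorem exists_lift_of_isCanonicalLift {r i : ℕ} {N : ℕ∞} (hi : (i : ℕ∞) ≤ N)
    {D : ℕ → Module.End k A}
    {E : TruncatedWittVector p (r + 1) A →+ TruncatedWittVector p (r + 1) A}
    (h : IsCanonicalLift p k A r N D i E) : ∃ (Θ : Curve)
      (d : Fin n → ℕ → L), (∀ x, constantCoeff (Θ x) = x) ∧
      (∀ l, Θ (fr.S l) = C (fr.S l) + ∑ t ∈ Finset.range i, C (d l t) * X () ^ (t + 1)) ∧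
      ∀ q : ℚ, (i : ℚ) = q * (p : ℚ) ^ r → ∀ x x', jA x' = fr.wop Θ (fun _ => q) (jA x) →
        E (truncate (r + 1) x) = truncate (r + 1) x' := by
  obtain ⟨L', _, _, π', D', ⟨hflat, hsurj, hker, halg⟩, hD', hDD', hE⟩ := h
  let alg : Algebra (W k) L' := ((algebraMap (TruncatedWittVector p (r + 1) k) L').comp
    (truncate (r + 1))).toAlgebra
  have halg' : ∀ c, algebraMap (W k) L' c =
    algebraMap (TruncatedWittVector p (r + 1) k) L' (truncate (r + 1) c) := fun _ => rfl
  have hp : (p : L') ^ (r + 1) = 0 := by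
    have h1 : (p : L') ^ (r + 1) = algebraMap (TruncatedWittVector p (r + 1) k) L'
        (truncate (r + 1) ((p : W k) ^ (r + 1))) := by simp
    rw [h1, truncate_eq_zero_iff.2 (dvd_refl _), map_zero]
  have hπp : ∀ z, π' z = 0 → ∃ w, z = p * w := fun z hz => by
    rw [← RingHom.mem_ker, hker, Ideal.mem_span_singleton] at hz; exact hz
  obtain ⟨θ, hθ⟩ : ∃ θ : L →ₐ[W k] L', ∀ y, π' (θ y) = fr.π y := by
    have : IsAdicComplete (RingHom.ker π') L' := isAdicComplete_of_pow_eq_bot (by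
      rw [hker, Ideal.span_singleton_pow, hp, Ideal.span_singleton_eq_bot.2 rfl])
    let e := RingHom.quotientKerEquivOfSurjective hsurj
    have he : ∀ z, e.symm (π' z) = Ideal.Quotient.mk _ z := fun z => by
      rw [RingEquiv.symm_apply_eq, RingHom.quotientKerEquivOfSurjective_apply_mk]
    choose g hg using fun l => hsurj (fr.π (fr.S l))
    obtain ⟨θ, h1, -⟩ := fr.etale.exists_lift (RingHom.ker π')
      ((e.symm : A →+* L' ⧸ RingHom.ker π').comp fr.π) (fun c => by
        rw [RingHom.comp_apply, π_algebraMap]; rw [← he, halg', halg, coeff_truncate]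
        rfl) g (fun l => by rw [← he, hg]; rfl)
    refine ⟨θ, fun y => ?_⟩
    have h2 := h1 y; rw [← he] at h2; exact e.symm.injective h2
  have hθs : ∀ N, ∀ z, ∃ y w, z = θ y + (p : L') ^ N * w := by
    intro N; induction N with
    | zero => exact fun z => ⟨0, z, by simp⟩
    | succ N ih =>
      intro z; obtain ⟨y, w, rfl⟩ := ih z; obtain ⟨y', hy'⟩ := fr.surj (π' w)
      obtain ⟨w', hw'⟩ := hπp (w - θ y') (by rw [map_sub, hθ, hy', sub_self])
      refine ⟨y + p ^ N * y', w', ?_⟩; rw [map_add, map_mul, map_pow, map_natCast, pow_succ, mul_assoc, ← hw']; ring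
  have hθsurj : Surjective θ := fun z => by
    obtain ⟨y, w, h1⟩ := hθs (r + 1) z; exact ⟨y, by rw [h1, hp, zero_mul, add_zero]⟩
  have hθk : ∀ N, ∀ y, θ y = 0 → ∃ y' w, θ y' = 0 ∧ y = p ^ N * y' + p ^ (r + 1) * w := by
    intro N; induction N with
    | zero => exact fun y hy => ⟨y, 0, hy, by simp⟩
    | succ N ih =>
      intro y hy; obtain ⟨y', w, h1, rfl⟩ := ih y hy; obtain ⟨y1, rfl⟩ := fr.ker_π y' (by rw [← hθ, h1, map_zero])
      rw [map_mul, map_natCast] at h1; obtain ⟨v, hv⟩ := exists_of_p_mul_eq_zero (k := k) (r := r) h1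
      obtain ⟨v, rfl⟩ := hθsurj v; refine ⟨y1 - p ^ r * v, w + p ^ N * v, ?_, by ring⟩
      rw [map_sub, map_mul, map_pow, map_natCast, hv, sub_self]
  have hθker : ∀ y, θ y = 0 → ∃ w, y = p ^ (r + 1) * w := fun y hy => by
    obtain ⟨y', w, -, h1⟩ := hθk (r + 1) y hy; exact ⟨y' + w, by rw [h1]; ring⟩
  choose d hd using fun l t => hθsurj (D' (t + 1) (θ (fr.S l)))
  obtain ⟨Θ, h0, hΘ⟩ := fr.etale.exists_hasseSchmidt
    (fun l => C (fr.S l) + ∑ t ∈ Finset.range i, C (d l t) * X () ^ (t + 1)) (fun l => by simp)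
  have hcoef : ∀ t, t + 1 ≤ i → ∀ l, hsCoeff Θ (single () (t + 1)) (fr.S l) = d l t := by
    intro t ht l; rw [hsCoeff_apply, hΘ, map_add, map_sum, coeff_C, if_neg (by simp), zero_add, sum_eq_single t]
    · rw [coeff_C_mul, coeff_X_pow, if_pos rfl, mul_one]
    · intro b _ hb; rw [coeff_C_mul, coeff_X_pow, if_neg (fun h => hb (by
        have := DFunLike.congr_fun h (); simp only [single_eq_same] at this; omega)), mul_zero]
    · grind
  have key : ∀ t ≤ i, ∀ y, D' t (θ y) = θ (hsCoeff Θ (single () t) y) := by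
    intro t; induction t using Nat.strong_induction_on with
    | _ t ih =>
    intro ht; rcases t with _ | t
    · intro y; rw [hD'.1, single_zero]; exact congrArg θ (h0 y).symm
    let δ : L →ₗ[W k] L' :=
      { toFun := fun y => D' (t + 1) (θ y) - θ (hsCoeff Θ (single () (t + 1)) y)
        map_add' := fun x y => by simp; ring
        map_smul' := fun c y => by
          have h1 : D' (t + 1) (θ (c • y)) = c • D' (t + 1) (θ y) := by
            rw [map_smul, smul_def, smul_def, halg', ← smul_def, ← smul_def, map_smul]
          rw [h1, map_smul, map_smul, RingHom.id_apply, smul_sub] }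
    have hδ0 : δ = 0 := by
      refine fr.etale.eq_zero_of_leibniz θ δ (fun x y => ?_) (fun l => ?_)
      · change D' (t + 1) (θ (x * y)) - θ (hsCoeff Θ (single () (t + 1)) (x * y)) =
          θ x * (D' (t + 1) (θ y) - θ (hsCoeff Θ (single () (t + 1)) y)) +
          θ y * (D' (t + 1) (θ x) - θ (hsCoeff Θ (single () (t + 1)) x))
        rw [(isHasseSchmidt_hsCoeff Θ h0).2 _ le_top, map_mul, hD'.2 _ ((Nat.cast_le.2 ht).trans hi),
          map_sum, ← sum_sub_distrib]
        rw [Finset.Nat.antidiagonal_succ, sum_cons, sum_map]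
        have hz : ∀ y, hsCoeff Θ (single () 0) y = y := fun y => by rw [single_zero]; exact h0 y
        rcases t with _ | t
        · simp only [Finset.Nat.antidiagonal_zero, sum_singleton, Function.Embedding.prodMap,
            Function.Embedding.coeFn_mk, Prod.map, Function.Embedding.refl_apply, hD'.1,
            LinearMap.id_apply, hz, map_mul]
          simp; ring
        · rw [Finset.Nat.antidiagonal_succ', sum_cons, sum_map, sum_eq_zero]
          · simp only [Function.Embedding.prodMap,
              Function.Embedding.coeFn_mk, Prod.map, Function.Embedding.refl_apply, hD'.1,
              LinearMap.id_apply, hz, map_mul, Nat.succ_eq_add_one]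
            ring
          · intro ij hij; have h3 := mem_antidiagonal.1 hij; simp only [Function.Embedding.prodMap,
              Function.Embedding.coeFn_mk, Prod.map, Function.Embedding.refl_apply,
              Nat.succ_eq_add_one, map_mul]
            rw [ih (ij.1 + 1) (by omega) (by omega), ih (ij.2 + 1) (by omega) (by omega), sub_self]
      · change D' (t + 1) (θ (fr.S l)) - θ (hsCoeff Θ (single () (t + 1)) (fr.S l)) = 0; rw [hcoef t ht, hd, sub_self]
    intro y; exact sub_eq_zero.1 (LinearMap.congr_fun hδ0 y)
  refine ⟨Θ, d, h0, hΘ, fun q hq x x' hx' => ?_⟩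
  obtain ⟨y, rfl⟩ := fr.exists_map_eq x
  obtain ⟨z, hz⟩ : ∃ z : W L, ∀ i : Fin (r + 1), fr.π (z.coeff i) =
      (E (truncate (r + 1) (WittVector.map fr.π y))).coeff i := by
    choose f hf using fr.surj
    exact ⟨WittVector.mk p fun i => if h : i < r + 1 then
      f ((E (truncate (r + 1) (WittVector.map fr.π y))).coeff ⟨i, h⟩) else 0, fun i => by
      rw [coeff_mk, dif_pos i.2, hf]⟩
  have h1 := hE (truncate (r + 1) (WittVector.map fr.π y)) (fun i => θ (y.coeff i))
    (fun i => θ (z.coeff i)) (fun i => by rw [hθ, coeff_truncate, map_coeff]) (fun i => by rw [hθ, hz])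
  have hsum : ∀ y : W L, ∑ i : Fin (r + 1), (p : L') ^ (i : ℕ) * θ (y.coeff i) ^ p ^ (r - i) =
      θ (ghostComponent r y) := fun y => by
    rw [ghost_eq_sum, Finset.sum_range, map_sum]; refine sum_congr rfl fun i _ => ?_
    rw [map_mul, map_pow, map_pow, map_natCast]
  rw [hsum, hsum, key i le_rfl, ← sub_eq_zero, ← map_sub] at h1
  obtain ⟨w, hw⟩ := hθker _ h1
  have hK : IsScaled p r (fun _ => q) (single () i) := fun k => by rw [single_eq_same, hq]
  have h6 : truncate (r + 1) (fr.ι (ghostComponent r z)) = truncate (r + 1)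
        (fr.ι (hsCoeff Θ (single () i) (ghostComponent r y))) := by
    rw [truncate_eq_iff, ← map_sub, hw, map_mul, map_pow, map_natCast]; exact dvd_mul_right _ _
  rw [((fr.rep_map r y).rep_wop Θ hK).2, (fr.rep_map r z).2, truncate_frob_iff, ← hx', fr.truncate_j_iff] at h6
  rw [← h6]
  ext i
  rw [coeff_truncate, map_coeff, hz]

end

end CoordFrame

section

theorem exists_truncEnd (f : End (W A))
    (hf : ∀ x ∈ filV p A N, f x ∈ filV p A N) :
    ∃ E : TruncatedWittVector p N A →+ TruncatedWittVector p N A, ∀ x, E (truncate N x) = truncate N (f x) := by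
  have h1 : ∀ x y, truncate N x = truncate N y → truncate N (f x) = truncate N (f y) := by
    intro x y h; have := hf (x - y) (by rw [filV, RingHom.mem_ker, map_sub, h, sub_self])
    rwa [map_sub, filV, RingHom.mem_ker, map_sub, sub_eq_zero] at this
  choose g hg using truncate_surjective p N A
  refine ⟨AddMonoidHom.mk' (fun x => truncate N (f (g x))) fun x y => ?_, fun x => h1 _ _ (hg _)⟩
  rw [← map_add, ← map_add]
  exact h1 _ _ (by rw [hg, map_add, hg, hg])

namespace CoordFrame

open WittFrame MvPowerSeries

variable (fr)

/-- `g` maps `W(A)` to itself. -/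
def PreservesWA (A : Type*) [CommRing A] [Algebra A R] (g : End (W R)) : Prop :=
  ∀ x : W A, ∃ x', j p A R x' = g (j p A R x)

/-- `f` is the restriction of `g` to `W(A)`. -/
def IsRes (f : End (W A)) (g : End (W R)) : Prop := ∀ x, jA (f x) = g (jA x)

include fr in
theorem PreservesWA.exists_isRes {g : End (W R)} (hg : PreservesWA A g) :
    ∃ f : End (W A), IsRes f g := by
  choose f hf using hg
  refine ⟨AddMonoidHom.mk' f fun x y => fr.j_injective ?_, hf⟩
  rw [hf, map_add, map_add, map_add, hf, hf]

include fr in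
theorem IsRes.map_filV {f : End (W A)} {g : End (W R)} (h : IsRes f g)
    {x : W A} (hx : x ∈ filV p A N) : f x ∈ filV p A N := by
  rw [mem_filV_iff_dvd fr.inj] at hx ⊢
  obtain ⟨z, hz⟩ := hx
  rw [h, hz]
  exact (map_p_pow_mul g N z).symm ▸ dvd_mul_right _ _

/-- The operator `{Θ}_Q` as an element of the endomorphism ring. -/
def opE [Finite κ] (Θ : L →ₐ[W k] MvPowerSeries κ L) (Q : κ → ℚ) :
    End (W R) := fr.wop Θ Q

/-- The operator `c {Θ}_q`. -/
def gen (Θ : Curve) (q : ℚ) (c : W R) : End (W R) := mulOp p R c * fr.opE Θ fun _ => q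

theorem gen_apply (Θ : Curve) (q : ℚ) (c z : W R) :
    fr.gen Θ q c z = c * fr.wop Θ (fun _ => q) z := rfl

/-- The group of finite sums of operators `c {Θ}_q` of level `≤ m`, where `Θ` is a Hasse-Schmidt
derivation of `L` with the property `P`. -/
def elem (m : ℤ) (P : Curve → Prop) :
    AddSubgroup (End (W R)) :=
  AddSubgroup.closure {f | ∃ Θ : Curve, (∀ x, constantCoeff (Θ x) = x) ∧ P Θ ∧ ∃ q : ℚ, 0 < q ∧ q ≤ (p : ℚ) ^ m ∧
      ∃ c ∈ wd p A R (den p (cst q)), f = fr.gen Θ q c}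

/-- The values of `Θ` on the coordinates are polynomials. -/
def IsPoly (Θ : Curve) : Prop :=
  ∃ (N : ℕ) (d : Fin n → ℕ → L), ∀ l, Θ (fr.S l) = C (fr.S l) + ∑ t ∈ Finset.range N, C (d l t) * X () ^ (t + 1)

variable {fr}

theorem elem_mono {P Q : Curve → Prop}
    (h : ∀ Θ, P Θ → Q Θ) : fr.elem m P ≤ fr.elem m Q := by
  refine AddSubgroup.closure_mono ?_
  rintro _ ⟨Θ, h1, h2, h3⟩
  exact ⟨Θ, h1, h _ h2, h3⟩

theorem gen_mem_elem {Θ : Curve}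
    (h0 : ∀ x, constantCoeff (Θ x) = x) {q : ℚ} (hq : 0 < q) (hqm : q ≤ (p : ℚ) ^ m) {c : W R}
    (hc : c ∈ wd p A R (den p (cst q))) : fr.gen Θ q c ∈ fr.elem m fun _ => True :=
  AddSubgroup.subset_closure ⟨Θ, h0, trivial, q, hq, hqm, c, hc, rfl⟩

theorem gen_preservesWA (Θ : Curve) {q : ℚ} {c : W R}
    (hc : c ∈ wd p A R (den p (cst q))) : PreservesWA A (fr.gen Θ q c) := by
  intro x
  obtain ⟨w, hw⟩ := mem_wd_zero.1 (mul_mem_wd fr.inj hc (fr.wop_mem_wd Θ (fun _ => q) (j_mem_wd 0 x)) (fr.dvd_wop_of_mem_wd Θ (fun _ => q) (j_mem_wd 0 x)) (by omega))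
  exact ⟨w, hw.symm⟩

theorem PreservesWA.add {g g' : End (W R)} (h : PreservesWA A g)
    (h' : PreservesWA A g') : PreservesWA A (g + g') := fun x => by
  obtain ⟨y, hy⟩ := h x
  obtain ⟨y', hy'⟩ := h' x
  exact ⟨y + y', by rw [map_add, hy, hy']; rfl⟩

theorem PreservesWA.neg {g : End (W R)} (h : PreservesWA A g) :
    PreservesWA A (-g) := fun x => by
  obtain ⟨y, hy⟩ := h x
  exact ⟨-y, by rw [map_neg, hy]; rfl⟩

theorem elem_preservesWA {P : Curve → Prop}
    {g : End (W R)} (hg : g ∈ fr.elem m P) : PreservesWA A g := by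
  induction hg using closure_induction with
  | mem g h =>
    obtain ⟨Θ, -, -, q, -, -, c, hc, rfl⟩ := h; exact gen_preservesWA Θ hc
  | zero => exact fun x => ⟨0, map_zero _⟩
  | add g g' _ _ h h' => exact h.add h'
  | neg g _ h => exact h.neg

theorem elem_smul {P : Curve → Prop}
    {g : End (W R)} (hg : g ∈ fr.elem m P) (c : W k) (z : W R) :
    g (WittVector.map (algebraMap k R) c * z) = WittVector.map (algebraMap k R) c * g z := by
  induction hg using closure_induction with
  | mem g h =>
    obtain ⟨Θ, -, -, q, -, -, b, -, rfl⟩ := h; rw [gen_apply, gen_apply, fr.wop_smul Θ fr.ι_algebraMap, mul_left_comm]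
  | zero => exact (mul_zero _).symm
  | add g g' _ _ h h' =>
    change g _ + g' _ = _ * (g z + g' z); rw [h, h', mul_add]
  | neg g _ h =>
    change -g _ = _ * -g z; rw [h, mul_neg]

theorem mulOp_j_mul_mem_elem {P : Curve → Prop}
    {g : End (W R)} (hg : g ∈ fr.elem m P) {c : W R} (hc : c ∈ wd p A R 0) :
    mulOp p R c * g ∈ fr.elem m P := by
  induction hg using closure_induction with
  | mem g h =>
    obtain ⟨Θ, h0, hP, q, h1, h2, b, hb, rfl⟩ := h; refine AddSubgroup.subset_closure ⟨Θ, h0, hP, q, h1, h2, c * b,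
      mul_mem (wd_mono (Nat.zero_le _) hc) hb, ?_⟩
    rw [gen, gen, map_mul, mul_assoc]
  | zero => rw [mul_zero]; exact zero_mem _
  | add g g' _ _ h h' => rw [mul_add]; exact add_mem h h'
  | neg g _ h =>
    have : mulOp p R c * -g = -(mulOp p R c * g) := AddMonoidHom.ext fun z => mul_neg c (g z)
    rw [this]; exact neg_mem h

/-- `φ` is the operator induced by `g` on `W_N(A)`. -/
def Induces (N : ℕ) (g : End (W R))
    (φ : TruncatedWittVector p N A →+ TruncatedWittVector p N A) : Prop :=
  ∀ x x', truncate N (jA x') = truncate N (g (jA x)) → φ (truncate N x) = truncate N x'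

theorem Induces.add {g g' : End (W R)} (hg : PreservesWA A g)
    (hg' : PreservesWA A g') {φ φ' : TruncatedWittVector p N A →+ TruncatedWittVector p N A}
    (h : Induces N g φ) (h' : Induces N g' φ') (fr : CoordFrame p k A R L n) :
    Induces N (g + g') (φ + φ') := by
  intro x x' hx
  obtain ⟨y, hy⟩ := hg x
  obtain ⟨y', hy'⟩ := hg' x
  rw [AddMonoidHom.add_apply, h x y (congrArg _ hy), h' x y' (congrArg _ hy'), ← map_add,
    ← fr.truncate_j_iff, map_add, hy, hy', hx]
  rfl

theorem exists_EWTrunc_of_gen [Module.Flat (W k) L] {r : ℕ}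
    {Θ : Curve} (h0 : ∀ x, constantCoeff (Θ x) = x) {q : ℚ}
    (hq : 0 < q) (hqm : q ≤ (p : ℚ) ^ m) {c : W R} (hc : c ∈ wd p A R (den p (cst q))) :
    ∃ ψ ∈ EWTrunc p k A m r, Induces (r + 1) (fr.gen Θ q c) ψ := by
  by_cases hr : ∃ K, IsScaled p r (cst q) K
  swap
  · refine ⟨0, zero_mem _, fun x x' hx => ?_⟩
    have h1 : (p : W R) ^ (r + 1) ∣ fr.gen Θ q c (jA x) := (fr.wop_j_dvd Θ hr x).mul_left c
    rw [truncate_eq_zero_iff.2 h1, ← map_zero (truncate (r + 1)), ← map_zero (jA), fr.truncate_j_iff] at hx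
    rw [hx, map_zero]
    rfl
  obtain ⟨K, hK⟩ := hr
  set i := K () with hi
  have hiq := hK ()
  have hp0 := p_pos p
  have hi0 : 0 < i := by
    have : (0 : ℚ) < i := by rw [hiq]; positivity
    exact_mod_cast this
  have hden := IsScaled.den_eq (κ := Unit) hi0.ne' hiq
  have hbound : i ≤ (p : ℚ) ^ ((r : ℤ) + m) := by
    rw [hiq, zpow_add₀ hp0.ne', zpow_natCast, mul_comm]; exact mul_le_mul_of_nonneg_left hqm (by positivity)
  obtain ⟨D, hD, hDΘ⟩ := fr.exists_reduction h0
  have hres1 : PreservesWA A (fr.opE Θ fun _ => q) := fun x => by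
    obtain ⟨x', hx'⟩ := fr.exists_wop_j Θ (fun _ => q) x
    exact ⟨x', hx'.symm⟩
  obtain ⟨f, hf⟩ := PreservesWA.exists_isRes fr hres1
  obtain ⟨E, hE⟩ := exists_truncEnd f fun x hx => hf.map_filV fr hx
  have hcan : IsCanonicalLift p k A r (i : ℕ∞) D i E :=
    fr.isCanonicalLift_wop h0 hiq _ hDΘ fun x x' hx => by
      rw [hE, ← fr.truncate_j_iff, hf, hx]
      rfl
  have hDi : IsHasseSchmidt k (i : ℕ∞) D := ⟨hD.1, fun l _ => hD.2 l le_top⟩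
  rcases le_or_gt r (padicValNat p i) with hv | hv
  · rw [hden, Nat.sub_eq_zero_of_le hv] at hc; obtain ⟨c0, rfl⟩ := mem_wd_zero.1 hc
    refine ⟨truncate (r + 1) c0 • E, Submodule.smul_mem _ _ (Submodule.subset_span
      ⟨i, D, E, 1, hi0, hbound, hDi, hcan, fun _ x => ?_, fun h => absurd hv (not_le.2 h)⟩), ?_⟩
    · simp
    · intro x x' hx; rw [AddMonoidHom.smul_apply, hE, smul_eq_mul, ← map_mul, ← fr.truncate_j_iff, hx, map_mul, hf]
      rfl
  · obtain ⟨f', hf'⟩ := PreservesWA.exists_isRes fr (gen_preservesWA Θ hc)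
    obtain ⟨E', hE'⟩ := exists_truncEnd f' fun x hx => hf'.map_filV fr hx
    rw [hden] at hc; obtain ⟨a, ha⟩ := mem_wd.1 hc
    refine ⟨E', Submodule.subset_span ⟨i, D, E, a, hi0, hbound, hDi, hcan,
      fun h => absurd hv (not_lt.2 h), fun _ x => ?_⟩, fun x x' hx => ?_⟩
    · obtain ⟨x, rfl⟩ := truncate_surjective p (r + 1) A x
      have h1 := fr.dvd_wop_of_mem_wd Θ (fun _ => q) (j_mem_wd 0 x)
      rw [hden, Nat.sub_zero] at h1; obtain ⟨b, hb, hb'⟩ := exists_frob_neg_mul fr.inj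
        (fr.wop_mem_wd Θ (fun _ => q) (j_mem_wd 0 x)) h1
      refine ⟨b, ?_, ?_⟩
      · rw [hE, ← fr.truncate_j_iff, hf, ← hb']
        rfl
      · rw [hE', ← fr.truncate_j_iff, hf', j_verschiebung, map_mul (jA),
          map_mul (frob p R _), ha, frob_neg_frob, mul_left_comm, ← hb]
        rfl
    · rw [hE', ← fr.truncate_j_iff, hf', hx]

theorem exists_EWTrunc_of_elem [Module.Flat (W k) L]
    {P : Curve → Prop} {r : ℕ} {g : End (W R)}
    (hg : g ∈ fr.elem m P) :
    ∃ ψ ∈ EWTrunc p k A m r, Induces (r + 1) g ψ := by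
  induction hg using closure_induction with
  | mem g h =>
    obtain ⟨Θ, h0, -, q, hq, hqm, c, hc, rfl⟩ := h; exact exists_EWTrunc_of_gen h0 hq hqm hc
  | zero =>
    refine ⟨0, zero_mem _, fun x x' hx => ?_⟩
    have : truncate (r + 1) (jA x') = truncate (r + 1) (jA 0) := by rw [hx, map_zero]; rfl
    rw [fr.truncate_j_iff] at this; rw [this, map_zero]; rfl
  | add g g' hg hg' h h' =>
    obtain ⟨ψ, h1, h2⟩ := h; obtain ⟨ψ', h3, h4⟩ := h'
    exact ⟨ψ + ψ', add_mem h1 h3, h2.add (elem_preservesWA hg) (elem_preservesWA hg') h4 fr⟩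
  | neg g hg h =>
    obtain ⟨ψ, h1, h2⟩ := h; refine ⟨-ψ, neg_mem h1, fun x x' hx => ?_⟩
    have h3 : truncate (r + 1) (jA (-x')) = truncate (r + 1) (g (jA x)) := by
      rw [map_neg, map_neg, hx]; change -(truncate (r + 1) (-(g (jA x)))) = _; rw [map_neg, neg_neg]
    rw [AddMonoidHom.neg_apply, h2 x _ h3, map_neg, neg_neg]

theorem mem_EW_of_approx [Module.Flat (W k) L] {φ : End (W A)}
    (h : ∀ N, ∃ g ∈ fr.elem m (fun _ => True), ∀ x, truncate N (jA (φ x)) =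
      truncate N (g (jA x))) : φ ∈ EW p k A m := by
  refine ⟨fun c x => ?_, fun i x hx => ?_, fun r hr => ?_⟩
  · apply fr.j_injective; refine eq_of_truncate_eq p R _ _ fun N => ?_
    obtain ⟨g, hg, hgx⟩ := h N
    have hc : jA (WittVector.map (algebraMap k A) c) = WittVector.map (algebraMap k R) c := by
      ext i; rw [coeff_j, map_coeff, map_coeff, ← IsScalarTower.algebraMap_apply]
    rw [hgx, map_mul, hc, elem_smul hg, map_mul, ← hgx, ← hc, ← map_mul, ← map_mul]
  · rw [mem_filV_iff_dvd fr.inj] at hx ⊢; obtain ⟨g, hg, hgx⟩ := h i; obtain ⟨z, hz⟩ := hx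
    rw [← truncate_eq_zero_iff, hgx, hz, truncate_eq_zero_iff]; exact (map_p_pow_mul g i z).symm ▸ dvd_mul_right _ _
  · obtain ⟨g, hg, hgx⟩ := h (r + 1); obtain ⟨ψ, h1, h2⟩ := exists_EWTrunc_of_elem hg
    exact ⟨ψ, h1, fun x => (h2 x _ (hgx x)).symm⟩

theorem exists_elem_of_isElementary {r : ℕ}
    {φ : TruncatedWittVector p (r + 1) A →+ TruncatedWittVector p (r + 1) A}
    (h : IsElementary p k A m r φ) : ∃ g ∈ fr.elem m fr.IsPoly, Induces (r + 1) g φ := by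
  obtain ⟨i, D, E, a, hi, him, hD, hE, hr1, hr2⟩ := h
  obtain ⟨Θ, d, h0, hΘ, hq⟩ := fr.exists_lift_of_isCanonicalLift le_rfl hE
  have hp0 := p_pos p
  have hpr : 0 < (p : ℚ) ^ r := by positivity
  set q : ℚ := i / p ^ r with hqdef
  have hiq : i = q * (p : ℚ) ^ r := by rw [hqdef, div_mul_cancel₀ _ hpr.ne']
  have hq0 : 0 < q := div_pos (Nat.cast_pos.2 hi) hpr
  have hqm : q ≤ p ^ m := by
    rw [hqdef, div_le_iff₀ hpr, mul_comm, ← zpow_natCast, ← zpow_add₀ hp0.ne']; exact him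
  have hE' := hq q hiq
  rcases le_or_gt r (padicValNat p i) with hv | hv
  · refine ⟨fr.gen Θ q (jA (WittVector.frobenius^[padicValNat p i - r] a)),
      AddSubgroup.subset_closure ⟨Θ, h0, ⟨_, d, hΘ⟩, q, hq0, hqm, _, j_mem_wd _ _, rfl⟩,
      fun x x' hx => ?_⟩
    obtain ⟨y, hy⟩ := fr.exists_wop_j Θ (fun _ => q) x
    rw [gen_apply, hy, ← map_mul, fr.truncate_j_iff] at hx; rw [hr1 hv, hE' x y hy.symm, hx, map_mul]
  · refine ⟨fr.gen Θ q (frob p R (-(r - padicValNat p i : ℕ)) (jA a)),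
      AddSubgroup.subset_closure ⟨Θ, h0, ⟨_, d, hΘ⟩, q, hq0, hqm, _, (IsScaled.den_eq (κ := Unit) hi.ne' hiq) ▸ frob_neg_j_mem_wd _ _, rfl⟩,
      fun x x' hx => ?_⟩
    obtain ⟨y, hy⟩ := fr.exists_wop_j Θ (fun _ => q) x
    obtain ⟨b, hb1, hb2⟩ := hr2 hv (truncate (r + 1) x); rw [hE' x y hy.symm, ← fr.truncate_j_iff] at hb1
    rw [hb2, ← fr.truncate_j_iff, hx, gen_apply, hy, map_mul (truncate (r + 1)), hb1,
      ← map_mul, j_verschiebung, j_verschiebung, mul_left_comm, ← map_mul, ← map_mul]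

theorem exists_elem_of_EWTrunc {r : ℕ}
    {ψ : TruncatedWittVector p (r + 1) A →+ TruncatedWittVector p (r + 1) A}
    (h : ψ ∈ EWTrunc p k A m r) : ∃ g ∈ fr.elem m fr.IsPoly, Induces (r + 1) g ψ := by
  induction h using Submodule.span_induction with
  | mem ψ h => exact exists_elem_of_isElementary h
  | zero =>
    refine ⟨0, zero_mem _, fun x x' hx => ?_⟩
    have : truncate (r + 1) (jA x') = truncate (r + 1) (jA 0) := by rw [hx, map_zero]; rfl
    rw [fr.truncate_j_iff] at this; rw [this, map_zero]; rfl
  | add ψ ψ' _ _ h h' =>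
    obtain ⟨g, h1, h2⟩ := h; obtain ⟨g', h3, h4⟩ := h'
    exact ⟨g + g', add_mem h1 h3, h2.add (elem_preservesWA h1) (elem_preservesWA h3) h4 fr⟩
  | smul c ψ _ h =>
    obtain ⟨g, h1, h2⟩ := h; obtain ⟨c, rfl⟩ := truncate_surjective p (r + 1) A c
    refine ⟨mulOp p R (jA c) * g, mulOp_j_mul_mem_elem h1 (j_mem_wd _ _), fun x x' hx => ?_⟩
    obtain ⟨y, hy⟩ := elem_preservesWA h1 x
    rw [AddMonoidHom.smul_apply, h2 x y (congrArg _ hy), smul_eq_mul, ← map_mul,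
      ← fr.truncate_j_iff, hx, map_mul (jA), hy]
    rfl

theorem exists_approx_of_mem_EW {φ : End (W A)} (h : φ ∈ EW p k A m) (N : ℕ) :
    ∃ g ∈ fr.elem m fr.IsPoly, ∀ x, truncate N (jA (φ x)) = truncate N (g (jA x)) := by
  obtain ⟨ψ, hψ, hφ⟩ := h.2.2 (max N (-m).toNat) (by omega)
  obtain ⟨g, hg, hgψ⟩ := exists_elem_of_EWTrunc (fr := fr) hψ
  refine ⟨g, hg, fun x => ?_⟩
  obtain ⟨y, hy⟩ := elem_preservesWA hg x
  rw [← hy, fr.truncate_j_iff]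
  refine truncate_of_le (Nat.le_succ_of_le (le_max_left N (-m).toNat)) ?_
  rw [hφ]
  exact hgψ x y (congrArg _ hy)

end CoordFrame
end

namespace CoordFrame

section

open WittFrame MvPowerSeries

variable (fr)

theorem IsRes.add {f f' : End (W A)} {g g' : End (W R)} (h : IsRes f g)
    (h' : IsRes f' g') : IsRes (f + f') (g + g') := fun x =>
  (map_add (jA) _ _).trans (congrArg₂ _ (h x) (h' x))

theorem IsRes.neg {f : End (W A)} {g : End (W R)} (h : IsRes f g) :
    IsRes (-f) (-g) := fun x => (map_neg (jA) _).trans (congrArg _ (h x))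

theorem IsRes.mul {f f' : End (W A)} {g g' : End (W R)} (h : IsRes f g)
    (h' : IsRes f' g') : IsRes (f * f') (g * g') := fun x =>
  (h (f' x)).trans (congrArg g (h' x))

theorem isRes_zero : IsRes (0 : End (W A)) (0 : End (W R)) := fun _ => map_zero (jA)

theorem isRes_one : IsRes (1 : End (W A)) (1 : End (W R)) := fun _ => rfl

theorem isRes_mulOp (a : W A) : IsRes (mulOp p A a) (mulOp p R (jA a)) := fun x => map_mul (jA) a x

theorem end_sum_apply {M ι : Type*} [AddCommGroup M] (s : Finset ι) (f : ι → End M)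
    (x : M) : (∑ i ∈ s, f i) x = ∑ i ∈ s, f i x :=
  map_sum (AddMonoidHom.eval x : (M →+ M) →+ M) f s

theorem dvd_end_sum {M ι : Type*} [CommRing M] (s : Finset ι) (f : ι → End M) {a : M}
    (x : M) (h : ∀ i ∈ s, a ∣ f i x) : a ∣ (∑ i ∈ s, f i) x :=
  (dvd_sum h).trans (end_sum_apply s f x).symm.dvd

variable (p k A R) in
/-- The operators on `W(R)` whose restriction to `W(A)` belongs to `D_{W(A)}^{(m)}`. -/
def resDW (m : ℤ) : Subring (End (W R)) where
  carrier := {g | ∃ P ∈ DW p k A m, IsRes P g}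
  zero_mem' := ⟨0, zero_mem _, isRes_zero⟩
  one_mem' := ⟨1, one_mem _, isRes_one⟩
  add_mem' := fun ⟨P, h, hP⟩ ⟨Q, h', hQ⟩ => ⟨P + Q, add_mem h h', hP.add hQ⟩
  neg_mem' := fun ⟨P, h, hP⟩ => ⟨-P, neg_mem h, hP.neg⟩
  mul_mem' := fun ⟨P, h, hP⟩ ⟨Q, h', hQ⟩ => ⟨P * Q, mul_mem h h', hP.mul hQ⟩

variable (p k A R) in
/-- The operators on `W(R)` whose restriction to `W(A)` belongs to `I^{(N)}`. -/
def resI (m : ℤ) (N : ℕ) : AddSubgroup (End (W R)) where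
  carrier := {g | ∃ P ∈ idealI p k A m N, IsRes P.1 g}
  zero_mem' := ⟨0, zero_mem _, isRes_zero⟩
  add_mem' := fun ⟨P, h, hP⟩ ⟨Q, h', hQ⟩ => ⟨P + Q, add_mem h h', hP.add hQ⟩
  neg_mem' := fun ⟨P, h, hP⟩ => ⟨-P, neg_mem h, hP.neg⟩

theorem mem_resDW {g : End (W R)} :
    g ∈ resDW p k A R m ↔ ∃ P ∈ DW p k A m, IsRes P g := Iff.rfl

theorem mem_resI {g : End (W R)} :
    g ∈ resI p k A R m N ↔ ∃ P ∈ idealI p k A m N, IsRes P.1 g := Iff.rfl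

theorem mul_mem_resI_left {g h : End (W R)}
    (hg : g ∈ resDW p k A R m) (hh : h ∈ resI p k A R m N) : g * h ∈ resI p k A R m N := by
  obtain ⟨P, h1, h2⟩ := hg
  obtain ⟨Q, h3, h4⟩ := hh
  exact ⟨⟨P, h1⟩ * Q, TwoSidedIdeal.mul_mem_left _ _ _ h3, h2.mul h4⟩

theorem mul_mem_resI_right {g h : End (W R)}
    (hg : g ∈ resI p k A R m N) (hh : h ∈ resDW p k A R m) : g * h ∈ resI p k A R m N := by
  obtain ⟨P, h1, h2⟩ := hh
  obtain ⟨Q, h3, h4⟩ := hg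
  exact ⟨Q * ⟨P, h1⟩, TwoSidedIdeal.mul_mem_right _ _ _ h3, h4.mul h2⟩

theorem mulOp_mem_resDW {c : W R} (hc : c ∈ wd p A R 0) :
    mulOp p R c ∈ resDW p k A R m := by
  obtain ⟨a, rfl⟩ := mem_wd_zero.1 hc
  exact ⟨mulOp p A a, (DW.mul p k m a).2, isRes_mulOp a⟩

include fr in
theorem mulOp_mem_resI {c : W R} (hc : c ∈ wd p A R 0) (h : (p : W R) ^ N ∣ c) :
    mulOp p R c ∈ resI p k A R m N := by
  obtain ⟨a, rfl⟩ := mem_wd_zero.1 hc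
  exact ⟨DW.mul p k m a, subset_span (Or.inl
    ⟨a, (mem_filV_iff_dvd fr.inj).2 h, rfl⟩), isRes_mulOp a⟩

include fr in
theorem dvd_of_mem_resI {g : End (W R)} (hg : g ∈ resI p k A R m N)
    (x : W A) : (p : W R) ^ N ∣ g (jA x) := by
  obtain ⟨P, h1, h2⟩ := hg
  rw [← h2, ← mem_filV_iff_dvd fr.inj]
  exact idealI_apply_mem p k A m N P h1 x

variable {fr}

include fr in
theorem preservesWA_of_approx {g : End (W R)}
    (h : ∀ e, ∃ g', PreservesWA A g' ∧ ∀ x, truncate e (g (jA x)) = truncate e (g' (jA x))) :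
    PreservesWA A g := by
  intro x
  choose g' h1 h2 using h
  choose y hy using fun e => h1 e x
  obtain ⟨z, hz⟩ := exists_limit (fun e => y e) fun e => by
    rw [← fr.truncate_j_iff, hy, hy, ← h2 e x]; exact (truncate_of_le e.le_succ (h2 (e + 1) x)).symm
  refine ⟨z, eq_of_truncate_eq p R _ _ fun e => ?_⟩
  rw [h2 e x, ← hy, fr.truncate_j_iff, hz]

variable [Module.Flat (WittVector p k) L]

theorem mem_resDW_of_approx {g : End (W R)}
    (h : ∀ e, ∃ g' ∈ fr.elem m (fun _ => True), ∀ x, truncate e (g (jA x)) = truncate e (g' (jA x))) :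
    ∃ P ∈ EW p k A m, IsRes P g := by
  obtain ⟨f, hf⟩ := PreservesWA.exists_isRes fr (preservesWA_of_approx (fr := fr) fun e => by
    obtain ⟨g', h1, h2⟩ := h e; exact ⟨g', elem_preservesWA h1, h2⟩)
  refine ⟨f, mem_EW_of_approx (fr := fr) fun N => ?_, hf⟩
  obtain ⟨g', h1, h2⟩ := h N
  exact ⟨g', h1, fun x => by rw [hf, h2]⟩

theorem mem_resI_of_approx {g : End (W R)}
    (h : ∀ e, ∃ g' ∈ fr.elem m (fun _ => True), ∀ x, truncate e (g (jA x)) = truncate e (g' (jA x)))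
    (hN : ∀ x, (p : W R) ^ N ∣ g (jA x)) : g ∈ resI p k A R m N := by
  obtain ⟨f, h1, h2⟩ := mem_resDW_of_approx h
  exact ⟨⟨f, Subring.subset_closure (Or.inr h1)⟩, subset_span (Or.inr ⟨h1, fun x => by
    rw [mem_filV_iff_dvd fr.inj, h2]; exact hN x⟩), h2⟩

theorem elem_le_resDW {g : End (W R)} (hg : g ∈ fr.elem m fun _ => True) :
    g ∈ resDW p k A R m := by
  obtain ⟨f, h1, h2⟩ := mem_resDW_of_approx fun _ => ⟨g, hg, fun _ => rfl⟩
  exact ⟨f, Subring.subset_closure (Or.inr h1), h2⟩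

theorem gen_mem_resDW {Θ : Curve}
    (h0 : ∀ x, constantCoeff (Θ x) = x) {q : ℚ} (hq : 0 < q) (hqm : q ≤ (p : ℚ) ^ m) {c : W R}
    (hc : c ∈ wd p A R (den p (cst q))) : fr.gen Θ q c ∈ resDW p k A R m :=
  elem_le_resDW (gen_mem_elem h0 hq hqm hc)

omit [Module.Flat (W k) L] in
theorem dvd_gen (Θ : Curve) (q : ℚ) (c : W R) (x : W A) :
    (p : W R) ^ (den p (cst q)) ∣ fr.gen Θ q c (jA x) :=
  (fr.dvd_wop_of_mem_wd Θ (fun _ => q) (j_mem_wd 0 x)).mul_left c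

theorem gen_mem_resI {Θ : Curve}
    (h0 : ∀ x, constantCoeff (Θ x) = x) {q : ℚ} (hq : 0 < q) (hqm : q ≤ (p : ℚ) ^ m) {c : W R}
    (hc : c ∈ wd p A R (den p (cst q))) (hN : N ≤ den p (cst q)) :
    fr.gen Θ q c ∈ resI p k A R m N :=
  mem_resI_of_approx (fun _ => ⟨_, gen_mem_elem h0 hq hqm hc, fun _ => rfl⟩) fun x =>
    (pow_dvd_pow _ hN).trans (dvd_gen Θ q c x)

theorem gen_mul_mulOp_sub_mem {N G δ d : ℕ}
    {Θ : Curve} (h0 : ∀ x, constantCoeff (Θ x) = x) {q : ℚ}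
    (hqm : q ≤ (p : ℚ) ^ m) {b c : W R} (hb : b ∈ wd p A R δ)
    (hc : c ∈ wd p A R d) (hGδ : δ ≤ G) (hGd : d ≤ G) (hGN : N ≤ G) {K : Unit →₀ ℕ}
    (hK : IsScaled p G (cst q) K) :
    fr.gen Θ q b * mulOp p R c - ∑ ij ∈ antidiagonal K,
      fr.gen Θ (scl p G ij.2 ()) (b * fr.wop Θ (scl p G ij.1) c) ∈ resI p k A R m N := by
  have key : ∀ e, ∃ s : Finset ((Unit →₀ ℕ) × (Unit →₀ ℕ)), ∃ r, (∀ ij ∈ s,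
      0 < scl p r ij.2 () ∧ scl p r ij.2 () ≤ (p : ℚ) ^ m ∧ G < den p (scl p r ij.2)) ∧ ∀ x,
      truncate e ((fr.gen Θ q b * mulOp p R c -
        ∑ ij ∈ antidiagonal K, fr.gen Θ (scl p G ij.2 ()) (b * fr.wop Θ (scl p G ij.1) c)) (jA x)) =
      truncate e ((∑ ij ∈ s, fr.gen Θ (scl p r ij.2 ())
        (b * fr.wop Θ (scl p r ij.1) c)) (jA x)) := by
    intro e; set a := e + d with ha
    set r := G + a with hr
    have hscl : ∀ i : Unit →₀ ℕ, scl p r (p ^ a • i) = scl p G i := fun i =>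
      ((isScaled_scl G i).add_right a).eq_scl.symm
    have hp0 := p_pos p; have hpr : (0 : ℚ) < (p : ℚ) ^ r := by positivity
    obtain ⟨y', hy'⟩ : ∃ y', fr.Rep e r c y' := by
      obtain ⟨w, hw⟩ := mem_wd.1 hc; obtain ⟨y', hy'⟩ := fr.exists_rep_of_j (Nat.le_add_left e G) w
      rw [hw, rep_frob_iff] at hy'; exact ⟨y', by rwa [hr, ha, ← add_assoc]⟩
    refine ⟨(antidiagonal (p ^ a • K)).filter fun ij => ¬ p ^ a ∣ ij.2 (), r, fun ij hij => ?_, fun x => ?_⟩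
    · rw [mem_filter, mem_antidiagonal] at hij; obtain ⟨h1, h2⟩ := hij
      refine ⟨div_pos (Nat.cast_pos.2 (Nat.pos_of_ne_zero fun h => h2 (h ▸ dvd_zero _))) hpr, le_trans ?_ hqm, ?_⟩
      · have h3 := (hK.add_right a) (); rw [scl, div_le_iff₀ hpr, ← h3, ← h1]
        exact Nat.cast_le.2 (Nat.le_add_left _ _)
      · by_contra hd
        obtain ⟨J, hJ⟩ := (scalable_scl r ij.2).exists_isScaled (not_lt.1 hd)
        exact h2 (((hJ.add_right a).unique (isScaled_scl r ij.2)) ▸ Dvd.intro (J ()) rfl)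
    · obtain ⟨y, hy⟩ := fr.exists_rep_of_j (e := e) (r := r) (by omega) x
      have h1 := hy'.wop_mul Θ hy (hK.add_right a); have h2 : ∑ ij ∈ (antidiagonal (p ^ a • K)).filter
            (fun ij => p ^ a ∣ ij.2 ()), fr.wop Θ (scl p r ij.1) c * fr.wop Θ (scl p r ij.2) (jA x) =
          ∑ ij ∈ antidiagonal K, fr.wop Θ (scl p G ij.1) c * fr.wop Θ (scl p G ij.2) (jA x) := by
        have hinj : Injective fun i : Unit →₀ ℕ => p ^ a • i := fun i i' h =>
          Finsupp.ext fun u => Nat.eq_of_mul_eq_mul_left (pow_pos (Fact.out : p.Prime).pos a)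
            (DFunLike.congr_fun h u)
        symm
        refine Finset.sum_bij (fun ij _ => (p ^ a • ij.1, p ^ a • ij.2)) (fun ij hij => ?_)
          (fun ij _ ij' _ h => ?_) (fun ij hij => ?_) fun ij _ => ?_
        · rw [mem_antidiagonal] at hij; rw [mem_filter, mem_antidiagonal, ← hij, smul_add]
          exact ⟨rfl, Dvd.intro _ rfl⟩
        · grind
        · rw [mem_filter, mem_antidiagonal] at hij; obtain ⟨h3, t, ht⟩ := hij
          have h5 : ij.1 () + ij.2 () = p ^ a * K () := DFunLike.congr_fun h3 ()
          obtain ⟨t', ht'⟩ : p ^ a ∣ ij.1 () := by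
            rw [ht] at h5; exact (Nat.dvd_add_left (Dvd.intro _ rfl)).1 (Dvd.intro _ h5.symm)
          have h6 : ij = (p ^ a • single () t', p ^ a • single () t) := by
            refine Prod.ext (Finsupp.ext fun _ => ?_) (Finsupp.ext fun _ => ?_)
            · simpa using ht'
            · simpa using ht
          refine ⟨(single () t', single () t), ?_, h6.symm⟩; rw [mem_antidiagonal]; refine hinj ?_; rw [h6] at h3
          simpa [smul_add] using h3
        · rw [hscl, hscl]
      rw [← Finset.sum_filter_add_sum_filter_not _ (fun ij => p ^ a ∣ ij.2 ()), h2] at h1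
      refine truncate_of_le e.le_succ ?_; have h7 : (fr.gen Θ q b * mulOp p R c - ∑ ij ∈ antidiagonal K,
          fr.gen Θ (scl p G ij.2 ()) (b * fr.wop Θ (scl p G ij.1) c)) (jA x) =
          b * (fr.wop Θ (fun _ => q) (c * jA x) - ∑ ij ∈ antidiagonal K,
            fr.wop Θ (scl p G ij.1) c * fr.wop Θ (scl p G ij.2) (jA x)) := by
        rw [mul_sub, mul_sum]; refine congrArg (b * fr.wop Θ (fun _ => q) (c * jA x) - ·) ?_
        refine (end_sum_apply _ _ _).trans ?_; exact sum_congr rfl fun ij _ => mul_assoc _ _ _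
      rw [h7, map_mul, map_sub, h1, map_add, add_sub_cancel_left, ← map_mul, mul_sum]
      refine congrArg _ (Eq.trans ?_ (end_sum_apply _ _ _).symm)
      exact sum_congr rfl fun ij _ => (mul_assoc _ _ _).symm
  have hmem : ∀ (r : ℕ) (ij : (Unit →₀ ℕ) × (Unit →₀ ℕ)), G < den p (scl p r ij.2) →
      b * fr.wop Θ (scl p r ij.1) c ∈ wd p A R (den p (scl p r ij.2)) := by
    intro r ij h; have := fr.mul_wop_mem_coef Θ (mem_coef_zero.2 hb) (mem_coef_zero.2 hc) (scl p r ij.1)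
      (d' := den p (scl p r ij.2)) ((hGδ.trans h.le).trans (le_max_right _ _))
    rw [max_eq_right (hGd.trans h.le), max_self] at this; exact mem_coef_zero.1 this
  refine mem_resI_of_approx (fr := fr) (fun e => ?_) fun x => ?_
  · obtain ⟨s, r, h1, h2⟩ := key e; refine ⟨_, sum_mem fun ij hij => ?_, h2⟩
    obtain ⟨h3, h4, h5⟩ := h1 ij hij; exact gen_mem_elem h0 h3 h4 (hmem r ij h5)
  · obtain ⟨s, r, h1, h2⟩ := key N; rw [← truncate_eq_zero_iff, h2, truncate_eq_zero_iff]
    refine dvd_end_sum _ _ _ fun ij hij => ?_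
    exact dvd_trans (pow_dvd_pow _ (hGN.trans (h1 ij hij).2.2.le)) (dvd_gen (fr := fr) Θ (scl p r ij.2 ()) (b * fr.wop Θ (scl p r ij.1) c) x)

end

end CoordFrame

section

theorem padicInt_eq_of_dvd {x y : ℤ_[p]} (s : ℕ) (h : ∀ r, s ≤ r → (p : ℤ_[p]) ^ (r - s) ∣ x - y) :
    x = y := by
  by_contra hxy
  refine FiniteMultiplicity.not_iff_forall.2 (fun N => ?_)
    (FiniteMultiplicity.of_not_isUnit PadicInt.prime_p.not_isUnit (sub_ne_zero.2 hxy))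
  simpa using h (s + N) (Nat.le_add_right _ _)

theorem p_pow_dvd_choose_of_dvd {a t M i : ℕ} (hM : p ^ (a + t) ∣ M) (hi : ¬ p ^ (t + 1) ∣ i) :
    p ^ a ∣ M.choose i := by
  rcases Nat.eq_zero_or_pos i with rfl | hi0
  · exact absurd (dvd_zero _) hi
  rcases Nat.eq_zero_or_pos M with rfl | hM0
  · rw [choose_eq_zero_of_lt hi0]; exact dvd_zero _
  obtain ⟨i, rfl⟩ := Nat.exists_eq_succ_of_ne_zero hi0.ne'
  obtain ⟨M, rfl⟩ := Nat.exists_eq_succ_of_ne_zero hM0.ne'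
  have hp : p.Prime := Fact.out
  have h2 := (Nat.add_one_mul_choose_eq M i) ▸ hM.mul_right _
  obtain ⟨v, w, hw, hv⟩ := Nat.exists_eq_pow_mul_and_not_dvd (n := i + 1) (Nat.succ_ne_zero i) p
    hp.ne_one
  have hvt : v ≤ t := by
    by_contra h
    exact hi ((pow_dvd_pow p (by omega)).trans (hv ▸ Dvd.intro _ rfl))
  obtain ⟨C, hC⟩ : ∃ C, C = (M + 1).choose (i + 1) := ⟨_, rfl⟩
  rw [← hC] at h2
  rw [Nat.succ_eq_add_one, Nat.succ_eq_add_one, ← hC]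
  rw [hv, mul_left_comm, show a + t = v + (a + t - v) by omega, pow_add] at h2
  exact (pow_dvd_pow p (by omega)).trans ((((Nat.Prime.coprime_iff_not_dvd hp).2 hw).pow_left _).dvd_of_dvd_mul_right (Nat.dvd_of_mul_dvd_mul_left (pow_pos hp.pos v) h2))

variable {κ : Type*}

theorem Scalable.exists_not_dvd [Finite κ] {Q : κ → ℚ} (_ : Scalable p Q) (h0 : 0 < den p Q) {t : ℕ}
    {K : κ →₀ ℕ} (hK : IsScaled p (den p Q + t) Q K) : ∃ k, ¬ p ^ (t + 1) ∣ K k := by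
  by_contra hc
  push Not at hc
  obtain ⟨J, hJ⟩ := IsScaled.exists_of_dvd
    (by rwa [show den p Q - 1 + (t + 1) = den p Q + t by omega]) hc
  have := hJ.den_le
  omega

theorem p_pow_dvd_wbinom [Fintype κ] {Q Q' : κ → ℚ} (hQ : Scalable p Q) (hQ' : Scalable p Q') :
    (p : ℤ_[p]) ^ (max (den p Q) (den p Q') - den p (Q + Q')) ∣ wbinom Q Q' := by
  set s := max (den p Q) (den p Q') with hs
  set a := s - den p (Q + Q') with ha
  rcases Nat.eq_zero_or_pos a with h0 | hpos
  · rw [h0, pow_zero]; exact one_dvd _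
  obtain ⟨K0, hK0⟩ := hQ.exists_isScaled (le_max_left (den p Q) (den p Q'))
  obtain ⟨J0, hJ0⟩ := hQ'.exists_isScaled (le_max_right (den p Q) (den p Q'))
  obtain ⟨M0, hM0⟩ := (hQ.add hQ').exists_den
  have hK := hK0.add_right a
  have hJ := hJ0.add_right a
  have hM := hM0.add_right (a + a)
  have hKJ : p ^ a • K0 + p ^ a • J0 = p ^ (a + a) • M0 := by
    refine (hK.add hJ).unique ?_; rwa [show den p (Q + Q') + (a + a) = s + a by omega] at hM
  have h1 := wbinom_spec (Nat.le_add_right s a) hK0 hJ0 hK hJ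
  rw [Nat.add_sub_cancel_left] at h1
  refine (dvd_sub_left ?_).1 h1
  suffices h : p ^ a ∣ multiChoose (p ^ a • K0 + p ^ a • J0) (p ^ a • K0) by
    have := Nat.cast_dvd_cast (α := ℤ_[p]) h; rwa [cast_pow] at this
  obtain ⟨l, hl⟩ : ∃ l, ¬ p ^ (a + 1) ∣ (p ^ a • K0) l := by
    rcases max_choice (den p Q) (den p Q') with h | h
    · refine hQ.exists_not_dvd (by omega) ?_
      rwa [← h, ← hs]
    · obtain ⟨l, hl⟩ := hQ'.exists_not_dvd (by omega) (by rwa [← h, ← hs])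
      refine ⟨l, fun h2 => hl ?_⟩
      have h3 : (p ^ a • K0) l + (p ^ a • J0) l = p ^ (a + a) * M0 l := DFunLike.congr_fun hKJ l
      refine (Nat.dvd_add_right h2).1 (h3 ▸ ((pow_dvd_pow p (by omega)).mul_right _))
  refine dvd_trans ?_ (Finset.dvd_prod_of_mem _ (mem_univ l))
  refine p_pow_dvd_choose_of_dvd ?_ hl
  rw [hKJ]
  exact Dvd.intro _ rfl

theorem wbinom_of_disjoint [Fintype κ] {Q Q' : κ → ℚ} (hQ : Scalable p Q) (hQ' : Scalable p Q')
    (h : ∀ k, Q k = 0 ∨ Q' k = 0) : wbinom (p := p) Q Q' = 1 := by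
  obtain ⟨s, K0, hK0⟩ := hQ
  obtain ⟨s', J0, hJ0⟩ := hQ'
  have hK0 := hK0.add_right s'
  have hJ0 := hJ0.add_right s
  rw [add_comm s'] at hJ0
  refine padicInt_eq_of_dvd (s + s') fun r hr => ?_
  have hK := hK0.add_right (r - (s + s'))
  have hJ := hJ0.add_right (r - (s + s'))
  rw [Nat.add_sub_cancel' hr] at hK hJ
  convert (wbinom_spec hr hK0 hJ0 hK hJ) using 2
  symm
  rw [multiChoose]
  refine (Nat.cast_eq_one).2 (prod_eq_one fun k _ => ?_)
  rcases h k with h | h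
  · have h2 := hK k; rw [h, zero_mul, Nat.cast_eq_zero] at h2; rw [h2, Nat.choose_zero_right]
  · have h2 := hJ k; rw [h, zero_mul, Nat.cast_eq_zero] at h2; rw [Finsupp.add_apply, h2, add_zero, Nat.choose_self]

theorem choose_modEq_one (c a y : ℕ) (hy : y < p ^ c) : (y + p ^ c * a).choose y ≡ 1 [MOD p] := by
  induction c generalizing y with
  | zero =>
    rw [pow_zero, Nat.lt_one_iff] at hy; rw [hy, Nat.choose_zero_right]
  | succ c ih =>
    refine Choose.choose_modEq_choose_mod_mul_choose_div_nat.trans ?_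
    have h1 : (y + p ^ (c + 1) * a) % p = y % p := by rw [pow_succ', mul_assoc, Nat.add_mul_mod_self_left]
    have h2 : (y + p ^ (c + 1) * a) / p = y / p + p ^ c * a := by
      rw [pow_succ', mul_assoc, Nat.add_mul_div_left _ _ ((Fact.out : p.Prime).pos)]
    rw [h1, h2, Nat.choose_self, one_mul]; exact ih _ (Nat.div_lt_of_lt_mul (by rwa [← pow_succ']))

theorem p_dvd_wbinom_sub_one [Fintype κ] {Q Q' : κ → ℚ} (hQ : Scalable p Q)
    (hQ' : Scalable p Q') {z : ℤ} (h : ∀ k, Q k < p ^ z)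
    (h' : ∀ k, ∃ a : ℕ, Q' k = a * p ^ z) : (p : ℤ_[p]) ∣ wbinom Q Q' - 1 := by
  obtain ⟨s, K0, hK0⟩ := hQ
  obtain ⟨s', J0, hJ0⟩ := hQ'
  replace hK0 := hK0.add_right s'
  replace hJ0 := hJ0.add_right s
  rw [add_comm s'] at hJ0
  generalize p ^ s' • K0 = K0 at hK0
  generalize p ^ s • J0 = J0 at hJ0
  set t := (-z).toNat + 1 with ht
  have hK := hK0.add_right t
  have hJ := hJ0.add_right t
  set r := s + s' + t with hr
  have hp0 := p_pos p
  obtain ⟨c, hc⟩ : ∃ c : ℕ, c = r + z := ⟨(r + z).toNat, by rw [Int.toNat_of_nonneg]; omega⟩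
  have hcq : p ^ z * p ^ r = (p : ℚ) ^ c := by
    rw [← zpow_natCast _ r, ← zpow_natCast _ c, ← zpow_add₀ hp0.ne', hc, add_comm]
  have h1 := wbinom_spec (Nat.le_add_right (s + s') t) hK0 hJ0 hK hJ
  rw [Nat.add_sub_cancel_left] at h1
  have h3 : multiChoose (p ^ t • K0 + p ^ t • J0) (p ^ t • K0) ≡ 1 [MOD p] := by
    rw [multiChoose, ← Finset.prod_const_one (s := (Finset.univ : Finset κ))]; refine Nat.ModEq.prod fun k _ => ?_
    obtain ⟨a, ha⟩ := h' k; have h4 : (p ^ t • J0) k = p ^ c * a := by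
      have := hJ k; rw [ha, mul_assoc, hcq, mul_comm] at this; exact_mod_cast this
    have h5 : (p ^ t • K0) k < p ^ c := by
      have := mul_lt_mul_of_pos_right (h k) (pow_pos hp0 r); rw [← hK k, hcq] at this; exact_mod_cast this
    rw [Finsupp.add_apply, h4]; exact choose_modEq_one c a _ h5
  have h6 : (p : ℤ_[p]) ∣ (multiChoose (p ^ t • K0 + p ^ t • J0) (p ^ t • K0) : ℤ_[p]) - 1 := by
    have := (Nat.modEq_iff_dvd.1 h3.symm)
    simpa using map_dvd (Int.castRingHom ℤ_[p]) this
  simpa using dvd_add ((dvd_pow_self _ (Nat.succ_ne_zero _)).trans h1) h6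

theorem isUnit_wbinom [Fintype κ] {Q Q' : κ → ℚ} (hQ : Scalable p Q)
    (hQ' : Scalable p Q') {z : ℤ} (h : ∀ k, Q k < p ^ z)
    (h' : ∀ k, ∃ a : ℕ, Q' k = a * p ^ z) : IsUnit (wbinom (p := p) Q Q') := by
  by_contra hu
  have h2 : (p : ℤ_[p]) ∣ wbinom Q Q' := by
    rw [← Ideal.mem_span_singleton, ← PadicInt.maximalIdeal_eq_span_p]; exact hu
  have h3 : (p : ℤ_[p]) ∣ 1 := by simpa using dvd_sub h2 (p_dvd_wbinom_sub_one hQ hQ' h h')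
  exact PadicInt.prime_p.not_isUnit (isUnit_of_dvd_one h3)

theorem isScaled_single_iff [DecidableEq κ] {r : ℕ} {k : κ} {q : ℚ} :
    (∃ K, IsScaled p r (Pi.single k q) K) ↔ ∃ K, IsScaled p r (cst q) K := by
  constructor
  · rintro ⟨K, hK⟩
    exact ⟨single () (K k), fun _ => by simpa using hK k⟩
  · rintro ⟨K, hK⟩
    refine ⟨single k (K ()), fun k' => ?_⟩
    rcases eq_or_ne k' k with rfl | h
    · simpa using hK ()
    · simp [h]

theorem den_single [DecidableEq κ] (k : κ) (q : ℚ) :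
    den p (Pi.single k q : κ → ℚ) = den p (cst q) :=
  congrArg sInf (Set.ext fun _ => isScaled_single_iff)

theorem scalable_single [DecidableEq κ] {k : κ} {q : ℚ} :
    Scalable p (Pi.single k q : κ → ℚ) ↔ Scalable p (cst q) :=
  exists_congr fun _ => isScaled_single_iff

theorem Scalable.apply {Q : κ → ℚ} (h : Scalable p Q) (k : κ) : Scalable p (fun _ : Unit => Q k) := by
  obtain ⟨r, K, hK⟩ := h
  exact ⟨r, single () (K k), fun _ => by simpa using hK k⟩

theorem Scalable.den_apply_le {Q : κ → ℚ} (h : Scalable p Q) (k : κ) :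
    den p (fun _ : Unit => Q k) ≤ den p Q := by
  obtain ⟨K, hK⟩ := h.exists_den
  exact IsScaled.den_le (K := single () (K k)) fun _ => by simpa using hK k

theorem Scalable.exists_den_apply [Finite κ] {Q : κ → ℚ} (h : Scalable p Q) (h0 : 0 < den p Q) :
    ∃ k, den p (fun _ : Unit => Q k) = den p Q := by
  obtain ⟨K, hK⟩ := h.exists_den
  obtain ⟨k, hk⟩ := h.exists_not_dvd h0 (t := 0) hK
  refine ⟨k, le_antisymm (h.den_apply_le k) ?_⟩
  by_contra hlt
  obtain ⟨J, hJ⟩ := (h.apply k).exists_den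
  have h1 := hJ.add_right (den p Q - den p fun _ : Unit => Q k)
  rw [Nat.add_sub_cancel' (h.den_apply_le k)] at h1
  have h2 : IsScaled p (den p Q) (fun _ => Q k) (single () (K k)) := fun _ => by simpa using hK k
  have h3 := DFunLike.congr_fun (h1.unique h2) ()
  simp only [Finsupp.smul_apply, smul_eq_mul, single_eq_same] at h3
  refine hk (h3 ▸ Dvd.dvd.mul_right (pow_dvd_pow p ?_) _)
  omega

theorem scalable_zpow (m : ℤ) : Scalable p (fun _ : Unit => p ^ m) := by
  refine ⟨(-m).toNat, single () (p ^ (m + (-m).toNat).toNat), fun _ => ?_⟩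
  rw [single_eq_same, cast_pow, ← zpow_natCast, ← zpow_natCast, ← zpow_add₀ (p_pos p).ne']
  congr 1
  omega

theorem den_zpow (m : ℤ) : den p (fun _ : Unit => p ^ m) = (-m).toNat := by
  have h := IsScaled.den_eq (p := p) (κ := Unit) (q := p ^ m) (r := (-m).toNat)
    (i := p ^ (m + (-m).toNat).toNat) (pow_ne_zero _ (Fact.out : p.Prime).ne_zero) (by
      rw [cast_pow, ← zpow_natCast, ← zpow_natCast, ← zpow_add₀ (p_pos p).ne']; congr 1; omega)
  rw [h, padicValNat.prime_pow]
  omega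

end

section

open MvPowerSeries

variable {R₀ B : Type*} [CommRing R₀] [CommRing B] [Algebra R₀ B] {n : ℕ} {S : Fin n → B}
  {κ κ' : Type*}

theorem IsTaylor.hsCoeff_single_one_apply [DecidableEq κ] {lam : κ → Fin n}
    {Θ : B →ₐ[R₀] MvPowerSeries κ B} (h : IsTaylor S lam Θ) (k : κ) (l : Fin n) :
    hsCoeff Θ (single k 1) (S l) = if lam k = l then 1 else 0 := by
  obtain ⟨s, hs, hl⟩ := h.2 l
  rw [hsCoeff_apply, hl, map_add, map_sum, coeff_C, if_neg (by simp), zero_add]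
  simp only [coeff_X, Finsupp.single_left_inj one_ne_zero]
  rw [Finset.sum_ite_eq]
  simp only [hs]

theorem IsTaylor.hsCoeff_single_one_mul {lam : κ → Fin n} {Θ : B →ₐ[R₀] MvPowerSeries κ B}
    (h : IsTaylor S lam Θ) (k : κ) (x y : B) : hsCoeff Θ (single k 1) (x * y) =
      x * hsCoeff Θ (single k 1) y + y * hsCoeff Θ (single k 1) x := by
  classical
  rw [hsCoeff_mul, Finsupp.antidiagonal_single, sum_map, Finset.Nat.antidiagonal_succ]
  simp [IsTaylor.hsCoeff_zero h, mul_comm]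

theorem IsTaylor.hsCoeff_single_eq [Finite κ] [Finite κ'] [IsAddTorsionFree B] {lam : κ → Fin n}
    {lam' : κ' → Fin n} {Θ : B →ₐ[R₀] MvPowerSeries κ B} {Θ' : B →ₐ[R₀] MvPowerSeries κ' B}
    (hS : IsEtaleCoordinates R₀ S) (h : IsTaylor S lam Θ) (h' : IsTaylor S lam' Θ') {k : κ}
    {k' : κ'} (hk : lam k = lam' k') (i : ℕ) :
    hsCoeff Θ (single k i) = hsCoeff Θ' (single k' i) := by
  classical
  have hd : hsCoeff Θ (single k 1) = hsCoeff Θ' (single k' 1) := by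
    rw [← sub_eq_zero]; refine hS.eq_zero_of_leibniz (AlgHom.id R₀ B) _ (fun x y => ?_) fun l => ?_
    · simp only [LinearMap.sub_apply, h.hsCoeff_single_one_mul, h'.hsCoeff_single_one_mul, AlgHom.coe_id, id]; ring
    · rw [LinearMap.sub_apply, h.hsCoeff_single_one_apply, h'.hsCoeff_single_one_apply, hk, sub_self]
  induction i with
  | zero =>
    ext x; rw [single_zero, single_zero, h.hsCoeff_zero, h'.hsCoeff_zero]
  | succ i ih =>
    ext x; have h1 := h.hsCoeff_single hS k (single k i) x; rw [hd, ih, h'.hsCoeff_single hS k' (single k' i) x] at h1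
    simp only [single_eq_same, ← single_add] at h1; exact (nsmul_right_injective (Nat.succ_ne_zero i) h1).symm

end

theorem mul_ofFn_pow_prod {M : Type*} [Monoid M] {n : ℕ} (f : Fin n → M)
    (hf : ∀ i j, Commute (f i) (f j)) (I : Fin n → ℕ) (l : Fin n) :
    f l * (ofFn fun i => f i ^ I i).prod = (ofFn fun i => f i ^ (I + Pi.single l 1 : Fin n → ℕ) i).prod := by
  have hcomm : ∀ x ∈ Set.range f, ∀ y ∈ Set.range f, x * y = y * x := by
    rintro _ ⟨i, rfl⟩ _ ⟨j, rfl⟩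
    exact hf i j
  letI : CommMonoid (Submonoid.closure (Set.range f)) :=
    { (inferInstance : Monoid (Submonoid.closure (Set.range f))) with
      mul_comm := fun a b => (Submonoid.isMulCommutative_closure M hcomm).is_comm.comm a b }
  let g : Fin n → Submonoid.closure (Set.range f) := fun i => ⟨f i, Submonoid.subset_closure ⟨i, rfl⟩⟩
  have h : ∀ J : Fin n → ℕ, (ofFn fun i => f i ^ J i).prod =
      ((∏ i, g i ^ J i : Submonoid.closure (Set.range f)) : M) := by
    intro J; rw [← List.prod_ofFn, ← Submonoid.coe_subtype, map_list_prod, List.map_ofFn]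
    rfl
  rw [h, h]
  have h1 : ∏ i, g i ^ (I + Pi.single l 1 : Fin n → ℕ) i = g l * ∏ i, g i ^ I i := by
    simp only [Pi.add_apply, pow_add, prod_mul_distrib]; rw [mul_comm]; congr 1
    rw [Finset.prod_eq_single l (fun i _ hi => by rw [Pi.single_eq_of_ne hi, pow_zero])
      (fun h => absurd (mem_univ l) h), Pi.single_eq_same, pow_one]
  rw [h1]
  rfl

theorem IsScaled.single {p : ℕ} [Fact p.Prime] {κ : Type*} [DecidableEq κ] {r : ℕ} {q : ℚ}
    {K : Unit →₀ ℕ} (hK : IsScaled p r (cst q) K) (k : κ) :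
    IsScaled p r (Pi.single k q) (single k (K ())) := by
  intro i
  rcases eq_or_ne i k with rfl | hi
  · simpa using hK ()
  · simp [hi]

section

namespace CoordFrame

open WittFrame MvPowerSeries

variable (fr)

/-- The Taylor expansion in the directions `lam k`. -/
def taylor [Finite κ] (lam : κ → Fin n) : L →ₐ[W k] MvPowerSeries κ L := (fr.etale.exists_isTaylor lam).choose

theorem isTaylor [Finite κ] (lam : κ → Fin n) : IsTaylor fr.S lam (fr.taylor lam) :=
  (fr.etale.exists_isTaylor lam).choose_spec

/-- The operator `∏_k {∂_{lam k}}_{Q k}`. -/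
def tOp [Finite κ] (lam : κ → Fin n) (Q : κ → ℚ) : End (W R) := fr.opE (fr.taylor lam) Q

theorem tOp_apply [Finite κ] (lam : κ → Fin n) (Q : κ → ℚ) (z : W R) :
    fr.tOp lam Q z = fr.wop (fr.taylor lam) Q z := rfl

theorem tOp_zero [Finite κ] (lam : κ → Fin n) : fr.tOp lam 0 = 1 :=
  AddMonoidHom.ext fun z => fr.wop_zero _ (fr.isTaylor lam).hsCoeff_zero z

theorem tOp_eq_zero [Finite κ] (lam : κ → Fin n) {Q : κ → ℚ} (h : ¬ Scalable p Q) :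
    fr.tOp lam Q = 0 := fr.wop_eq_zero _ h

theorem tOp_mul_zp [Finite κ] (lam : κ → Fin n) (Q : κ → ℚ) (c : ℤ_[p]) :
    fr.tOp lam Q * mulOp p R (zp p R c) = mulOp p R (zp p R c) * fr.tOp lam Q :=
  AddMonoidHom.ext fun z => fr.wop_zp _ fr.ι_algebraMap Q c z

variable [IsAddTorsionFree L]

theorem tOp_mul [Fintype κ] (lam : κ → Fin n) {Q Q' : κ → ℚ} (h : Scalable p Q)
    (h' : Scalable p Q') :
    fr.tOp lam Q * fr.tOp lam Q' = mulOp p R (zp p R (wbinom Q Q')) * fr.tOp lam (Q + Q') := by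
  obtain ⟨K, hK⟩ := h.exists_isScaled (le_max_left _ (den p Q'))
  obtain ⟨J, hJ⟩ := h'.exists_isScaled (le_max_right (den p Q) _)
  exact AddMonoidHom.ext fun z => fr.wop_wop fr.etale (fr.isTaylor lam) hK hJ z

theorem wbinom_comm [Fintype κ] {Q Q' : κ → ℚ} (h : Scalable p Q)
    (h' : Scalable p Q') : wbinom (p := p) Q Q' = wbinom Q' Q := by
  obtain ⟨K, hK⟩ := h.exists_isScaled (le_max_left _ (den p Q'))
  obtain ⟨J, hJ⟩ := h'.exists_isScaled (le_max_right (den p Q) _)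
  refine padicInt_eq_of_dvd (max (den p Q) (den p Q')) fun r hr => ?_
  obtain ⟨K', hK'⟩ := h.exists_isScaled ((le_max_left _ (den p Q')).trans hr)
  obtain ⟨J', hJ'⟩ := h'.exists_isScaled ((le_max_right (den p Q) _).trans hr)
  have h1 := wbinom_spec hr hK hJ hK' hJ'
  have h3 : multiChoose (K' + J') K' = multiChoose (J' + K') J' := by
    rw [add_comm J']; refine prod_congr rfl fun k _ => ?_
    rw [Finsupp.add_apply]; exact Nat.choose_symm_add
  rw [h3] at h1
  simpa using dvd_sub h1 (wbinom_spec hr hJ hK hJ' hK')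

theorem tOp_commute [Finite κ] (lam : κ → Fin n) (Q Q' : κ → ℚ) :
    Commute (fr.tOp lam Q) (fr.tOp lam Q') := by
  have := Fintype.ofFinite κ
  by_cases h : Scalable p Q
  · by_cases h' : Scalable p Q'
    · rw [Commute, SemiconjBy, fr.tOp_mul lam h h', fr.tOp_mul lam h' h, wbinom_comm h h', add_comm]
    · rw [fr.tOp_eq_zero lam h']; exact Commute.zero_right _
  · rw [fr.tOp_eq_zero lam h]; exact Commute.zero_left _

theorem tOp_mul_of_disjoint [Finite κ] (lam : κ → Fin n) {Q Q' : κ → ℚ}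
    (h : Scalable p Q) (h' : Scalable p Q') (hd : ∀ k, Q k = 0 ∨ Q' k = 0) :
    fr.tOp lam Q * fr.tOp lam Q' = fr.tOp lam (Q + Q') := by
  have := Fintype.ofFinite κ
  rw [fr.tOp_mul lam h h', wbinom_of_disjoint h h' hd, map_one, map_one, one_mul]

theorem tOp_single {κ κ' : Type*} [Finite κ] [Finite κ'] [DecidableEq κ] [DecidableEq κ']
    (lam : κ → Fin n) (lam' : κ' → Fin n) {k : κ} {k' : κ'} (hk : lam k = lam' k') (q : ℚ) :
    fr.tOp lam (Pi.single k q) = fr.tOp lam' (Pi.single k' q) := by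
  refine AddMonoidHom.ext fun z => fr.eq_of_rep (z := z) fun e r y hy => ?_
  by_cases hq : ∃ K, IsScaled p r (cst q) K
  · obtain ⟨K, hK⟩ := hq; change truncate (e + 1) (fr.wop (fr.taylor lam) (Pi.single k q) z) =
      truncate (e + 1) (fr.wop (fr.taylor lam') (Pi.single k' q) z)
    rw [hy.wop _ (hK.single k), hy.wop _ (hK.single k'),
      (fr.isTaylor lam).hsCoeff_single_eq fr.etale (fr.isTaylor lam') hk]
  · change truncate (e + 1) (fr.wop (fr.taylor lam) (Pi.single k q) z) =
      truncate (e + 1) (fr.wop (fr.taylor lam') (Pi.single k' q) z)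
    rw [hy.wop_eq_zero _ (by rwa [isScaled_single_iff]), hy.wop_eq_zero _ (by rwa [isScaled_single_iff])]

theorem tOp_single_unit [Finite κ] [DecidableEq κ] (lam : κ → Fin n) (k : κ) (q : ℚ) :
    fr.tOp lam (Pi.single k q) = fr.tOp (fun _ : Unit => lam k) (fun _ => q) := by
  rw [fr.tOp_single lam (fun _ => lam k) (k' := ()) rfl]
  congr 1

theorem tOp_list_prod [Finite κ] [DecidableEq κ] (lam : κ → Fin n) {Q : κ → ℚ}
    (hQ : Scalable p Q) (s : List κ) (hs : s.Nodup) :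
    (s.map fun k => fr.tOp lam (Pi.single k (Q k))).prod = fr.tOp lam (fun k => if k ∈ s then Q k else 0) := by
  have hsc : ∀ s : List κ, Scalable p (fun k => if k ∈ s then Q k else 0) := by
    intro s; obtain ⟨r, K, hK⟩ := hQ; refine ⟨r, K.filter (· ∈ s), fun k => ?_⟩
    rw [Finsupp.filter_apply]; by_cases h : k ∈ s
    · simpa [h] using hK k
    · simp [h]
  induction s with
  | nil => simp; exact (fr.tOp_zero lam).symm
  | cons a s ih =>
    rw [List.nodup_cons] at hs; rw [List.map_cons, List.prod_cons, ih hs.2,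
      fr.tOp_mul_of_disjoint lam (scalable_single.2 (hQ.apply a)) (hsc s)]
    · congr 1
      funext k
      rw [Pi.add_apply]; rcases eq_or_ne k a with rfl | hk
      · simp [hs.1]
      · simp [hk]
    · grind

theorem tOp_eq_prod (lam : Fin n → Fin n) {Q : Fin n → ℚ} (hQ : Scalable p Q) :
    (ofFn fun l => fr.tOp lam (Pi.single l (Q l))).prod = fr.tOp lam Q := by
  rw [List.ofFn_eq_map, fr.tOp_list_prod lam hQ _ (List.nodup_finRange n)]
  simp

end CoordFrame
end

variable [IsAddTorsionFree L] [CharP A p] [Module.Flat (WittVector p k) L]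

theorem Scalable.of_add {p : ℕ} [Fact p.Prime] {κ : Type*} {Q Q' : κ → ℚ}
    (h : Scalable p (Q + Q')) (h' : Scalable p Q') (h0 : ∀ k, 0 ≤ Q k) : Scalable p Q := by
  obtain ⟨K, hK⟩ := h.exists_isScaled (le_max_left _ (den p Q'))
  obtain ⟨J, hJ⟩ := h'.exists_isScaled (le_max_right (den p (Q + Q')) _)
  refine ⟨max (den p (Q + Q')) (den p Q'), K - J, fun k => ?_⟩
  have h1 := hK k
  have h2 := hJ k
  have h3 : J k ≤ K k := by
    have : (J k : ℚ) ≤ K k := by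
      rw [h1, h2]; exact mul_le_mul_of_nonneg_right (le_add_of_nonneg_left (h0 k)) (by positivity)
    exact_mod_cast this
  rw [Finsupp.tsub_apply, Nat.cast_sub h3, h1, h2, Pi.add_apply]
  ring

section

namespace CoordFrame

open WittFrame MvPowerSeries

variable (fr)

/-- `{∂}_{p^m}^I` on `W(R)`. -/
def powE (m : ℤ) (I : Fin n → ℕ) : End (W R) := (ofFn fun l => fr.tOp id (Pi.single l ((p : ℚ) ^ m)) ^ I l).prod

variable (p) in
/-- The denominator allowed in the coefficient of `{∂}_Q {∂}_{p^m}^I`. -/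
def normDen (m : ℤ) (Q : Fin n → ℚ) (I : Fin n → ℕ) : ℕ := max (den p Q) (if I = 0 then 0 else (-m).toNat)

/-- `z {∂}_Q {∂}_{p^m}^I` -/
def term (m : ℤ) (Q : Fin n → ℚ) (I : Fin n → ℕ) (z : W R) : End (W R) := mulOp p R z * (fr.tOp id Q * fr.powE m I)

/-- The sums of operators `z {∂}_Q {∂}_{p^m}^I`, `Q ∈ [0, p^m)^n`, of level `N`. -/
def normal (m : ℤ) (N : ℕ) : AddSubgroup (End (W R)) :=
  AddSubgroup.closure {f | ∃ (Q : Fin n → ℚ) (I : Fin n → ℕ), Scalable p Q ∧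
    (∀ l, Q l < (p : ℚ) ^ m) ∧ ∃ z ∈ coef p A R N (normDen p m Q I), f = fr.term m Q I z}

variable {fr}

theorem term_mem_normal {Q : Fin n → ℚ} {I : Fin n → ℕ} (hQ : Scalable p Q)
    (hlt : ∀ l, Q l < p ^ m) {z : W R} (hz : z ∈ coef p A R N (normDen p m Q I)) :
    fr.term m Q I z ∈ fr.normal m N :=
  AddSubgroup.subset_closure ⟨Q, I, hQ, hlt, z, hz, rfl⟩

theorem powE_zero (m : ℤ) : fr.powE m 0 = 1 := by
  rw [powE]
  simp

theorem tOp_mul_powE (m : ℤ) (I : Fin n → ℕ) (l : Fin n) :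
    fr.tOp id (Pi.single l (p ^ m)) * fr.powE m I = fr.powE m (I + Pi.single l 1) :=
  mul_ofFn_pow_prod (fun l => fr.tOp id (Pi.single l (p ^ m)))
    (fun _ _ => fr.tOp_commute id _ _) I l

theorem mulOp_mul_mulOp (a b : W R) (f : End (W R)) :
    mulOp p R a * (mulOp p R b * f) = mulOp p R (a * b) * f := by
  rw [map_mul, mul_assoc]

theorem step_mem_normal {l : Fin n} {q : ℚ} (hq : Scalable p (cst q))
    (hqm : q ≤ p ^ m) {Q : Fin n → ℚ} {I : Fin n → ℕ} (hQ : Scalable p Q)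
    (hlt : ∀ l, Q l < p ^ m) {z : W R}
    (hz : z ∈ coef p A R N (max (normDen p m Q I) (den p (cst q)))) :
    mulOp p R z * fr.tOp id (Pi.single l q) * (fr.tOp id Q * fr.powE m I) ∈ fr.normal m N := by
  have hI1 : I + Pi.single l 1 ≠ 0 := fun h => by
    have := congrFun h l; simp at this
  have hqs : Scalable p (Pi.single l q : Fin n → ℚ) := scalable_single.2 hq
  rcases hqm.eq_or_lt with rfl | hqlt
  · have h1 : mulOp p R z * fr.tOp id (Pi.single l (p ^ m)) * (fr.tOp id Q * fr.powE m I) =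
        fr.term m Q (I + Pi.single l 1) z := by
      rw [term, ← tOp_mul_powE, mul_assoc, ← mul_assoc (fr.tOp id Q), ← mul_assoc (fr.tOp id _)
        (fr.tOp id Q), (fr.tOp_commute id _ _).eq]
    rw [h1]; refine term_mem_normal hQ hlt ?_; have h2 : normDen p m Q (I + Pi.single l 1) =
        max (normDen p m Q I) (den p fun _ : Unit => p ^ m) := by
      rw [den_zpow, normDen, normDen, if_neg hI1]
      split_ifs <;> omega
    rw [h2]; exact hz
  have hdiv := p_pow_dvd_wbinom hqs hQ
  rw [den_single l q] at hdiv
  have hmul := fr.tOp_mul id hqs hQ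
  by_cases hcase : q + Q l < p ^ m
  · have h1 : mulOp p R z * fr.tOp id (Pi.single l q) * (fr.tOp id Q * fr.powE m I) =
        fr.term m (Pi.single l q + Q) I (zp p R (wbinom (Pi.single l q) Q) * z) := by
      rw [term, mul_assoc, ← mul_assoc (fr.tOp id _) (fr.tOp id Q), hmul, mul_assoc, mulOp_mul_mulOp, mul_comm z]
    rw [h1]; refine term_mem_normal (hqs.add hQ) (fun i => ?_) (zp_mul_mem_coef hz
      (dvd_trans (pow_dvd_pow _ ?_) hdiv))
    · rcases eq_or_ne i l with rfl | hi
      · simpa using hcase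
      · simpa [hi] using hlt i
    · rw [normDen, normDen]; omega
  · set Q' : Fin n → ℚ := update Q l (q + Q l - p ^ m) with hQ'
    have hsum : Q' + Pi.single l ((p : ℚ) ^ m) = Pi.single l q + Q := by
      funext i
      rcases eq_or_ne i l with rfl | hi
      · simp [hQ']
      · simp [hQ', hi]
    have hpm : Scalable p (Pi.single l ((p : ℚ) ^ m) : Fin n → ℚ) := scalable_single.2 (scalable_zpow m)
    have hQ's : Scalable p Q' := by
      refine Scalable.of_add (hsum ▸ hqs.add hQ) hpm fun i => ?_
      rcases eq_or_ne i l with rfl | hi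
      · simpa [hQ'] using hcase
      · simpa [hQ', hi] using hQ.nonneg i
    have hQ'lt : ∀ i, Q' i < p ^ m := fun i => by grind
    have hu : IsUnit (wbinom (p := p) Q' (Pi.single l (p ^ m))) := by
      refine isUnit_wbinom hQ's hpm hQ'lt fun i => ?_
      rcases eq_or_ne i l with rfl | hi
      · exact ⟨1, by simp⟩
      · exact ⟨0, by simp [hi]⟩
    obtain ⟨v, hv⟩ := hu.exists_left_inv; have hmul' := fr.tOp_mul id hQ's hpm; rw [hsum] at hmul'
    have hback : fr.tOp id (Pi.single l q + Q) =
        mulOp p R (zp p R v) * (fr.tOp id Q' * fr.tOp id (Pi.single l (p ^ m))) := by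
      rw [hmul', mulOp_mul_mulOp, ← map_mul, hv, map_one, map_one, one_mul]
    have h1 : mulOp p R z * fr.tOp id (Pi.single l q) * (fr.tOp id Q * fr.powE m I) =
        fr.term m Q' (I + Pi.single l 1) (zp p R (v * wbinom (Pi.single l q) Q) * z) := by
      rw [term, mul_assoc, ← mul_assoc (fr.tOp id _) (fr.tOp id Q), hmul, hback, ← tOp_mul_powE,
        mul_assoc, mul_assoc, mul_assoc, mulOp_mul_mulOp, mulOp_mul_mulOp, map_mul (zp p R)]
      congr 2; ring
    rw [h1]; refine term_mem_normal hQ's hQ'lt (zp_mul_mem_coef hz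
      (dvd_trans (pow_dvd_pow _ ?_) (hdiv.mul_left v)))
    have h2 := den_add_le hQ's hpm; rw [hsum, den_single, den_zpow] at h2; rw [normDen, normDen, if_neg hI1]
    have h3 : (if I = 0 then 0 else (-m).toNat) ≤ (-m).toNat := by split_ifs <;> omega
    omega

theorem gen_taylor (l : Fin n) (q : ℚ) (c : W R) :
    fr.gen (fr.taylor fun _ => l) q c = mulOp p R c * fr.tOp id (Pi.single l q) := by
  rw [fr.tOp_single_unit id l q]
  rfl

theorem tOp_single_mem_resDW {l : Fin n} {q : ℚ} (h0 : 0 ≤ q) (hq : q ≤ p ^ m) :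
    fr.tOp id (Pi.single l q) ∈ resDW p k A R m := by
  rcases h0.eq_or_lt with rfl | hpos
  · rw [Pi.single_zero, fr.tOp_zero]; exact one_mem _
  · have := gen_mem_resDW (fr := fr) (fr.isTaylor fun _ => l).1 hpos hq
      (one_mem (wd p A R (den p fun _ => q)))
    rwa [gen_taylor, map_one, one_mul] at this

theorem tOp_mem_resDW {Q : Fin n → ℚ} (hQ : Scalable p Q) (hq : ∀ l, Q l ≤ p ^ m) :
    fr.tOp id Q ∈ resDW p k A R m := by
  rw [← fr.tOp_eq_prod id hQ]
  refine list_prod_mem fun f hf => ?_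
  rw [List.mem_ofFn] at hf
  obtain ⟨l, rfl⟩ := hf
  exact tOp_single_mem_resDW (hQ.nonneg l) (hq l)

theorem powE_mem_resDW (m : ℤ) (I : Fin n → ℕ) : fr.powE m I ∈ resDW p k A R m := by
  refine list_prod_mem fun f hf => ?_
  rw [List.mem_ofFn] at hf
  obtain ⟨l, rfl⟩ := hf
  have hp0 := p_pos p
  exact pow_mem (tOp_single_mem_resDW (by positivity) le_rfl) _

theorem gen_mul_term_mem {N₁ N₂ : ℕ} (N : ℕ) {l : Fin n} {q : ℚ}
    (hq : Scalable p (cst q)) (hqm : q ≤ p ^ m) {b : W R}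
    (hb : b ∈ coef p A R N₁ (den p (cst q))) {Q : Fin n → ℚ} {I : Fin n → ℕ}
    (hQ : Scalable p Q) (hlt : ∀ l, Q l < p ^ m) {z : W R}
    (hz : z ∈ coef p A R N₂ (normDen p m Q I)) :
    fr.gen (fr.taylor fun _ => l) q b * fr.term m Q I z ∈
      fr.normal m (max N₁ N₂) ⊔ resI p k A R m N := by
  set δ := den p fun _ => q
  set d := normDen p m Q I with hd
  set G := δ + d + N with hG
  obtain ⟨K, hK⟩ := hq.exists_isScaled (show δ ≤ G by omega)
  have htail := gen_mul_mulOp_sub_mem (fr := fr) (N := N)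
    (fr.isTaylor fun _ => l).1 hqm hb.1 hz.1 (by omega) (by omega) (by omega) hK
  have hright : fr.tOp id Q * fr.powE m I ∈ resDW p k A R m :=
    mul_mem (tOp_mem_resDW hQ fun l => (hlt l).le) (powE_mem_resDW m I)
  have h1 := mul_mem_resI_right htail hright
  rw [sub_mul, sum_mul, mul_assoc] at h1
  rw [← sub_add_cancel (fr.gen (fr.taylor fun _ => l) q b * fr.term m Q I z)]
  rw [term]
  refine add_mem (AddSubgroup.mem_sup_right h1) (AddSubgroup.mem_sup_left (sum_mem fun ij hij => ?_))
  rw [gen_taylor]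
  rw [mem_antidiagonal] at hij
  have hp0 := p_pos p
  have hsum : scl p G ij.1 + scl p G ij.2 = fun _ => q := by
    rw [hK.eq_scl]
    funext u
    rw [Pi.add_apply, scl, scl, scl, ← hij, Finsupp.add_apply, Nat.cast_add, add_div]
  have hle : δ ≤ max (den p (scl p G ij.1)) (den p (scl p G ij.2)) := by
    have := den_add_le (scalable_scl (p := p) G ij.1) (scalable_scl G ij.2); rwa [hsum] at this
  refine step_mem_normal (scalable_scl G ij.2) ?_ hQ hlt ?_
  · refine le_trans ?_ hqm; have := congrFun hsum (); rw [Pi.add_apply] at this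
    linarith [(scalable_scl (p := p) G ij.1).nonneg ()]
  · exact fr.mul_wop_mem_coef _ hb hz _ hle

end CoordFrame
end

theorem end_mul_neg {M : Type*} [AddCommGroup M] (f g : End M) : f * -g = -(f * g) :=
  AddMonoidHom.ext fun z => map_neg f (g z)

theorem end_neg_mul {M : Type*} [AddCommGroup M] (f g : End M) : -f * g = -(f * g) := rfl

section

namespace CoordFrame

open WittFrame MvPowerSeries

variable (fr) in
/-- The operators whose left multiplication respects the filtration by normal forms of level `N₂`,
up to operators in `I^{(N)}` for all `N`, and raises the level to `N₁`. -/
def good (m : ℤ) (N₁ : ℕ) : AddSubgroup (End (W R)) where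
  carrier := {g | g ∈ resDW p k A R m ∧ ∀ N₂ N, ∀ t ∈ fr.normal m N₂,
    g * t ∈ fr.normal m (max N₁ N₂) ⊔ resI p k A R m N}
  zero_mem' := ⟨zero_mem _, fun _ _ _ _ => by rw [zero_mul]; exact zero_mem _⟩
  add_mem' := fun h h' => ⟨add_mem h.1 h'.1, fun N₂ N t ht => by
    rw [add_mul]; exact add_mem (h.2 N₂ N t ht) (h'.2 N₂ N t ht)⟩
  neg_mem' := fun h => ⟨neg_mem h.1, fun N₂ N t ht => by rw [end_neg_mul]; exact neg_mem (h.2 N₂ N t ht)⟩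

theorem mul_mem_good {N₁ N₂ : ℕ} {g g' : End (W R)} (h : g ∈ fr.good m N₁)
    (h' : g' ∈ fr.good m N₂) : g * g' ∈ fr.good m (max N₁ N₂) := by
  refine ⟨mul_mem h.1 h'.1, fun N₃ N t ht => ?_⟩
  obtain ⟨t', ht', i, hi, hti⟩ := AddSubgroup.mem_sup.1 (h'.2 N₃ N t ht)
  rw [mul_assoc, ← hti, mul_add, max_assoc]
  exact add_mem (h.2 _ N t' ht') (AddSubgroup.mem_sup_right (mul_mem_resI_left h.1 hi))

theorem one_mem_good (m : ℤ) : (1 : End (W R)) ∈ fr.good m 0 :=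
  ⟨one_mem _, fun N₂ N t ht => by
    rw [one_mul, Nat.zero_max]; exact AddSubgroup.mem_sup_left ht⟩

theorem mem_good_of_term {N₁ : ℕ} {g : End (W R)} (hg : g ∈ resDW p k A R m)
    (h : ∀ N₂ N Q I z, Scalable p Q → (∀ l, Q l < p ^ m) → z ∈ coef p A R N₂ (normDen p m Q I) →
      g * fr.term m Q I z ∈ fr.normal m (max N₁ N₂) ⊔ resI p k A R m N) : g ∈ fr.good m N₁ := by
  refine ⟨hg, fun N₂ N t ht => ?_⟩
  induction ht using closure_induction with
  | mem t ht =>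
    obtain ⟨Q, I, h1, h2, z, h3, rfl⟩ := ht; exact h N₂ N Q I z h1 h2 h3
  | zero => rw [mul_zero]; exact zero_mem _
  | add t t' _ _ h1 h2 => rw [mul_add]; exact add_mem h1 h2
  | neg t _ h1 => rw [end_mul_neg]; exact neg_mem h1

theorem mulOp_mem_good {c : W R} (hc : c ∈ coef p A R N 0) :
    mulOp p R c ∈ fr.good m N := by
  refine mem_good_of_term (mulOp_mem_resDW hc.1) fun N₂ N' Q I z hQ hlt hz => AddSubgroup.mem_sup_left ?_
  rw [term, mulOp_mul_mulOp]
  refine term_mem_normal hQ hlt ⟨mul_mem (wd_mono (Nat.zero_le _) hc.1) hz.1, ?_⟩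
  rcases max_choice N N₂ with h | h
  · rw [h]; exact ((pow_dvd_pow _ (by omega)).trans hc.2).mul_right z
  · rw [h]; exact hz.2.mul_left c

theorem gen_mem_good {l : Fin n} {q : ℚ} (hq : Scalable p (cst q))
    (hqm : q ≤ p ^ m) {b : W R} (hb : b ∈ coef p A R N (den p (cst q))) :
    mulOp p R b * fr.tOp id (Pi.single l q) ∈ fr.good m N := by
  rcases (hq.nonneg ()).eq_or_lt with rfl | hpos
  · rw [Pi.single_zero, fr.tOp_zero, mul_one]; have hd : den p (fun _ : Unit => (0 : ℚ)) = 0 := den_zero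
    rw [hd] at hb; exact mulOp_mem_good hb
  rw [← gen_taylor]
  exact mem_good_of_term (gen_mem_resDW (fr.isTaylor _).1 hpos hqm hb.1)
    fun N₂ N' Q I z hQ hlt hz => gen_mul_term_mem N' hq hqm hb hQ hlt hz

theorem tOp_mem_good {Q : Fin n → ℚ} (hQ : Scalable p Q) (hq : ∀ l, Q l ≤ p ^ m) :
    fr.tOp id Q ∈ fr.good m 0 := by
  rw [← fr.tOp_eq_prod id hQ]
  refine List.prod_induction (· ∈ fr.good m 0) (fun g g' h h' => ?_) (one_mem_good m) fun f hf => ?_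
  · have h1 := mul_mem_good h h'; rwa [max_self] at h1
  · rw [List.mem_ofFn] at hf; obtain ⟨l, rfl⟩ := hf; have := gen_mem_good (fr := fr) (l := l) (hQ.apply l) (hq l)
      (mem_coef_zero.2 (one_mem _))
    rwa [map_one, one_mul] at this

theorem exists_tOp_split {Q : Fin n → ℚ} (hQ : Scalable p Q) (h0 : 0 < den p Q) :
    ∃ l, 0 < Q l ∧ den p (fun _ : Unit => Q l) = den p Q ∧ Scalable p (update Q l 0) ∧
      fr.tOp id Q = fr.tOp id (Pi.single l (Q l)) * fr.tOp id (update Q l 0) := by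
  obtain ⟨l, hl⟩ := hQ.exists_den_apply h0
  have h1 : Scalable p (Pi.single l (Q l) : Fin n → ℚ) := scalable_single.2 (hQ.apply l)
  have hsum : Pi.single l (Q l) + update Q l 0 = Q := by
    funext i
    rcases eq_or_ne i l with rfl | hi
    · simp
    · simp [hi]
  have h2 : Scalable p (update Q l 0) := by
    refine Scalable.of_add (Q' := Pi.single l (Q l)) ?_ h1 fun i => ?_
    · rwa [add_comm, hsum]
    · rcases eq_or_ne i l with rfl | hi
      · simp
      · simpa [hi] using hQ.nonneg i
  refine ⟨l, (hQ.nonneg l).lt_of_ne fun h => ?_, hl, h2, ?_⟩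
  · rw [← h] at hl; have := den_zero (p := p) (κ := Unit); change den p (0 : Unit → ℚ) = _ at hl; omega
  · rw [fr.tOp_mul_of_disjoint id h1 h2, hsum]; intro i; rcases eq_or_ne i l with rfl | hi
    · exact Or.inr (by simp)
    · exact Or.inl (by simp [hi])

theorem mulOp_mul_tOp_mem_good {Q : Fin n → ℚ} (hQ : Scalable p Q)
    (hq : ∀ l, Q l ≤ p ^ m) {c : W R} (hc : c ∈ coef p A R N (den p Q)) :
    mulOp p R c * fr.tOp id Q ∈ fr.good m N := by
  have hp0 := p_pos p
  rw [← Nat.max_zero N]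
  rcases Nat.eq_zero_or_pos (den p Q) with h0 | h0
  · rw [h0] at hc; exact mul_mem_good (mulOp_mem_good hc) (tOp_mem_good hQ hq)
  · obtain ⟨l, -, hl, h2, h3⟩ := exists_tOp_split (fr := fr) hQ h0; rw [h3, ← mul_assoc]
    refine mul_mem_good (gen_mem_good (hQ.apply l) (hq l) (hl.symm ▸ hc))
      (tOp_mem_good h2 fun i => ?_)
    rcases eq_or_ne i l with rfl | hi
    · rw [update_self]; positivity
    · simp [*]

theorem tOp_mem_resI {Q : Fin n → ℚ} (hQ : Scalable p Q)
    (hq : ∀ l, Q l ≤ p ^ m) {c : W R} (hc : c ∈ coef p A R N (den p Q)) :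
    mulOp p R c * fr.tOp id Q ∈ resI p k A R m N := by
  have hp0 := p_pos p
  rcases Nat.eq_zero_or_pos (den p Q) with h0 | h0
  · rw [h0] at hc; exact mul_mem_resI_right (mulOp_mem_resI fr hc.1 (by simpa using hc.2)) (tOp_mem_resDW hQ hq)
  · obtain ⟨l, hpos, hl, h2, h3⟩ := exists_tOp_split (fr := fr) hQ h0; rw [h3, ← mul_assoc]
    refine mul_mem_resI_right ?_ (tOp_mem_resDW h2 fun i => ?_)
    · rw [← gen_taylor]; have hc1 := hc.1; rw [← hl] at hc1; refine mem_resI_of_approx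
        (fun _ => ⟨_, gen_mem_elem (fr.isTaylor _).1 hpos (hq l) hc1, fun _ => rfl⟩) fun x => ?_
      have h4 := fr.dvd_wop_of_mem_wd (fr.taylor (cst l)) (fun _ => Q l)
        (j_mem_wd 0 x)
      rw [hl] at h4; refine (pow_dvd_pow _ (show N ≤ (N - den p Q) + (den p Q - 0) by omega)).trans ?_
      rw [pow_add]; exact mul_dvd_mul hc.2 h4
    · grind

theorem term_mem_resI {Q : Fin n → ℚ} {I : Fin n → ℕ} (hQ : Scalable p Q)
    (hlt : ∀ l, Q l < p ^ m) {z : W R} (hz : z ∈ coef p A R N (normDen p m Q I)) :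
    fr.term m Q I z ∈ resI p k A R m N := by
  have hp0 := p_pos p
  rcases le_or_gt (normDen p m Q I) (den p Q) with h | h
  · rw [term, ← mul_assoc]; exact mul_mem_resI_right (tOp_mem_resI hQ (fun l => (hlt l).le) (coef_mono h hz))
      (powE_mem_resDW m I)
  · have hI : I ≠ 0 := by
      rintro rfl
      rw [normDen, if_pos rfl] at h; omega
    obtain ⟨l, hl⟩ := Function.ne_iff.1 hI; rw [normDen, if_neg hI] at hz h
    rw [max_eq_right (by omega), ← den_zpow (p := p), ← den_single l] at hz
    have h1 : I = (I - Pi.single l 1) + Pi.single l 1 := by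
      funext i
      rcases eq_or_ne i l with rfl | hi
      · simp; have : I i ≠ 0 := hl; omega
      · simp [hi]
    rw [term, h1, ← tOp_mul_powE, ← mul_assoc (fr.tOp id Q), (fr.tOp_commute id _ _).eq, mul_assoc, ← mul_assoc]
    refine mul_mem_resI_right (tOp_mem_resI (scalable_single.2 (scalable_zpow m))
      (fun i => ?_) hz) (mul_mem (tOp_mem_resDW hQ fun l => (hlt l).le) (powE_mem_resDW m _))
    rcases eq_or_ne i l with rfl | hi
    · simp
    · rw [Pi.single_eq_of_ne hi]; positivity

end CoordFrame
end

section

open MvPowerSeries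

variable {R₀ B : Type*} [CommRing R₀] [CommRing B] [Algebra R₀ B] {n : ℕ} {S : Fin n → B}

theorem IsTaylor.hsCoeff_prod_pow {Θ : B →ₐ[R₀] MvPowerSeries (Fin n) B} (h : IsTaylor S id Θ)
    (J : Fin n →₀ ℕ) (M : Fin n → ℕ) : hsCoeff Θ J (∏ l, S l ^ M l) =
      ∏ l, ((M l).choose (J l) : B) * S l ^ (M l - J l) := by
  have h1 : ∀ l, Θ (S l) = C (S l) + X l := by
    intro l; obtain ⟨s, hs, hl⟩ := h.2 l; have : s = {l} := Finset.ext fun i => by rw [hs, Finset.mem_singleton, id]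
    rw [hl, this, sum_singleton]
  have h2 : ∀ l, (X l + C (S l)) ^ M l = ∑ i ∈ Finset.range (M l + 1),
      monomial (single l i) (((M l).choose i : B) * S l ^ (M l - i)) := by
    intro l; rw [add_pow]; refine sum_congr rfl fun i _ => ?_
    rw [X_pow_eq, ← map_pow, ← map_natCast (C), ← monomial_zero_eq_C_apply,
      ← monomial_zero_eq_C_apply, monomial_mul_monomial, monomial_mul_monomial]
    simp; rw [mul_comm]
  have h3 : ∀ (f : Fin n → ℕ) (c : Fin n → B), ∏ l, monomial (single l (f l)) (c l) =
      monomial (equivFunOnFinite.symm f) (∏ l, c l) := by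
    intro f c; have : ∀ s, ∏ l ∈ s, monomial (single l (f l)) (c l) =
        monomial (∑ l ∈ s, single l (f l)) (∏ l ∈ s, c l) := by
      intro s; induction s using Finset.cons_induction with
      | empty => simp [monomial_zero_eq_C_apply]
      | cons a s ha ih => rw [Finset.prod_cons, ih, monomial_mul_monomial, sum_cons, Finset.prod_cons]
    rw [this]; congr 1; congr 1; ext l; simp [Finsupp.finsetSum_apply, single_apply]
  rw [hsCoeff_apply, map_prod]
  simp only [map_pow, h1, add_comm (C _), h2]
  rw [Finset.prod_univ_sum, map_sum]
  simp only [h3, coeff_monomial]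
  rw [sum_eq_single (⇑J)]
  · rw [if_pos (by ext; simp)]
  · intro f _ hf; rw [if_neg]
    rintro rfl
    exact hf (by ext; simp)
  · intro hJ; rw [if_pos (by ext; simp)]
    rw [Fintype.mem_piFinset] at hJ
    push Not at hJ
    obtain ⟨l, hl⟩ := hJ; rw [mem_range, not_lt] at hl
    exact prod_eq_zero (mem_univ l) (by rw [choose_eq_zero_of_lt hl]; simp)

end

section

theorem not_dvd_choose_p_pow (c i : ℕ) : ¬ p ^ (i + 1) ∣ (p ^ c + p ^ c * i).choose (p ^ c) := by
  have hp : p.Prime := Fact.out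
  obtain ⟨y, hy⟩ : ∃ y, p ^ c = y + 1 := ⟨p ^ c - 1, by have := hp.pos; have := pow_pos this c; omega⟩
  have h1 := Nat.add_one_mul_choose_eq (y + p ^ c * i) y
  rw [show y + p ^ c * i + 1 = p ^ c + p ^ c * i by omega, ← hy,
    show p ^ c + p ^ c * i = p ^ c * (i + 1) by ring, mul_comm _ (p ^ c), mul_assoc] at h1
  have h3 := choose_modEq_one (p := p) c i y (by omega)
  intro hd
  rw [show p ^ c + p ^ c * i = p ^ c * (i + 1) by ring, ← Nat.eq_of_mul_eq_mul_left (pow_pos hp.pos c) h1] at hd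
  have h4 : Nat.Coprime p ((y + p ^ c * i).choose y) := by
    rw [Nat.Prime.coprime_iff_not_dvd hp]; intro h5
    exact hp.one_lt.ne' (Nat.dvd_one.1 (Nat.modEq_zero_iff_dvd.1 ((Nat.modEq_zero_iff_dvd.2 h5).symm.trans h3).symm))
  exact absurd (Nat.le_of_dvd (Nat.succ_pos i) ((h4.pow_left (i + 1)).dvd_of_dvd_mul_right hd)) (not_le.2 (Nat.lt_pow_self hp.one_lt))

theorem wbinom_single_ne_zero {n : ℕ} (m : ℤ) (l : Fin n) {I : Fin n → ℕ}
    (hI : Scalable p fun i => (I i : ℚ) * p ^ m) :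
    wbinom (p := p) (Pi.single l (p ^ m)) (fun i => (I i : ℚ) * p ^ m) ≠ 0 := by
  intro h0
  have hp : p.Prime := Fact.out
  have hs : Scalable p (Pi.single l ((p : ℚ) ^ m) : Fin n → ℚ) := scalable_single.2 (scalable_zpow m)
  have hd1 : den p (Pi.single l (p ^ m) : Fin n → ℚ) = (-m).toNat := by rw [den_single, den_zpow]
  set s := max (den p (Pi.single l (p ^ m) : Fin n → ℚ)) (den p fun i => (I i : ℚ) * p ^ m) with hsdef
  have hs1 : (-m).toNat ≤ s := hd1 ▸ le_max_left _ _
  obtain ⟨K0, hK0⟩ := hs.exists_isScaled (le_max_left _ _)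
  obtain ⟨J0, hJ0⟩ := hI.exists_isScaled (le_max_right _ _)
  obtain ⟨K, hK⟩ := hs.exists_isScaled (r := s + (I l + 1)) ((le_max_left _ _).trans (Nat.le_add_right s _))
  obtain ⟨J, hJ⟩ := hI.exists_isScaled (r := s + (I l + 1)) ((le_max_right _ _).trans (Nat.le_add_right s _))
  have h1 := wbinom_spec (Nat.le_add_right s (I l + 1)) hK0 hJ0 hK hJ
  rw [h0, zero_sub, dvd_neg, Nat.add_sub_cancel_left] at h1
  have h2 : p ^ (I l + 1) ∣ multiChoose (K + J) K := by
    have h3 : (p : ℤ_[p]) ^ (I l + 1) ∣ ((multiChoose (K + J) K : ℤ) : ℤ_[p]) := by rwa [Int.cast_natCast]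
    rw [PadicInt.pow_p_dvd_int_iff] at h3; exact_mod_cast h3
  obtain ⟨c, hc⟩ : ∃ c : ℕ, c = m + (s + (I l + 1) : ℕ) := ⟨(m + (s + (I l + 1) : ℕ)).toNat, by omega⟩
  have hcq : p ^ m * p ^ (s + (I l + 1)) = ((p ^ c : ℕ) : ℚ) := by
    rw [cast_pow, ← zpow_natCast _ (s + (I l + 1)), ← zpow_natCast _ c, ← zpow_add₀ (Nat.cast_pos.2 hp.pos).ne', hc]
  have hKl : K l = p ^ c := by
    have := hK l; rw [Pi.single_eq_same, hcq] at this; exact_mod_cast this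
  have hJl : J l = p ^ c * I l := by
    have := hJ l; rw [mul_assoc, hcq, mul_comm] at this; exact_mod_cast this
  have h4 : multiChoose (K + J) K = (p ^ c + p ^ c * I l).choose (p ^ c) := by
    rw [multiChoose, Finset.prod_eq_single l]
    · rw [Finsupp.add_apply, hKl, hJl]
    · intro i _ hi; have : K i = 0 := by
        have := hK i; rw [Pi.single_eq_of_ne hi, zero_mul] at this; exact_mod_cast this
      rw [this, Nat.choose_zero_right]
    · exact fun h => absurd (mem_univ l) h
  exact not_dvd_choose_p_pow c (I l) (h4 ▸ h2)

end

section

namespace CoordFrame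

open WittFrame MvPowerSeries

variable (fr) in
/-- The Teichmüller lift of a monomial in the coordinates. -/
def teich (K : Fin n →₀ ℕ) : W A := teichmuller p (∏ l, fr.π (fr.S l) ^ K l)

theorem rep_teich (K : Fin n →₀ ℕ) (e : ℕ) :
    fr.Rep e e (jA (fr.teich K)) (∏ l, fr.S l ^ (p ^ e * K l)) := by
  have h := fr.rep_map e (teichmuller p (∏ l, fr.S l ^ K l))
  rw [WittVector.map_teichmuller, ghostComponent_teichmuller, map_prod] at h
  simp only [map_pow, ← Finset.prod_pow, ← pow_mul] at h
  simpa only [mul_comm, teich] using h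

theorem tOp_teich_eq_zero {d : ℕ} {Q Q' : Fin n → ℚ} {K : Fin n →₀ ℕ} (hK : IsScaled p d Q K)
    {l : Fin n} (hl : Q l < Q' l) :
    fr.tOp id Q' (frob p R (-d) (jA (fr.teich K))) = 0 := by
  have hp0 := p_pos p
  refine (frob p R d).injective ?_
  rw [map_zero]
  refine (fr.frob_wop (fr.taylor id) d Q' _).trans ?_
  rw [frob_frob_neg]
  refine eq_of_truncate_succ fun e => ?_
  by_cases hJ : ∃ J, IsScaled p e (fun l => Q' l * p ^ (d : ℤ)) J
  · obtain ⟨J, hJ⟩ := hJ; rw [(rep_teich K e).wop _ hJ, (fr.isTaylor id).hsCoeff_prod_pow, prod_eq_zero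
      (mem_univ l), map_zero, map_zero]
    rw [choose_eq_zero_of_lt, cast_zero, zero_mul]; have h3 : ((p ^ e * K l : ℕ) : ℚ) < J l := by
      rw [hJ l, Nat.cast_mul, hK l, cast_pow, zpow_natCast, mul_comm]
      exact mul_lt_mul_of_pos_right (mul_lt_mul_of_pos_right hl (pow_pos hp0 d)) (pow_pos hp0 e)
    exact_mod_cast h3
  · rw [(rep_teich K e).wop_eq_zero _ hJ, map_zero]

theorem tOp_teich_self {d : ℕ} {Q : Fin n → ℚ} {K : Fin n →₀ ℕ} (hK : IsScaled p d Q K) :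
    fr.tOp id Q (frob p R (-d) (jA (fr.teich K))) = 1 := by
  have hp0 := p_pos p
  refine (frob p R d).injective ?_
  rw [map_one]
  refine (fr.frob_wop (fr.taylor id) d Q _).trans ?_
  rw [frob_frob_neg]
  refine eq_of_truncate_succ fun e => ?_
  have hJ : IsScaled p e (fun l => Q l * p ^ (d : ℤ)) (p ^ e • K) := by
    rw [isScaled_mul_iff, add_comm]; exact hK.add_right e
  rw [(rep_teich K e).wop _ hJ, (fr.isTaylor id).hsCoeff_prod_pow, prod_eq_one, map_one, map_one]
  intro l _
  simp

theorem dvd_of_sum_tOp {ι : Type*} {s : Finset ι} {Q : ι → Fin n → ℚ} (hQ : ∀ i ∈ s, Scalable p (Q i))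
    (hinj : Set.InjOn Q s) {c : ι → W R}
    (h : ∀ x, (p : W R) ^ N ∣ ∑ i ∈ s, c i * fr.tOp id (Q i) (jA x)) {i : ι} (hi : i ∈ s) :
    (p : W R) ^ N ∣ p ^ den p (Q i) * c i := by
  by_contra hcon
  classical
  obtain ⟨i0, hi0, hmin⟩ := (s.filter fun i => ¬ (p : W R) ^ N ∣ p ^ den p (Q i) * c i).exists_min_image
    (fun i => ∑ l, Q i l) ⟨i, mem_filter.2 ⟨hi, hcon⟩⟩
  rw [mem_filter] at hi0
  obtain ⟨K, hK⟩ := (hQ i0 hi0.1).exists_den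
  refine hi0.2 ?_
  have h1 := h (verschiebung^[den p (Q i0)] (fr.teich K))
  rw [← add_sum_erase s _ hi0.1] at h1
  have h2 := (dvd_add_left (dvd_sum fun i' hi' => ?_)).1 h1
  · rw [j_verschiebung] at h2; have h3 : fr.tOp id (Q i0) (p ^ den p (Q i0) *
        frob p R (-(den p (Q i0) : ℕ)) (jA (fr.teich K))) = p ^ den p (Q i0) := by
      refine (map_p_pow_mul _ _ _).trans ?_; refine (congrArg _ (tOp_teich_self hK)).trans (mul_one _)
    rwa [h3, mul_comm] at h2
  · rw [mem_erase] at hi'; by_cases hd : (p : W R) ^ N ∣ p ^ den p (Q i') * c i'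
    · obtain ⟨y, hy⟩ := fr.dvd_wop_of_mem_wd (fr.taylor id) (Q i') (j_mem_wd 0
        (verschiebung^[den p (Q i0)] (fr.teich K)))
      have hy' : fr.tOp id (Q i') (jA (verschiebung^[den p (Q i0)] (fr.teich K))) =
        (p : W R) ^ (den p (Q i') - 0) * y := hy
      rw [hy', Nat.sub_zero, ← mul_assoc, mul_comm (c i')]; exact hd.mul_right y
    · have hle := hmin i' (mem_filter.2 ⟨hi'.2, hd⟩); obtain ⟨l, hl⟩ : ∃ l, Q i0 l < Q i' l := by
        by_contra hc
        push Not at hc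
        refine hi'.1 (hinj hi'.2 hi0.1 (funext fun l => le_antisymm (hc l) ?_))
        by_contra hlt
        exact absurd hle (not_le.2 (Finset.sum_lt_sum (fun l _ => hc l)
          ⟨l, mem_univ l, not_le.1 hlt⟩))
      have h3 : fr.tOp id (Q i') (jA (verschiebung^[den p (Q i0)] (fr.teich K))) = 0 := by
        rw [j_verschiebung]; refine (map_p_pow_mul _ _ _).trans ?_
        refine (congrArg _ (tOp_teich_eq_zero hK hl)).trans (mul_zero _)
      rw [h3, mul_zero]; exact dvd_zero _

theorem scalable_mul_zpow (m : ℤ) (I : Fin n → ℕ) :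
    Scalable p fun l => (I l : ℚ) * p ^ m := by
  refine ⟨(-m).toNat, equivFunOnFinite.symm fun l => I l * p ^ (m + (-m).toNat).toNat, fun l => ?_⟩
  rw [Finsupp.equivFunOnFinite_symm_apply_apply, mul_assoc, ← zpow_natCast, ← zpow_add₀ (p_pos p).ne']
  push_cast
  rw [← zpow_natCast]
  congr 2
  omega

theorem exists_powE_eq (m : ℤ) (I : Fin n → ℕ) : ∃ ν, ν ≠ 0 ∧
    fr.powE m I = mulOp p R (zp p R ν) * fr.tOp id fun l => (I l : ℚ) * p ^ m := by
  induction hN : ∑ l, I l generalizing I with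
  | zero =>
    have h0 : I = 0 := funext fun l => (Finset.sum_eq_zero_iff.1 hN) l (mem_univ l)
    refine ⟨1, one_ne_zero, ?_⟩; have h1 : (fun l => (I l : ℚ) * p ^ m) = 0 := by
      rw [h0]
      funext l
      simp
    rw [h1, h0, powE_zero, fr.tOp_zero, map_one, map_one, one_mul]
  | succ N ih =>
    obtain ⟨l, -, hl⟩ := Finset.exists_ne_zero_of_sum_ne_zero (f := I)
      (s := Finset.univ) (by omega)
    set I' := I - Pi.single l 1 with hI'
    have h1 : I = I' + Pi.single l 1 := by
      funext i
      rcases eq_or_ne i l with rfl | hi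
      · simp only [hI', Pi.add_apply, Pi.sub_apply, Pi.single_eq_same]; omega
      · simp [hI', hi]
    have h2 : ∑ l, I' l = N := by
      have h3 : ∑ i, I i = ∑ i, I' i + 1 := by
        rw [h1]; simp only [Pi.add_apply, sum_add_distrib, Finset.sum_pi_single', mem_univ, if_true]
      omega
    obtain ⟨ν, hν, h⟩ := ih I' h2; refine ⟨ν * wbinom (Pi.single l (p ^ m)) (fun i => (I' i : ℚ) * p ^ m),
      mul_ne_zero hν (wbinom_single_ne_zero m l (scalable_mul_zpow (p := p) m I')), ?_⟩
    have h5 : (Pi.single l ((p : ℚ) ^ m) + fun i => (I' i : ℚ) * p ^ m) = fun i => (I i : ℚ) * p ^ m := by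
      funext i
      rw [h1]; rcases eq_or_ne i l with rfl | hi
      · simp; ring
      · simp [hi]
    rw [h1, ← tOp_mul_powE, h, ← mul_assoc, fr.tOp_mul_zp, mul_assoc,
      fr.tOp_mul id (scalable_single.2 (scalable_zpow m)) (scalable_mul_zpow m I'), h5,
      mulOp_mul_mulOp, map_mul (zp p R), ← h1]

/-- `Q + p^m I` -/
def shift (p : ℕ) (m : ℤ) (Q : Fin n → ℚ) (I : Fin n → ℕ) : Fin n → ℚ := Q + fun l => (I l : ℚ) * (p : ℚ) ^ m

theorem scalable_shift (m : ℤ) {Q : Fin n → ℚ} (hQ : Scalable p Q) (I : Fin n → ℕ) :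
    Scalable p (shift p m Q I) := hQ.add (scalable_mul_zpow m I)

theorem shift_inj {Q Q' : Fin n → ℚ} {I I' : Fin n → ℕ} (h0 : ∀ l, 0 ≤ Q l)
    (hlt : ∀ l, Q l < p ^ m) (h0' : ∀ l, 0 ≤ Q' l) (hlt' : ∀ l, Q' l < p ^ m)
    (h : shift p m Q I = shift p m Q' I') : Q = Q' ∧ I = I' := by
  have hI : I = I' := by
    funext l
    have h1 := congrFun h l; have hpm := (h0 l).trans_lt (hlt l); simp only [shift, Pi.add_apply] at h1
    have h2 : ∀ a b : ℕ, ∀ x y, 0 ≤ x → y < (p : ℚ) ^ m → x + a * (p : ℚ) ^ m = y + b * (p : ℚ) ^ m → a ≤ b := by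
      intro a b x y hx hy hxy
      by_contra hlt
      have h3 : (b : ℚ) + 1 ≤ a := by exact_mod_cast not_le.1 hlt
      nlinarith
    exact le_antisymm (h2 _ _ _ _ (h0 l) (hlt' l) h1) (h2 _ _ _ _ (h0' l) (hlt l) h1.symm)
  subst hI
  exact ⟨add_right_cancel h, rfl⟩

theorem exists_term_eq (m : ℤ) {Q : Fin n → ℚ} (hQ : Scalable p Q) (hlt : ∀ l, Q l < p ^ m)
    (I : Fin n → ℕ) : ∃ ν, ν ≠ 0 ∧ ∀ z, fr.term m Q I z = mulOp p R (zp p R ν * z) * fr.tOp id (shift p m Q I) := by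
  obtain ⟨ν, hν, h⟩ := exists_powE_eq (fr := fr) m I
  refine ⟨ν * wbinom Q fun l => (I l : ℚ) * p ^ m, mul_ne_zero hν (isUnit_wbinom hQ (scalable_mul_zpow m I) hlt fun l => ⟨I l, rfl⟩).ne_zero,
    fun z => ?_⟩
  rw [term, h, ← mul_assoc (fr.tOp id Q), fr.tOp_mul_zp, mul_assoc,
    fr.tOp_mul id hQ (scalable_mul_zpow m I), mulOp_mul_mulOp, mulOp_mul_mulOp,
    map_mul (zp p R), shift]
  congr 2
  ring

theorem eq_zero_of_dvd_p_pow_mul {D : ℕ} {ν : ℤ_[p]} (hν : ν ≠ 0) {c : W R}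
    (h : ∀ N, (p : W R) ^ N ∣ p ^ D * (zp p R ν * c)) : c = 0 := by
  have hzero : p ^ D * (zp p R ν * c) = 0 := by
    refine eq_of_truncate_eq p R _ _ fun N => ?_
    rw [map_zero, truncate_eq_zero_iff]; exact h N
  rw [PadicInt.unitCoeff_spec hν, map_mul, map_pow, map_natCast, ← mul_zero ((p : W R) ^ D)] at hzero
  have h1 := p_pow_mul_cancel _ hzero
  rw [mul_assoc, mul_left_comm, ← mul_zero ((p : W R) ^ ν.valuation)] at h1
  exact ((PadicInt.unitCoeff hν).isUnit.map (zp p R)).mul_right_eq_zero.1 (p_pow_mul_cancel _ h1)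

end CoordFrame
end

section

open PowerSeries

open Classical in
theorem exists_nodes (n : ℕ) : ∃ P : Finset ℤ⟦X⟧, P.card = 2 ^ n ∧
    ∀ a ∈ P, (∏ b ∈ P.erase a, (a - b)) ∣ (X : ℤ⟦X⟧) ^ 2 ^ n := by
  induction n with
  | zero => exact ⟨{0}, rfl, fun a ha => by simp [Finset.mem_singleton.1 ha]⟩
  | succ n ih =>
    obtain ⟨P, hP, hd⟩ := ih; have hinj : ∀ e, Injective fun a : ℤ⟦X⟧ => e + X * a := fun e a b h =>
      mul_left_cancel₀ PowerSeries.X_ne_zero (add_left_cancel h)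
    have hdisj : ∀ e e', e ≠ e' → Disjoint (P.map ⟨_, hinj (C e)⟩) (P.map ⟨_, hinj (C e')⟩) := by
      intro e e' he; rw [Finset.disjoint_left]; intro x hx hx'; obtain ⟨a, -, rfl⟩ := Finset.mem_map.1 hx
      obtain ⟨b, -, hb⟩ := Finset.mem_map.1 hx'; have := congrArg constantCoeff hb; simp at this; exact he this.symm
    have key : ∀ e e', IsUnit (e - e') → ∀ a ∈ P,
        (∏ b ∈ (P.map ⟨_, hinj (C e)⟩ ∪ P.map ⟨_, hinj (C e')⟩).erase (C e + X * a), (C e + X * a - b)) ∣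
          (X : ℤ⟦X⟧) ^ 2 ^ (n + 1) := by
      intro e e' he a ha; have hne : e ≠ e' := fun h => by simp [h] at he
      have hnot : C e + X * a ∉ P.map ⟨_, hinj (C e')⟩ := Finset.disjoint_left.1 (hdisj e e' hne)
        (Finset.mem_map.2 ⟨a, ha, rfl⟩)
      rw [Finset.erase_union_distrib, Finset.erase_eq_of_notMem hnot,
        Finset.prod_union (Finset.disjoint_of_subset_left (Finset.erase_subset _ _) (hdisj e e' hne)),
        Finset.prod_map]
      have h1 : (P.map ⟨_, hinj (C e)⟩).erase (C e + X * a) = (P.erase a).map ⟨_, hinj (C e)⟩ :=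
        (Finset.map_erase ⟨_, hinj (C e)⟩ P a).symm
      rw [h1, Finset.prod_map]; have h2 : ∏ b ∈ P.erase a, (C e + X * a - (C e + X * b)) =
          X ^ (2 ^ n - 1) * ∏ b ∈ P.erase a, (a - b) := by
        rw [← hP, ← Finset.card_erase_of_mem ha, ← Finset.prod_const, ← prod_mul_distrib]
        exact prod_congr rfl fun b _ => by ring
      have h3 : IsUnit (∏ b ∈ P, (C e + X * a - (C e' + X * b))) := by
        rw [IsUnit.prod_iff]; intro b _; rw [PowerSeries.isUnit_iff_constantCoeff]
        simpa using he
      simp only [Function.Embedding.coeFn_mk]; rw [h2, h3.mul_right_dvd, pow_succ, mul_two, pow_add]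
      exact mul_dvd_mul (pow_dvd_pow _ (Nat.sub_le _ _)) (hd a ha)
    refine ⟨P.map ⟨_, hinj (C 0)⟩ ∪ P.map ⟨_, hinj (C 1)⟩, ?_, fun a ha => ?_⟩
    · rw [Finset.card_union_of_disjoint (hdisj 0 1 zero_ne_one), Finset.card_map, Finset.card_map, hP]; ring
    · rcases Finset.mem_union.1 ha with ha | ha
      · obtain ⟨b, hb, rfl⟩ := Finset.mem_map.1 ha; exact key 0 1 (by norm_num) b hb
      · obtain ⟨b, hb, rfl⟩ := Finset.mem_map.1 ha; rw [Finset.union_comm]; exact key 1 0 (by norm_num) b hb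

open Classical in
theorem exists_interpolation (n : ℕ) : ∃ P, ∀ j < 2 ^ n, ∃ c : ℤ⟦X⟧ → ℤ⟦X⟧,
    ∀ j' < 2 ^ n, ∑ a ∈ P, c a * a ^ j' = if j' = j then X ^ 2 ^ n else 0 := by
  obtain ⟨P, hP, hd⟩ := exists_nodes n
  choose! q hq using hd
  refine ⟨P, fun j hj => ⟨fun a => q a * (∏ b ∈ P.erase a, (Polynomial.X - Polynomial.C b)).coeff j,
    fun j' hj' => ?_⟩⟩
  have h1 : ∑ a ∈ P, Polynomial.C (q a * a ^ j') * ∏ b ∈ P.erase a, (Polynomial.X - Polynomial.C b) =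
      Polynomial.C ((X : ℤ⟦X⟧) ^ 2 ^ n) * Polynomial.X ^ j' := by
    refine Polynomial.eq_of_degrees_lt_of_eval_finset_eq P ?_ ?_ fun a ha => ?_
    · refine (Polynomial.degree_sum_le _ _).trans_lt ?_; rw [Finset.sup_lt_iff (WithBot.bot_lt_coe _)]; intro a ha
      refine ((Polynomial.degree_mul_le _ _).trans (add_le_of_nonpos_left Polynomial.degree_C_le)).trans_lt ?_
      rw [Polynomial.degree_prod]; simp; exact_mod_cast Finset.card_erase_lt_of_mem ha
    · refine (Polynomial.degree_C_mul_X_pow_le _ _).trans_lt ?_; rw [hP]; exact_mod_cast hj'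
    · rw [Polynomial.eval_finsetSum, sum_eq_single a]
      · rw [Polynomial.eval_mul, Polynomial.eval_prod, Polynomial.eval_mul, Polynomial.eval_pow,
          Polynomial.eval_C, Polynomial.eval_C, Polynomial.eval_X, hq a ha]
        simp; ring
      · intro b hb hba; rw [Polynomial.eval_mul, Polynomial.eval_prod, prod_eq_zero
          (mem_erase.2 ⟨hba.symm, ha⟩), mul_zero]
        simp
      · exact fun h => absurd ha h
  have h2 := congrArg (fun f => Polynomial.coeff f j) h1
  simp only [Polynomial.finsetSum_coeff, Polynomial.coeff_C_mul, Polynomial.coeff_X_pow] at h2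
  rw [show (if j' = j then (X : ℤ⟦X⟧) ^ 2 ^ n else 0) = X ^ 2 ^ n * if j = j' then 1 else 0 by simp [eq_comm], ← h2]
  exact sum_congr rfl fun a _ => by ring

theorem exists_arcs {κ : Type*} [Fintype κ] [DecidableEq κ] (K : κ → ℕ) (hK : 0 < ∑ k, K k) :
    ∃ (s : Finset (κ → ℤ⟦X⟧)) (α : (κ → ℤ⟦X⟧) → κ → ℤ⟦X⟧) (c : (κ → ℤ⟦X⟧) → ℕ → ℤ) (M : ℕ),
      M ≤ 6 * Fintype.card κ * ∑ k, K k ∧ (∀ z k, constantCoeff (α z k) = 0) ∧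
      ∀ K', ∑ z ∈ s, ∑ j ∈ Finset.Icc 1 M, c z j * coeff j (∏ k, α z k ^ K' k) = if K' = K then 1 else 0 := by
  set S := ∑ k, K k with hS
  have hκ : 0 < Fintype.card κ := by
    rw [Fintype.card_pos_iff]
    by_contra h
    rw [not_nonempty_iff] at h; simp [hS] at hK
  obtain ⟨n, hn1, hn2⟩ : ∃ n, 2 * S < 2 ^ n ∧ 2 ^ n ≤ 4 * S := by
    refine ⟨Nat.log 2 S + 2, ?_, ?_⟩
    · have := Nat.lt_pow_succ_log_self one_lt_two S; rw [pow_succ] at this ⊢; omega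
    · have := Nat.pow_log_le_self 2 hK.ne'; rw [pow_add]; omega
  have hKn : ∀ k, K k < 2 ^ n := fun k => by
    have := single_le_sum (fun i _ => Nat.zero_le (K i)) (mem_univ k)
    omega
  obtain ⟨P, hP⟩ := exists_interpolation n
  choose! c hc using hP
  set a := 2 * Fintype.card κ with ha
  set M := Fintype.card κ * 2 ^ n + a * S with hM
  have hprod : ∀ (z : κ → ℤ⟦X⟧) (K' : κ → ℕ), ∏ k, (X ^ a * z k) ^ K' k = X ^ (a * ∑ k, K' k) * ∏ k, z k ^ K' k := by
    intro z K'; simp only [mul_pow, prod_mul_distrib, ← pow_mul]; rw [Finset.prod_pow_eq_pow_sum, mul_sum]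
  have hsum : ∀ K', coeff M (∑ z ∈ Fintype.piFinset fun _ => P,
      (∏ k, c (K k) (z k)) * ∏ k, (X ^ a * z k) ^ K' k) = if K' = K then 1 else 0 := by
    intro K'; have h1 : ∑ z ∈ Fintype.piFinset fun _ => P, (∏ k, c (K k) (z k)) * ∏ k, (X ^ a * z k) ^ K' k =
        X ^ (a * ∑ k, K' k) * ∏ k, ∑ y ∈ P, c (K k) y * y ^ K' k := by
      rw [Finset.prod_univ_sum, mul_sum]; refine sum_congr rfl fun z _ => ?_
      rw [hprod, prod_mul_distrib]; ring
    rw [h1]; by_cases hlt : M < a * ∑ k, K' k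
    · have h2 : K' ≠ K := by grind
      rw [if_neg h2]; exact PowerSeries.X_pow_dvd_iff.1 (Dvd.intro _ rfl) M hlt
    · have h3 : ∑ k, K' k < 2 ^ n := by
        have h4 : a * ∑ k, K' k < a * 2 ^ n := by
          refine (not_lt.1 hlt).trans_lt ?_; have := Nat.mul_lt_mul_of_pos_left hn1 hκ; rw [hM, ha]
          nlinarith
        exact lt_of_mul_lt_mul_left h4 (Nat.zero_le a)
      have h6 : ∏ k, ∑ y ∈ P, c (K k) y * y ^ K' k = if K' = K then (X : ℤ⟦X⟧) ^ (Fintype.card κ * 2 ^ n) else 0 := by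
        rw [prod_congr rfl fun k _ => hc (K k) (hKn k) (K' k) ((fun k => (single_le_sum (fun i _ => Nat.zero_le (K' i)) (mem_univ k)).trans_lt h3) k)]
        split_ifs with h
        · subst h; simp only [if_true, Finset.prod_const, ← pow_mul, Finset.card_univ]; rw [mul_comm]
        · obtain ⟨k, hk⟩ := Function.ne_iff.1 h; exact prod_eq_zero (mem_univ k) (if_neg hk)
      rw [h6]
      split_ifs with h
      · simp [*]
      · rw [mul_zero, map_zero]
  refine ⟨Fintype.piFinset fun _ => P, fun z k => X ^ a * z k,
    fun z j => coeff (M - j) (∏ k, c (K k) (z k)), M, ?_, fun z k => ?_, fun K' => ?_⟩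
  · rw [hM, ha]
    nlinarith [Nat.mul_le_mul_left (Fintype.card κ) hn2]
  · rw [map_mul, map_pow, PowerSeries.constantCoeff_X, zero_pow (by omega), zero_mul]
  · have hexp : ∀ K', ∑ z ∈ Fintype.piFinset fun _ => P, ∑ j ∈ Finset.range (M + 1),
        coeff (M - j) (∏ k, c (K k) (z k)) * coeff j (∏ k, (X ^ a * z k) ^ K' k) = if K' = K then 1 else 0 := by
      intro K'; rw [← hsum K', map_sum]; refine sum_congr rfl fun z _ => ?_
      rw [PowerSeries.coeff_mul, Finset.Nat.sum_antidiagonal_eq_sum_range_succ_mk, ← Finset.sum_range_reflect]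
      refine sum_congr rfl fun j hj => ?_
      rw [mem_range] at hj; rw [Nat.add_sub_cancel, Nat.sub_sub_self (by omega)]
    have hsplit : ∀ f : ℕ → ℤ, ∑ j ∈ Finset.range (M + 1), f j = f 0 + ∑ j ∈ Finset.Icc 1 M, f j := by
      intro f; rw [Finset.sum_range_succ', add_comm]; congr 1
      rw [Finset.range_eq_Ico, Finset.sum_Ico_add' (fun j => f j) 0 M 1]
      rfl
    by_cases h0 : K' = 0
    · have hne : K' ≠ K := by
        rintro rfl
        simp [hS, h0] at hK
      rw [if_neg hne]; refine sum_eq_zero fun z _ => sum_eq_zero fun j hj => ?_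
      rw [h0]; simp only [Pi.zero_apply, pow_zero, Finset.prod_const_one]
      rw [PowerSeries.coeff_one, if_neg (by rw [Finset.mem_Icc] at hj; omega), mul_zero]
    · rw [← hexp K']; refine sum_congr rfl fun z _ => ?_
      rw [hsplit, hprod]; have h7 : coeff 0 (X ^ (a * ∑ k, K' k) * ∏ k, z k ^ K' k : ℤ⟦X⟧) = 0 := by
        refine PowerSeries.X_pow_dvd_iff.1 (Dvd.intro _ rfl) 0 ?_; refine Nat.mul_pos (by omega) ?_
        obtain ⟨k, hk⟩ := Function.ne_iff.1 h0; exact (Nat.pos_of_ne_zero hk).trans_le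
          (single_le_sum (fun i _ => Nat.zero_le (K' i)) (mem_univ k))
      rw [h7, mul_zero, zero_add]

end

section

open MvPowerSeries

variable {R₀ B : Type*} [CommRing R₀] [CommRing B] [Algebra R₀ B]

theorem exists_arc {κ : Type*} [Fintype κ] (Θ : B →ₐ[R₀] MvPowerSeries κ B)
    (hΘ : ∀ x, constantCoeff (Θ x) = x) (d : κ → B) (α : κ → PowerSeries ℤ)
    (hα : ∀ k, PowerSeries.constantCoeff (α k) = 0) :
    ∃ E : B →ₐ[R₀] MvPowerSeries Unit B, (∀ x, constantCoeff (E x) = x) ∧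
      (∀ (i : ℕ) (x : B), ∃ T : Finset (κ →₀ ℕ), ∀ T', T ⊆ T' → hsCoeff E (single () i) x = ∑ K ∈ T', hsCoeff Θ K x *
          ((∏ k, d k ^ K k) * ((PowerSeries.coeff i (∏ k, α k ^ K k) : ℤ) : B))) ∧
      ∀ x (s : Finset κ), Θ x = C x + ∑ k ∈ s, X k →
        E x = C x + ∑ k ∈ s, C (d k) * PowerSeries.map (Int.castRingHom B) (α k) := by
  let φ : PowerSeries ℤ →+* MvPowerSeries Unit B := PowerSeries.map (Int.castRingHom B)
  have hφ : ∀ i f, MvPowerSeries.coeff (single () i) (φ f) =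
    ((PowerSeries.coeff i f : ℤ) : B) := fun i f => PowerSeries.coeff_map _ _ _
  let a : κ → MvPowerSeries Unit B := fun k => C (d k) * φ (α k)
  have ha0 : ∀ k, constantCoeff (a k) = 0 := fun k => by
    have h : constantCoeff (φ (α k)) = 0 := by
      have := hφ 0 (α k); rw [single_zero, PowerSeries.coeff_zero_eq_constantCoeff_apply, hα] at this
      simpa using this
    rw [map_mul, h, mul_zero]
  have ha := hasSubst_of_constantCoeff_zero ha0
  have hprod : ∀ (i : ℕ) (K : κ →₀ ℕ), coeff (single () i) (K.prod fun k e => a k ^ e) =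
      (∏ k, d k ^ K k) * ((PowerSeries.coeff i (∏ k, α k ^ K k) : ℤ) : B) := by
    intro i K; rw [Finsupp.prod_fintype _ _ fun k => pow_zero _]
    have : ∏ k, a k ^ K k = C (∏ k, d k ^ K k) * φ (∏ k, α k ^ K k) := by
      simp only [a, mul_pow, prod_mul_distrib, map_prod, map_pow]
    rw [this, coeff_C_mul, hφ]
  let E : B →ₐ[R₀] MvPowerSeries Unit B := ((substAlgHom ha).restrictScalars R₀).comp Θ
  have hE : ∀ (i : ℕ) (x : B), ∃ T, ∀ T', T ⊆ T' → hsCoeff E (single () i) x = ∑ K ∈ T', hsCoeff Θ K x *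
          ((∏ k, d k ^ K k) * ((PowerSeries.coeff i (∏ k, α k ^ K k) : ℤ) : B)) := by
    intro i x; refine ⟨(coeff_subst_finite ha (Θ x) (single () i)).toFinset, fun T' hT => ?_⟩
    have h1 : hsCoeff E (single () i) x = coeff (single () i) (subst a (Θ x)) := by
      rw [← coe_substAlgHom ha]
      rfl
    rw [h1, coeff_subst ha, finsum_eq_sum_of_support_subset]
    · refine sum_congr rfl fun K _ => ?_
      rw [hprod, smul_eq_mul]
      rfl
    · intro K hK; exact hT ((Set.Finite.mem_toFinset _).2 hK)
  refine ⟨E, fun x => ?_, hE, fun x s hx => ?_⟩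
  swap
  · change substAlgHom ha (Θ x) = _
    rw [hx, map_add, map_sum, show (C x : MvPowerSeries κ B) = algebraMap B _ x from rfl, AlgHom.commutes]; congr 1
    exact sum_congr rfl fun k _ => substAlgHom_X ha k
  have h1 : constantCoeff (E x) = hsCoeff E (single () 0) x := by
    rw [single_zero]
    rfl
  obtain ⟨T, hT⟩ := hE 0 x
  rw [h1, hT (insert 0 T) (Finset.subset_insert _ _), sum_eq_single 0]
  · simp; exact hΘ x
  · intro K _ hK; have : PowerSeries.coeff 0 (∏ k, α k ^ K k) = 0 := by
      rw [PowerSeries.coeff_zero_eq_constantCoeff_apply, map_prod]; obtain ⟨k, hk⟩ := Finsupp.ne_iff.1 hK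
      exact prod_eq_zero (mem_univ k) (by rw [map_pow, hα, zero_pow hk])
    rw [this, Int.cast_zero, mul_zero, mul_zero]
  · simp

theorem exists_hsCoeff_combination {κ : Type*} [Fintype κ] [DecidableEq κ]
    (Θ : B →ₐ[R₀] MvPowerSeries κ B) (hΘ : ∀ x, constantCoeff (Θ x) = x) (d : κ → B) (K : κ →₀ ℕ)
    (hK : K ≠ 0) :
    ∃ (s : Finset (κ → PowerSeries ℤ)) (E : (κ → PowerSeries ℤ) → B →ₐ[R₀] MvPowerSeries Unit B)
      (c : (κ → PowerSeries ℤ) → ℕ → ℤ) (M : ℕ), M ≤ 6 * Fintype.card κ * ∑ k, K k ∧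
      (∀ z x, constantCoeff (E z x) = x) ∧
      ∀ x, ∑ z ∈ s, ∑ i ∈ Finset.Icc 1 M, (c z i : B) * hsCoeff (E z) (single () i) x =
        (∏ k, d k ^ K k) * hsCoeff Θ K x := by
  obtain ⟨s, α, c, M, hM, hα, h⟩ := exists_arcs (fun k => K k) (by
    obtain ⟨k, hk⟩ := Finsupp.ne_iff.1 hK; exact (Nat.pos_of_ne_zero hk).trans_le
      (single_le_sum (fun i _ => Nat.zero_le _) (mem_univ k)))
  choose E hE0 hE _hE' using fun z => exists_arc Θ hΘ d (α z) (hα z)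
  refine ⟨s, E, c, M, hM, hE0, fun x => ?_⟩
  choose T hT using fun z i => hE z i x
  let T' := insert K (s.biUnion fun z => (Finset.Icc 1 M).biUnion fun i => T z i)
  have h1 : ∀ z ∈ s, ∀ i ∈ Finset.Icc 1 M, (c z i : B) * hsCoeff (E z) (single () i) x =
      ∑ J ∈ T', hsCoeff Θ J x * (∏ k, d k ^ J k) * ((c z i * PowerSeries.coeff i (∏ k, α z k ^ J k) : ℤ) : B) := by
    intro z hz i hi; rw [hT z i T' ((Finset.subset_biUnion_of_mem _ hi).trans
      ((Finset.subset_biUnion_of_mem (fun z => (Finset.Icc 1 M).biUnion fun i => T z i) hz).trans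
        (Finset.subset_insert _ _))), mul_sum]
    refine sum_congr rfl fun J _ => ?_
    push_cast; ring
  rw [sum_congr rfl fun z hz => sum_congr rfl (h1 z hz)]
  rw [sum_congr rfl fun z _ => Finset.sum_comm, Finset.sum_comm]
  rw [sum_congr rfl fun J _ => (by
    rw [sum_congr rfl fun z _ => (mul_sum _ _ _).symm, ← mul_sum] : _ = hsCoeff Θ J x * (∏ k, d k ^ J k) * ∑ z ∈ s, ∑ i ∈ Finset.Icc 1 M,
        ((c z i * PowerSeries.coeff i (∏ k, α z k ^ J k) : ℤ) : B))]
  rw [sum_eq_single K]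
  · have := congrArg (fun t : ℤ => (t : B)) (h fun k => K k)
    simp only [if_true, Int.cast_one, Int.cast_sum] at this; rw [this]; ring
  · intro J _ hJ; have := congrArg (fun t : ℤ => (t : B)) (h fun k => J k)
    rw [if_neg fun h' => hJ (DFunLike.coe_injective h')] at this
    simp only [Int.cast_zero, Int.cast_sum] at this; rw [this, mul_zero]
  · grind

end

section

theorem dvd_prod_sub_prod {ι S : Type*} [CommRing S] (s : Finset ι) (f g : ι → S) {d : S}
    (h : ∀ i ∈ s, d ∣ f i - g i) : d ∣ ∏ i ∈ s, f i - ∏ i ∈ s, g i := by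
  simp only [← Ideal.mem_span_singleton, ← Ideal.Quotient.eq, map_prod] at h ⊢
  exact prod_congr rfl h

theorem p_pow_dvd_choose_add_sub {a b n y M : ℕ} (hn : p ^ a ∣ n) (hy : y < p ^ a) (hM : p ^ b ∣ M) :
    (p : ℤ) ^ (b + 1 - a) ∣ ((n + y).choose M : ℤ) - (n.choose M : ℤ) := by
  rcases lt_or_ge b a with hab | hab
  · simp [*]
  have ha : ∀ i, 0 < i → i < p ^ a → ∃ a', a = a' + 1 ∧ ¬ p ^ (a' + 1) ∣ i := by
    intro i h0 hi
    cases a with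
    | zero => rw [pow_zero] at hi; omega
    | succ a' => exact ⟨a', rfl, fun h => absurd (Nat.le_of_dvd h0 h) (by omega)⟩
  have key : ∀ i, 0 < i → i ≤ M → i < p ^ a → p ^ (b + 1 - a) ∣ n.choose (M - i) := by
    intro i h0 hiM hi; obtain ⟨a', rfl, hi'⟩ := ha i h0 hi; have h1 : p ^ (b + 1 - (a' + 1)) ∣ M.choose i :=
      p_pow_dvd_choose_of_dvd (by rwa [show b + 1 - (a' + 1) + a' = b by omega]) hi'
    have hdM := (pow_dvd_pow p hab).trans hM; rcases lt_or_ge n M with hnM | hnM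
    · have h2 := Nat.le_of_dvd (by omega) (Nat.dvd_sub hdM hn)
      rw [choose_eq_zero_of_lt (by omega)]
      exact dvd_zero _
    · have h2 : n.choose M * M.choose i = n.choose (M - i) * (i + (n - M)).choose i := by
        have h3 := Nat.choose_mul (n := n) (s := M - i) (Nat.sub_le _ _)
        rwa [Nat.choose_symm hiM, Nat.sub_sub_self hiM, show n - (M - i) = i + (n - M) by omega] at h3
      obtain ⟨t, ht⟩ := Nat.dvd_sub hn hdM; have h3 : ¬ p ∣ (i + (n - M)).choose i := by
        rw [ht]; have := choose_modEq_one (a' + 1) t i hi; intro h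
        rw [Nat.ModEq, Nat.mod_eq_zero_of_dvd h, Nat.mod_eq_of_lt (Fact.out : p.Prime).one_lt] at this
        exact zero_ne_one this
      exact (Nat.Coprime.pow_left _ (((Fact.out : p.Prime).coprime_iff_not_dvd).2 h3)).dvd_of_dvd_mul_right (h2 ▸ h1.mul_left _)
  rw [Nat.add_choose_eq, Finset.Nat.sum_antidiagonal_eq_sum_range_succ_mk, Finset.sum_range_succ]
  simp only [Nat.sub_self, Nat.choose_zero_right, mul_one]
  push_cast
  rw [add_sub_cancel_right]
  refine dvd_sum fun t ht => ?_
  rw [mem_range] at ht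
  rcases lt_or_ge y (M - t) with h | h
  · rw [choose_eq_zero_of_lt h]; simp
  · have := key (M - t) (by omega) (by omega) (by omega)
    rw [Nat.sub_sub_self ht.le] at this; exact Dvd.dvd.mul_right (by exact_mod_cast this) _

variable {κ : Type*} [Fintype κ]

/-- The integral part of `p ^ g * A`. -/
def floorAt (p g : ℕ) (A : κ → ℚ) : κ →₀ ℕ := equivFunOnFinite.symm fun k => ⌊A k * (p : ℚ) ^ g⌋₊

theorem floorAt_apply (g : ℕ) (A : κ → ℚ) (k : κ) : floorAt p g A k = ⌊A k * p ^ g⌋₊ := rfl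

theorem floorAt_of_isScaled {g : ℕ} {A : κ → ℚ} {K : κ →₀ ℕ} (h : IsScaled p g A K) :
    floorAt p g A = K := Finsupp.ext fun k => by
  rw [floorAt_apply, ← h k, Nat.floor_natCast]

theorem floorAt_apply_of_isScaled {g t : ℕ} {A : κ → ℚ} {K : κ →₀ ℕ} (h : IsScaled p (g + t) A K)
    (k : κ) : floorAt p g A k = K k / p ^ t := by
  have h1 : A k * p ^ g = (K k : ℚ) / ((p ^ t : ℕ) : ℚ) := by
    rw [h k, cast_pow, pow_add, ← mul_assoc, mul_div_cancel_right₀ _ (p_pow_ne_zero t)]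
  rw [floorAt_apply, h1, Nat.floor_div_eq_div]

theorem scl_floorAt_le (g : ℕ) {A : κ → ℚ} (hA : Scalable p A) : scl p g (floorAt p g A) ≤ A := by
  intro k
  have h0 := pow_pos (p_pos p) g
  rw [scl, div_le_iff₀ h0, floorAt_apply]
  exact Nat.floor_le (mul_nonneg (hA.nonneg k) h0.le)

theorem lt_scl_floorAt (g : ℕ) (A : κ → ℚ) (k : κ) :
    A k < scl p g (floorAt p g A) k + 1 / p ^ g := by
  rw [scl, ← add_div, lt_div_iff₀ (pow_pos (p_pos p) g), floorAt_apply]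
  exact Nat.lt_floor_add_one _

open Classical in
/-- The binomial coefficient `A` over `B`, which is zero unless `B ≤ A`. -/
def upperBinom (p : ℕ) [Fact p.Prime] (B A : κ → ℚ) : ℤ_[p] := if B ≤ A then wbinom B (A - B) else 0

theorem upperBinom_of_le {A B : κ → ℚ} (h : B ≤ A) : upperBinom p B A = wbinom B (A - B) := if_pos h

theorem upperBinom_of_not_le {A B : κ → ℚ} (h : ¬ B ≤ A) : upperBinom p B A = 0 := if_neg h

theorem IsScaled.le_iff {r : ℕ} {A B : κ → ℚ} {K J : κ →₀ ℕ} (h : IsScaled p r A K)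
    (h' : IsScaled p r B J) : J ≤ K ↔ B ≤ A := by
  rw [Finsupp.le_def]
  refine forall_congr' fun k => ?_
  rw [← Nat.cast_le (α := ℚ), h k, h' k, mul_le_mul_iff_left₀ (pow_pos (p_pos p) r)]

theorem IsScaled.sub {r : ℕ} {A B : κ → ℚ} {K J : κ →₀ ℕ} (h : IsScaled p r A K)
    (h' : IsScaled p r B J) (hle : J ≤ K) : IsScaled p r (A - B) (K - J) := fun k => by
  rw [Finsupp.tsub_apply, Nat.cast_sub (hle k), h k, h' k, Pi.sub_apply, sub_mul]

theorem upperBinom_spec {s : ℕ} {A B : κ → ℚ} {K0 J0 : κ →₀ ℕ} (hA0 : IsScaled p s A K0)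
    (hB0 : IsScaled p s B J0) {r : ℕ} (hs : s ≤ r) {K J : κ →₀ ℕ} (hA : IsScaled p r A K)
    (hB : IsScaled p r B J) :
    (p : ℤ_[p]) ^ (r - s) ∣ upperBinom p B A - (multiChoose K J : ℤ_[p]) := by
  by_cases h : B ≤ A
  · rw [upperBinom_of_le h]; have h1 := wbinom_spec hs hB0 (hA0.sub hB0 ((hA0.le_iff hB0).2 h)) hB
      (hA.sub hB ((hA.le_iff hB).2 h))
    rwa [add_tsub_cancel_of_le ((hA.le_iff hB).2 h)] at h1
  · rw [upperBinom_of_not_le h]; rw [← hA.le_iff hB, Finsupp.le_def] at h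
    push Not at h
    obtain ⟨k, hk⟩ := h; rw [multiChoose, prod_eq_zero (mem_univ k) (choose_eq_zero_of_lt hk)]; simp

theorem upperBinom_self {B : κ → ℚ} (hB : Scalable p B) : upperBinom p B B = 1 := by
  obtain ⟨J, hJ⟩ := hB.exists_den
  refine padicInt_eq_of_dvd (den p B) fun r hr => ?_
  obtain ⟨K, hK⟩ := hB.exists_isScaled hr
  simpa [multiChoose] using upperBinom_spec hJ hJ hr hK hK

theorem upperBinom_congr {g g₁ : ℕ} (hg : g₁ ≤ g) (J : κ →₀ ℕ) {A A' : κ → ℚ} (hA : Scalable p A)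
    (hA' : Scalable p A') (h : floorAt p g A = floorAt p g A') :
    (p : ℤ_[p]) ^ (g + 1 - g₁) ∣ upperBinom p (scl p g₁ J) A - upperBinom p (scl p g₁ J) A' := by
  set s := max g₁ (max (den p A) (den p A')) with hs
  obtain ⟨K0, hK0⟩ := hA.exists_isScaled (r := s) (by omega)
  obtain ⟨K0', hK0'⟩ := hA'.exists_isScaled (r := s) (by omega)
  obtain ⟨J0, hJ0⟩ := (scalable_scl (p := p) g₁ J).exists_isScaled
    ((den_scl_le g₁ J).trans (le_max_left _ _))
  set t := s + 1 with ht
  obtain ⟨K, hK⟩ := hA.exists_isScaled (r := g + t) (by omega)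
  obtain ⟨K', hK'⟩ := hA'.exists_isScaled (r := g + t) (by omega)
  have hJ : IsScaled p (g + t) (scl p g₁ J) (p ^ (g + t - g₁) • J) := by
    have := (isScaled_scl (p := p) g₁ J).add_right (g + t - g₁); rwa [show g₁ + (g + t - g₁) = g + t by omega] at this
  have h1 : ∀ {B : κ → ℚ} {M : κ →₀ ℕ}, IsScaled p (g + t) B M → (p : ℤ) ^ (g + 1 - g₁) ∣
      (multiChoose M (p ^ (g + t - g₁) • J) : ℤ) -
        multiChoose (p ^ t • floorAt p g B) (p ^ (g + t - g₁) • J) := by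
    intro B M hM; rw [multiChoose, multiChoose, Nat.cast_prod, Nat.cast_prod]
    refine dvd_prod_sub_prod _ _ _ fun k _ => ?_
    have h2 : M k = p ^ t * floorAt p g B k + M k % p ^ t := by rw [floorAt_apply_of_isScaled hM, Nat.div_add_mod]
    have h3 := p_pow_dvd_choose_add_sub
      (Dvd.intro (floorAt p g B k) rfl)
      (Nat.mod_lt (M k) (pow_pos (Fact.out : p.Prime).pos t))
      (Dvd.intro (J k) rfl : p ^ (g + t - g₁) ∣ p ^ (g + t - g₁) * J k)
    rw [← h2, show g + t - g₁ + 1 - t = g + 1 - g₁ by omega] at h3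
    exact h3
  have h2 := dvd_sub (h1 hK) (h1 hK')
  rw [h, sub_sub_sub_cancel_right] at h2
  have h3 : (p : ℤ_[p]) ^ (g + 1 - g₁) ∣ (multiChoose K (p ^ (g + t - g₁) • J) : ℤ_[p]) -
      (multiChoose K' (p ^ (g + t - g₁) • J) : ℤ_[p]) := by
    simpa using map_dvd (Int.castRingHom ℤ_[p]) h2
  have h4 := (pow_dvd_pow (p : ℤ_[p]) (show g + 1 - g₁ ≤ g + t - s by omega)).trans
    (upperBinom_spec hK0 hJ0 (by omega) hK hJ)
  have h5 := (pow_dvd_pow (p : ℤ_[p]) (show g + 1 - g₁ ≤ g + t - s by omega)).trans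
    (upperBinom_spec hK0' hJ0 (by omega) hK' hJ)
  convert (dvd_sub (dvd_add h4 h3) h5) using 1
  ring

theorem exists_triangular_solution {ι S : Type*} [PartialOrder ι] [CommRing S] (M : ι → ι → S)
    (h1 : ∀ i, M i i = 1) (h0 : ∀ i j, ¬ j ≤ i → M i j = 0) (s : Finset ι) (c : ι → S) :
    ∃ x : ι → S, ∀ i ∈ s, ∑ j ∈ s, x j * M i j = c i := by
  classical
  induction s using Finset.strongInduction with
  | H s ih =>
    rcases s.eq_empty_or_nonempty with rfl | hs
    · simp
    obtain ⟨m, hm⟩ := s.exists_maximal hs; obtain ⟨x, hx⟩ := ih (s.erase m) (Finset.erase_ssubset hm.1)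
    refine ⟨update x m (c m - ∑ j ∈ s.erase m, x j * M m j), fun i hi => ?_⟩
    rw [← add_sum_erase s _ hm.1, update_self]; rw [sum_congr rfl fun j hj => congrArg (· * M i j)
      (update_of_ne (ne_of_mem_erase hj) (c m - ∑ j ∈ s.erase m, x j * M m j) x)]
    by_cases him : i = m
    · rw [him, h1, mul_one, sub_add_cancel]
    · have : ¬ m ≤ i := fun h => him (le_antisymm (hm.2 hi h) h)
      rw [h0 i m this, mul_zero, zero_add, hx i (mem_erase.2 ⟨him, hi⟩)]

theorem exists_combination_upperBinom (X : Set (κ → ℚ)) (hX : ∀ A ∈ X, Scalable p A)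
    (hfin : ∀ g, (floorAt p g '' X).Finite) (g₀ E : ℕ) :
    ∃ t ∈ AddSubgroup.closure {f : (κ → ℚ) → ℤ_[p] | ∃ g ≥ g₀, ∃ B ∈ X, ∃ a,
        f = fun A => a * upperBinom p (scl p g (floorAt p g B)) A},
      ∀ A ∈ X, (p : ℤ_[p]) ^ E ∣ 1 - t A := by
  induction E with
  | zero => exact ⟨0, zero_mem _, fun A _ => by rw [pow_zero]; exact one_dvd _⟩
  | succ E ih =>
    obtain ⟨t, ht, hd⟩ := ih; have hcont : ∃ G, ∀ g ≥ G, ∀ A ∈ X, ∀ A' ∈ X, floorAt p g A = floorAt p g A' →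
        (p : ℤ_[p]) ^ (E + 1) ∣ t A - t A' := by
      clear hd
      induction ht using closure_induction with
      | mem f hf =>
        obtain ⟨g, -, B, -, a, rfl⟩ := hf; refine ⟨g + E, fun g' hg' A hA A' hA' h => ?_⟩
        rw [← mul_sub]; exact ((pow_dvd_pow _ (by omega)).trans (upperBinom_congr (by omega) _ (hX A hA) (hX A' hA')
          h)).mul_left a
      | zero => exact ⟨0, fun g _ A _ A' _ _ => by simp⟩
      | add f f' _ _ hf hf' =>
        obtain ⟨G, hG⟩ := hf; obtain ⟨G', hG'⟩ := hf'; refine ⟨max G G', fun g hg A hA A' hA' h => ?_⟩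
        rw [Pi.add_apply, Pi.add_apply, add_sub_add_comm]; exact dvd_add (hG g (le_of_max_le_left hg) A hA A' hA' h)
          (hG' g (le_of_max_le_right hg) A hA A' hA' h)
      | neg f _ hf =>
        obtain ⟨G, hG⟩ := hf; refine ⟨G, fun g hg A hA A' hA' h => ?_⟩
        rw [Pi.neg_apply, Pi.neg_apply, ← neg_sub', dvd_neg]; exact hG g hg A hA A' hA' h
    obtain ⟨G, hG⟩ := hcont; set g := max G g₀
    choose! rep hrep1 hrep2 using fun (F : κ →₀ ℕ) (hF : F ∈ (hfin g).toFinset) =>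
      (Set.mem_image _ _ _).1 ((hfin g).mem_toFinset.1 hF)
    choose! c hc using hd
    obtain ⟨x, hx⟩ := exists_triangular_solution
      (fun F F' => upperBinom p (scl p g F') (scl p g F))
      (fun F => upperBinom_self (scalable_scl g F))
      (fun F F' h => upperBinom_of_not_le (by rwa [← (isScaled_scl g F).le_iff (isScaled_scl g F')]))
      (hfin g).toFinset fun F => c (rep F)
    refine ⟨t + ∑ F ∈ (hfin g).toFinset, fun A => p ^ E * x F *
      upperBinom p (scl p g F) A, add_mem ht (sum_mem fun F hF => AddSubgroup.subset_closure ?_),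
      fun A hA => ?_⟩
    · refine ⟨g, le_max_right _ _, rep F, hrep1 F hF, p ^ E * x F, ?_⟩; rw [hrep2 F hF]
    · set F := floorAt p g A with hF
      have hFm := (hfin g).mem_toFinset.2 ⟨A, hA, rfl⟩
      have h2 : ∀ F' ∈ (hfin g).toFinset, (p : ℤ_[p]) ∣ x F' * upperBinom p (scl p g F') A -
          x F' * upperBinom p (scl p g F') (scl p g F) := by
        intro F' _; have := upperBinom_congr (le_refl g) F' (hX A hA) (scalable_scl g F)
          (by rw [floorAt_of_isScaled (isScaled_scl g F)])
        rw [Nat.add_sub_cancel_left, pow_one] at this; rw [← mul_sub]; exact this.mul_left _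
      have h3 := dvd_sum h2; rw [sum_sub_distrib, hx F hFm] at h3; have h4 := mul_dvd_mul_left ((p : ℤ_[p]) ^ E) h3
      rw [← pow_succ] at h4; have h5 : (t + ∑ F ∈ (hfin g).toFinset, fun A => p ^ E * x F *
          upperBinom p (scl p g F) A) A = t A + p ^ E *
            ∑ F ∈ (hfin g).toFinset, x F * upperBinom p (scl p g F) A := by
        rw [Pi.add_apply, Finset.sum_apply, mul_sum]; congr 1; exact sum_congr rfl fun F _ => mul_assoc _ _ _
      rw [h5]; have h7 := dvd_add (hG g (le_max_left _ _) A hA _ (hrep1 F hFm) (hrep2 F hFm).symm) h4; rw [← dvd_neg]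
      convert h7 using 1
      rw [mul_sub, ← hc (rep F) (hrep1 F hFm)]; ring

end

section

variable {κ : Type*} [Fintype κ]

/-- The weight of a multi-index, where the `k`-th entry has weight `u k + 1`. -/
def wt (u : κ → ℕ) : (κ → ℚ) →+ ℚ where
  toFun Q := ∑ k, ((u k + 1 : ℕ) : ℚ) * Q k
  map_zero' := by simp
  map_add' Q Q' := by simp [mul_add, sum_add_distrib]

theorem wt_apply (u : κ → ℕ) (Q : κ → ℚ) : wt u Q = ∑ k, ((u k + 1 : ℕ) : ℚ) * Q k := rfl

theorem sum_le_wt (u : κ → ℕ) {Q : κ → ℚ} (hQ : ∀ k, 0 ≤ Q k) (s : Finset κ) :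
    ∑ k ∈ s, Q k ≤ wt u Q := by
  refine (Finset.sum_le_sum_of_subset_of_nonneg (Finset.subset_univ s) fun k _ _ => hQ k).trans
    (sum_le_sum fun k _ => le_mul_of_one_le_left (hQ k) (by push_cast; linarith [(Nat.cast_nonneg (u k) : 0 ≤ u k)]))

theorem wt_mono (u : κ → ℕ) {Q Q' : κ → ℚ} (h : Q ≤ Q') : wt u Q ≤ wt u Q' :=
  sum_le_sum fun k _ => mul_le_mul_of_nonneg_left (h k) (Nat.cast_nonneg _)

theorem wt_scl (u : κ → ℕ) (r : ℕ) (K : κ →₀ ℕ) :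
    wt u (scl p r K) = ((∑ k, (u k + 1) * K k : ℕ) : ℚ) / p ^ r := by
  rw [wt_apply, Nat.cast_sum, sum_div]
  exact sum_congr rfl fun k _ => by rw [Nat.cast_mul, scl, mul_div_assoc]

variable (p) in
theorem finite_wt_le (u : κ → ℕ) (q : ℚ) (r : ℕ) : {K : κ →₀ ℕ | wt u (scl p r K) ≤ q}.Finite := by
  refine (Finsupp.finite_of_nat_weight_le (fun _ => 1) (fun _ => one_ne_zero)
    ⌊q * p ^ r⌋₊).subset fun K hK => ?_
  rw [Set.mem_ofPred_eq] at hK ⊢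
  have h1 : Finsupp.weight (fun _ => 1) K = ∑ k, K k := by
    rw [Finsupp.weight_apply, Finsupp.sum_fintype K (fun _ c => c • 1) fun _ => zero_smul ℕ 1]
    simp
  rw [h1]
  refine Nat.le_floor ?_
  rw [← div_le_iff₀ (pow_pos (p_pos p) r), Nat.cast_sum, sum_div]
  exact (sum_le_wt u (fun k => (scalable_scl r K).nonneg k) Finset.univ).trans hK

variable (p) in
/-- The multi-indices of weight `q` with denominator dividing `p ^ r`. -/
def lvl (u : κ → ℕ) (q : ℚ) (r : ℕ) : Finset (κ →₀ ℕ) :=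
  ((finite_wt_le p u q r).subset fun _ (h : wt u (scl p r _) = q) => h.le).toFinset

theorem mem_lvl {u : κ → ℕ} {q : ℚ} {r : ℕ} {K : κ →₀ ℕ} :
    K ∈ lvl p u q r ↔ wt u (scl p r K) = q := Set.Finite.mem_toFinset _

theorem den_le_of_wt_eq (u : κ → ℕ) {Q : κ → ℚ} (hQ : Scalable p Q) :
    den p (fun _ : Unit => wt u Q) ≤ den p Q := by
  obtain ⟨K, hK⟩ := hQ.exists_den
  refine IsScaled.den_le (K := single () (∑ k, (u k + 1) * K k)) fun _ => ?_
  rw [single_eq_same, hK.eq_scl, wt_scl, ← hK.eq_scl, div_mul_cancel₀ _ (p_pow_ne_zero _)]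

theorem p_smul_injective {r : ℕ} : Injective fun K : κ →₀ ℕ => p ^ r • K := fun _ _ h =>
  Finsupp.ext fun k => Nat.eq_of_mul_eq_mul_left (pow_pos (Fact.out : p.Prime).pos r)
    (DFunLike.congr_fun h k)

theorem scl_succ_smul (r : ℕ) (K : κ →₀ ℕ) : scl p (r + 1) (p ^ 1 • K) = scl p r K :=
  ((isScaled_scl r K).add_right 1).eq_scl.symm

theorem dvd_sum_lvl_succ_sub {S : Type*} [CommRing S] (u : κ → ℕ) (q : ℚ) (r : ℕ)
    (f : (κ → ℚ) → S) {a : S} (h : ∀ Q, Scalable p Q → r < den p Q → a ∣ f Q) :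
    a ∣ ∑ K ∈ lvl p u q (r + 1), f (scl p (r + 1) K) - ∑ K ∈ lvl p u q r, f (scl p r K) := by
  have h1 : (lvl p u q r).image (fun K => p ^ 1 • K) ⊆ lvl p u q (r + 1) := by
    intro K hK; obtain ⟨J, hJ, rfl⟩ := Finset.mem_image.1 hK; rw [mem_lvl, scl_succ_smul]; exact mem_lvl.1 hJ
  rw [← Finset.sum_sdiff h1, Finset.sum_image fun _ _ _ _ h => p_smul_injective h,
    sum_congr rfl fun K _ => congrArg f (scl_succ_smul r K), add_sub_cancel_right]
  refine dvd_sum fun K hK => h _ (scalable_scl _ _) ?_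
  by_contra hle
  obtain ⟨J, hJ⟩ := (scalable_scl (r + 1) K).exists_isScaled (not_lt.1 hle)
  rw [Finset.mem_sdiff, Finset.mem_image] at hK
  refine hK.2 ⟨J, ?_, ?_⟩
  · rw [mem_lvl, ← hJ.eq_scl]; exact mem_lvl.1 hK.1
  · exact (hJ.add_right 1).unique (isScaled_scl _ _)

end

section

namespace CoordFrame

open WittFrame MvPowerSeries

variable (fr)

variable [Fintype κ] (d : κ → L)

open Classical in
/-- The monomial `[d] ^ Q`, formed with the Teichmüller representatives of `d`. -/
def dpow (Q : κ → ℚ) : W R :=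
  if h : Scalable p Q then frob p R (-(den p Q : ℤ))
    (jA (teichmuller p (∏ k, fr.π (d k) ^ h.exists_den.choose k))) else 0

theorem frob_j_teichmuller (a : ℕ) (x : A) :
    frob p R a (jA (teichmuller p x)) = jA (teichmuller p x ^ p ^ a) := by
  ext i
  rw [coeff_frob, coeff_j, coeff_j, ← map_pow, ← map_pow]
  cases i with
  | zero => rw [teichmuller_coeff_zero, teichmuller_coeff_zero]
  | succ i =>
    rw [WittVector.teichmuller_coeff_pos p _ _ i.succ_pos, WittVector.teichmuller_coeff_pos p _ _ i.succ_pos,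
      zero_pow (pow_ne_zero _ (Fact.out : p.Prime).ne_zero)]

theorem dpow_eq {r : ℕ} {Q : κ → ℚ} {K : κ →₀ ℕ} (hK : IsScaled p r Q K) : fr.dpow d Q =
    frob p R (-(r : ℤ)) (jA (teichmuller p (∏ k, fr.π (d k) ^ K k))) := by
  have h := hK.scalable
  rw [dpow, dif_pos h]
  set K0 := h.exists_den.choose
  obtain ⟨a, ha⟩ := exists_eq_add_of_le hK.den_le
  have h2 : K = p ^ a • K0 := by
    rw [ha] at hK; exact hK.unique (h.exists_den.choose_spec.add_right a)
  have h3 : ∏ k, fr.π (d k) ^ K k = (∏ k, fr.π (d k) ^ K0 k) ^ p ^ a := by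
    rw [← Finset.prod_pow, h2]; exact prod_congr rfl fun k _ => by rw [← pow_mul, mul_comm]; rfl
  rw [h3, map_pow, ← frob_j_teichmuller, ← frob_add]
  congr 2
  rw [ha]
  push_cast
  ring

theorem dpow_add {Q Q' : κ → ℚ} (h : Scalable p Q) (h' : Scalable p Q') :
    fr.dpow d (Q + Q') = fr.dpow d Q * fr.dpow d Q' := by
  obtain ⟨K, hK⟩ := h.exists_isScaled (le_max_left (den p Q) (den p Q'))
  obtain ⟨K', hK'⟩ := h'.exists_isScaled (le_max_right (den p Q) (den p Q'))
  rw [fr.dpow_eq d hK, fr.dpow_eq d hK', fr.dpow_eq d (hK.add hK'), ← map_mul, ← map_mul, ← map_mul,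
    ← prod_mul_distrib]
  simp only [Finsupp.add_apply, pow_add]

theorem dpow_zero : fr.dpow d 0 = 1 := by
  rw [fr.dpow_eq d (r := 0) (K := 0) fun _ => by simp]
  simp

theorem dpow_mem_wd {Q : κ → ℚ} (h : Scalable p Q) : fr.dpow d Q ∈ wd p A R (den p Q) := by
  obtain ⟨K, hK⟩ := h.exists_den
  rw [fr.dpow_eq d hK]
  exact frob_neg_j_mem_wd _ _

variable (lam : κ → Fin n)

/-- The operator `[d] ^ Q {∂}_Q`. -/
def dOp (Q : κ → ℚ) : End (W R) := mulOp p R (fr.dpow d Q) * fr.tOp lam Q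

theorem dOp_apply (Q : κ → ℚ) (z : W R) : fr.dOp d lam Q z = fr.dpow d Q * fr.tOp lam Q z := rfl

theorem dvd_tOp_j (Q : κ → ℚ) (x : W A) : (p : W R) ^ den p Q ∣ fr.tOp lam Q (jA x) := by
  have h := fr.dvd_wop_of_mem_wd (fr.taylor lam) Q (j_mem_wd 0 x)
  rwa [Nat.sub_zero] at h

theorem dvd_dOp (Q : κ → ℚ) (x : W A) : (p : W R) ^ den p Q ∣ fr.dOp d lam Q (jA x) :=
  (fr.dvd_tOp_j lam Q x).mul_left _

theorem truncate_dOp {r : ℕ} {Q : κ → ℚ} {K : κ →₀ ℕ} (hK : IsScaled p r Q K) {x : W A} {y : L}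
    (hy : fr.Rep r r (jA x) y) : truncate (r + 1) (fr.dOp d lam Q (jA x)) = truncate (r + 1) (frob p R (-(r : ℤ))
        (fr.ι ((∏ k, d k ^ K k) * hsCoeff (fr.taylor lam) K y))) := by
  obtain ⟨K0, hK0⟩ := hK.scalable.exists_den
  obtain ⟨a, ha⟩ := exists_eq_add_of_le hK.den_le
  have h2 : K = p ^ a • K0 := by
    rw [ha] at hK; exact hK.unique (hK0.add_right a)
  have h1 := hy.wop (fr.taylor lam) hK
  rw [truncate_eq_iff] at h1 ⊢
  have h3 : (p : W R) ^ (a + 1) ∣ fr.dpow d Q - frob p R (-(r : ℤ)) (fr.ι (∏ k, d k ^ K k)) := by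
    have h4 := fr.rep_map a (teichmuller p (∏ k, d k ^ K0 k))
    rw [WittVector.map_teichmuller, ghostComponent_teichmuller, map_prod] at h4
    rw [fr.dpow_eq d hK0, ← p_pow_dvd_frob_iff (d := r), map_sub, frob_frob_neg, ← frob_add, ← dvd_neg, neg_sub]
    convert (truncate_eq_iff.1 h4.2) using 2
    · rw [h2, ← Finset.prod_pow]; exact congrArg fr.ι (prod_congr rfl fun k _ => by rw [← pow_mul, mul_comm]; rfl)
    · simp [*]
  rw [dOp_apply, map_mul fr.ι, map_mul (frob p R (-(r : ℤ)))]
  have h6 := mul_dvd_mul h3 (fr.dvd_tOp_j lam Q x)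
  rw [← pow_add, show a + 1 + den p Q = r + 1 by omega] at h6
  have h7 := dvd_add h6 (h1.mul_left (frob p R (-(r : ℤ)) (fr.ι (∏ k, d k ^ K k))))
  rw [← fr.tOp_apply] at h7
  convert h7 using 1
  ring

variable (u : κ → ℕ)

/-- The partial sums of `∑ h(Q) [d] ^ Q {∂}_Q`, where `Q` has weight `q`. -/
def levelSum (h : (κ → ℚ) → ℤ_[p]) (q : ℚ) (r : ℕ) (z : W R) : W R :=
  ∑ K ∈ lvl p u q r, zp p R (h (scl p r K)) * fr.dOp d lam (scl p r K) z

theorem levelSum_succ (h : (κ → ℚ) → ℤ_[p]) (q : ℚ) (r : ℕ) (x : W A) :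
    truncate (r + 1) (fr.levelSum d lam u h q (r + 1) (jA x)) =
      truncate (r + 1) (fr.levelSum d lam u h q r (jA x)) := by
  rw [truncate_eq_iff]
  exact dvd_sum_lvl_succ_sub u q r (fun Q => zp p R (h Q) * fr.dOp d lam Q (jA x)) fun Q _ hr =>
    ((pow_dvd_pow _ hr).trans (fr.dvd_dOp d lam Q x)).mul_left _

theorem exists_hsCoeff_eq_sum {Θ : Curve}
    (h0 : ∀ x, constantCoeff (Θ x) = x) (hΘ : fr.IsPoly Θ) :
    ∃ (N : ℕ) (d : Fin n × Fin N → L), ∀ (r i : ℕ) (y : L) (q : ℚ), (i : ℚ) = q * (p : ℚ) ^ r →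
      hsCoeff Θ (single () i) y = ∑ K ∈ lvl p (fun z : Fin n × Fin N => (z.2 : ℕ)) q r,
        (∏ z, d z ^ K z) * hsCoeff (fr.taylor Prod.fst) K y := by
  classical
  obtain ⟨N, d, hd⟩ := hΘ
  refine ⟨N, fun z => d z.1 z.2, fun r i y q hq => ?_⟩
  obtain ⟨E, hE0, hE, hE'⟩ := exists_arc (fr.taylor (Prod.fst : Fin n × Fin N → Fin n))
    (fr.isTaylor _).1 (fun z => d z.1 z.2) (fun z => PowerSeries.X ^ ((z.2 : ℕ) + 1))
    fun z => by rw [map_pow, PowerSeries.constantCoeff_X, zero_pow (Nat.succ_ne_zero _)]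
  have hEΘ : Θ = E := by
    refine fr.etale.hasseSchmidt_ext Θ E h0 hE0 fun l => ?_
    obtain ⟨s, hs, hs'⟩ := (fr.isTaylor (Prod.fst : Fin n × Fin N → Fin n)).2 l; rw [hd, hE' _ s hs']; congr 1
    have hs2 : s = Finset.univ.map ⟨fun t => (l, t), fun a b h => (Prod.ext_iff.1 h).2⟩ := by
      ext z; rw [hs, Finset.mem_map]
      constructor
      · rintro rfl
        exact ⟨z.2, mem_univ _, rfl⟩
      · rintro ⟨t, -, rfl⟩
        rfl
    rw [hs2, sum_map, Finset.sum_range]; refine sum_congr rfl fun t _ => ?_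
    rw [map_pow, PowerSeries.map_X]
    rfl
  subst hEΘ
  obtain ⟨T, hT⟩ := hE i y
  have hcoeff : ∀ K, PowerSeries.coeff i
      (∏ z : Fin n × Fin N, (PowerSeries.X ^ ((z.2 : ℕ) + 1) : PowerSeries ℤ) ^ K z) =
        if K ∈ lvl p (fun z : Fin n × Fin N => (z.2 : ℕ)) q r then 1 else 0 := by
    intro K; simp only [← pow_mul]; rw [Finset.prod_pow_eq_pow_sum, PowerSeries.coeff_X_pow]
    refine if_congr ?_ rfl rfl; rw [mem_lvl, wt_scl, div_eq_iff (p_pow_ne_zero r), ← hq, Nat.cast_inj, eq_comm]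
  rw [hT (T ∪ lvl p (fun z => (z.2 : ℕ)) q r) Finset.subset_union_left]
  symm
  refine Finset.sum_subset_zero_on_sdiff Finset.subset_union_right (fun K hK => ?_) fun K hK => ?_
  · rw [hcoeff, if_neg (Finset.mem_sdiff.1 hK).2, Int.cast_zero, mul_zero, mul_zero]
  · rw [hcoeff, if_pos hK, Int.cast_one, mul_one, mul_comm]

theorem exists_truncate_gen {Θ : Curve}
    (h0 : ∀ x, constantCoeff (Θ x) = x) (hΘ : fr.IsPoly Θ) :
    ∃ (N : ℕ) (d : Fin n × Fin N → L), ∀ (r : ℕ) (q : ℚ) (c : W R) (x : W A),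
      truncate (r + 1) (fr.gen Θ q c (jA x)) = truncate (r + 1)
        (c * fr.levelSum d Prod.fst (fun z : Fin n × Fin N => (z.2 : ℕ)) 1 q r (jA x)) := by
  obtain ⟨N, d, hd⟩ := fr.exists_hsCoeff_eq_sum h0 hΘ
  refine ⟨N, d, fun r q c x => ?_⟩
  rw [gen_apply, map_mul, map_mul]
  congr 1
  obtain ⟨y, hy⟩ := fr.exists_rep_of_j (le_refl r) x
  by_cases hq : ∃ K, IsScaled p r (cst q) K
  · obtain ⟨K, hK⟩ := hq; obtain ⟨i, rfl⟩ : ∃ i, K = single () i := ⟨K (), (Finsupp.unique_single K).trans rfl⟩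
    rw [hy.wop Θ hK, hd r i y q (by simpa using hK ()), levelSum, map_sum, map_sum, map_sum, map_sum]
    refine sum_congr rfl fun K _ => ?_
    rw [Pi.one_apply, map_one, one_mul, fr.truncate_dOp d Prod.fst (isScaled_scl r K) hy]
  · rw [hy.wop_eq_zero Θ hq, levelSum, sum_eq_zero, map_zero]; intro K hK
    refine absurd ⟨single () (∑ z, ((z.2 : ℕ) + 1) * K z), fun _ => ?_⟩ hq
    rw [← mem_lvl.1 hK, wt_scl, div_mul_cancel₀ _ (p_pow_ne_zero r), single_eq_same]

theorem exists_mem_EW_of_approx (f : ℕ → W R → W R)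
    (h : ∀ r, ∃ g ∈ fr.elem m (fun _ => True), ∀ x, truncate (r + 1) (f r (jA x)) = truncate (r + 1) (g (jA x)))
    (hf : ∀ r x, truncate (r + 1) (f (r + 1) (jA x)) = truncate (r + 1) (f r (jA x))) :
    ∃ φ ∈ EW p k A m, ∀ r x, truncate (r + 1) (jA (φ x)) = truncate (r + 1) (f r (jA x)) := by
  choose g hg hgf using h
  choose y hy using fun r => elem_preservesWA (hg r)
  have hlim : ∀ x, ∃ z, ∀ r, truncate (r + 1) (jA z) = truncate (r + 1) (f r (jA x)) := by
    intro x; obtain ⟨z, hz⟩ := exists_limit (fun N => y N x) fun N => by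
      rw [← fr.truncate_j_iff, hy, hy]
      refine (truncate_of_le (Nat.le_succ_of_le N.le_succ) (hgf (N + 1) x)).symm.trans ?_
      exact (truncate_of_le N.le_succ (hf N x)).trans (truncate_of_le N.le_succ (hgf N x))
    refine ⟨z, fun r => ?_⟩
    rw [(fr.truncate_j_iff).2 (hz (r + 1)), hy, ← hf]; exact (truncate_of_le (Nat.le_succ _) (hgf (r + 1) x)).symm
  choose φ hφ using hlim
  have hadd : ∀ x x', φ (x + x') = φ x + φ x' := fun x x' => fr.j_injective <|
    eq_of_truncate_succ fun r => by grind
  refine ⟨AddMonoidHom.mk' φ hadd, mem_EW_of_approx fun N => ⟨g N, hg N, fun x => ?_⟩, fun r x => hφ x r⟩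
  exact truncate_of_le N.le_succ ((hφ x N).trans (hgf N x))

theorem exists_EW_levelSum (h : (κ → ℚ) → ℤ_[p]) {q : ℚ} (hq : 0 < q)
    (hqm : 6 * Fintype.card κ * q ≤ p ^ m) : ∃ φ ∈ EW p k A m, ∀ r x, truncate (r + 1) (jA (φ x)) = truncate (r + 1)
        (fr.levelSum d lam u h q r (jA x)) := by
  classical
  refine fr.exists_mem_EW_of_approx (fr.levelSum d lam u h q) (fun r => ?_)
    (fr.levelSum_succ d lam u h q)
  have key : ∀ K ∈ lvl p u q r, ∃ g ∈ fr.elem m (fun _ => True), ∀ x,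
      truncate (r + 1) (fr.dOp d lam (scl p r K) (jA x)) = truncate (r + 1) (g (jA x)) := by
    intro K hK; have hK0 : K ≠ 0 := by
      rintro rfl
      rw [mem_lvl, show scl p r (0 : κ →₀ ℕ) = 0 from funext fun k => by simp [scl], map_zero] at hK
      exact hq.ne hK
    obtain ⟨s, E, c, M, hM, hE0, hE⟩ := exists_hsCoeff_combination (fr.taylor lam)
      (fr.isTaylor lam).1 d K hK0
    have h0 := pow_pos (p_pos p) r; refine ⟨∑ z ∈ s, ∑ i ∈ Finset.Icc 1 M, fr.gen (E z) (i / p ^ r)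
      ((c z i : ℤ) : W R), sum_mem fun z _ => sum_mem fun i hi => gen_mem_elem (hE0 z) ?_ ?_
        (intCast_mem _ _), fun x => ?_⟩
    · rw [Finset.mem_Icc] at hi; exact div_pos (Nat.cast_pos.2 (by omega)) h0
    · refine le_trans ?_ hqm; have h1 := sum_le_wt u (fun k => (scalable_scl (p := p) r K).nonneg k) Finset.univ
      rw [mem_lvl.1 hK] at h1; refine le_trans ?_ (mul_le_mul_of_nonneg_left h1 (by positivity))
      simp only [scl]; rw [← sum_div, ← mul_div_assoc]; refine div_le_div_of_nonneg_right ?_ h0.le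
      exact_mod_cast (Finset.mem_Icc.1 hi).2.trans hM
    · obtain ⟨y, hy⟩ := fr.exists_rep_of_j (le_refl r) x; rw [fr.truncate_dOp d lam (isScaled_scl r K) hy, ← hE y]
      refine Eq.trans ?_ (congrArg _ (end_sum_apply s _ _)).symm; rw [map_sum, map_sum, map_sum, map_sum]
      refine sum_congr rfl fun z _ => ?_
      refine Eq.trans ?_ (congrArg _ (end_sum_apply _ _ _)).symm; rw [map_sum, map_sum, map_sum, map_sum]
      refine sum_congr rfl fun i _ => ?_
      rw [gen_apply, map_mul fr.ι, map_mul (frob p R _), map_mul, map_mul, map_intCast fr.ι, map_intCast (frob p R _),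
        hy.wop (E z) (K := single () i) fun _ => by simp]
  choose! g hg hgx using key
  refine ⟨∑ K ∈ lvl p u q r, mulOp p R (zp p R (h (scl p r K))) * g K,
    sum_mem fun K hK => mulOp_j_mul_mem_elem (hg K hK) (zp_mem_wd 0 _), fun x => ?_⟩
  refine Eq.trans ?_ (congrArg _ (end_sum_apply _ _ _)).symm
  rw [levelSum, map_sum, map_sum]
  refine sum_congr rfl fun K hK => ?_
  change _ = truncate (r + 1) (zp p R (h (scl p r K)) * g K (jA x))
  rw [map_mul, map_mul, hgx K hK]

end CoordFrame

end

namespace CoordFrame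

section

open WittFrame MvPowerSeries

/-- The sum of the entries over the fibres of `lam`. -/
def push [Fintype κ] (lam : κ → Fin n) (Q : κ → ℚ) (l : Fin n) : ℚ :=
  ∑ k ∈ Finset.univ.filter (fun k => lam k = l), Q k

theorem push_add [Fintype κ] (lam : κ → Fin n) (Q Q' : κ → ℚ) :
    push lam (Q + Q') = push lam Q + push lam Q' := funext fun _ => sum_add_distrib

theorem push_single [Fintype κ] [DecidableEq κ] (lam : κ → Fin n) (k : κ) (q : ℚ) :
    push lam (Pi.single k q) = Pi.single (lam k) q := by
  funext l
  rw [push, Finset.sum_pi_single']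
  by_cases h : lam k = l
  · subst h; simp
  · simp [h]

theorem push_zero [Fintype κ] (lam : κ → Fin n) : push lam (0 : κ → ℚ) = 0 := funext fun _ => Finset.sum_const_zero

theorem exists_tOp_eq [Fintype κ] (lam : κ → Fin n) {Q : κ → ℚ}
    (hQ : Scalable p Q) : Scalable p (push lam Q) ∧ ∃ γ, (p : ℤ_[p]) ^ (den p Q - den p (push lam Q)) ∣ γ ∧
        fr.tOp lam Q = mulOp p R (zp p R γ) * fr.tOp id (push lam Q) := by
  classical
  have key : ∀ s : Finset κ, Scalable p (fun k => if k ∈ s then Q k else 0) ∧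
      Scalable p (push lam fun k => if k ∈ s then Q k else 0) ∧
      ∃ γ, (p : ℤ_[p]) ^ (den p (fun k => if k ∈ s then Q k else 0) -
          den p (push lam fun k => if k ∈ s then Q k else 0)) ∣ γ ∧
        fr.tOp lam (fun k => if k ∈ s then Q k else 0) =
          mulOp p R (zp p R γ) * fr.tOp id (push lam fun k => if k ∈ s then Q k else 0) := by
    intro s; induction s using Finset.induction_on with
    | empty =>
      have h0 : (fun k => if k ∈ (∅ : Finset κ) then Q k else 0) = 0 := funext fun k => by simp
      rw [h0, push_zero]; refine ⟨scalable_zero, scalable_zero, 1, ?_, ?_⟩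
      · rw [den_zero, Nat.zero_sub, pow_zero]
      · rw [tOp_zero, tOp_zero, map_one, map_one, one_mul]
    | insert k s hk ih =>
      obtain ⟨h1, h2, γ, hγ, h3⟩ := ih; have h4 : (fun i => if i ∈ insert k s then Q i else 0) =
          Pi.single k (Q k) + fun i => if i ∈ s then Q i else 0 := by
        funext i
        by_cases hi : i = k
        · subst hi; simp [hk]
        · simp [hi]
      have hs := hQ.apply k; have hs1 : Scalable p (Pi.single k (Q k) : κ → ℚ) := scalable_single.2 hs
      have hs2 : Scalable p (Pi.single (lam k) (Q k) : Fin n → ℚ) := scalable_single.2 hs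
      rw [h4, push_add, push_single]; refine ⟨hs1.add h1, hs2.add h2, γ * wbinom (Pi.single (lam k) (Q k))
        (push lam fun i => if i ∈ s then Q i else 0), ?_, ?_⟩
      · have h5 := mul_dvd_mul hγ (p_pow_dvd_wbinom hs2 h2); rw [← pow_add, den_single] at h5
        refine (pow_dvd_pow _ ?_).trans h5; have h6 := den_add_le hs1 h1; rw [den_single] at h6; omega
      · rw [← fr.tOp_mul_of_disjoint lam hs1 h1 fun i => by
          by_cases hi : i = k
          · subst hi; exact Or.inr (if_neg hk)
          · exact Or.inl (Pi.single_eq_of_ne hi _), h3, ← mul_assoc, tOp_mul_zp, mul_assoc,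
          fr.tOp_single lam id rfl, tOp_mul _ id hs2 h2, mulOp_mul_mulOp, ← map_mul]
  simpa using (key Finset.univ).2

theorem exists_tOp_eq_term [Fintype κ]
    (lam : κ → Fin n) {Q : κ → ℚ} (hQ : Scalable p Q) {c : W R}
    (hc : c ∈ coef p A R N (den p Q)) : ∃ c' ∈ coef p A R N (den p (push lam Q)),
      mulOp p R c * fr.tOp lam Q = mulOp p R c' * fr.tOp id (push lam Q) := by
  obtain ⟨-, γ, hγ, h⟩ := fr.exists_tOp_eq lam hQ
  refine ⟨zp p R γ * c, zp_mul_mem_coef hc hγ, ?_⟩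
  rw [h, mulOp_mul_mulOp, mul_comm c]

variable (fr) in
/-- The operators that are combinations of the `c {∂}_Q` with `Q ≤ p ^ m`. -/
def low (m : ℤ) : AddSubgroup (End (W R)) :=
  AddSubgroup.closure {f | ∃ Q : Fin n → ℚ, Scalable p Q ∧ (∀ l, Q l ≤ (p : ℚ) ^ m) ∧
    ∃ c ∈ wd p A R (den p Q), f = mulOp p R c * fr.tOp id Q}

theorem push_le [Fintype κ] (lam : κ → Fin n) (w : κ → ℕ) {Q : κ → ℚ}
    (hQ : Scalable p Q) (l : Fin n) : push lam Q l ≤ wt w Q := sum_le_wt w (fun k => hQ.nonneg k) _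

theorem tOp_mem_low [Fintype κ] (lam : κ → Fin n) {Q : κ → ℚ}
    (hQ : Scalable p Q) (hm : ∀ l, push lam Q l ≤ p ^ m) {c : W R}
    (hc : c ∈ wd p A R (den p Q)) : mulOp p R c * fr.tOp lam Q ∈ fr.low m := by
  obtain ⟨c', hc', h⟩ := exists_tOp_eq_term (fr := fr) lam hQ (mem_coef_zero.2 hc)
  exact h ▸ AddSubgroup.subset_closure ⟨_, (fr.exists_tOp_eq lam hQ).1, hm, c', mem_coef_zero.1 hc', rfl⟩

theorem low_le_resDW {f : End (W R)} (hf : f ∈ fr.low m) :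
    f ∈ resDW p k A R m := by
  induction hf using closure_induction with
  | mem f hf =>
    obtain ⟨Q, hQ, hm, c, hc, rfl⟩ := hf; exact (mulOp_mul_tOp_mem_good hQ hm (mem_coef_zero.2 hc)).1
  | zero => exact zero_mem _
  | add f f' _ _ h h' => exact add_mem h h'
  | neg f _ h => exact neg_mem h

theorem mulOp_mul_tOp_mem_resI' [Fintype κ] (lam : κ → Fin n) {Q : κ → ℚ}
    (hQ : Scalable p Q) (hm : ∀ l, push lam Q l ≤ p ^ m) (hN : N ≤ den p Q) {c : W R}
    (hc : c ∈ wd p A R (den p Q)) : mulOp p R c * fr.tOp lam Q ∈ resI p k A R m N := by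
  have hc0 : c ∈ coef p A R N (den p Q) := ⟨hc, by simp [*]⟩
  obtain ⟨c', hc', h⟩ := exists_tOp_eq_term (fr := fr) lam hQ hc0
  exact h ▸ tOp_mem_resI (fr.exists_tOp_eq lam hQ).1 hm hc'

theorem gen_mul_mem_resI {N δ D : ℕ} {Θ : Curve}
    (h0 : ∀ x, constantCoeff (Θ x) = x) {c : W R} (hc : c ∈ wd p A R δ)
    {T : End (W R)} (hT : ∀ ν ∈ wd p A R D, mulOp p R ν * T ∈ resDW p k A R m)
    (hT' : max N δ < D → ∀ ν ∈ wd p A R D, mulOp p R ν * T ∈ resI p k A R m N) {ε : ℚ}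
    (hs : Scalable p (cst ε)) (hε : 0 < ε) (hεm : ε ≤ (p : ℚ) ^ m)
    (hlt : ε < 1 / (p : ℚ) ^ max N δ) {ν : W R} (hν : ν ∈ wd p A R D) :
    fr.gen Θ ε (c * ν) * T ∈ resI p k A R m N := by
  have hden := hs.lt_den_of_lt (k := ()) hε hlt
  have hTT : T ∈ resDW p k A R m := by
    have := hT 1 (one_mem _); rwa [map_one, one_mul] at this
  rcases le_or_gt D (max N δ) with hD | hD
  · refine mul_mem_resI_right (gen_mem_resI h0 hε hεm (mul_mem (wd_mono ?_ hc) (wd_mono ?_ hν)) ?_) hTT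
    all_goals omega
  set G := max D (den p fun _ => ε) with hG
  have h0' := pow_pos (p_pos p) G
  have key : ∀ i : ℕ, i / p ^ G ≤ ε → ∀ ν ∈ wd p A R D, fr.gen Θ (i / p ^ G) (c * ν) * T ∈ resI p k A R m N := by
    intro i; induction i using Nat.strong_induction_on with
    | _ i ih =>
      intro hi ν hν; rcases Nat.eq_zero_or_pos i with rfl | hpos
      · have h1 : fr.gen Θ ((0 : ℕ) / p ^ G) (c * ν) = mulOp p R (c * ν) := by
          have h2 : (fun _ : Unit => ((0 : ℕ) : ℚ) / (p : ℚ) ^ G) = 0 := funext fun _ => by simp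
          refine AddMonoidHom.ext fun z => ?_
          refine (fr.gen_apply _ _ _ _).trans ?_; rw [h2, fr.wop_zero Θ h0]
          rfl
        rw [h1]; exact hT' hD _ (mul_mem (wd_mono (by omega) hc) hν)
      · have hq0 := div_pos (Nat.cast_pos.2 hpos) h0'; have hK : IsScaled p G (fun _ => i / p ^ G) (single () i) :=
          fun _ => by rw [single_eq_same, div_mul_cancel₀ _ h0'.ne']
        have hd := hK.scalable.lt_den_of_lt (k := ()) hq0 (hi.trans_lt hlt)
        have h1 := mul_mem_resI_right (gen_mul_mulOp_sub_mem (fr := fr) (N := N) h0 (hi.trans hεm) hc hν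
          (by omega) (by omega) (by omega) hK) hTT
        rw [sub_mul, mul_assoc] at h1
        have h2 : fr.gen Θ ((i : ℚ) / (p : ℚ) ^ G) c * (mulOp p R ν * T) ∈ resI p k A R m N :=
          mul_mem_resI_right (gen_mem_resI h0 hq0 (hi.trans hεm) (wd_mono (by omega) hc) (by omega))
            (hT ν hν)
        have h3 := sub_mem h2 h1; rw [sub_sub_cancel, sum_mul, antidiagonal_unit i fun a b =>
          fr.gen Θ (scl p G b ()) (c * fr.wop Θ (scl p G a) ν) * T,
          ← add_sum_erase _ _ (mem_antidiagonal.2 (zero_add i) : (0, i) ∈ _)] at h3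
        have h4 : fr.gen Θ (scl p G (single () i) ()) (c * fr.wop Θ
            (scl p G (single () 0)) ν) = fr.gen Θ (i / p ^ G) (c * ν) := by
          have h5 : scl p G (single () 0 : Unit →₀ ℕ) = 0 := funext fun _ => by simp [scl]
          rw [h5, fr.wop_zero Θ h0, scl, single_eq_same]
        rw [h4] at h3; refine (AddSubgroup.add_mem_cancel_right _ (sum_mem fun ij hij => ?_)).1 h3
        rw [mem_erase, mem_antidiagonal] at hij; have h6 : ij.2 < i := by grind
        rw [scl, single_eq_same]
        exact ih ij.2 h6 (le_trans (div_le_div_of_nonneg_right (Nat.cast_le.2 h6.le) h0'.le) hi) _ (fr.wop_mem_wd Θ (scl p G (single () ij.1)) hν)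
  obtain ⟨K, hK⟩ := hs.exists_isScaled (le_max_right D (den p fun _ => ε))
  have h1 : ((K () : ℕ) : ℚ) / p ^ G = ε := by rw [hK (), mul_div_cancel_right₀ _ h0'.ne']
  have h2 := key (K ()) h1.le ν hν
  rwa [h1] at h2

end

section

open WittFrame MvPowerSeries

variable [Fintype κ]

variable (fr) in
/-- `f` is the operator `∑ h(Q) c [d] ^ Q {∂}_Q`, the sum over the `Q` of weight `q`. -/
def IsWeightedSum (d : κ → L) (lam : κ → Fin n) (w : κ → ℕ) (q : ℚ) (c : W R)
    (h : (κ → ℚ) → ℤ_[p]) (f : End (W R)) : Prop :=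
  ∀ (r : ℕ) (x : W A), truncate (r + 1) (f (jA x)) = truncate (r + 1) (c * fr.levelSum d lam w h q r (jA x))

variable {d : κ → L} {lam : κ → Fin n} {w : κ → ℕ} {q : ℚ} {c : WittVector p R}

theorem IsWeightedSum.of_ge {h : (κ → ℚ) → ℤ_[p]} {f : End (W R)} (r₀ : ℕ)
    (hf : ∀ (r : ℕ) (x : W A), r₀ ≤ r → truncate (r + 1) (f (jA x)) =
      truncate (r + 1) (c * fr.levelSum d lam w h q r (jA x))) :
    fr.IsWeightedSum d lam w q c h f := by
  have key : ∀ t r x, r₀ ≤ r + t → truncate (r + 1) (f (jA x)) =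
      truncate (r + 1) (c * fr.levelSum d lam w h q r (jA x)) := by
    intro t; induction t with
    | zero => exact fun r x hr => hf r x hr
    | succ t ih =>
      intro r x hr; rw [truncate_of_le (Nat.le_succ _) (ih (r + 1) x (by omega)), map_mul, levelSum_succ, map_mul]
  exact fun r x => key r₀ r x (Nat.le_add_left _ _)

theorem IsWeightedSum.add {h h' : (κ → ℚ) → ℤ_[p]} {f f' : End (W R)}
    (hf : fr.IsWeightedSum d lam w q c h f) (hf' : fr.IsWeightedSum d lam w q c h' f') :
    fr.IsWeightedSum d lam w q c (h + h') (f + f') := fun r x => by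
  refine ((map_add (truncate (r + 1)) _ _).trans
    (congrArg₂ (· + ·) (hf r x) (hf' r x))).trans ?_
  rw [← map_add, ← mul_add, levelSum, levelSum, levelSum, ← sum_add_distrib]
  simp only [Pi.add_apply, map_add, add_mul]

theorem IsWeightedSum.neg {h : (κ → ℚ) → ℤ_[p]} {f : End (W R)}
    (hf : fr.IsWeightedSum d lam w q c h f) : fr.IsWeightedSum d lam w q c (-h) (-f) := fun r x => by
  refine ((map_neg (truncate (r + 1)) _).trans (congrArg (- ·) (hf r x))).trans ?_
  rw [← map_neg, ← mul_neg, levelSum, levelSum, ← Finset.sum_neg_distrib]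
  simp

theorem IsWeightedSum.zero : fr.IsWeightedSum d lam w q c 0 0 := fun r x => by
  rw [levelSum]
  simp

theorem dpow_mul_dOp_tOp {Q B : κ → ℚ} (hQ : Scalable p Q) (hB : Scalable p B) (z : W R) :
    fr.dpow d B * fr.dOp d lam Q (fr.tOp lam B z) = zp p R (wbinom Q B) * fr.dOp d lam (Q + B) z := by
  have h1 : fr.tOp lam Q (fr.tOp lam B z) = zp p R (wbinom Q B) * fr.tOp lam (Q + B) z :=
    DFunLike.congr_fun (fr.tOp_mul lam hQ hB) z
  rw [dOp_apply, dOp_apply, h1, fr.dpow_add d hQ hB]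
  ring

theorem isWeightedSum_upperBinom {Θ : Curve}
    (hΘ : ∀ (r : ℕ) (q : ℚ) (c : W R) (x : W A), truncate (r + 1) (fr.gen Θ q c (jA x)) = truncate (r + 1)
        (c * fr.levelSum d lam w 1 q r (jA x)))
    {B : κ → ℚ} (hB : Scalable p B) (a : ℤ_[p]) :
    fr.IsWeightedSum d lam w q c (fun Q => a * upperBinom p B Q)
      (fr.gen Θ (q - wt w B) (c * (zp p R a * fr.dpow d B)) * fr.tOp lam B) := by
  refine IsWeightedSum.of_ge (den p B) fun r x hr => ?_
  obtain ⟨J, hJ⟩ := hB.exists_isScaled hr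
  obtain ⟨x', hx'⟩ := fr.exists_wop_j (fr.taylor lam) B x
  have hx'' : fr.tOp lam B (jA x) = jA x' := by rw [tOp_apply, hx']
  refine (congrArg (truncate (r + 1)) (congrArg (fr.gen Θ (q - wt w B)
    (c * (zp p R a * fr.dpow d B))) hx'')).trans ?_
  rw [hΘ, ← hx'', mul_assoc]
  refine congrArg (fun z => truncate (r + 1) (c * z)) ?_
  rw [levelSum, levelSum, mul_sum]
  have h1 : ∀ K ∈ lvl p w q r, K ∉ (lvl p w q r).filter (fun K => J ≤ K) →
      zp p R (a * upperBinom p B (scl p r K)) * fr.dOp d lam (scl p r K) (jA x) = 0 := by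
    intro K hK hK'; rw [mem_filter, not_and] at hK'; have h2 := hK' hK; rw [(isScaled_scl r K).le_iff hJ] at h2
    rw [upperBinom_of_not_le h2, mul_zero, map_zero, zero_mul]
  rw [← Finset.sum_subset (Finset.filter_subset _ _) h1]
  have hadd : ∀ K, scl p r (K + J) = scl p r K + B := fun K => by
    rw [hJ.eq_scl]; exact ((isScaled_scl r K).add (isScaled_scl r J)).eq_scl.symm
  refine Finset.sum_nbij' (fun K => K + J) (fun K => K - J) (fun K hK => ?_) (fun K hK => ?_)
    (fun K _ => add_tsub_cancel_right K J)
    (fun K hK => tsub_add_cancel_of_le (mem_filter.1 hK).2) fun K hK => ?_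
  · rw [mem_filter, mem_lvl, hadd, map_add, mem_lvl.1 hK]; exact ⟨sub_add_cancel _ _, le_add_self⟩
  · rw [mem_filter, mem_lvl] at hK; have h2 := hadd (K - J); rw [tsub_add_cancel_of_le hK.2] at h2
    rw [mem_lvl, ← hK.1, h2, map_add, add_sub_cancel_right]
  · rw [hadd, upperBinom_of_le (le_add_of_nonneg_left fun k => (scalable_scl r K).nonneg k),
      add_sub_cancel_right, wbinom_comm hB (scalable_scl r K), map_mul (zp p R), mul_assoc, mul_assoc,
      ← dpow_mul_dOp_tOp (scalable_scl r K) hB, Pi.one_apply, map_one, one_mul]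

theorem exists_DW_levelSum (h : (κ → ℚ) → ℤ_[p]) {q : ℚ} (hq : 0 ≤ q)
    (hqm : 6 * Fintype.card κ * q ≤ p ^ m) : ∃ φ ∈ DW p k A m, ∀ r x, truncate (r + 1) (jA (φ x)) = truncate (r + 1)
        (fr.levelSum d lam w h q r (jA x)) := by
  rcases hq.eq_or_lt with rfl | hq
  · refine ⟨mulOp p A (zp p A (h 0)), Subring.subset_closure (Or.inl ⟨_, rfl⟩), fun r x => ?_⟩
    have h1 : lvl p w 0 r = {0} := by
      ext K; have h0 : scl p r (0 : κ →₀ ℕ) = 0 := funext fun k => by simp [scl]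
      rw [mem_lvl, Finset.mem_singleton]; refine ⟨fun hK => ?_, fun hK => by rw [hK, h0, map_zero]⟩
      ext k; have h2 := sum_le_wt w (fun k => (scalable_scl (p := p) r K).nonneg k) {k}
      rw [hK, sum_singleton, scl, div_le_iff₀ (pow_pos (p_pos p) r), zero_mul] at h2
      exact Nat.le_zero.1 (by exact_mod_cast h2)
    have h0 : scl p r (0 : κ →₀ ℕ) = 0 := funext fun k => by simp [scl]
    rw [levelSum, h1, sum_singleton, h0, dOp_apply, dpow_zero, tOp_zero, one_mul]
    change truncate (r + 1) (jA (zp p A (h 0) * x)) = _; rw [map_mul (jA), j, map_zp]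
    rfl
  · obtain ⟨φ, h1, h2⟩ := fr.exists_EW_levelSum d lam w h hq hqm; exact ⟨φ, Subring.subset_closure (Or.inr h1), h2⟩

theorem levelSum_eq_sum {g r : ℕ} (hr : g ≤ r) {h : (κ → ℚ) → ℤ_[p]}
    {v : (κ →₀ ℕ) → (κ → ℚ) → ℤ_[p]}
    (hv : ∀ Q, Scalable p Q → (∀ k, Q k < p ^ (-(g : ℤ))) → ∀ F, wt w (Q + scl p g F) = q →
      v F Q * wbinom Q (scl p g F) = h (Q + scl p g F))
    {Ω : Finset (κ →₀ ℕ)} (hΩ : ∀ Q, Scalable p Q → wt w Q = q → floorAt p g Q ∈ Ω) (z : W R) :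
    fr.levelSum d lam w h q r z = ∑ F ∈ Ω, fr.dpow d (scl p g F) * fr.levelSum d lam w
      (fun Q => open Classical in if ∀ k, Q k < p ^ (-(g : ℤ)) then v F Q else 0)
      (q - wt w (scl p g F)) r (fr.tOp lam (scl p g F) z) := by
  obtain ⟨t, rfl⟩ := exists_eq_add_of_le hr
  have h0 : ∀ a, 0 < (p : ℚ) ^ a := fun a => pow_pos (p_pos p) a
  rw [levelSum, ← Finset.sum_fiberwise_of_maps_to (g := fun K => floorAt p g (scl p (g + t) K))
    fun K hK => hΩ _ (scalable_scl _ _) (mem_lvl.1 hK)]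
  refine sum_congr rfl fun F _ => ?_
  rw [levelSum, mul_sum]
  have hlt : ∀ K : κ →₀ ℕ, (∀ k, scl p (g + t) K k < (p : ℚ) ^ (-(g : ℤ))) ↔ ∀ k, K k < p ^ t := by
    intro K; refine forall_congr' fun k => ?_
    rw [scl, div_lt_iff₀ (h0 _), pow_add, ← mul_assoc, zpow_neg, zpow_natCast, inv_mul_cancel₀ (h0 g).ne', one_mul]
    exact_mod_cast Iff.rfl
  have h1 : ∀ K ∈ lvl p w (q - wt w (scl p g F)) (g + t), K ∉ (lvl p w (q - wt w (scl p g F)) (g + t)).filter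
        (fun K => ∀ k, scl p (g + t) K k < p ^ (-(g : ℤ))) →
      fr.dpow d (scl p g F) * (zp p R (if ∀ k, scl p (g + t) K k < p ^ (-(g : ℤ)) then
        v F (scl p (g + t) K) else 0) * fr.dOp d lam (scl p (g + t) K) (fr.tOp lam (scl p g F) z)) = 0 := by grind
  rw [← Finset.sum_subset (Finset.filter_subset _ _) h1]
  have hadd : ∀ K, scl p (g + t) (K + p ^ t • F) = scl p (g + t) K + scl p g F := fun K =>
    ((isScaled_scl (g + t) K).add ((isScaled_scl (p := p) g F).add_right t)).eq_scl.symm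
  have hfl : ∀ (K : κ →₀ ℕ) k, floorAt p g (scl p (g + t) K) k = K k / p ^ t := fun K k =>
    floorAt_apply_of_isScaled (isScaled_scl (g + t) K) k
  have hle : ∀ K, floorAt p g (scl p (g + t) K) = F → p ^ t • F ≤ K := by
    intro K hK k; rw [← hK]; change p ^ t * floorAt p g (scl p (g + t) K) k ≤ K k; rw [hfl]; exact Nat.mul_div_le _ _
  have hpt := pow_pos (Fact.out : p.Prime).pos t
  symm
  refine Finset.sum_nbij' (fun K => K + p ^ t • F) (fun K => K - p ^ t • F) (fun K hK => ?_)
    (fun K hK => ?_) (fun K _ => add_tsub_cancel_right K _)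
    (fun K hK => tsub_add_cancel_of_le (hle K (mem_filter.1 hK).2)) fun K hK => ?_
  · rw [mem_filter, mem_lvl, hlt] at hK; rw [mem_filter, mem_lvl, hadd, map_add, hK.1]
    refine ⟨sub_add_cancel _ _, Finsupp.ext fun k => ?_⟩
    rw [← hadd, hfl]; change (K k + p ^ t * F k) / p ^ t = F k
    rw [Nat.add_mul_div_left _ _ hpt, Nat.div_eq_of_lt (hK.2 k), zero_add]
  · rw [mem_filter, mem_lvl] at hK; have h2 := hadd (K - p ^ t • F); rw [tsub_add_cancel_of_le (hle K hK.2)] at h2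
    rw [mem_filter, mem_lvl, hlt, ← hK.1, h2, map_add, add_sub_cancel_right]; refine ⟨rfl, fun k => ?_⟩
    have h3 := hfl K k; rw [hK.2] at h3; change K k - p ^ t * F k < p ^ t; rw [h3, ← Nat.mod_eq_sub_mul_div]
    exact Nat.mod_lt _ hpt
  · rw [mem_filter, mem_lvl] at hK
    rw [if_pos hK.2, hadd, ← hv _ (scalable_scl _ _) hK.2 F (by rw [map_add, hK.1, sub_add_cancel]),
      mul_left_comm, dpow_mul_dOp_tOp (scalable_scl _ _) (scalable_scl _ _), map_mul (zp p R), mul_assoc]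

end

section

open WittFrame MvPowerSeries

theorem tOp_mem_resDW' [Fintype κ] (lam : κ → Fin n) {Q : κ → ℚ}
    (hQ : Scalable p Q) (hm : ∀ l, push lam Q l ≤ p ^ m) :
    fr.tOp lam Q ∈ resDW p k A R m := by
  have := low_le_resDW (tOp_mem_low (fr := fr) lam hQ hm (one_mem _))
  rwa [map_one, one_mul] at this

variable [Fintype κ] {d : κ → L} {lam : κ → Fin n} {w : κ → ℕ} {q : ℚ}
  {c : WittVector p R}

theorem IsWeightedSum.mem_resI_of_dvd {N δ g E : ℕ} (hc : c ∈ wd p A R δ) (hE : N + δ + g ≤ E)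
    (hg : 6 * Fintype.card κ * ∑ k, ((w k + 1 : ℕ) : ℚ) ≤ p ^ m * p ^ g)
    (hqm : q ≤ p ^ m) {h : (κ → ℚ) → ℤ_[p]}
    (hh : ∀ Q, Scalable p Q → wt w Q = q → (p : ℤ_[p]) ^ E ∣ h Q) {f : End (W R)}
    (hf : fr.IsWeightedSum d lam w q c h f) : f ∈ resI p k A R m N := by
  choose! h₁ hh₁ using hh
  set Ω := (finite_wt_le p w q g).toFinset.filter
    (fun F => 6 * Fintype.card κ * (q - wt w (scl p g F)) ≤ p ^ m) with hΩdef
  have hΩ : ∀ Q, Scalable p Q → wt w Q = q → floorAt p g Q ∈ Ω := by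
    intro Q hQ hwt; rw [hΩdef, mem_filter, Set.Finite.mem_toFinset]
    refine ⟨(wt_mono w (scl_floorAt_le g hQ)).trans hwt.le, ?_⟩; rw [← hwt, ← map_sub]
    have h1 : wt w (Q - scl p g (floorAt p g Q)) ≤ (∑ k, ((w k + 1 : ℕ) : ℚ)) / p ^ g := by
      rw [wt_apply, sum_div]; refine sum_le_sum fun k _ => ?_
      rw [← mul_one_div]; refine mul_le_mul_of_nonneg_left ?_ (Nat.cast_nonneg _)
      rw [Pi.sub_apply, sub_le_iff_le_add']; exact (lt_scl_floorAt g Q k).le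
    refine (mul_le_mul_of_nonneg_left h1 (by positivity)).trans ?_
    rw [← mul_div_assoc, div_le_iff₀ (pow_pos (p_pos p) g)]; exact hg
  let v : (κ →₀ ℕ) → (κ → ℚ) → ℤ_[p] := fun F Q => h₁ (Q + scl p g F) * Ring.inverse (wbinom Q (scl p g F))
  have hv : ∀ Q, Scalable p Q → (∀ k, Q k < p ^ (-(g : ℤ))) → ∀ F,
      wt w (Q + scl p g F) = q → v F Q * wbinom Q (scl p g F) = h₁ (Q + scl p g F) := by
    intro Q hQ hlt F _; rw [mul_assoc, Ring.inverse_mul_cancel _ (isUnit_wbinom hQ (scalable_scl g F) hlt fun k =>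
      ⟨F k, by rw [scl, zpow_neg, zpow_natCast, div_eq_mul_inv]⟩), mul_one]
  let v' : (κ →₀ ℕ) → (κ → ℚ) → ℤ_[p] := fun F Q => if ∀ k, Q k < p ^ (-(g : ℤ)) then v F Q else 0
  let z : (κ →₀ ℕ) → W R := fun F => p ^ N * (p ^ (E - N) * (c * fr.dpow d (scl p g F)))
  have hP : ∀ F ∈ Ω, ∃ P, P ∈ idealI p k A m N ∧ ∀ r x, truncate (r + 1) (jA (P.1 x)) = truncate (r + 1)
        (z F * fr.levelSum d lam w (v' F) (q - wt w (scl p g F)) r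
          (fr.tOp lam (scl p g F) (jA x))) := by
    intro F hF; rw [hΩdef, mem_filter, Set.Finite.mem_toFinset] at hF
    obtain ⟨φ, hφ, hφ'⟩ := exists_DW_levelSum (fr := fr) (v' F)
      (sub_nonneg.2 hF.1) hF.2
    have hz0 : p ^ (E - N) * (c * fr.dpow d (scl p g F)) ∈ wd p A R 0 := by
      refine p_pow_mul_mem_wd (mul_mem (wd_mono ?_ hc) (wd_mono ?_ (fr.dpow_mem_wd d (scalable_scl g F))))
      · omega
      · have := den_scl_le (p := p) g F; omega
    obtain ⟨P₁, hP₁, hP₁'⟩ := mulOp_mem_resI fr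
      (mul_mem (pow_mem (natCast_mem (wd p A R 0) p) N) hz0) (Dvd.intro _ rfl)
    obtain ⟨T, hT, hT'⟩ := tOp_mem_resDW' (fr := fr) lam (scalable_scl g F) fun l =>
      (push_le lam w (scalable_scl g F) l).trans (hF.1.trans hqm)
    refine ⟨P₁ * (⟨φ, hφ⟩ * ⟨T, hT⟩), TwoSidedIdeal.mul_mem_right _ _ _ hP₁, fun r x => ?_⟩
    refine (congrArg (truncate (r + 1)) (hP₁' (φ (T x)))).trans ?_; change truncate (r + 1) (z F * jA (φ (T x))) = _
    rw [map_mul (truncate (r + 1)) (z F), map_mul (truncate (r + 1)) (z F), hφ', hT']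
  choose! P hP hP' using hP
  have hsum : ∀ s, s ⊆ Ω → ∑ F ∈ s, P F ∈ idealI p k A m N := by
    intro s hs; induction s using Finset.induction_on with
    | empty => exact zero_mem _
    | insert F s hF ih =>
      rw [sum_insert hF]; exact add_mem (hP F (hs (mem_insert_self F s)))
        (ih ((Finset.subset_insert F s).trans hs))
  have hcoe : ∀ (s : Finset (κ →₀ ℕ)) (x : W A), jA ((∑ F ∈ s, P F).1 x) = ∑ F ∈ s, jA ((P F).1 x) := by
    intro s x; induction s using Finset.induction_on with
    | empty => exact map_zero (jA)
    | insert F s hF ih =>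
      rw [sum_insert hF, sum_insert hF, ← ih]; exact map_add (jA) _ _
  refine mem_resI.2 ⟨∑ F ∈ Ω, P F, hsum Ω subset_rfl, fun x => eq_of_truncate_succ fun e => ?_⟩
  refine truncate_of_le (Nat.succ_le_succ (le_max_left e g)) ?_
  have h1 : fr.levelSum d lam w h q (max e g) (jA x) = p ^ E * fr.levelSum d lam w h₁ q (max e g) (jA x) := by
    rw [levelSum, levelSum, mul_sum]; refine sum_congr rfl fun K hK => ?_
    rw [hh₁ _ (scalable_scl _ K) (mem_lvl.1 hK), map_mul (zp p R), map_pow, map_natCast, mul_assoc]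
  rw [hf, h1, levelSum_eq_sum (le_max_right e g) hv hΩ, hcoe, map_sum, mul_sum, mul_sum, map_sum]
  refine sum_congr rfl fun F hF => ?_
  rw [hP' F hF]
  congr 1
  have h2 : p ^ E = p ^ N * (p : W R) ^ (E - N) := by rw [← pow_add, Nat.add_sub_cancel' (by omega)]
  rw [h2]
  ring

set_option maxHeartbeats 400000 in
theorem gen_mem_low_sup_resI (N : ℕ) {Θ : Curve}
    (h0 : ∀ x, constantCoeff (Θ x) = x) (hΘ : fr.IsPoly Θ) {q : ℚ}
    (hqm : q ≤ (p : ℚ) ^ m) {c : W R} (hc : c ∈ wd p A R (den p (cst q))) :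
    fr.gen Θ q c ∈ fr.low m ⊔ resI p k A R m N := by
  obtain ⟨M, d, hd⟩ := fr.exists_truncate_gen h0 hΘ
  set w : Fin n × Fin M → ℕ := fun z => (z.2 : ℕ)
  set δ := den p fun _ => q with hδ
  set V : ℚ := ∑ k, ((w k + 1 : ℕ) : ℚ) with hW
  have hW0 : 0 ≤ V := Finset.sum_nonneg fun _ _ => Nat.cast_nonneg _
  have hp0 := p_pos p
  have hp1 : (1 : ℚ) < p := Nat.one_lt_cast.2 (Fact.out : p.Prime).one_lt
  obtain ⟨g, hg⟩ : ∃ g, 6 * Fintype.card (Fin n × Fin M) * V ≤ p ^ m * p ^ g := by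
    obtain ⟨g, hg⟩ := pow_unbounded_of_one_lt (6 * Fintype.card (Fin n × Fin M) * V / p ^ m) hp1; refine ⟨g, ?_⟩
    rw [div_lt_iff₀' (zpow_pos hp0 m)] at hg; exact hg.le
  obtain ⟨g₀, hg₀⟩ := pow_unbounded_of_one_lt (V * p ^ max N δ) hp1
  obtain ⟨t, ht, htE⟩ := exists_combination_upperBinom
    {Q : Fin n × Fin M → ℚ | Scalable p Q ∧ wt w Q = q} (fun Q hQ => hQ.1)
    (fun g => (finite_wt_le p w q g).subset (by
      rintro _ ⟨Q, hQ, rfl⟩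
      exact (wt_mono w (scl_floorAt_le g hQ.1)).trans hQ.2.le)) g₀ (N + δ + g)
  have hgen : fr.IsWeightedSum d Prod.fst w q c 1 (fr.gen Θ q c) := fun r x => hd r q c x
  have key : ∃ f ∈ fr.low m ⊔ resI p k A R m N, fr.IsWeightedSum d Prod.fst w q c t f := by
    clear htE
    induction ht using closure_induction with
    | zero => exact ⟨0, zero_mem _, .zero⟩
    | add t t' _ _ h h' =>
      obtain ⟨f, h1, h2⟩ := h; obtain ⟨f', h1', h2'⟩ := h'; exact ⟨f + f', add_mem h1 h1', h2.add h2'⟩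
    | neg t _ h =>
      obtain ⟨f, h1, h2⟩ := h; exact ⟨-f, neg_mem h1, h2.neg⟩
    | mem t ht =>
      obtain ⟨g, hg, Q, ⟨hQ, hwt⟩, a, rfl⟩ := ht; set B := scl p g (floorAt p g Q)
      have hB : Scalable p B := scalable_scl _ _; have hle := scl_floorAt_le g hQ
      have hBq := (wt_mono w hle).trans hwt.le; have hBm : ∀ l, push Prod.fst B l ≤ p ^ m := fun l =>
        (push_le Prod.fst w hB l).trans (hBq.trans hqm)
      refine ⟨_, ?_, isWeightedSum_upperBinom hd hB a⟩; have hν := mul_mem (zp_mem_wd _ a) (fr.dpow_mem_wd d hB)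
      rcases hBq.eq_or_lt with heq | hlt
      · refine AddSubgroup.mem_sup_left ?_; have h1 : fr.gen Θ (q - wt w B) (c * (zp p R a * fr.dpow d B)) =
            mulOp p R (c * (zp p R a * fr.dpow d B)) := by
          have h2 : (fun _ : Unit => q - wt w B) = 0 := funext fun _ => by rw [heq, sub_self]; rfl
          refine AddMonoidHom.ext fun z => ?_
          refine (fr.gen_apply _ _ _ _).trans ?_; rw [h2, fr.wop_zero Θ h0]
          rfl
        rw [h1]; refine tOp_mem_low _ hB hBm (mul_mem (wd_mono ?_ hc) hν); have := den_le_of_wt_eq w hB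
        rwa [heq] at this
      · refine AddSubgroup.mem_sup_right ?_; have hsub : q - wt w B = wt w (Q - B) := by rw [map_sub, hwt]
        have hεs : Scalable p fun _ : Unit => q - wt w B := by
          obtain ⟨K, hK⟩ := hQ.exists_isScaled (le_max_right g (den p Q))
          obtain ⟨J, hJ⟩ := hB.exists_isScaled ((den_scl_le g (floorAt p g Q)).trans (le_max_left g (den p Q)))
          refine ⟨max g (den p Q), single () (∑ k, (w k + 1) * (K - J) k), fun _ => ?_⟩
          rw [single_eq_same, hsub, (hK.sub hJ ((hK.le_iff hJ).2 hle)).eq_scl, wt_scl, div_mul_cancel₀ _ (p_pow_ne_zero _)]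
        refine gen_mul_mem_resI h0 hc (fun ν hν => low_le_resDW
            (tOp_mem_low _ hB hBm hν)) (fun hlt ν hν =>
          mulOp_mul_tOp_mem_resI' _ hB hBm (by omega) hν) hεs (sub_pos.2 hlt) ?_ ?_ hν
        · exact (sub_le_self _ ((Finset.sum_nonneg fun k _ =>
            mul_nonneg (Nat.cast_nonneg _) (hB.nonneg k)))).trans hqm
        · have hpg := pow_pos hp0 g; have h3 : q - wt w B ≤ V / p ^ g := by
            rw [hsub, wt_apply, hW, sum_div]; refine sum_le_sum fun k _ => ?_
            rw [← mul_one_div]; refine mul_le_mul_of_nonneg_left ?_ (Nat.cast_nonneg _)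
            rw [Pi.sub_apply, sub_le_iff_le_add']; exact (lt_scl_floorAt g Q k).le
          refine h3.trans_lt ?_; rw [div_lt_div_iff₀ hpg (pow_pos hp0 _), one_mul]
          exact hg₀.trans_le (pow_le_pow_right₀ hp1.le hg)
  obtain ⟨f, hf, hf'⟩ := key
  have h2 := (hgen.add hf'.neg).mem_resI_of_dvd hc le_rfl hg hqm fun Q hQ hwt => by
    rw [Pi.add_apply, Pi.neg_apply, ← sub_eq_add_neg]; exact htE Q ⟨hQ, hwt⟩
  have h3 := add_mem (AddSubgroup.mem_sup_right h2) hf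
  rwa [neg_add_cancel_right] at h3

end

section

open WittFrame MvPowerSeries

theorem exists_finsupp_of_mem_low {f : End (W R)} (hf : f ∈ fr.low m) :
    ∃ c : (Fin n → ℚ) →₀ W R, (∀ Q ∈ c.support, Scalable p Q ∧ ∀ l, Q l ≤ p ^ m) ∧
      (∀ Q, c Q ∈ wd p A R (den p Q)) ∧ f = c.sum fun Q z => mulOp p R z * fr.tOp id Q := by
  induction hf using closure_induction with
  | mem f hf =>
    obtain ⟨Q, hQ, hm, c, hc, rfl⟩ := hf; refine ⟨single Q c, fun Q' hQ' => ?_, fun Q' => ?_, ?_⟩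
    · rw [Finset.mem_singleton.1 (Finsupp.support_single_subset hQ')]; exact ⟨hQ, hm⟩
    · by_cases h : Q = Q'
      · subst h; rwa [single_eq_same]
      · simp [*]
    · simp
  | zero => exact ⟨0, by simp, fun _ => zero_mem _, by rw [Finsupp.sum_zero_index]⟩
  | add f f' _ _ h h' =>
    obtain ⟨c, h1, h2, rfl⟩ := h; obtain ⟨c', h1', h2', rfl⟩ := h'
    refine ⟨c + c', fun Q hQ => ?_, fun Q => add_mem (h2 Q) (h2' Q), ?_⟩
    · rcases Finset.mem_union.1 (Finsupp.support_add hQ) with h | h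
      exacts [h1 Q h, h1' Q h]
    · rw [Finsupp.sum_add_index' (fun Q => by rw [map_zero, zero_mul])
        fun Q z z' => by rw [map_add, add_mul]]
  | neg f _ h =>
    obtain ⟨c, h1, h2, rfl⟩ := h
    refine ⟨-c, fun Q hQ => h1 Q (by rwa [Finsupp.support_neg] at hQ), fun Q => neg_mem (h2 Q), ?_⟩
    rw [Finsupp.sum_neg_index (fun Q => by rw [map_zero, zero_mul]), Finsupp.sum, Finsupp.sum,
      ← Finset.sum_neg_distrib]
    exact sum_congr rfl fun Q _ => by rw [map_neg]; rfl

theorem low_mem_good {f : End (W R)} (hf : f ∈ fr.low m)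
    (hN : ∀ x, (p : W R) ^ N ∣ f (jA x)) : f ∈ fr.good m N := by
  obtain ⟨c, h1, h2, rfl⟩ := exists_finsupp_of_mem_low hf
  refine sum_mem fun Q hQ => mulOp_mul_tOp_mem_good (h1 Q hQ).1 (h1 Q hQ).2 ⟨h2 Q, ?_⟩
  have h3 := dvd_of_sum_tOp (fun Q hQ => (h1 Q hQ).1)
    (Set.injOn_id _) (fun x => by
      have := hN x; rw [Finsupp.sum] at this
      rw [end_sum_apply c.support (fun Q => mulOp p R (c Q) * fr.tOp id Q) (jA x)] at this
      exact this) hQ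
  rcases le_total N (den p Q) with h | h
  · simp [*]
  · obtain ⟨z, hz⟩ := h3; refine ⟨z, p_pow_mul_cancel (den p Q) ?_⟩
    rw [← mul_assoc, ← pow_add, Nat.add_sub_cancel' h]; exact hz

variable (fr) in
/-- The version of `good` for operators on `W(A)`. -/
def goodDW (m : ℤ) (N₁ : ℕ) : AddSubgroup (DW p k A m) where
  carrier := {f | ∀ N₂ N, ∀ (P : DW p k A m), ∀ g ∈ fr.normal m N₂, IsRes P.1 g →
    ∃ g' ∈ fr.normal m (max N₁ N₂), ∃ P' ∈ idealI p k A m N, IsRes (f * P - P').1 g'}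
  zero_mem' := fun N₂ N P g _ _ => ⟨0, zero_mem _, 0, zero_mem _, by
    rw [zero_mul, sub_zero]; exact isRes_zero⟩
  add_mem' := fun {f f'} h h' N₂ N P g hg hP => by
    obtain ⟨g₁, h1, P₁, h2, h3⟩ := h N₂ N P g hg hP; obtain ⟨g₂, h1', P₂, h2', h3'⟩ := h' N₂ N P g hg hP
    refine ⟨g₁ + g₂, add_mem h1 h1', P₁ + P₂, add_mem h2 h2', ?_⟩; have := h3.add h3'
    rwa [← AddMemClass.coe_add, sub_add_sub_comm, ← add_mul] at this
  neg_mem' := fun {f} h N₂ N P g hg hP => by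
    obtain ⟨g₁, h1, P₁, h2, h3⟩ := h N₂ N P g hg hP; refine ⟨-g₁, neg_mem h1, -P₁, neg_mem h2, ?_⟩; have := h3.neg
    rwa [← NegMemClass.coe_neg, neg_sub', ← neg_mul] at this

theorem mul_mem_goodDW {N₁ N₂ : ℕ} {f f' : DW p k A m} (h : f ∈ fr.goodDW m N₁)
    (h' : f' ∈ fr.goodDW m N₂) : f * f' ∈ fr.goodDW m (max N₁ N₂) := by
  intro N₃ N P g hg hP
  obtain ⟨g₁, h1, P₁, h2, h3⟩ := h' N₃ N P g hg hP
  obtain ⟨g₂, h1', P₂, h2', h3'⟩ := h _ N _ g₁ h1 h3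
  refine ⟨g₂, by rwa [max_assoc], f * P₁ + P₂, add_mem (TwoSidedIdeal.mul_mem_left _ _ _ h2) h2', ?_⟩
  rwa [mul_sub, ← mul_assoc, sub_sub] at h3'

theorem goodDW_of_isRes {N₁ : ℕ} {f : DW p k A m} {g₀ : End (W R)}
    (h : IsRes f.1 g₀) (hg₀ : g₀ ∈ fr.good m N₁) : f ∈ fr.goodDW m N₁ := by
  intro N₂ N P g hg hP
  obtain ⟨g', hg', e, ⟨P', hP', he⟩, h1⟩ := AddSubgroup.mem_sup.1 (hg₀.2 N₂ N g hg)
  refine ⟨g', hg', P', hP', ?_⟩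
  have h2 := (h.mul hP).add he.neg
  rw [← h1, add_neg_cancel_right] at h2
  rw [sub_eq_add_neg]
  exact h2

theorem goodDW_of_approx {N₁ : ℕ} {f : DW p k A m}
    (h : ∀ N, ∃ f' ∈ fr.goodDW m N₁, f - f' ∈ idealI p k A m N) : f ∈ fr.goodDW m N₁ := by
  intro N₂ N P g hg hP
  obtain ⟨f', hf', hd⟩ := h N
  obtain ⟨g', h1, P', h2, h3⟩ := hf' N₂ N P g hg hP
  refine ⟨g', h1, P' + (f - f') * P, add_mem h2 (TwoSidedIdeal.mul_mem_right _ _ _ hd), ?_⟩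
  convert h3 using 2
  rw [sub_mul]
  abel

theorem sub_mem_EW {φ ψ : End (W A)} (hφ : φ ∈ EW p k A m) {g : End (W R)}
    (hg : g ∈ fr.elem m fr.IsPoly) (hψ : IsRes ψ g) : φ - ψ ∈ EW p k A m := by
  refine mem_EW_of_approx (fr := fr) fun N => ?_
  obtain ⟨g', h1, h2⟩ := exists_approx_of_mem_EW (fr := fr) hφ N
  refine ⟨g' - g, elem_mono (fun _ _ => trivial) (sub_mem h1 hg), fun x => ?_⟩
  change truncate N (jA (φ x - ψ x)) = truncate N (g' (jA x) - g (jA x))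
  rw [map_sub, map_sub, map_sub, h2, hψ]

theorem elem_le_low_sup_resI (N : ℕ) {g : End (W R)} (hg : g ∈ fr.elem m fr.IsPoly) :
    g ∈ fr.low m ⊔ resI p k A R m N := by
  induction hg using closure_induction with
  | mem g hg =>
    obtain ⟨Θ, h0, hΘ, q, -, hqm, c, hc, rfl⟩ := hg; exact gen_mem_low_sup_resI N h0 hΘ hqm hc
  | zero => exact zero_mem _
  | add g g' _ _ h h' => exact add_mem h h'
  | neg g _ h => exact neg_mem h

theorem idealI_anti {M N : ℕ} (h : M ≤ N) : idealI p k A m N ≤ idealI p k A m M := by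
  have hf : filV p A N ≤ filV p A M := fun x hx => by
    rw [filV, mem_ker_truncate] at hx ⊢; exact fun i hi => hx i (hi.trans_le h)
  refine TwoSidedIdeal.span_le.2 ?_
  rintro P (⟨a, ha, h⟩ | ⟨h, h'⟩)
  · exact subset_span (Or.inl ⟨a, hf ha, h⟩)
  · exact subset_span (Or.inr ⟨h, fun x => hf (h' x)⟩)

theorem exists_low_approx (N : ℕ) {f : DW p k A m} (hf : f.1 ∈ EW p k A m) :
    ∃ f', ∃ g ∈ fr.low m, IsRes f'.1 g ∧ f - f' ∈ idealI p k A m N := by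
  obtain ⟨g, hg, hfg⟩ := exists_approx_of_mem_EW (fr := fr) hf N
  obtain ⟨ψ, hψ, hψg⟩ : ∃ ψ : DW p k A m, ψ.1 ∈ EW p k A m ∧ IsRes ψ.1 g := by
    obtain ⟨ψ, hψ, hψg⟩ := mem_resDW_of_approx fun e => ⟨g, elem_mono (fun _ _ => trivial) hg, fun _ => rfl⟩
    exact ⟨⟨ψ, Subring.subset_closure (Or.inr hψ)⟩, hψ, hψg⟩
  have h0 := elem_le_low_sup_resI N hg
  rw [AddSubgroup.mem_sup] at h0
  obtain ⟨l, hl, e, he, h1⟩ := h0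
  rw [mem_resI] at he
  obtain ⟨P', hP', he⟩ := he
  refine ⟨ψ - P', l, hl, ?_, ?_⟩
  · have h2 := hψg.add he.neg; rw [← h1, add_neg_cancel_right, ← sub_eq_add_neg] at h2; exact h2
  · have h2 : f - ψ ∈ idealI p k A m N := by
      refine subset_span (Or.inr ⟨sub_mem_EW hf hg hψg, fun x => ?_⟩)
      rw [mem_filV_iff_dvd fr.inj]; have h3 : (f - ψ).1 x = f.1 x - ψ.1 x := rfl; rw [h3, map_sub, hψg]
      exact truncate_eq_iff.1 (hfg x)
    rw [← sub_add]; exact add_mem h2 hP'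

theorem EW_mem_goodDW {N₁ : ℕ} {f : DW p k A m} (hf : f.1 ∈ EW p k A m)
    (hN : ∀ x, f.1 x ∈ filV p A N₁) : f ∈ fr.goodDW m N₁ := by
  refine goodDW_of_approx fun N => ?_
  obtain ⟨f', g, hg, hfg, h1⟩ := exists_low_approx (fr := fr) (max N N₁) hf
  refine ⟨f', goodDW_of_isRes hfg (low_mem_good hg fun x => ?_), idealI_anti (le_max_left N N₁) h1⟩
  have h2 : f'.1 x ∈ filV p A N₁ := by
    have h3 := idealI_apply_mem p k A m N₁ _ (idealI_anti (le_max_right N N₁) h1) x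
    have h4 : (f - f').1 x = f.1 x - f'.1 x := rfl; rw [h4] at h3; have h5 := sub_mem (hN x) h3
    rwa [sub_sub_cancel] at h5
  rw [← hfg]
  exact (mem_filV_iff_dvd fr.inj).1 h2

theorem mulOp_mem_goodDW {f : DW p k A m} {a : W A} (ha : a ∈ filV p A N)
    (h : f.1 = mulOp p A a) : f ∈ fr.goodDW m N := by
  refine goodDW_of_isRes (g₀ := mulOp p R (jA a)) ?_
    (mulOp_mem_good ⟨j_mem_wd 0 a, (mem_filV_iff_dvd fr.inj).1 ha⟩)
  rw [h]
  exact isRes_mulOp a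

theorem mem_goodDW (f : DW p k A m) : f ∈ fr.goodDW m 0 := by
  suffices h : ∀ g, ∀ hg : g ∈ DW p k A m, ∀ f, f.1 = g → f ∈ fr.goodDW m 0 from
    h f.1 f.2 f rfl
  intro g hg
  have h0 : ∀ a, a ∈ filV p A 0 := fun a => (mem_filV_iff_dvd fr.inj).2 (by rw [pow_zero]; exact one_dvd _)
  induction hg using Subring.closure_induction with
  | mem g hg =>
    rintro f rfl
    rcases hg with ⟨a, ha⟩ | hf
    · exact mulOp_mem_goodDW (h0 a) ha.symm
    · exact EW_mem_goodDW hf fun x => h0 _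
  | zero =>
    intro f hf; rw [show f = 0 from Subtype.ext hf]; exact zero_mem _
  | one =>
    intro f hf; exact mulOp_mem_goodDW (h0 1) (hf.trans (map_one _).symm)
  | add g g' hg hg' h h' =>
    intro f hf; rw [show f = ⟨g, hg⟩ + ⟨g', hg'⟩ from Subtype.ext hf]; exact add_mem (h _ rfl) (h' _ rfl)
  | neg g hg h =>
    intro f hf; rw [show f = -⟨g, hg⟩ from Subtype.ext hf]; exact neg_mem (h _ rfl)
  | mul g g' hg hg' h h' =>
    intro f hf; rw [show f = ⟨g, hg⟩ * ⟨g', hg'⟩ from Subtype.ext hf]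
    have := mul_mem_goodDW (h ⟨g, hg⟩ rfl) (h' ⟨g', hg'⟩ rfl); rwa [max_self] at this

theorem mem_goodDW_of_mem_idealI {f : DW p k A m} (hf : f ∈ idealI p k A m N) :
    f ∈ fr.goodDW m N := by
  let J : TwoSidedIdeal (DW p k A m) := TwoSidedIdeal.mk' (fr.goodDW m N) (zero_mem _) add_mem neg_mem
    (fun {P Q} hQ => by
      have := mul_mem_goodDW (mem_goodDW P) hQ; rwa [Nat.zero_max] at this)
    (fun {P Q} hP => by
      have := mul_mem_goodDW hP (mem_goodDW Q); rwa [Nat.max_zero] at this)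
  have hJ : idealI p k A m N ≤ J := by
    refine TwoSidedIdeal.span_le.2 ?_
    rintro P (⟨a, ha, h⟩ | ⟨h, h'⟩)
    · exact (TwoSidedIdeal.mem_mk' _ _ _ _ _ _ _).2 (mulOp_mem_goodDW ha h)
    · exact (TwoSidedIdeal.mem_mk' _ _ _ _ _ _ _).2 (EW_mem_goodDW h h')
  exact (TwoSidedIdeal.mem_mk' _ _ _ _ _ _ _).1 (hJ hf)

theorem exists_normal_of_mem_idealI {M : ℕ} {f : DW p k A m} (hf : f ∈ idealI p k A m M)
    (N : ℕ) : ∃ g ∈ fr.normal m M, ∃ P' ∈ idealI p k A m N, IsRes (f - P').1 g := by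
  have h1 : (1 : End (W R)) ∈ fr.normal m 0 := by
    have := term_mem_normal (fr := fr) (I := 0) scalable_zero
      (fun l => zpow_pos (p_pos p) m) (mem_coef_zero.2 (one_mem _))
    rwa [term, tOp_zero, powE_zero, map_one, one_mul, one_mul] at this
  obtain ⟨g, h2, P', h3, h4⟩ := mem_goodDW_of_mem_idealI hf 0 N 1 1 h1 isRes_one
  rw [Nat.max_zero] at h2
  rw [mul_one] at h4
  exact ⟨g, h2, P', h3, h4⟩

theorem idealI_zero (m : ℤ) (f : DW p k A m) : f ∈ idealI p k A m 0 := by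
  have h1 : (1 : DW p k A m) ∈ idealI p k A m 0 := by
    refine subset_span (Or.inl ⟨1, ?_, (map_one _).symm⟩); rw [mem_filV_iff]; exact ⟨1, rfl⟩
  have := TwoSidedIdeal.mul_mem_left _ f _ h1
  rwa [mul_one] at this

end

section

open WittFrame MvPowerSeries

/-- Indices of the terms of an expansion. -/
abbrev TermIndex (p n : ℕ) (m : ℤ) := Option (BasisIndex p n m) × (Fin n → ℕ)

variable (p n) in
/-- The exponent of a basic operator `{∂}_Q`; `none` stands for `Q = 0`. -/
def expo (o : Option (BasisIndex p n m)) : Fin n → ℚ := o.elim 0 fun i => scl p i.den (equivFunOnFinite.symm i.num)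

theorem scalable_expo (o : Option (BasisIndex p n m)) : Scalable p (expo p n o) := by
  cases o with
  | none => exact scalable_zero
  | some i => exact scalable_scl _ _

theorem expo_lt (o : Option (BasisIndex p n m)) (l : Fin n) : expo p n o l < p ^ m := by
  cases o with
  | none => exact zpow_pos (p_pos p) m
  | some i => exact i.lt l

theorem den_expo_some (i : BasisIndex p n m) : den p (expo p n (some i)) = i.den := by
  have h1 : IsScaled p i.den (expo p n (some i)) (equivFunOnFinite.symm i.num) := isScaled_scl _ _
  refine le_antisymm h1.den_le (not_lt.1 fun hlt => ?_)
  obtain ⟨K, hK⟩ := (scalable_expo (some i)).exists_isScaled (Nat.le_sub_one_of_lt hlt)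
  have h2 := hK.add_right 1
  rw [Nat.sub_add_cancel (by omega)] at h2
  rcases i.reduced with h | ⟨l, hl⟩
  · omega
  · refine hl ?_; have h3 := DFunLike.congr_fun (h1.unique h2) l; rw [Finsupp.smul_apply, pow_one, smul_eq_mul] at h3
    exact ⟨_, h3⟩

theorem expo_injective : Injective (expo p n (m := m)) := by
  have h0 : ∀ i : BasisIndex p n m, expo p n (some i) ≠ 0 := fun i h => i.ne_zero <| by
    have h1 : IsScaled p i.den (expo p n (some i)) (equivFunOnFinite.symm i.num) := isScaled_scl _ _; rw [h] at h1
    have h2 := h1.unique (J := 0) fun l => by simp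
    funext l
    exact DFunLike.congr_fun h2 l
  intro o o' h
  cases o with
  | none =>
    cases o' with
    | none => rfl
    | some i => exact absurd h.symm (h0 i)
  | some i =>
    cases o' with
    | none => exact absurd h (h0 i)
    | some i' =>
      have h2 : IsScaled p i'.den (expo p n (some i')) (equivFunOnFinite.symm i'.num) := isScaled_scl _ _
      have h3 : i.den = i'.den := by rw [← den_expo_some i, h, den_expo_some]
      rw [← h, ← h3] at h2; have h4 := equivFunOnFinite.symm.injective ((isScaled_scl _ _).unique h2)
      obtain ⟨d, u, h5, h6, h7⟩ := i; obtain ⟨d', u', h5', h6', h7'⟩ := i'; obtain rfl : d = d' := h3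
      obtain rfl : u = u' := h4
      rfl

theorem exists_expo_eq {Q : Fin n → ℚ} (hQ : Scalable p Q) (hlt : ∀ l, Q l < p ^ m) :
    ∃ o : Option (BasisIndex p n m), expo p n o = Q := by
  obtain ⟨K, hK⟩ := hQ.exists_den
  by_cases h0 : K = 0
  · refine ⟨none, ?_⟩; subst h0; rw [hK.eq_scl]
    funext l
    simp [expo, scl]
  · refine ⟨some ⟨den p Q, K, fun l => ?_, fun h => h0 (DFunLike.coe_injective h), ?_⟩, ?_⟩
    · have := hlt l; rwa [hK.eq_scl] at this
    · by_contra! h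
      obtain ⟨h1, h2⟩ := h; obtain ⟨J, hJ⟩ := IsScaled.exists_of_dvd (r := den p Q - 1)
        (by rwa [Nat.sub_add_cancel (by omega)]) fun l => by rw [pow_one]; exact h2 l
      have := hJ.den_le; omega
    · exact hK.eq_scl.symm

theorem normDen_expo_none (I : Fin n → ℕ) :
    normDen p m (expo p n (none : Option (BasisIndex p n m))) I = if I = 0 then 0 else (-m).toNat := by
  have hd : den p (expo p n (none : Option (BasisIndex p n m))) = 0 := den_zero
  rw [normDen, hd, Nat.zero_max]

theorem normDen_expo_some (i : BasisIndex p n m) (I : Fin n → ℕ) :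
    normDen p m (expo p n (some i)) I = i.den := by
  rw [normDen, den_expo_some]
  refine max_eq_left ?_
  split_ifs with hI
  · exact Nat.zero_le _
  · rcases le_total 0 m with hm | hm
    · grind
    · obtain ⟨l, hl⟩ := Function.ne_iff.1 i.ne_zero
      have h1 := (scalable_expo (some i)).lt_den_of_lt (g := (-m).toNat) (k := l) ?_ ?_
      · rw [den_expo_some] at h1; exact h1.le
      · exact div_pos (Nat.cast_pos.2 (Nat.pos_of_ne_zero hl)) (pow_pos (p_pos p) _)
      · refine (expo_lt (some i) l).trans_eq ?_
        rw [one_div, ← zpow_natCast, ← zpow_neg, Int.toNat_of_nonneg (by omega), neg_neg]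

include fr in
theorem IsRes.ext {f f' : End (W A)} {g : End (W R)} (h : IsRes f g)
    (h' : IsRes f' g) : f = f' :=
  AddMonoidHom.ext fun x => fr.j_injective ((h x).trans (h' x).symm)

include fr in
theorem dvd_j_frob_iff {d N : ℕ} {a : W A} :
    frob p R (-d) (jA a) ∈ coef p A R N d ↔ a ∈ filV p A (N - d) := by
  rw [mem_coef, p_pow_dvd_frob_iff, mem_filV_iff_dvd fr.inj]
  exact and_iff_right (frob_neg_j_mem_wd d a)

section

theorem term_add (m : ℤ) (Q : Fin n → ℚ) (I : Fin n → ℕ) (z z' : W R) :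
    fr.term m Q I z + fr.term m Q I z' = fr.term m Q I (z + z') := by
  rw [term, term, term, map_add, add_mul]

theorem exists_basisOp (m : ℤ) (x : TermIndex p n m) (a : W A) :
    ∃ P : DW p k A m, IsRes P.1 (fr.term m (expo p n x.1) x.2
      (frob p R (-normDen p m (expo p n x.1) x.2) (jA a))) := by
  obtain ⟨P, -, h⟩ := mem_resI.1 (term_mem_resI (fr := fr)
    (scalable_expo x.1) (expo_lt x.1) (mem_coef_zero.2 (frob_neg_j_mem_wd _ a)))
  exact ⟨P, h⟩

variable (fr) in
/-- The operator `F^{-d}(a) {∂}_Q {∂}_{p^m}^I` on `W(A)`, where `d` is the denominator exponent. -/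
def basisOp (m : ℤ) (x : TermIndex p n m) : W A →+ DW p k A m :=
  AddMonoidHom.mk' (fun a => (exists_basisOp (fr := fr) m x a).choose) fun a b => by
    refine Subtype.ext (IsRes.ext (fr := fr) (exists_basisOp (fr := fr) m x (a + b)).choose_spec ?_)
    have h := (exists_basisOp (fr := fr) m x a).choose_spec.add
      (exists_basisOp (fr := fr) m x b).choose_spec
    rwa [term_add, ← map_add, ← map_add] at h

theorem isRes_basisOp (m : ℤ) (x : TermIndex p n m) (a : W A) :
    IsRes (fr.basisOp m x a).1 (fr.term m (expo p n x.1) x.2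
      (frob p R (-normDen p m (expo p n x.1) x.2) (jA a))) :=
  (exists_basisOp m x a).choose_spec

theorem basisOp_mem_idealI {x : TermIndex p n m} {a : W A}
    (ha : a ∈ filV p A (N - normDen p m (expo p n x.1) x.2)) :
    fr.basisOp m x a ∈ idealI p k A m N := by
  obtain ⟨P, hP, h⟩ := mem_resI.1 (term_mem_resI (fr := fr)
    (scalable_expo x.1) (expo_lt x.1) ((dvd_j_frob_iff (fr := fr)).2 ha))
  rwa [show fr.basisOp m x a = P from Subtype.ext ((isRes_basisOp m x a).ext (fr := fr) h)]

theorem exists_op (l : Fin n) (q : ℚ) :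
    ∃ P : End (W A), IsRes P (fr.tOp id (Pi.single l q)) :=
  PreservesWA.exists_isRes fr fun x => by
    obtain ⟨x', h⟩ := fr.exists_wop_j (fr.taylor id) (Pi.single l q) x; exact ⟨x', by rw [tOp_apply, h]⟩

variable (fr) in
/-- The operator `{∂_l}_q` on `W(A)`. -/
def op (l : Fin n) (q : ℚ) : End (W A) := (exists_op (fr := fr) l q).choose

theorem isRes_op (l : Fin n) (q : ℚ) : IsRes (fr.op l q) (fr.tOp id (Pi.single l q)) := (exists_op l q).choose_spec

theorem isRes_pow {f : End (W A)} {g : End (W R)} (h : IsRes f g) (i : ℕ) :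
    IsRes (f ^ i) (g ^ i) := by
  induction i with
  | zero =>
    rw [pow_zero, pow_zero]; exact isRes_one
  | succ i ih =>
    rw [pow_succ, pow_succ]; exact ih.mul h

theorem isRes_ofFn_prod {s : ℕ} {f : Fin s → End (W A)} {g : Fin s → End (W R)}
    (h : ∀ i, IsRes (f i) (g i)) : IsRes (ofFn f).prod (ofFn g).prod := by
  induction s with
  | zero =>
    rw [List.ofFn_zero, List.ofFn_zero, List.prod_nil, List.prod_nil]; exact isRes_one
  | succ s ih =>
    rw [ofFn_succ, ofFn_succ, List.prod_cons, List.prod_cons]; exact (h 0).mul (ih fun i => h _)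

theorem isRes_fracOp (i : BasisIndex p n m) :
    IsRes (fracOp p fr.op i) (fr.tOp id (expo p n (some i))) := by
  rw [← tOp_eq_prod fr id (scalable_expo (some i))]
  exact isRes_ofFn_prod fun l => isRes_op l _

theorem isRes_powOp (m : ℤ) (I : Fin n → ℕ) : IsRes (powOp p fr.op m I) (fr.powE m I) :=
  isRes_ofFn_prod fun l => isRes_pow (isRes_op l _) _

theorem exists_pow (m : ℤ) (I : Fin n → ℕ) : ∃ P : DW p k A m, P.1 = powOp p fr.op m I := by
  obtain ⟨P, h, h'⟩ := mem_resDW.1 (powE_mem_resDW (fr := fr) m I)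
  exact ⟨⟨P, h⟩, h'.ext (fr := fr) (isRes_powOp m I)⟩

variable (fr) in
/-- The operator `{∂}_{p^m}^I`. -/
def pow (m : ℤ) (I : Fin n → ℕ) : DW p k A m := (exists_pow (fr := fr) m I).choose

theorem pow_coe (m : ℤ) (I : Fin n → ℕ) : (fr.pow m I).1 = powOp p fr.op m I := (exists_pow m I).choose_spec

theorem basisOp_mul_pow (i : BasisIndex p n m) (I : Fin n → ℕ) (a : W A) :
    fr.basisOp m (some i, 0) a * fr.pow m I = fr.basisOp m (some i, I) a := by
  refine Subtype.ext (IsRes.ext (fr := fr) ?_ (isRes_basisOp m (some i, I) a))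
  have h1 := (isRes_basisOp (fr := fr) m (some i, 0) a).mul (isRes_powOp (fr := fr) m I)
  rw [← pow_coe] at h1
  rw [normDen_expo_some, term] at h1 ⊢
  rwa [powE_zero, mul_one, mul_assoc] at h1

theorem isFrobMul_basisOp (x : TermIndex p n m) (a : W A)
    {P : End (W A)} (hP : IsRes P (fr.tOp id (expo p n x.1) * fr.powE m x.2)) :
    IsFrobMul p A (normDen p m (expo p n x.1) x.2) a P (fr.basisOp m x a).1 := by
  intro y
  have h1 := dvd_of_mem_resI fr (term_mem_resI (fr := fr)
    (N := normDen p m (expo p n x.1) x.2) (scalable_expo x.1) (expo_lt x.1)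
    ⟨one_mem _, by rw [Nat.sub_self, pow_zero]⟩) y
  rw [term, map_one, one_mul, ← hP] at h1
  obtain ⟨b, h2, h3⟩ := exists_frob_neg_mul fr.inj (mem_wd_zero.2 ⟨P y, rfl⟩) h1
  refine ⟨b, fr.j_injective h3, fr.j_injective ?_⟩
  have h4 : fr.term m (expo p n x.1) x.2 (frob p R (-normDen p m (expo p n x.1) x.2) (jA a))
      (jA y) = frob p R (-normDen p m (expo p n x.1) x.2) (jA a) * jA (P y) := by
    rw [hP, term]
    rfl
  rw [isRes_basisOp, h4, h2, j_verschiebung, map_mul (jA), map_mul (frob p R _)]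
  ring

end

end

end CoordFrame

section

open MvPowerSeries

variable {R₀ B : Type*} [CommRing R₀] [CommRing B] [Algebra R₀ B] {n : ℕ} {S : Fin n → B}

theorem IsCoordinateHS.exists_algHom {d : Fin n → ℕ → Module.End R₀ B} (hd : IsCoordinateHS R₀ S d)
    (l : Fin n) : ∃ Θ : B →ₐ[R₀] MvPowerSeries Unit B, (∀ x, constantCoeff (Θ x) = x) ∧
      ∀ x K, coeff K (Θ x) = d l (K ()) x := by
  refine ⟨AlgHom.ofLinearMap
    { toFun := fun x K => d l (K ()) x
      map_add' := fun x y => funext fun K => map_add _ _ _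
      map_smul' := fun c x => funext fun K => map_smul _ _ _ } ?_ fun x y => ?_, fun x => ?_,
    fun x K => rfl⟩
  · have h1 : ∀ i, d l i 1 = if i = 0 then 1 else 0 := fun i => by
      have := hd.2.1 l i 0; rw [pow_zero] at this; rw [this, Nat.zero_sub, pow_zero, mul_one]
      split_ifs with h
      · rw [h, Nat.choose_self, Nat.cast_one]
      · rw [choose_eq_zero_of_lt (Nat.pos_of_ne_zero h), cast_zero]
    refine MvPowerSeries.ext fun K => ?_
    rw [coeff_one]; refine (h1 (K ())).trans ?_
    refine if_congr ⟨fun h => Finsupp.ext fun _ => h, fun h => by rw [h]; rfl⟩ rfl rfl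
  · refine MvPowerSeries.ext fun K => ?_
    obtain ⟨t, rfl⟩ : ∃ t, K = single () t := ⟨K (), Finsupp.unique_single K⟩
    rw [coeff_mul, CoordFrame.antidiagonal_unit t fun a b => coeff a _ * coeff b _]
    refine ((hd.1 l).2 (single () t ()) le_top x y).trans ?_; rw [single_eq_same]; refine sum_congr rfl fun ij _ => ?_
    change _ = d l (single () ij.1 ()) x * d l (single () ij.2 ()) y; rw [single_eq_same, single_eq_same]
  · change d l 0 x = x; rw [(hd.1 l).1]
    rfl

theorem IsCoordinateHS.unique (hS : IsEtaleCoordinates R₀ S) {d d' : Fin n → ℕ → Module.End R₀ B}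
    (hd : IsCoordinateHS R₀ S d) (hd' : IsCoordinateHS R₀ S d') : d = d' := by
  funext l i
  obtain ⟨Θ, h0, h1⟩ := hd.exists_algHom l
  obtain ⟨Θ', h0', h1'⟩ := hd'.exists_algHom l
  have h2 : Θ = Θ' := by
    refine hS.hasseSchmidt_ext _ _ h0 h0' fun l' => MvPowerSeries.ext fun K => ?_
    rw [h1, h1']; by_cases hl : l' = l
    · subst hl; have h4 := hd.2.1 l' (K ()) 1; have h5 := hd'.2.1 l' (K ()) 1; rw [pow_one] at h4 h5; rw [h4, h5]
    · rcases Nat.eq_zero_or_pos (K ()) with h | h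
      · rw [h, (hd.1 l).1, (hd'.1 l).1]
      · have h4 := hd.2.2 l l' (K ()) 1 hl h; have h5 := hd'.2.2 l l' (K ()) 1 hl h; rw [pow_one] at h4 h5
        rw [h4, h5]
  refine LinearMap.ext fun x => ?_
  have h3 := h1 x (single () i)
  rw [h2, h1', single_eq_same] at h3
  exact h3.symm

end

section

namespace CoordFrame

open WittFrame MvPowerSeries

variable (fr) in
/-- The operators `∂_l^{[i]}` on the lift. -/
def del (l : Fin n) (i : ℕ) : Module.End (W k) L := hsCoeff (fr.taylor (cst l)) (single () i)

theorem del_eq (l : Fin n) (i : ℕ) : fr.del l i = hsCoeff (fr.taylor id) (single l i) :=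
  (fr.isTaylor fun _ => l).hsCoeff_single_eq fr.etale (fr.isTaylor id) rfl i

theorem isCoordinateHS_del : IsCoordinateHS (W k) fr.S fr.del := by
  have h : ∀ l l' i j, fr.del l i (fr.S l' ^ j) = ((j.choose (single l i l') : L) * fr.S l' ^ (j - single l i l')) *
        ∏ l'' ∈ Finset.univ.erase l', ((0 : ℕ).choose (single l i l'') : L) := by
    intro l l' i j; have h1 := (fr.isTaylor id).hsCoeff_prod_pow (single l i) (Pi.single l' j)
    rw [← mul_prod_erase _ _ (mem_univ l'), ← mul_prod_erase _ _ (mem_univ l'), Pi.single_eq_same,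
      prod_congr rfl (g := fun _ => (1 : L)) fun x hx => by
        rw [Pi.single_eq_of_ne (ne_of_mem_erase hx), pow_zero], Finset.prod_const_one,
      mul_one] at h1
    rw [del_eq, h1]; refine congrArg _ (prod_congr rfl fun x hx => ?_)
    rw [Pi.single_eq_of_ne (ne_of_mem_erase hx), Nat.zero_sub, pow_zero, mul_one]
  refine ⟨fun l => isHasseSchmidt_hsCoeff _ (fr.isTaylor fun _ => l).1, fun l i j => ?_, fun l l' i j hl hi => ?_⟩
  · rw [h, single_eq_same, prod_eq_one, mul_one]; intro x hx
    rw [Finsupp.single_eq_of_ne (ne_of_mem_erase hx), Nat.choose_self, Nat.cast_one]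
  · rw [h, prod_eq_zero (mem_erase.2 ⟨hl.symm, mem_univ l⟩), mul_zero]
    rw [single_eq_same, choose_eq_zero_of_lt hi, cast_zero]

theorem isWittHasse_op {D : Fin n → ℕ → Module.End k A}
    (hD : ∀ l i y, D l i (fr.π y) = fr.π (fr.del l i y)) (l : Fin n) (q : ℚ) :
    IsWittHasse p k A (D l) q (fr.op l q) := by
  intro r
  have hop : IsRes (fr.op l q) (fr.tOp (cst l) fun _ => q) := by
    have h := isRes_op (fr := fr) l q; rwa [fr.tOp_single_unit id l q] at h
  obtain ⟨E, hE⟩ := exists_truncEnd (fr.op l q) fun x hx => hop.map_filV fr hx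
  refine ⟨E, fun x => (hE x).symm, fun i hi => ?_, fun hi => ?_⟩
  · refine isCanonicalLift_wop fr (fr.isTaylor fun _ => l).1 hi ⊤ (hD l) fun x x' h => ?_
    rw [hE, fr.j_injective ((hop x).trans h.symm)]
  · refine AddMonoidHom.ext fun x => ?_
    obtain ⟨x, rfl⟩ := truncate_surjective p (r + 1) A x; rw [hE]; refine (mem_filV_iff_dvd fr.inj).2 ?_; rw [hop]
    refine fr.wop_j_dvd _ ?_ x
    rintro ⟨K, hK⟩
    exact hi ⟨K (), hK ()⟩

theorem exists_isCoordinateHS {T : Fin n → A} (hT : ∀ l, fr.π (fr.S l) = T l) :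
    ∃ D, IsCoordinateHS k T D ∧ ∀ l i y, D l i (fr.π y) = fr.π (fr.del l i y) := by
  choose D hD hD' using fun l => exists_reduction fr (fr.isTaylor fun _ => l).1
  replace hD' : ∀ l i y, D l i (fr.π y) = fr.π (fr.del l i y) := hD'
  refine ⟨D, ⟨hD, fun l i j => ?_, fun l l' i j hl hi => ?_⟩, hD'⟩
  · rw [← hT, ← map_pow, hD', (isCoordinateHS_del).2.1, map_mul, map_natCast, map_pow]
  · rw [← hT, ← map_pow, hD', (isCoordinateHS_del).2.2 l l' i j hl hi, map_zero]

theorem isBasicOperators {T : Fin n → A} (hT : ∀ l, fr.π (fr.S l) = T l) (m : ℤ) :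
    IsBasicOperators p k T m fr.op (fun i => fr.basisOp m (some i, 0)) (fr.pow m)
      (fun I => fr.basisOp m (none, I)) where
  op_spec := by
    obtain ⟨D, hD, hD'⟩ := exists_isCoordinateHS hT; exact ⟨D, hD, isWittHasse_op hD'⟩
  frac_spec i a := by
    have h := isFrobMul_basisOp (fr := fr) (some i, 0) a
      (by rw [powE_zero, mul_one]; exact isRes_fracOp i)
    rwa [normDen_expo_some] at h
  pow_spec := pow_coe m
  head_spec I a := by
    have h := isFrobMul_basisOp (none, I) a
      (by
        rw [show fr.tOp id (expo p n (none : Option (BasisIndex p n m))) = 1 from tOp_zero fr id, one_mul]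
        exact isRes_powOp m I)
    rwa [normDen_expo_none] at h

end CoordFrame

end

section

theorem mk_eq_mk_iff {r : ℕ} {P Q : DW p k A m} :
    (idealI p k A m r).ringCon.mk' P = (idealI p k A m r).ringCon.mk' Q ↔ P - Q ∈ idealI p k A m r := by
  rw [← sub_eq_zero, ← map_sub, ← TwoSidedIdeal.mem_ker, ker_ringCon_mk']

theorem mk_eq_zero_iff {r : ℕ} {P : DW p k A m} :
    (idealI p k A m r).ringCon.mk' P = 0 ↔ P ∈ idealI p k A m r := by
  rw [← TwoSidedIdeal.mem_ker, ker_ringCon_mk']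

theorem DHat.tendsto_iff {ι : Type*} {l : Filter ι} {f : ι → DHat p k A m}
    {g : DHat p k A m} : Tendsto f l (𝓝 g) ↔ ∀ N, ∀ᶠ i in l, (f i).1 N = g.1 N := by
  let _ : ∀ r, TopologicalSpace (idealI p k A m r).ringCon.Quotient := fun _ => ⊥
  have : ∀ r, DiscreteTopology (idealI p k A m r).ringCon.Quotient := fun _ => ⟨rfl⟩
  have h : IsInducing fun f : DHat p k A m => (f : ∀ r, (idealI p k A m r).ringCon.Quotient) := ⟨rfl⟩
  rw [h.tendsto_nhds_iff, tendsto_pi_nhds]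
  refine forall_congr' fun N => ?_
  rw [nhds_discrete, tendsto_pure]
  rfl

theorem DHat.coe_sum {ι : Type*} (s : Finset ι) (f : ι → DHat p k A m) (N : ℕ) :
    (∑ i ∈ s, f i).1 N = ∑ i ∈ s, (f i).1 N := map_sum (DHat.proj p k A m N) f s

theorem DHat.hasSum_of_iff {ι : Type*} {f : ι → DW p k A m} {g : DHat p k A m} :
    HasSum (fun i => DHat.of p k A m (f i)) g ↔ ∀ N, ∀ᶠ s in atTop,
      (idealI p k A m N).ringCon.mk' (∑ i ∈ s, f i) = g.1 N := by
  rw [HasSum, SummationFilter.unconditional_filter, DHat.tendsto_iff]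
  refine forall_congr' fun N => eventually_congr (Eventually.of_forall fun s => ?_)
  rw [← map_sum]
  rfl

theorem DHat.exists_hasSum {ι : Type*} {f : ι → DW p k A m} {X : ℕ → Finset ι}
    (hX : ∀ N, ∀ i ∉ X N, f i ∈ idealI p k A m N) :
    ∃ g, HasSum (fun i => DHat.of p k A m (f i)) g ∧
      ∀ N s, X N ⊆ s → g.1 N = (idealI p k A m N).ringCon.mk' (∑ i ∈ s, f i) := by
  classical
  have h : ∀ N s, X N ⊆ s → (idealI p k A m N).ringCon.mk' (∑ i ∈ X N, f i) =
      (idealI p k A m N).ringCon.mk' (∑ i ∈ s, f i) := by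
    intro N s hs; rw [map_sum, map_sum]; exact Finset.sum_subset hs fun i _ hi => mk_eq_zero_iff.2 (hX N i hi)
  refine ⟨⟨fun N => (idealI p k A m N).ringCon.mk' (∑ i ∈ X N, f i), fun r =>
    ⟨∑ i ∈ (Finset.range (r + 1)).biUnion X, f i, fun s hs => h s _
      (Finset.subset_biUnion_of_mem X (Finset.mem_range_succ_iff.2 hs))⟩⟩, ?_, h⟩
  refine DHat.hasSum_of_iff.2 fun N => ?_
  filter_upwards [eventually_ge_atTop (X N)] with s hs
  exact (h N s hs).symm

theorem DHat.exists_coe_eq (Q : DHat p k A m) (N : ℕ) :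
    ∃ P, Q.1 N = (idealI p k A m N).ringCon.mk' P := by
  obtain ⟨P, h⟩ := Q.2 N
  exact ⟨P, h N le_rfl⟩

namespace CoordFrame

open WittFrame MvPowerSeries

variable (fr) in
/-- Finite sums of basic operators. -/
def basisSum (m : ℤ) : (TermIndex p n m →₀ W A) →+ DW p k A m := Finsupp.liftAddHom fun x => fr.basisOp m x

theorem basisSum_single (x : TermIndex p n m) (a : W A) :
    fr.basisSum m (single x a) = fr.basisOp m x a :=
  Finsupp.liftAddHom_apply_single _ x a

theorem basisSum_eq {c : TermIndex p n m →₀ W A}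
    {s : Finset (TermIndex p n m)} (hs : c.support ⊆ s) :
    fr.basisSum m c = ∑ x ∈ s, fr.basisOp m x (c x) := by
  rw [basisSum, Finsupp.liftAddHom_apply]
  exact Finsupp.sum_of_support_subset _ hs _ fun x _ => map_zero _

theorem exists_basisSum_of_normal {M : ℕ} {g : End (W R)} (hg : g ∈ fr.normal m M) :
    ∃ c, (∀ x, c x ∈ filV p A (M - normDen p m (expo p n x.1) x.2)) ∧ IsRes (fr.basisSum m c).1 g := by
  induction hg using closure_induction with
  | mem g hg =>
    obtain ⟨Q, I, hQ, hlt, z, hz, rfl⟩ := hg; obtain ⟨o, rfl⟩ := exists_expo_eq hQ hlt; obtain ⟨a, ha⟩ := hz.1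
    have hz' : z = frob p R (-normDen p m (expo p n o) I) (jA a) := by
      rw [ha]; exact (frob_neg_frob _ _).symm
    refine ⟨single (o, I) a, fun x => ?_, ?_⟩
    · by_cases h : (o, I) = x
      · subst h; rw [single_eq_same]; rw [hz'] at hz; exact (dvd_j_frob_iff (fr := fr)).1 hz
      · simp [*]
    · rw [basisSum_single, hz']; exact isRes_basisOp m (o, I) a
  | zero => exact ⟨0, fun _ => zero_mem _, by rw [map_zero]; exact isRes_zero⟩
  | add g g' _ _ h h' =>
    obtain ⟨c, h1, h2⟩ := h; obtain ⟨c', h1', h2'⟩ := h'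
    exact ⟨c + c', fun x => add_mem (h1 x) (h1' x), by rw [map_add]; exact h2.add h2'⟩
  | neg g _ h =>
    obtain ⟨c, h1, h2⟩ := h; exact ⟨-c, fun x => neg_mem (h1 x), by rw [map_neg]; exact h2.neg⟩

theorem exists_basisSum {M : ℕ} {f : DW p k A m} (hf : f ∈ idealI p k A m M)
    (N : ℕ) : ∃ c, (∀ x, c x ∈ filV p A (M - normDen p m (expo p n x.1) x.2)) ∧
        f - fr.basisSum m c ∈ idealI p k A m N := by
  obtain ⟨g, hg, P', hP', h1⟩ := exists_normal_of_mem_idealI (fr := fr) hf N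
  obtain ⟨c, hc, h2⟩ := exists_basisSum_of_normal hg
  refine ⟨c, hc, ?_⟩
  rwa [Subtype.ext (h2.ext (fr := fr) h1), sub_sub_cancel]

theorem exists_coefficients (Q : DHat p k A m) :
    ∃ (a : TermIndex p n m → W A)
      (C : ℕ → TermIndex p n m →₀ W A), ∀ N, Q.1 N = (idealI p k A m N).ringCon.mk' (fr.basisSum m (C N)) ∧
          ∀ x, a x - C N x ∈ filV p A (N - normDen p m (expo p n x.1) x.2) := by
  have hstep : ∀ N (c : TermIndex p n m →₀ W A), ∃ c', Q.1 N = (idealI p k A m N).ringCon.mk' (fr.basisSum m c) →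
          Q.1 (N + 1) = (idealI p k A m (N + 1)).ringCon.mk' (fr.basisSum m c') ∧
            ∀ x, c' x - c x ∈ filV p A (N - normDen p m (expo p n x.1) x.2) := by
    intro N c; obtain ⟨P, hP⟩ := Q.2 (N + 1); by_cases h : Q.1 N = (idealI p k A m N).ringCon.mk' (fr.basisSum m c)
    · rw [hP N (Nat.le_succ N), mk_eq_mk_iff] at h; obtain ⟨c', h1, h2⟩ := exists_basisSum (fr := fr) h (N + 1)
      refine ⟨c + c', fun _ => ⟨?_, fun x => ?_⟩⟩
      · rw [hP (N + 1) le_rfl, mk_eq_mk_iff, map_add, ← sub_sub]; exact h2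
      · simp [*]
    · exact ⟨0, fun h' => absurd h' h⟩
  choose next hnext using hstep
  let C : ℕ → TermIndex p n m →₀ W A := fun N => Nat.rec 0 next N
  have hC : ∀ N, Q.1 N = (idealI p k A m N).ringCon.mk' (fr.basisSum m (C N)) := by
    intro N; induction N with
    | zero =>
      obtain ⟨P, hP⟩ := DHat.exists_coe_eq Q 0; rw [hP, mk_eq_mk_iff]; exact idealI_zero m _
    | succ N ih => exact (hnext N (C N) ih).1
  have hlim : ∀ x, ∃ a, ∀ N, a - C N x ∈ filV p A (N - normDen p m (expo p n x.1) x.2) := by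
    intro x; obtain ⟨a, ha⟩ := exists_limit (fun N => C (N + normDen p m (expo p n x.1) x.2) x)
      fun N => by
        have := (fun N x => (hnext N (C N) (hC N)).2 x) (N + normDen p m (expo p n x.1) x.2) x
        rw [Nat.add_sub_cancel, filV, RingHom.mem_ker, map_sub, sub_eq_zero] at this; rw [← this, Nat.add_right_comm]
    refine ⟨a, fun N => ?_⟩
    rcases le_total (normDen p m (expo p n x.1) x.2) N with h | h
    · have := ha (N - normDen p m (expo p n x.1) x.2); rw [Nat.sub_add_cancel h] at this
      rw [filV, RingHom.mem_ker, map_sub, this, sub_self]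
    · rw [Nat.sub_eq_zero_of_le h, mem_filV_iff]; exact ⟨_, rfl⟩
  choose a ha using hlim
  exact ⟨a, C, fun N => ⟨hC N, fun x => ha x N⟩⟩

theorem exists_dvd_of_basisSum (x : TermIndex p n m) :
    ∃ (ν : ℤ_[p]) (D : ℕ), ν ≠ 0 ∧ ∀ N (c : TermIndex p n m →₀ W A), (∀ y, (fr.basisSum m c).1 y ∈ filV p A N) →
          (p : W R) ^ N ∣ p ^ D * (zp p R ν * frob p R (-normDen p m (expo p n x.1) x.2) (jA (c x))) := by
  choose ν hν hterm using fun x : TermIndex p n m => exists_term_eq (fr := fr) m (scalable_expo x.1) (expo_lt x.1) x.2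
  refine ⟨ν x, den p (shift p m (expo p n x.1) x.2), hν x, fun N c hc => ?_⟩
  classical
  refine dvd_of_sum_tOp (fr := fr) (s := insert x c.support)
    (Q := fun x => shift p m (expo p n x.1) x.2)
    (c := fun x => zp p R (ν x) * frob p R (-normDen p m (expo p n x.1) x.2) (jA (c x)))
    (fun x _ => scalable_shift m (scalable_expo x.1) x.2) (fun x _ y _ h => ?_) (fun y => ?_)
    (mem_insert_self _ _)
  · obtain ⟨h1, h2⟩ := shift_inj (fun l => (scalable_expo x.1).nonneg l) (expo_lt x.1)
      (fun l => (scalable_expo y.1).nonneg l) (expo_lt y.1) h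
    exact Prod.ext (expo_injective h1) h2
  · have h1 := (mem_filV_iff_dvd fr.inj).1 (hc y)
    have h2 : (fr.basisSum m c).1 y = ∑ x ∈ insert x c.support, (fr.basisOp m x (c x)).1 y := by
      rw [basisSum_eq (Finset.subset_insert x c.support)]
      refine (DFunLike.congr_fun (map_sum (DW p k A m).subtype _ _) y).trans ?_; exact end_sum_apply _ _ y
    rw [h2, map_sum] at h1
    convert h1 using 2 with x hx
    rw [isRes_basisOp, hterm]
    rfl

theorem eq_zero_of_approx (x : TermIndex p n m) {a : W A}
    (h : ∀ N, ∃ c, (∀ y, (fr.basisSum m c).1 y ∈ filV p A N) ∧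
        a - c x ∈ filV p A (N - normDen p m (expo p n x.1) x.2)) : a = 0 := by
  obtain ⟨ν, D, hν, hD⟩ := exists_dvd_of_basisSum (fr := fr) x
  have h1 := eq_zero_of_dvd_p_pow_mul (D := D + normDen p m (expo p n x.1) x.2) hν
    (c := frob p R (-normDen p m (expo p n x.1) x.2) (jA a)) fun N => by
      obtain ⟨c, h2, h3⟩ := h N; have h4 := hD N c h2
      rw [mem_filV_iff_dvd fr.inj, ← p_pow_dvd_frob_iff (d := -normDen p m (expo p n x.1) x.2),
        map_sub, map_sub] at h3
      have h5 := mul_dvd_mul (dvd_refl ((p : W R) ^ normDen p m (expo p n x.1) x.2)) h3; rw [← pow_add] at h5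
      have h6 := (pow_dvd_pow (p : W R) (show N ≤ _ by omega)).trans h5
      refine (dvd_add (h4.mul_left (p ^ normDen p m (expo p n x.1) x.2)) (h6.mul_left (p ^ D * zp p R ν))).trans (dvd_of_eq ?_)
      rw [pow_add]; ring
  exact (map_eq_zero_iff (jA) fr.j_injective).1 ((map_eq_zero_iff (frob p R _) (frob p R _).injective).1 h1)

end CoordFrame

end

namespace CoordFrame

section

open WittFrame MvPowerSeries

theorem coe_mul_add {B : DHat p k A m} {S : DW p k A m}
    (h : B.1 N = (idealI p k A m N).ringCon.mk' S) (P H : DW p k A m) :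
    (B * DHat.of p k A m P + DHat.of p k A m H).1 N = (idealI p k A m N).ringCon.mk' (H + S * P) := by
  change B.1 N * (idealI p k A m N).ringCon.mk' P + (idealI p k A m N).ringCon.mk' H = _
  rw [h, ← map_mul, ← map_add, add_comm]

/-- The coefficients of an expansion as one family. -/
def allCoeff {p n : ℕ} {V : Type*} (a : (Fin n → ℕ) → V)
    (α : (Fin n → ℕ) → BasisIndex p n m → V) (x : TermIndex p n m) : V :=
  x.1.elim (a x.2) (α x.2)

theorem eventually_eq_basisSum {Q : DHat p k A m} {a : (Fin n → ℕ) → W A}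
    {α : (Fin n → ℕ) → BasisIndex p n m → W A} {B : (Fin n → ℕ) → DHat p k A m}
    (h : IsExpansion p k (fun i => fr.basisOp m (some i, 0)) (fr.pow m)
      (fun I => fr.basisOp m (none, I)) Q a α B) (N : ℕ) :
    ∀ᶠ s in atTop, ∀ᶠ t in atTop, Q.1 N = (idealI p k A m N).ringCon.mk'
      (∑ x ∈ Finset.insertNone t ×ˢ s, fr.basisOp m x (allCoeff a α x)) := by
  have h2 := DHat.tendsto_iff.1 h.2 N
  rw [SummationFilter.unconditional_filter] at h2
  filter_upwards [h2] with s hs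
  filter_upwards [(Filter.eventually_all_finset s).2 fun I _ => DHat.hasSum_of_iff.1 (h.1 I) N] with t ht
  rw [← hs, DHat.coe_sum, Finset.sum_product_right, map_sum]
  refine sum_congr rfl fun I hI => ?_
  rw [coe_mul_add (ht I hI).symm, Finset.sum_insertNone, sum_mul]
  refine congrArg (fun z => (idealI p k A m N).ringCon.mk' (fr.basisOp m (none, I) (a I) + z))
    (sum_congr rfl fun i _ => ?_)
  rw [basisOp_mul_pow]
  rfl

theorem isExpansion_unique {Q : DHat p k A m} {a a' : (Fin n → ℕ) → W A}
    {α α' : (Fin n → ℕ) → BasisIndex p n m → W A} {B B' : (Fin n → ℕ) → DHat p k A m}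
    (h : IsExpansion p k (fun i => fr.basisOp m (some i, 0)) (fr.pow m)
      (fun I => fr.basisOp m (none, I)) Q a α B)
    (h' : IsExpansion p k (fun i => fr.basisOp m (some i, 0)) (fr.pow m)
      (fun I => fr.basisOp m (none, I)) Q a' α' B') : a' = a ∧ α' = α := by
  have key : ∀ x, allCoeff a' α' x = allCoeff a α x := by
    intro x; rw [← sub_eq_zero]; refine eq_zero_of_approx (fr := fr) x fun N => ?_
    obtain ⟨s, hs, hs', hs0⟩ := ((eventually_eq_basisSum h N).and
      ((eventually_eq_basisSum h' N).and (eventually_ge_atTop {x.2}))).exists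
    obtain ⟨t, ht, ht', ht0⟩ := (hs.and (hs'.and (eventually_ge_atTop (x.1.toFinset)))).exists
    let c : TermIndex p n m →₀ W A := ∑ x ∈ Finset.insertNone t ×ˢ s, single x (allCoeff a' α' x - allCoeff a α x)
    have hx : x ∈ Finset.insertNone t ×ˢ s := by
      refine mem_product.2 ⟨Finset.mem_insertNone.2 fun i hi => ht0 ?_, hs0 (Finset.mem_singleton_self _)⟩
      exact Option.mem_toFinset.2 hi
    refine ⟨c, fun y => idealI_apply_mem p k A m N _ ?_ y, ?_⟩
    · rw [map_sum, sum_congr rfl fun x _ => basisSum_single x _]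
      simp_rw [map_sub]
      rw [sum_sub_distrib, ← mk_eq_mk_iff, ← ht, ← ht']
    · have h1 : c x = allCoeff a' α' x - allCoeff a α x := by
        rw [Finsupp.finsetSum_apply, sum_eq_single x, single_eq_same]
        · exact fun y _ hy => Finsupp.single_eq_of_ne' hy
        · exact fun h => absurd hx h
      rw [h1, sub_self]; exact zero_mem _
  exact ⟨funext fun I => key (none, I), funext fun I => funext fun i => key (some i, I)⟩

theorem exists_isExpansion (Q : DHat p k A m) :
    ∃ (a : (Fin n → ℕ) → W A) (α : (Fin n → ℕ) → BasisIndex p n m → W A)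
      (B : (Fin n → ℕ) → DHat p k A m),
      IsExpansion p k (fun i => fr.basisOp m (some i, 0)) (fr.pow m)
        (fun I => fr.basisOp m (none, I)) Q a α B ∧
      (∀ N, ∀ᶠ I in cofinite, a I ∈ filV p A N) ∧ Tendsto B cofinite (𝓝 0) := by
  classical
  obtain ⟨a, C, hC⟩ := exists_coefficients (fr := fr) Q
  have ha : ∀ N x, x ∉ (C N).support → a x ∈ filV p A (N - normDen p m (expo p n x.1) x.2) := fun N x hx => by grind
  let t : ℕ → Finset (BasisIndex p n m) := fun N => (((C N).support.image Prod.fst).eraseNone)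
  let s : ℕ → Finset (Fin n → ℕ) := fun N => (C N).support.image Prod.snd
  have hst : ∀ N, ∀ x ∈ (C N).support, x ∈ Finset.insertNone (t N) ×ˢ s N := fun N x hx =>
    mem_product.2 ⟨Finset.mem_insertNone.2 fun i hi => Finset.mem_eraseNone.2
      (Finset.mem_image.2 ⟨x, hx, hi⟩), Finset.mem_image_of_mem _ hx⟩
  have hfrac : ∀ I N i, (i ∉ t N ∨ I ∉ s N) → fr.basisOp m (some i, 0) (a (some i, I)) ∈ idealI p k A m N := by
    intro I N i h; refine basisOp_mem_idealI ?_; have h1 := ha N (some i, I) fun hx => by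
      have h2 := mem_product.1 (hst N _ hx); rcases h with h | h
      · exact h (Finset.mem_insertNone.1 h2.1 i rfl)
      · exact h h2.2
    rwa [normDen_expo_some] at h1 ⊢
  choose B hB hB' using fun I => DHat.exists_hasSum fun N i hi => hfrac I N i (Or.inl hi)
  refine ⟨fun I => a (none, I), fun I i => a (some i, I), B, ⟨hB, ?_⟩, fun N => ?_, ?_⟩
  · rw [HasSum, SummationFilter.unconditional_filter, DHat.tendsto_iff]; intro N
    filter_upwards [eventually_ge_atTop (s N)] with s' hs'
    have h1 : (∑ I ∈ s', (B I * DHat.of p k A m (fr.pow m I) +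
        DHat.of p k A m (fr.basisOp m (none, I) (a (none, I))))).1 N =
        (idealI p k A m N).ringCon.mk' (∑ x ∈ Finset.insertNone (t N) ×ˢ s', fr.basisOp m x (a x)) := by
      rw [DHat.coe_sum, Finset.sum_product_right, map_sum]; refine sum_congr rfl fun I _ => ?_
      rw [coe_mul_add (hB' I N _ subset_rfl), Finset.sum_insertNone, sum_mul]
      exact congrArg (fun z => (idealI p k A m N).ringCon.mk' (fr.basisOp m (none, I) (a (none, I)) + z))
        (sum_congr rfl fun i _ => basisOp_mul_pow i I _)
    rw [h1, (hC N).1, mk_eq_mk_iff, basisSum_eq (s := Finset.insertNone (t N) ×ˢ s')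
      fun x hx => Finset.product_subset_product_right hs' (hst N x hx), ← sum_sub_distrib]
    refine sum_mem fun x _ => ?_
    rw [← map_sub]; exact basisOp_mem_idealI ((hC N).2 x)
  · rw [Filter.eventually_cofinite]; refine (s (N + (-m).toNat)).finite_toSet.subset fun I hI => ?_
    by_contra h
    refine hI ?_; have h1 := ha (N + (-m).toNat) (none, I) fun hx => h (mem_product.1 (hst _ _ hx)).2
    rw [mem_filV_iff_dvd fr.inj] at h1 ⊢; refine (pow_dvd_pow _ ?_).trans h1; rw [normDen_expo_none]
    split_ifs <;> omega
  · rw [DHat.tendsto_iff]; intro N; rw [Filter.eventually_cofinite]; refine (s N).finite_toSet.subset fun I hI => ?_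
    by_contra h
    refine hI ?_; rw [hB' I N _ subset_rfl, map_sum]
    exact sum_eq_zero fun i _ => mk_eq_zero_iff.2 (hfrac I N i (Or.inr h))

include fr in
theorem toEnd_injective (m : ℤ) : Injective (DHat.toEnd p k A m) := by
  suffices h : ∀ Q, DHat.toEnd p k A m Q = 0 → Q = 0 from fun Q Q' hQ =>
    sub_eq_zero.1 (h _ (by rw [RingHom.map_sub, hQ, sub_self]))
  intro Q hQ
  obtain ⟨a, C, hC⟩ := exists_coefficients (fr := fr) Q
  have h0 : ∀ N y, (fr.basisSum m (C N)).1 y ∈ filV p A N := fun N y => by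
    rw [filV, RingHom.mem_ker, ← DHat.truncate_act p k A m Q y N _ (hC N).1]
    have : DHat.act p k A m Q y = 0 := DFunLike.congr_fun hQ y; rw [this, map_zero]
  refine Subtype.ext (funext fun N => (hC N).1.trans (mk_eq_zero_iff.2 ?_))
  rw [basisSum_eq subset_rfl]
  refine sum_mem fun x _ => basisOp_mem_idealI ?_
  have := (hC N).2 x
  rwa [(fun x => eq_zero_of_approx x fun N => ⟨C N, h0 N, (hC N).2 x⟩), zero_sub, neg_mem_iff] at this

end

end CoordFrame

section

theorem mul_ofFn_prod_update {M : Type*} [Monoid M] {n : ℕ} {x : M} {f : Fin n → M}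
    (h : ∀ i, Commute x (f i)) (l : Fin n) :
    x * (ofFn f).prod = (ofFn (update f l (x * f l))).prod := by
  induction n with
  | zero => exact l.elim0
  | succ n ih =>
    rw [ofFn_succ, ofFn_succ, List.prod_cons, List.prod_cons]
    cases l using Fin.cases with
    | zero =>
      rw [update_self, mul_assoc]; congr 3
    | succ l =>
      rw [update_of_ne (Fin.succ_ne_zero l).symm, ← mul_assoc, (h 0).eq, mul_assoc, ih (fun i => h _) l]
      congr 3
      funext i
      by_cases hi : i = l
      · subst hi; rw [update_self, update_self]
      · rw [update_of_ne hi, update_of_ne fun h => hi (Fin.succ_injective _ h)]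

theorem ofFn_mul_prod {M : Type*} [Monoid M] {n : ℕ} {f g : Fin n → M}
    (h : ∀ i j, Commute (g i) (f j)) : (ofFn fun i => f i * g i).prod = (ofFn f).prod * (ofFn g).prod := by
  induction n with
  | zero => simp
  | succ n ih =>
    have hc : Commute (g 0) (ofFn fun i : Fin n => f i.succ).prod :=
      Commute.list_prod_right _ _ fun x hx => by
        obtain ⟨i, rfl⟩ := List.mem_ofFn.1 hx; exact h _ _
    rw [ofFn_succ, ofFn_succ, ofFn_succ, List.prod_cons, List.prod_cons,
      List.prod_cons, ih fun i j => h _ _, mul_assoc, mul_assoc, ← mul_assoc (g 0), hc.eq, mul_assoc]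

variable {n : ℕ}

/-- The monomial of multidegree `K` in the `O l i`, `i ≤ q`. -/
def powBasis {Z : Type*} [Semiring Z] (q : ℕ) (O : Fin n → ℕ → Z) (K : Fin n → ℕ) : Z :=
  (ofFn fun l => O l (K l % q) * O l q ^ (K l / q)).prod

theorem map_powBasis {Z Z' : Type*} [Semiring Z] [Semiring Z'] (f : Z →+* Z') (q : ℕ) (O : Fin n → ℕ → Z)
    (K : Fin n → ℕ) : f (powBasis q O K) = powBasis q (fun l i => f (O l i)) K := by
  rw [powBasis, map_list_prod, List.map_ofFn]
  refine congrArg (fun g => (ofFn g).prod) (funext fun l => ?_)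
  rw [Function.comp_apply, map_mul, map_pow]

variable {Z : Type*} [Ring Z]

/-- The multiplication rules of divided powers of level `q`, in characteristic `p`. -/
structure IsDivPow (q : ℕ) (O : Fin n → ℕ → Z) : Prop where
  zero : ∀ l, O l 0 = 1
  comm : ∀ l l' i j, i ≤ q → j ≤ q → Commute (O l i) (O l' j)
  mul_lt : ∀ l i j, i + j < q → O l i * O l j = ((i + j).choose i : Z) * O l (i + j)
  mul_ge : ∀ l i j, i < q → j < q → q ≤ i + j → O l i * O l j = ((i + j).choose i : Z) * (O l (i + j - q) * O l q)

theorem IsDivPow.exists_mul {q : ℕ} {O : Fin n → ℕ → Z} (h : IsDivPow q O) (hq : 0 < q) {i : ℕ}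
    (hi : i ≤ q) (l : Fin n) (K : Fin n → ℕ) :
    ∃ c : ℕ, O l i * powBasis q O K = c * powBasis q O (K + Pi.single l i) := by
  have hstep : ∃ c : ℕ, O l i * (O l (K l % q) * O l q ^ (K l / q)) =
      c * (O l ((K l + i) % q) * O l q ^ ((K l + i) / q)) := by
    have hr := Nat.mod_lt (K l) hq; have hcomm := ((h.comm l l (K l % q) q hr.le le_rfl).pow_right (K l / q))
    rcases hi.eq_or_lt with rfl | hi
    · refine ⟨1, ?_⟩; rw [Nat.add_mod_right, Nat.add_div_right _ hq, pow_succ', Nat.cast_one, one_mul, ← mul_assoc,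
        (h.comm l l i _ le_rfl hr.le).eq, mul_assoc]
    · refine ⟨(i + K l % q).choose i, ?_⟩; have hK : K l + i = (i + K l % q) + q * (K l / q) := by
        have := Nat.mod_add_div (K l) q; omega
      rcases lt_or_ge (i + K l % q) q with h1 | h1
      · rw [← mul_assoc, h.mul_lt l i _ h1, hK, Nat.add_mul_mod_self_left, Nat.mod_eq_of_lt h1,
          Nat.add_mul_div_left _ _ hq, Nat.div_eq_of_lt h1, zero_add, mul_assoc]
      · have hK' : K l + i = (i + K l % q - q) + q * (K l / q + 1) := by
          rw [hK, mul_add, mul_one]; omega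
        have h2 : i + K l % q - q < q := by omega
        rw [← mul_assoc, h.mul_ge l i _ hi hr h1, hK', Nat.add_mul_mod_self_left, Nat.mod_eq_of_lt h2,
          Nat.add_mul_div_left _ _ hq, Nat.div_eq_of_lt h2, zero_add, pow_succ', mul_assoc, mul_assoc]
  obtain ⟨c, hc⟩ := hstep
  refine ⟨c, ?_⟩
  rw [powBasis, mul_ofFn_prod_update (fun l' => (h.comm l l' i _ hi ((fun l' => (Nat.mod_lt _ hq).le) l')).mul_right
    ((h.comm l l' i q hi le_rfl).pow_right _)) l, hc, powBasis,
    mul_ofFn_prod_update (fun l' => Nat.cast_commute c _) l]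
  refine congrArg (fun g => (ofFn g).prod) (funext fun l' => ?_)
  by_cases hl : l' = l
  · subst hl; rw [update_self, update_self, Pi.add_apply, Pi.single_eq_same]
  · rw [update_of_ne hl, update_of_ne hl, Pi.add_apply, Pi.single_eq_of_ne hl, add_zero]

theorem IsDivPow.exists_finsupp {q : ℕ} {O : Fin n → ℕ → Z} (h : IsDivPow q O) (hq : 0 < q)
    {P : Type*} [Ring P] (μ : P →+* Z)
    (hμ : ∀ l i a, i ≤ q → ∃ d : ℕ → P, O l i * μ a = ∑ ij ∈ antidiagonal i, μ (d ij.1) * O l ij.2) {z : Z}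
    (hz : z ∈ Subring.closure (Set.range μ ∪ {z | ∃ l, ∃ i ≤ q, z = O l i})) :
    ∃ f : (Fin n → ℕ) →₀ P, z = f.sum fun K a => μ a * powBasis q O K := by
  let T : AddSubgroup Z := AddSubgroup.closure {z | ∃ a K, z = μ a * powBasis q O K}
  have hT : ∀ a K, μ a * powBasis q O K ∈ T := fun a K => AddSubgroup.subset_closure ⟨a, K, rfl⟩
  have hmul : ∀ x, (∀ a K, x * (μ a * powBasis q O K) ∈ T) → ∀ t ∈ T, x * t ∈ T := by
    intro x hx t ht; induction ht using closure_induction with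
    | mem t ht =>
      obtain ⟨a, K, rfl⟩ := ht; exact hx a K
    | zero => rw [mul_zero]; exact zero_mem _
    | add t t' _ _ h h' => rw [mul_add]; exact add_mem h h'
    | neg t _ h => rw [mul_neg]; exact neg_mem h
  have key : ∀ t ∈ T, z * t ∈ T := by
    induction hz using Subring.closure_induction with
    | mem x hx =>
      rcases hx with ⟨b, rfl⟩ | ⟨l, i, hi, rfl⟩
      · refine hmul _ fun a K => ?_
        rw [← mul_assoc, ← map_mul]; exact hT _ _
      · refine hmul _ fun a K => ?_
        obtain ⟨d, hd⟩ := hμ l i a hi; rw [← mul_assoc, hd, sum_mul]; refine sum_mem fun ij hij => ?_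
        obtain ⟨c, hc⟩ := h.exists_mul hq
          ((le_add_self.trans (mem_antidiagonal.1 hij).le).trans hi) l K
        rw [mul_assoc, hc, ← map_natCast μ, ← mul_assoc, ← map_mul]; exact hT _ _
    | zero => exact fun t _ => by rw [zero_mul]; exact zero_mem _
    | one => exact fun t ht => by rwa [one_mul]
    | add x y _ _ hx hy => exact fun t ht => by rw [add_mul]; exact add_mem (hx t ht) (hy t ht)
    | neg x _ hx => exact fun t ht => by rw [neg_mul]; exact neg_mem (hx t ht)
    | mul x y _ _ hx hy => exact fun t ht => by rw [mul_assoc]; exact hx _ (hy t ht)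
  have h1 : powBasis q O 0 = 1 := by
    rw [powBasis]; refine List.prod_eq_one fun x hx => ?_
    obtain ⟨l, rfl⟩ := List.mem_ofFn.1 hx; rw [Pi.zero_apply, Nat.zero_mod, Nat.zero_div, pow_zero, mul_one, h.zero]
  have h2 := key 1 (by simpa [h1] using hT 1 0)
  rw [mul_one] at h2
  clear key hz
  induction h2 using closure_induction with
  | mem t ht =>
    obtain ⟨a, K, rfl⟩ := ht; exact ⟨single K a, by rw [Finsupp.sum_single_index (by rw [map_zero, zero_mul])]⟩
  | zero => exact ⟨0, by rw [Finsupp.sum_zero_index]⟩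
  | add t t' _ _ h h' =>
    obtain ⟨f, rfl⟩ := h; obtain ⟨f', rfl⟩ := h'
    exact ⟨f + f', by rw [Finsupp.sum_add_index' (fun K => by rw [map_zero, zero_mul])
      fun K a b => by rw [map_add, add_mul]]⟩
  | neg t _ h =>
    obtain ⟨f, rfl⟩ := h; refine ⟨-f, ?_⟩
    rw [Finsupp.sum_neg_index fun K => by rw [map_zero, zero_mul], Finsupp.sum, Finsupp.sum, ← Finset.sum_neg_distrib]
    exact sum_congr rfl fun K _ => by rw [map_neg, neg_mul]

theorem exists_ringEquiv_of_graph {X Y : Type*} [Ring X] [Ring Y] (G : Subring (X × Y))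
    (h1 : ∀ x, ∃ y, (x, y) ∈ G) (h2 : ∀ y, ∃ x, (x, y) ∈ G)
    (h : ∀ z ∈ G, z.1 = 0 ↔ z.2 = 0) : ∃ e : X ≃+* Y, ∀ z ∈ G, e z.1 = z.2 := by
  have hb1 : Function.Bijective ((RingHom.fst X Y).comp G.subtype) :=
    ⟨(injective_iff_map_eq_zero _).2 fun z hz =>
      Subtype.ext (Prod.ext hz ((h z.1 z.2).1 hz)), fun x => by
        obtain ⟨y, hy⟩ := h1 x; exact ⟨⟨_, hy⟩, rfl⟩⟩
  have hb2 : Function.Bijective ((RingHom.snd X Y).comp G.subtype) :=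
    ⟨(injective_iff_map_eq_zero _).2 fun z hz =>
      Subtype.ext (Prod.ext ((h z.1 z.2).2 hz) hz), fun y => by
        obtain ⟨x, hx⟩ := h2 y; exact ⟨⟨_, hx⟩, rfl⟩⟩
  refine ⟨(RingEquiv.ofBijective _ hb1).symm.trans (RingEquiv.ofBijective _ hb2), fun z hz => ?_⟩
  have h3 : (RingEquiv.ofBijective _ hb1).symm z.1 = ⟨z, hz⟩ := (RingEquiv.symm_apply_eq _).2 rfl
  rw [RingEquiv.trans_apply, h3]
  rfl

end

namespace CoordFrame

section

open WittFrame MvPowerSeries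

theorem mem_span_natCast_iff {E : Type*} [Ring E] {q : ℕ} {x : E} :
    x ∈ TwoSidedIdeal.span {(q : E)} ↔ ∃ y, x = q * y := by
  constructor
  · intro h; let J : TwoSidedIdeal E := TwoSidedIdeal.mk' {x | ∃ y, x = q * y}
      ⟨0, (mul_zero _).symm⟩ (fun ⟨x, hx⟩ ⟨y, hy⟩ => ⟨x + y, by rw [hx, hy, mul_add]⟩)
      (fun ⟨x, hx⟩ => ⟨-x, by rw [hx, mul_neg]⟩)
      (fun {x y} ⟨z, hz⟩ => ⟨x * z, by rw [hz, ← mul_assoc, ← mul_assoc, (Nat.cast_commute q x).eq]⟩)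
      (fun {x y} ⟨z, hz⟩ => ⟨z * y, by rw [hz, mul_assoc]⟩)
    have hJ : TwoSidedIdeal.span {(q : E)} ≤ J := TwoSidedIdeal.span_le.2 fun x hx =>
      (TwoSidedIdeal.mem_mk' _ _ _ _ _ _ _).2 ⟨1, by rw [Set.mem_singleton_iff.1 hx, mul_one]⟩
    exact (TwoSidedIdeal.mem_mk' {x : E | ∃ y, x = q * y} _ _ _ _ _ _).1 (hJ h)
  · rintro ⟨y, rfl⟩
    exact TwoSidedIdeal.mul_mem_right _ _ _ (subset_span rfl)

theorem natCast_mul_add_sub {E : Type*} [Ring E] (q v : ℕ) (g x : E) :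
    (q : E) * (g + (q : E) ^ v * x) - (q : E) * g = (q : E) ^ (v + 1) * x := by
  rw [mul_add, add_sub_cancel_left, pow_succ', mul_assoc]

theorem add_pow_mul_of_sub_eq {E : Type*} [Ring E] (q N : ℕ) (f : E) {g g' x : E}
    (h : g' - g = q * x) : f + (q : E) ^ N * g' = f + (q : E) ^ N * g + (q : E) ^ (N + 1) * x := by
  rw [eq_add_of_sub_eq' h, mul_add, pow_succ, mul_assoc, add_assoc]

theorem natCast_choose_eq_one {Z : Type*} [Ring Z] (hZ : (p : Z) = 0) {m s : ℕ} (hs : s < p ^ m) :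
    ((p ^ m + s).choose (p ^ m) : Z) = 1 := by
  have h := p_pow_dvd_choose_add_sub (dvd_refl (p ^ m)) hs (dvd_refl (p ^ m))
  rw [Nat.add_sub_cancel_left, pow_one, Nat.choose_self] at h
  obtain ⟨c, hc⟩ := h
  have h1 := congrArg (Int.cast (R := Z)) hc
  push_cast at h1
  rwa [hZ, zero_mul, sub_eq_zero] at h1

/-- `f` is a nonzero multiple of the differential operator `∂^{[K]}`. -/
def IsMultiple (fr : CoordFrame p k A R L n) (K : Fin n →₀ ℕ) (f : Module.End (W k) L) :
    Prop := ∃ ν : ℕ, ν ≠ 0 ∧ f = ν • hsCoeff (fr.taylor id) K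

theorem isMultiple_one : IsMultiple fr 0 1 :=
  ⟨1, one_ne_zero, by
    rw [one_smul]; exact LinearMap.ext fun x => ((fr.isTaylor id).hsCoeff_zero x).symm⟩

theorem isMultiple_del (l : Fin n) (i : ℕ) : IsMultiple fr (single l i) (fr.del l i) :=
  ⟨1, one_ne_zero, by rw [one_smul, del_eq]⟩

theorem hsCoeff_taylor_mul (K J : Fin n →₀ ℕ) : hsCoeff (fr.taylor id) K * hsCoeff (fr.taylor id) J =
    multiChoose (K + J) K • hsCoeff (fr.taylor id) (K + J) :=
  LinearMap.ext fun x => (fr.isTaylor id).hsCoeff_comp fr.etale K J x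

theorem IsMultiple.mul {K J : Fin n →₀ ℕ} {f g : Module.End (W k) L}
    (hf : IsMultiple fr K f) (hg : IsMultiple fr J g) : IsMultiple fr (K + J) (f * g) := by
  obtain ⟨a, ha, rfl⟩ := hf
  obtain ⟨b, hb, rfl⟩ := hg
  refine ⟨a * (b * multiChoose (K + J) K), mul_ne_zero ha (mul_ne_zero hb ?_), ?_⟩
  · exact Finset.prod_ne_zero_iff.2 fun l _ => (Nat.choose_pos (by simp)).ne'
  · rw [smul_mul_assoc, mul_smul_comm, hsCoeff_taylor_mul, smul_smul, smul_smul, mul_assoc]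

theorem IsMultiple.pow {K : Fin n →₀ ℕ} {f : Module.End (W k) L}
    (hf : IsMultiple fr K f) (d : ℕ) : IsMultiple fr (d • K) (f ^ d) := by
  induction d with
  | zero =>
    rw [zero_smul, pow_zero]; exact isMultiple_one
  | succ d ih =>
    rw [succ_nsmul, pow_succ]; exact ih.mul hf

theorem isMultiple_ofFn_prod {s : ℕ} {K : Fin s → Fin n →₀ ℕ}
    {f : Fin s → Module.End (W k) L} (h : ∀ i, IsMultiple fr (K i) (f i)) :
    IsMultiple fr (∑ i, K i) (ofFn f).prod := by
  induction s with
  | zero =>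
    rw [List.ofFn_zero, List.prod_nil, Finset.univ_eq_empty, Finset.sum_empty]; exact isMultiple_one
  | succ s ih =>
    rw [ofFn_succ, List.prod_cons, Fin.sum_univ_succ]; exact (h 0).mul (ih fun i => h _)

theorem isMultiple_powBasis (q : ℕ) (K : Fin n →₀ ℕ) : IsMultiple fr K (powBasis q fr.del K) := by
  have h := isMultiple_ofFn_prod (f := fun l => fr.del l (K l % q) * fr.del l q ^ (K l / q))
    fun l => (isMultiple_del l (K l % q)).mul ((isMultiple_del l q).pow (K l / q))
  have h1 : ∑ l, (single l (K l % q) + (K l / q) • single l q) = K := by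
    conv_rhs => rw [← Finsupp.univ_sum_single K]
    refine sum_congr rfl fun l _ => ?_
    rw [Finsupp.smul_single, ← single_add, smul_eq_mul, mul_comm, Nat.mod_add_div]
  rw [h1] at h
  exact h

theorem dvd_of_sum_hsCoeff {s : Finset (Fin n →₀ ℕ)} {c : (Fin n →₀ ℕ) → L} {a : L}
    (h : ∀ y, a ∣ ∑ K ∈ s, c K * hsCoeff (fr.taylor id) K y) (K : Fin n →₀ ℕ) (hK : K ∈ s) :
    a ∣ c K := by
  induction K using WellFoundedLT.induction with
  | ind K ih =>
    have h1 := h (∏ l, fr.S l ^ K l); rw [← add_sum_erase _ _ hK] at h1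
    have h2 : a ∣ ∑ J ∈ s.erase K, c J * hsCoeff (fr.taylor id) J (∏ l, fr.S l ^ K l) := by
      refine dvd_sum fun J hJ => ?_
      by_cases hle : J ≤ K
      · exact (ih J (lt_of_le_of_ne hle (ne_of_mem_erase hJ)) (Finset.mem_of_mem_erase hJ)).mul_right _
      · obtain ⟨l, hl⟩ : ∃ l, K l < J l := by
          by_contra! hcon
          exact hle hcon
        rw [(fr.isTaylor id).hsCoeff_prod_pow, prod_eq_zero (mem_univ l), mul_zero]
        · exact dvd_zero _
        · rw [choose_eq_zero_of_lt hl, cast_zero, zero_mul]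
    have h3 := (dvd_add_left h2).1 h1; rwa [(fr.isTaylor id).hsCoeff_prod_pow, prod_eq_one, mul_one] at h3; intro l _
    rw [Nat.choose_self, Nat.cast_one, one_mul, Nat.sub_self, pow_zero]

theorem dvd_of_dvd_mul_natCast {v u : ℕ} (hu : ¬ p ∣ u) {b : L}
    (h : (p : L) ^ (v + 1) ∣ b * (p ^ v * u : ℕ)) : (p : L) ∣ b := by
  obtain ⟨c, hc⟩ := h
  have h1 : b * u = p * c := by
    refine nsmul_right_injective (pow_ne_zero v (Fact.out : p.Prime).ne_zero) ?_; simp; push_cast at hc ⊢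
    linear_combination hc
  obtain ⟨x, y, hxy⟩ := Nat.isCoprime_iff_coprime.2 (((Fact.out : p.Prime).coprime_iff_not_dvd).2 hu)
  have h2 := congrArg (Int.cast (R := L)) hxy
  push_cast at h2
  exact ⟨x * b + y * c, by linear_combination (-b) * h2 + y * h1⟩

section

variable {m : ℕ}

variable (fr) in
/-- Multiplication operators as elements of Berthelot's ring. -/
def lmulB (m : ℕ) : L →+* BerthelotD p k fr.S m :=
  ((Algebra.lmul (W k) L).codRestrict (BerthelotD p k fr.S m)
    fun b => Algebra.subset_adjoin (Or.inl ⟨b, rfl⟩)).toRingHom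

variable (fr) in
/-- The operators `∂_l^{[i]}`, `i ≤ p^m`, as elements of Berthelot's ring. -/
def delB (m : ℕ) (l : Fin n) (i : ℕ) : BerthelotD p k fr.S m :=
  if h : i ≤ p ^ m then ⟨fr.del l i, Algebra.subset_adjoin (Or.inr
    ⟨fr.del, isCoordinateHS_del, l, i, h, rfl⟩)⟩ else 0

theorem delB_coe {l : Fin n} {i : ℕ} (h : i ≤ p ^ m) : (fr.delB m l i).1 = fr.del l i := by rw [delB, dif_pos h]

theorem lmulB_apply (b x : L) : (fr.lmulB m b).1 x = b * x := rfl

theorem multiChoose_single (l : Fin n) (i j : ℕ) :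
    multiChoose (single l i + single l j) (single l i) = (i + j).choose i := by
  rw [multiChoose, Finset.prod_eq_single l]
  · simp
  · grind
  · exact fun h => absurd (mem_univ l) h

theorem del_mul_del (l : Fin n) (i j : ℕ) :
    fr.del l i * fr.del l j = (i + j).choose i • fr.del l (i + j) := by
  rw [del_eq, del_eq, del_eq, hsCoeff_taylor_mul, multiChoose_single, single_add]

theorem del_commute (l l' : Fin n) (i j : ℕ) : Commute (fr.del l i) (fr.del l' j) := by
  rw [del_eq, del_eq, Commute, SemiconjBy, hsCoeff_taylor_mul, hsCoeff_taylor_mul, add_comm (single l' j)]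
  congr 1
  exact prod_congr rfl fun x _ => Nat.choose_symm_of_eq_add rfl

theorem isDivPow_delB {Z : Type*} [Ring Z] (hZ : (p : Z) = 0) (f : BerthelotD p k fr.S m →+* Z) :
    IsDivPow (p ^ m) fun l i => f (fr.delB m l i) where
  zero l := by
    rw [← map_one f]; refine congrArg f (Subtype.ext ?_); rw [delB_coe (Nat.zero_le _), (isCoordinateHS_del.1 l).1]
    rfl
  comm l l' i j hi hj := by
    refine Commute.map (f := f) (Subtype.ext ?_)
    change (fr.delB m l i).1 * (fr.delB m l' j).1 = (fr.delB m l' j).1 * (fr.delB m l i).1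
    rw [delB_coe hi, delB_coe hj]; exact del_commute l l' i j
  mul_lt l i j h := by
    rw [← map_mul, ← map_natCast f, ← map_mul, ← nsmul_eq_mul]; refine congrArg f (Subtype.ext ?_)
    change (fr.delB m l i).1 * (fr.delB m l j).1 = (i + j).choose i • (fr.delB m l (i + j)).1
    rw [delB_coe (by omega), delB_coe (by omega), delB_coe h.le, del_mul_del]
  mul_ge l i j hi hj h := by
    have h1 : (i + j).choose (p ^ m) • (fr.delB m l i * fr.delB m l j) =
        (i + j).choose i • (fr.delB m l (i + j - p ^ m) * fr.delB m l (p ^ m)) := by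
      refine Subtype.ext ?_; change (i + j).choose (p ^ m) • ((fr.delB m l i).1 * (fr.delB m l j).1) =
        (i + j).choose i • ((fr.delB m l (i + j - p ^ m)).1 * (fr.delB m l (p ^ m)).1)
      rw [delB_coe hi.le, delB_coe hj.le, delB_coe (by omega), delB_coe le_rfl, del_mul_del,
        del_mul_del, Nat.sub_add_cancel h, smul_comm, Nat.choose_symm h]
    have h2 := congrArg f h1
    rw [nsmul_eq_mul, nsmul_eq_mul, map_mul, map_mul, map_mul, map_mul, map_natCast, map_natCast] at h2
    obtain ⟨s, hs⟩ := exists_eq_add_of_le h; rwa [show ((i + j).choose (p ^ m) : Z) = 1 by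
      rw [hs]; exact natCast_choose_eq_one hZ (by omega), one_mul] at h2

theorem delB_mul_lmulB {l : Fin n} {i : ℕ} (hi : i ≤ p ^ m) (b : L) :
    fr.delB m l i * fr.lmulB m b = ∑ ij ∈ antidiagonal i, fr.lmulB m (fr.del l ij.1 b) * fr.delB m l ij.2 := by
  refine Subtype.ext (LinearMap.ext fun x => ?_)
  refine (congrArg (fun g : Module.End (W k) L => g (b * x)) (delB_coe hi)).trans ?_
  rw [(isCoordinateHS_del.1 l).2 i le_top]
  have h1 : (∑ ij ∈ antidiagonal i, fr.lmulB m (fr.del l ij.1 b) * fr.delB m l ij.2).1 x = ∑ ij ∈ antidiagonal i,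
        (fr.lmulB m (fr.del l ij.1 b) * fr.delB m l ij.2).1 x :=
    (DFunLike.congr_fun (map_sum (BerthelotD p k fr.S m).val _ _) x).trans (LinearMap.sum_apply _ _ _)
  rw [h1]
  refine sum_congr rfl fun ij hij => ?_
  refine congrArg (fun g : Module.End (W k) L => fr.del l ij.1 b * g x) ?_
  exact (delB_coe ((le_add_self.trans (mem_antidiagonal.1 hij).le).trans hi)).symm

theorem closure_eq_top (m : ℕ) : Subring.closure (Set.range (fr.lmulB m) ∪
    {z | ∃ l, ∃ i ≤ p ^ m, z = fr.delB m l i}) = ⊤ := by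
  rw [eq_top_iff]
  rintro ⟨R, hR⟩ -
  induction hR using Algebra.adjoin_induction with
  | mem x hx =>
    refine Subring.subset_closure ?_; rcases hx with ⟨b, rfl⟩ | ⟨d, hd, l, i, hi, rfl⟩
    · exact Or.inl ⟨b, rfl⟩
    · refine Or.inr ⟨l, i, hi, Subtype.ext ?_⟩
      exact (congrFun (congrFun (hd.unique fr.etale isCoordinateHS_del) l) i).trans (delB_coe hi).symm
  | algebraMap r =>
    refine Subring.subset_closure (Or.inl ⟨algebraMap _ L r, Subtype.ext (LinearMap.ext fun x => ?_)⟩)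
    rw [lmulB_apply, ← smul_def]
    rfl
  | add x y hx hy h h' => exact add_mem h h'
  | mul x y hx hy h h' => exact mul_mem h h'

theorem mem_idealP {R : BerthelotD p k fr.S m} :
    R ∈ BerthelotD.idealP p k fr.S m ↔ ∃ R', R = p * R' := mem_span_natCast_iff

theorem mk_idealP_eq_iff {R R' : BerthelotD p k fr.S m} :
    (BerthelotD.idealP p k fr.S m).ringCon.mk' R = (BerthelotD.idealP p k fr.S m).ringCon.mk' R' ↔
      ∃ R'', R - R' = p * R'' := by
  rw [← sub_eq_zero, ← map_sub, ← TwoSidedIdeal.mem_ker, ker_ringCon_mk', mem_idealP]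

theorem mk_natCast_p : (BerthelotD.idealP p k fr.S m).ringCon.mk' (p : BerthelotD p k fr.S m) = 0 := by
  rw [← TwoSidedIdeal.mem_ker, ker_ringCon_mk', mem_idealP]
  exact ⟨1, (mul_one _).symm⟩

variable (fr) in
/-- Left linear combinations of monomials on the lift. -/
def sumB (m : ℕ) : ((Fin n → ℕ) →₀ L) →+ BerthelotD p k fr.S m :=
  Finsupp.liftAddHom fun K =>
    (AddMonoidHom.mulRight (powBasis (p ^ m) (fr.delB m) K)).comp (fr.lmulB m).toAddMonoidHom

theorem sumB_apply (f : (Fin n → ℕ) →₀ L) :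
    fr.sumB m f = f.sum fun K b => fr.lmulB m b * powBasis (p ^ m) (fr.delB m) K := rfl

theorem exists_map_sumB {Y : Type*} [Ring Y] {ψ : BerthelotD p k fr.S m →+* Y} (hψ : ψ p = 0)
    (R : BerthelotD p k fr.S m) : ∃ g, ψ R = ψ (fr.sumB m g) := by
  obtain ⟨g, hg⟩ := (isDivPow_delB ((map_natCast ψ p).symm.trans hψ) ψ).exists_finsupp (pow_pos (Fact.out : p.Prime).pos m)
    (ψ.comp (fr.lmulB m)) (fun l i a hi => ⟨fun j => fr.del l j a, by
      rw [RingHom.comp_apply, ← map_mul, delB_mul_lmulB hi, map_sum]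
      exact sum_congr rfl fun ij _ => map_mul _ _ _⟩) (by
      have h1 : R ∈ Subring.closure (Set.range (fr.lmulB m) ∪
        {z | ∃ l, ∃ i ≤ p ^ m, z = fr.delB m l i}) := by rw [closure_eq_top]; trivial
      have h2 : ψ R ∈ Subring.map ψ _ := ⟨R, h1, rfl⟩; rw [RingHom.map_closure] at h2
      refine Subring.closure_mono ?_ h2
      rintro _ ⟨_, ⟨b, rfl⟩ | ⟨l, i, hi, rfl⟩, rfl⟩
      · exact Or.inl ⟨b, rfl⟩
      · exact Or.inr ⟨l, i, hi, rfl⟩)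
  refine ⟨g, ?_⟩
  rw [hg, sumB_apply, Finsupp.sum, Finsupp.sum, map_sum]
  refine sum_congr rfl fun K _ => ?_
  rw [map_mul, map_powBasis]
  rfl

theorem exists_sumB (N : ℕ) (R : BerthelotD p k fr.S m) :
    ∃ f R', R = fr.sumB m f + (p : BerthelotD p k fr.S m) ^ N * R' := by
  induction N with
  | zero => exact ⟨0, R, by rw [map_zero, zero_add, pow_zero, one_mul]⟩
  | succ N ih =>
    obtain ⟨f, R', h⟩ := ih; obtain ⟨g, hg⟩ := exists_map_sumB (fr := fr) mk_natCast_p R'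
    obtain ⟨R'', h4⟩ := mk_idealP_eq_iff.1 hg; refine ⟨f + p ^ N • g, R'', ?_⟩
    have h6 : p ^ N • fr.sumB m g = (p : BerthelotD p k fr.S m) ^ N * fr.sumB m g := by rw [nsmul_eq_mul, cast_pow]
    rw [map_add, map_nsmul, h6, h]; exact add_pow_mul_of_sub_eq p N _ h4

variable (fr) in
/-- The inclusion of Berthelot's ring into the endomorphisms of the lift. -/
def valB (m : ℕ) : BerthelotD p k fr.S m →+* Module.End (W k) L := (BerthelotD p k fr.S m).val.toRingHom

theorem dvd_of_sumB_mem {f : (Fin n → ℕ) →₀ L} (hf : fr.sumB m f ∈ BerthelotD.idealP p k fr.S m)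
    (K : Fin n → ℕ) : (p : L) ∣ f K := by
  obtain ⟨R, hR⟩ := mem_idealP.1 hf
  choose ν hν0 hν using fun K => isMultiple_powBasis (fr := fr) (p ^ m) K
  let e : (Fin n → ℕ) ≃ (Fin n →₀ ℕ) := equivFunOnFinite.symm
  obtain ⟨v, u, hu, huv⟩ := Nat.exists_eq_pow_mul_and_not_dvd (hν0 (e K)) p (Fact.out : p.Prime).ne_one
  obtain ⟨g, R', hg⟩ := exists_sumB v R
  have h1 : fr.sumB m (f - p • g) = (p : BerthelotD p k fr.S m) ^ (v + 1) * R' := by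
    rw [map_sub, map_nsmul, hR, hg, nsmul_eq_mul]; exact natCast_mul_add_sub p v _ _
  have hval : ∀ (h : (Fin n → ℕ) →₀ L) (s : Finset (Fin n → ℕ)), h.support ⊆ s → ∀ y,
      (fr.sumB m h).1 y = ∑ J ∈ s.map e.toEmbedding, (h (e.symm J) * ν J) * hsCoeff (fr.taylor id) J y := by
    intro h s hs y; rw [sumB_apply, Finsupp.sum_of_support_subset _ hs _ fun K _ => by rw [map_zero, zero_mul],
      sum_map]
    refine ((DFunLike.congr_fun (map_sum (BerthelotD p k fr.S m).val _ _) y).trans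
      (LinearMap.sum_apply _ _ _)).trans (sum_congr rfl fun J _ => ?_)
    have h2 : (powBasis (p ^ m) (fr.delB m) J).1 = powBasis (p ^ m) fr.del J := by
      refine (map_powBasis (fr.valB m) _ _ _).trans ?_; refine congrArg (fun g => (ofFn g).prod) (funext fun l => ?_)
      refine congrArg₂ (fun a b => a * b ^ (J l / p ^ m)) (delB_coe ?_) (delB_coe le_rfl)
      exact (Nat.mod_lt _ (pow_pos (Fact.out : p.Prime).pos m)).le
    change h J * (powBasis (p ^ m) (fr.delB m) J).1 y = _; rw [h2, show powBasis (p ^ m) fr.del J = _ from hν (e J)]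
    change h J * (ν (e J) • _) = h (e.symm (e J)) * _ * _; rw [Equiv.symm_apply_apply, nsmul_eq_mul, mul_assoc]
    rfl
  have h3 := dvd_of_sum_hsCoeff (s := (insert K (f - p • g).support).map e.toEmbedding)
    (c := fun J => (f - p • g) (e.symm J) * ν J) (a := p ^ (v + 1)) (fun y => by
      have h5 : p ^ (v + 1) • R' = (p : BerthelotD p k fr.S m) ^ (v + 1) * R' := by rw [nsmul_eq_mul, cast_pow]
      rw [← hval _ _ (Finset.subset_insert _ _), h1, ← h5]; refine ⟨R'.1 y, ?_⟩; rw [← cast_pow, ← nsmul_eq_mul]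
      rfl) (e K) (Finset.mem_map_of_mem _ (mem_insert_self _ _))
  rw [Equiv.symm_apply_apply, huv] at h3
  have h4 := dvd_of_dvd_mul_natCast hu h3
  rw [Finsupp.sub_apply, Finsupp.smul_apply, nsmul_eq_mul] at h4
  exact (dvd_sub_left (dvd_mul_right _ _)).1 h4

end

end

section

open WittFrame MvPowerSeries

theorem dvd_wbinom_sub [Fintype κ] {Q Q' : κ → ℚ} {K J : κ →₀ ℕ}
    (hK : IsScaled p 0 Q K) (hJ : IsScaled p 0 Q' J) :
    (p : ℤ_[p]) ∣ wbinom Q Q' - (multiChoose (K + J) K : ℤ_[p]) := by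
  have h1 := wbinom_spec (Nat.zero_le 1) hK hJ (hK.add_right 1) (hJ.add_right 1)
  obtain ⟨c, hc⟩ := dvd_multiChoose_sub (p := p) 0 (K + J) K
  rw [zero_add, pow_zero, one_smul, one_smul, smul_add] at hc
  rw [Nat.sub_zero, pow_one] at h1
  have h2 := congrArg (Int.cast (R := ℤ_[p])) hc
  push_cast at h2
  have h3 := dvd_add h1 (Dvd.intro _ ((congrArg (· * (c : ℤ_[p])) (pow_one (p : ℤ_[p])).symm).trans
    h2.symm))
  rwa [sub_add_sub_cancel] at h3

theorem IsRes.sum {ι : Type*} {s : Finset ι} {f : ι → End (W A)}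
    {g : ι → End (W R)} (h : ∀ i ∈ s, IsRes (f i) (g i)) :
    IsRes (∑ i ∈ s, f i) (∑ i ∈ s, g i) := by
  classical
  induction s using Finset.induction_on with
  | empty => exact isRes_zero
  | insert i s hi ih =>
    rw [sum_insert hi, sum_insert hi]
    exact (h i (mem_insert_self i s)).add (ih fun j hj => h j (mem_insert_of_mem hj))

theorem coeff_zero_op (l : Fin n) (i : ℕ) {c : W A} {y : L} (hy : fr.π y = c.coeff 0) :
    (fr.op l i c).coeff 0 = fr.π (fr.del l i y) := by
  have hrep : fr.Rep 0 0 (jA c) y := by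
    refine ⟨by simpa using pow_mul_mem_ghostRange 0 y, truncate_eq_iff_coeff.2 fun t ht => ?_⟩
    obtain rfl : t = 0 := by omega
    rw [cast_zero, frob_zero, fr.ι_coeff, coeff_j, hy]
  have hK : IsScaled p 0 (Pi.single l (i : ℚ)) (single l i) := fun l' => by
    by_cases h : l' = l
    · subst h; simp
    · simp [*]
  have h1 := truncate_eq_iff_coeff.1 (hrep.wop (fr.taylor id) hK) 0 (Nat.lt_succ_self 0)
  rw [cast_zero, neg_zero, frob_zero, fr.ι_coeff, ← del_eq] at h1
  refine fr.inj (Eq.trans ?_ h1)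
  rw [← coeff_j, isRes_op]
  rfl

variable (p k A) in
/-- Multiplication operators as a ring homomorphism. -/
def mulD (m : ℤ) : W A →+* DW p k A m :=
  (mulOp p A).codRestrict (DW p k A m) fun a => Subring.subset_closure (Or.inl ⟨a, rfl⟩)

theorem mulD_mem_idealI {a : W A} (ha : a ∈ filV p A N) :
    mulD p k A m a ∈ idealI p k A m N := subset_span (Or.inl ⟨a, ha, rfl⟩)

variable {m : ℕ}

theorem exists_opD (fr : CoordFrame p k A R L n) (m : ℕ) (l : Fin n) (i : ℕ) :
    ∃ P : DW p k A m, i ≤ p ^ m → P.1 = fr.op l i := by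
  by_cases h : i ≤ p ^ m
  · obtain ⟨P, hP, h1⟩ := mem_resDW.1 (tOp_single_mem_resDW (fr := fr)
      (Nat.cast_nonneg i) (by rw [zpow_natCast]; exact_mod_cast h))
    exact ⟨⟨P, hP⟩, fun _ => h1.ext (fr := fr) (isRes_op l i)⟩
  · exact ⟨0, fun h' => absurd h' h⟩

variable (fr) in
/-- The operators `{∂_l}_i`, `i ≤ p^m`. -/
def opD (m : ℕ) (l : Fin n) (i : ℕ) : DW p k A m := (exists_opD fr m l i).choose

theorem opD_coe {l : Fin n} {i : ℕ} (h : i ≤ p ^ m) : (fr.opD m l i).1 = fr.op l i :=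
  (exists_opD fr m l i).choose_spec h

theorem isRes_opD {l : Fin n} {i : ℕ} (h : i ≤ p ^ m) :
    IsRes (fr.opD m l i).1 (fr.tOp id (Pi.single l (i : ℚ))) := by
  rw [opD_coe h]
  exact isRes_op l i

theorem isScaled_single (l : Fin n) (i : ℕ) :
    IsScaled p 0 (Pi.single l (i : ℚ)) (single l i) := fun l' => by
  by_cases h : l' = l
  · subst h; simp
  · simp [*]

theorem exists_tOp_single_mul (l : Fin n) (i j : ℕ) : ∃ w,
    (p : ℤ_[p]) ∣ w - ((i + j).choose i : ℕ) ∧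
    fr.tOp id (Pi.single l i) * fr.tOp id (Pi.single l j) =
      mulOp p R (zp p R w) * fr.tOp id (Pi.single l ((i + j : ℕ) : ℚ)) := by
  have h1 := isScaled_single (p := p) l i
  have h2 := isScaled_single (p := p) l j
  refine ⟨wbinom (Pi.single l (i : ℚ)) (Pi.single l (j : ℚ)), ?_, ?_⟩
  · rw [← multiChoose_single l]; exact dvd_wbinom_sub h1 h2
  · rw [fr.tOp_mul id h1.scalable h2.scalable, ← Pi.single_add, ← Nat.cast_add]

theorem map_mulD_zp {Z : Type*} [Ring Z] {f : DW p k A m →+* Z}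
    (hf : ∀ P ∈ idealI p k A m 1, f P = 0) {w : ℤ_[p]} {c : ℕ} (h : (p : ℤ_[p]) ∣ w - c) :
    f (mulD p k A m (zp p A w)) = c := by
  rw [← sub_eq_zero, ← map_natCast (f.comp ((mulD p k A m).comp (zp p A))) c]
  rw [RingHom.comp_apply, RingHom.comp_apply, ← map_sub, ← map_sub, ← map_sub]
  refine hf _ (mulD_mem_idealI ?_)
  rw [filV, mem_ker_truncate]
  intro i hi
  obtain rfl : i = 0 := by omega
  obtain ⟨u, hu⟩ := h
  rw [hu, map_mul, map_natCast, mul_comm]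
  exact WittVector.mul_charP_coeff_zero _

theorem isRes_mulD_zp (w : ℤ_[p]) :
    IsRes (mulD p k A m (zp p A w)).1 (mulOp p R (zp p R w)) := by
  have h := isRes_mulOp (R := R) (zp p A w)
  rwa [j, map_zp] at h

theorem isDivPow_opD {Z : Type*} [Ring Z] {f : DW p k A m →+* Z}
    (hf : ∀ P ∈ idealI p k A m 1, f P = 0) : IsDivPow (p ^ m) fun l i => f (fr.opD m l i) where
  zero l := by
    rw [← map_one f]; refine congrArg f (Subtype.ext ((isRes_opD (Nat.zero_le _)).ext (fr := fr) ?_))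
    rw [cast_zero, Pi.single_zero, tOp_zero]; exact isRes_one
  comm l l' i j hi hj := by
    refine Commute.map (f := f) (Subtype.ext ?_); refine ((isRes_opD hi).mul (isRes_opD hj)).ext (fr := fr) ?_
    rw [(fr.tOp_commute id _ _).eq]; exact (isRes_opD hj).mul (isRes_opD hi)
  mul_lt l i j h := by
    obtain ⟨w, hw, h1⟩ := exists_tOp_single_mul (fr := fr) l i j; rw [← map_mulD_zp hf hw, ← map_mul, ← map_mul]
    refine congrArg f (Subtype.ext ?_); refine IsRes.ext (fr := fr) ?_ ((isRes_mulD_zp w).mul (isRes_opD h.le))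
    rw [← h1]; exact (isRes_opD (by omega)).mul (isRes_opD (by omega))
  mul_ge l i j hi hj h := by
    obtain ⟨w, hw, h1⟩ := exists_tOp_single_mul (fr := fr) l i j
    obtain ⟨w', hw', h1'⟩ := exists_tOp_single_mul (fr := fr) l (i + j - p ^ m) (p ^ m)
    rw [Nat.sub_add_cancel h] at h1' hw'; have h2 : mulD p k A m (zp p A w') * (fr.opD m l i * fr.opD m l j) =
        mulD p k A m (zp p A w) * (fr.opD m l (i + j - p ^ m) * fr.opD m l (p ^ m)) := by
      refine Subtype.ext ?_; refine IsRes.ext (fr := fr) ((isRes_mulD_zp w').mul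
        ((isRes_opD hi.le).mul (isRes_opD hj.le))) ?_
      rw [h1, mulOp_mul_mulOp, mul_comm, ← mulOp_mul_mulOp, ← h1']; exact (isRes_mulD_zp w).mul
        ((isRes_opD (by omega)).mul (isRes_opD le_rfl))
    have h3 := congrArg f h2; rw [map_mul f, map_mul f, map_mul f (mulD p k A m _), map_mul f, map_mulD_zp hf hw,
      map_mulD_zp hf hw'] at h3
    have hp : (p : Z) = 0 := by
      have := map_mulD_zp hf (w := 0) (by rw [zero_sub]; exact (dvd_refl _).neg_right)
      rw [← this, map_zero, map_zero, map_zero]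
    obtain ⟨s, hs⟩ := exists_eq_add_of_le h; rwa [show ((i + j).choose (i + j - p ^ m) : Z) = 1 by
      rw [Nat.choose_symm h, hs]; exact natCast_choose_eq_one hp (by omega), one_mul] at h3

theorem opD_mul_mulD {Z : Type*} [Ring Z] {f : DW p k A m →+* Z}
    (hf : ∀ P ∈ idealI p k A m 1, f P = 0) {l : Fin n} {i : ℕ} (hi : i ≤ p ^ m) (c : W A) :
    f (fr.opD m l i) * f (mulD p k A m c) = ∑ ij ∈ antidiagonal i,
      f (mulD p k A m (fr.op l ij.1 c)) * f (fr.opD m l ij.2) := by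
  let g : ℕ × ℕ → End (W R) := fun ij =>
    fr.gen (fr.taylor fun _ => l) (scl p 1 (single () ij.2) ())
      (1 * fr.wop (fr.taylor fun _ => l) (scl p 1 (single () ij.1)) (jA c))
  have hop : ∀ i, fr.tOp (fun _ => l) (fun _ => i) = fr.tOp id (Pi.single l (i : ℚ)) :=
    fun i => (fr.tOp_single_unit id l i).symm
  have h1 : fr.tOp id (Pi.single l i) * mulOp p R (jA c) -
      ∑ ij ∈ antidiagonal (p * i), g ij ∈ resI p k A R m 1 := by
    have h2 := gen_mul_mulOp_sub_mem (fr := fr)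
      (fr.isTaylor fun _ => l).1 (q := i) (by rw [zpow_natCast]; exact_mod_cast hi)
      (one_mem _) (j_mem_wd 0 c) zero_le_one zero_le_one le_rfl
      (K := single () (p * i)) fun _ => by rw [single_eq_same, Nat.cast_mul, pow_one, mul_comm]
    rw [antidiagonal_unit (p * i) fun a b =>
      fr.gen (fr.taylor fun _ => l) (scl p 1 b ()) (1 * fr.wop (fr.taylor fun _ => l)
        (scl p 1 a) (jA c))] at h2
    have h3 : fr.gen (fr.taylor fun _ => l) i 1 = fr.tOp id (Pi.single l (i : ℚ)) := by
      rw [gen_taylor, map_one, one_mul]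
    rwa [h3] at h2
  have h4 : ∑ ij ∈ antidiagonal (p * i), g ij -
      ∑ ij ∈ antidiagonal i, g (p * ij.1, p * ij.2) ∈ resI p k A R m 1 := by
    have h5 : ∑ ij ∈ antidiagonal i, g (p * ij.1, p * ij.2) =
        ∑ ij ∈ (antidiagonal (p * i)).filter fun ij => p ∣ ij.2, g ij := by
      refine Finset.sum_bij (fun ij _ => (p * ij.1, p * ij.2)) (fun ij hij => ?_) (fun a _ b _ h => ?_)
        (fun ij hij => ?_) fun _ _ => rfl
      · rw [mem_filter, mem_antidiagonal, ← mul_add, mem_antidiagonal.1 hij]; exact ⟨rfl, dvd_mul_right _ _⟩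
      · rw [Prod.mk.injEq] at h; exact Prod.ext (Nat.eq_of_mul_eq_mul_left (Fact.out : p.Prime).pos h.1)
          (Nat.eq_of_mul_eq_mul_left (Fact.out : p.Prime).pos h.2)
      · obtain ⟨h6, b, h7⟩ := mem_filter.1 hij; rw [mem_antidiagonal] at h6
        obtain ⟨a, h8⟩ : p ∣ ij.1 := (Nat.dvd_add_left ⟨b, h7⟩).1 ⟨i, h6⟩
        refine ⟨(a, b), ?_, Prod.ext h8.symm h7.symm⟩; rw [mem_antidiagonal]; rw [h7, h8, ← mul_add] at h6
        exact Nat.eq_of_mul_eq_mul_left (Fact.out : p.Prime).pos h6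
    rw [h5, ← Finset.sum_filter_add_sum_filter_not _ fun ij => p ∣ ij.2, add_sub_cancel_left]
    refine sum_mem fun ij hij => ?_
    obtain ⟨h6, h7⟩ := mem_filter.1 hij; have h9 : ij.2 ≠ 0 := fun h => h7 (h ▸ dvd_zero p)
    have h10 : den p (fun _ : Unit => scl p 1 (single () ij.2) ()) = 1 := by
      have h11 : ((ij.2 : ℕ) : ℚ) = scl p 1 (single () ij.2) () * p ^ 1 := by
        rw [← (isScaled_scl 1 (single () ij.2)) (), single_eq_same]
      rw [IsScaled.den_eq h9 h11, padicValNat.eq_zero_of_not_dvd h7]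
    refine gen_mem_resI (fr.isTaylor fun _ => l).1 ?_ ?_ ?_ h10.ge
    · refine div_pos (Nat.cast_pos.2 ?_) (pow_pos (p_pos p) _); rw [single_eq_same]; exact Nat.pos_of_ne_zero h9
    · rw [scl, single_eq_same, pow_one, div_le_iff₀ (p_pos p), zpow_natCast, mul_comm]
      exact_mod_cast (le_add_self.trans (mem_antidiagonal.1 h6).le).trans (Nat.mul_le_mul_left p hi)
    · rw [one_mul]; exact wd_mono (Nat.zero_le _) (wop_mem_wd _ _ _ (j_mem_wd 0 c))
  have h5 := add_mem h1 h4
  rw [sub_add_sub_cancel] at h5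
  obtain ⟨P', hP', h6⟩ := mem_resI.1 h5
  have h7 : IsRes (fr.opD m l i * mulD p k A m c -
      ∑ ij ∈ antidiagonal i, mulD p k A m (fr.op l ij.1 c) * fr.opD m l ij.2).1
      (fr.tOp id (Pi.single l i) * mulOp p R (jA c) -
        ∑ ij ∈ antidiagonal i, g (p * ij.1, p * ij.2)) := by
    have h8 := ((isRes_opD (fr := fr) (l := l) hi).mul (isRes_mulOp c)).add (IsRes.sum
      (f := fun ij => (mulD p k A m (fr.op l ij.1 c) * fr.opD m l ij.2).1)
      (g := fun ij => g (p * ij.1, p * ij.2))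
      (s := antidiagonal i) fun ij hij => ?_).neg
    · rw [← sub_eq_add_neg, ← sub_eq_add_neg] at h8; refine Eq.mp (congrArg (fun z => IsRes z _) ?_) h8
      have h9 := map_sum (DW p k A m).subtype
        (fun ij => mulD p k A m (fr.op l ij.1 c) * fr.opD m l ij.2)
        (antidiagonal i)
      exact congrArg (fun z => (fr.opD m l i).1 * mulOp p A c - z) h9.symm
    · have h9 : ∀ a, scl p 1 (single () (p * a)) = fun _ => (a : ℚ) := fun a => by
        funext _
        rw [scl, single_eq_same, Nat.cast_mul, pow_one, mul_div_cancel_left₀ _ (Nat.cast_ne_zero.2 (Fact.out : p.Prime).ne_zero)]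
      have h10 : g (p * ij.1, p * ij.2) = mulOp p R (jA (fr.op l ij.1 c)) * fr.tOp id (Pi.single l (ij.2 : ℚ)) := by
        change fr.gen _ (scl p 1 (single () (p * ij.2)) ())
          (1 * fr.wop _ (scl p 1 (single () (p * ij.1))) (jA c)) = _
        have h11 : fr.wop (fr.taylor fun _ => l) (fun _ : Unit => (ij.1 : ℚ)) (jA c) = jA (fr.op l ij.1 c) := by
          rw [isRes_op, ← hop, tOp_apply]
        rw [h9, h9, gen_taylor, one_mul, h11, ← hop]
      rw [h10]
      exact (isRes_mulOp _).mul (isRes_opD ((fun ij hij => (le_add_self.trans (mem_antidiagonal.1 hij).le).trans hi) ij hij))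
  have h9 := hf _ ((Subtype.ext (h7.ext (fr := fr) h6)) ▸ hP')
  rw [map_sub, map_mul, map_sum, sub_eq_zero] at h9
  rw [h9]
  exact sum_congr rfl fun ij _ => map_mul _ _ _

theorem mem_filV_of_basisSum_mem {M : ℕ}
    {c : TermIndex p n m →₀ W A}
    (hc : fr.basisSum m c ∈ idealI p k A m M) (x : TermIndex p n m) :
    c x ∈ filV p A (M - normDen p m (expo p n x.1) x.2) := by
  obtain ⟨ν, D, hν, hD⟩ := exists_dvd_of_basisSum (fr := fr) x
  set v := ν.valuation
  obtain ⟨c', h1, h2⟩ := exists_basisSum (fr := fr) hc (D + (v + M))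
  rw [← map_sub] at h2
  have h4 : (p : W R) ^ M ∣ frob p R (-normDen p m (expo p n x.1) x.2) (jA ((c - c') x)) := by
    obtain ⟨w, hw⟩ := hD _ _ fun y => idealI_apply_mem p k A m _ _ h2 y
    rw [pow_add, pow_add, mul_assoc, mul_assoc] at hw; have h6 := p_pow_mul_cancel D hw
    rw [PadicInt.unitCoeff_spec hν, map_mul (zp p R), map_pow, map_natCast, mul_comm (zp p R _), mul_assoc] at h6
    have h8 : zp p R ((PadicInt.unitCoeff hν)⁻¹ : ℤ_[p]ˣ) * zp p R (PadicInt.unitCoeff hν) = 1 := by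
      rw [← map_mul, Units.inv_mul, map_one]
    refine ⟨zp p R ((PadicInt.unitCoeff hν)⁻¹ : ℤ_[p]ˣ) * w, ?_⟩
    rw [mul_left_comm, ← p_pow_mul_cancel v h6, ← mul_assoc, h8, one_mul]
  rw [p_pow_dvd_frob_iff, ← mem_filV_iff_dvd fr.inj] at h4
  have h5 : c x - c' x ∈ filV p A (M - normDen p m (expo p n x.1) x.2) := by
    rw [mem_filV_iff_dvd fr.inj] at h4 ⊢; exact (pow_dvd_pow _ (Nat.sub_le _ _)).trans h4
  have h6 := add_mem h5 (h1 x)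
  rwa [sub_add_cancel] at h6

theorem basisOp_eq {o : Option (BasisIndex p n (m : ℤ))} {K : Fin n → ℕ}
    (h : ∀ l, expo p n o l = (K l % p ^ m : ℕ)) (a : W A) :
    normDen p m (expo p n o) (fun l => K l / p ^ m) = 0 ∧
    fr.basisOp m (o, fun l => K l / p ^ m) a = mulD p k A m a * powBasis (p ^ m) (fr.opD m) K := by
  have h0 : normDen p m (expo p n o) (fun l => K l / p ^ m) = 0 := by
    have h1 : den p (expo p n o) = 0 := Nat.le_zero.1 (IsScaled.den_le
      (K := equivFunOnFinite.symm fun l => K l % p ^ m) fun l => by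
        rw [h, pow_zero, mul_one]
        rfl)
    rw [normDen, h1, Nat.zero_max, Int.toNat_of_nonpos (by omega), ite_self]
  refine ⟨h0, Subtype.ext ((isRes_basisOp _ _ a).ext (fr := fr) ?_)⟩
  have h2 : IsRes (powBasis (p ^ m) (fr.opD m) K).1 (fr.tOp id (expo p n o) * fr.powE m fun l => K l / p ^ m) := by
    rw [← fr.tOp_eq_prod id (scalable_expo o), powE, ← ofFn_mul_prod fun l l' => (fr.tOp_commute id _ _).pow_left _]
    refine Eq.mp (congrArg (fun z => IsRes z _) (map_powBasis (DW p k A m).subtype (p ^ m) (fr.opD m) K).symm) (isRes_ofFn_prod fun l => ?_)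
    rw [h, zpow_natCast, ← cast_pow]
    exact (isRes_opD ((fun l => (Nat.mod_lt _ (pow_pos (Fact.out : p.Prime).pos m)).le) l)).mul (isRes_pow (isRes_opD le_rfl) _)
  rw [h0, cast_zero, neg_zero, frob_zero, term]
  exact (isRes_mulOp a).mul h2

end

section

open WittFrame MvPowerSeries

variable {m : ℕ}
  {L' : Type u} [CommRing L'] [Algebra (WittVector p k) L'] [IsAddTorsionFree L']
  [Module.Flat (WittVector p k) L'] {fr' : CoordFrame p k A R L' n} {T : Fin n → A}

theorem π_del_eq (hT : IsEtaleCoordinates k T) (h : ∀ l, fr.π (fr.S l) = T l)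
    (h' : ∀ l, fr'.π (fr'.S l) = T l) {y : L} {y' : L'} (hy : fr.π y = fr'.π y') (l : Fin n)
    (i : ℕ) : fr.π (fr.del l i y) = fr'.π (fr'.del l i y') := by
  obtain ⟨D, hD, hD'⟩ := exists_isCoordinateHS h
  obtain ⟨E, hE, hE'⟩ := exists_isCoordinateHS h'
  rw [← hD', ← hE', hy, hD.unique hT hE]

theorem mem_filV_one_iff {c : W A} : c ∈ filV p A 1 ↔ c.coeff 0 = 0 := by
  rw [filV, mem_ker_truncate]
  exact ⟨fun h => h 0 Nat.zero_lt_one, fun h i hi => by rwa [Nat.lt_one_iff.1 hi]⟩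

theorem exists_index (K : Fin n → ℕ) : ∃ o : Option (BasisIndex p n (m : ℤ)),
    ∀ l, expo p n o l = (K l % p ^ m : ℕ) := by
  obtain ⟨o, ho⟩ := exists_expo_eq (m := m) (Q := fun l => ((K l % p ^ m : ℕ) : ℚ))
    (IsScaled.scalable (K := equivFunOnFinite.symm fun l => K l % p ^ m) fun l => by
      rw [pow_zero, mul_one]
      rfl) fun l => by
      rw [zpow_natCast, ← cast_pow]; exact Nat.cast_lt.2 (Nat.mod_lt _ (pow_pos (Fact.out : p.Prime).pos m))
  exact ⟨o, fun l => congrFun ho l⟩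

theorem exists_multiindex {o : Option (BasisIndex p n (m : ℤ))} {I : Fin n → ℕ}
    (h : normDen p m (expo p n o) I = 0) : ∃ K : Fin n → ℕ,
      (∀ l, expo p n o l = (K l % p ^ m : ℕ)) ∧ I = fun l => K l / p ^ m := by
  have hp := pow_pos (Fact.out : p.Prime).pos m
  obtain ⟨J, hJ, hlt⟩ : ∃ J : Fin n → ℕ, (∀ l, expo p n o l = J l) ∧ ∀ l, J l < p ^ m := by
    rcases o with _ | i
    · exact ⟨0, fun l => by simp [expo], fun l => hp⟩
    · rw [normDen_expo_some] at h; refine ⟨i.num, fun l => ?_, fun l => ?_⟩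
      · change ((i.num l : ℕ) : ℚ) / p ^ i.den = _; rw [h, pow_zero, div_one]
      · have h1 := i.lt l; rw [h, pow_zero, div_one, zpow_natCast] at h1; exact_mod_cast h1
  refine ⟨fun l => J l + p ^ m * I l, fun l => ?_, funext fun l => ?_⟩
  · rw [hJ, Nat.add_mul_mod_self_left, Nat.mod_eq_of_lt (hlt l)]
  · rw [Nat.add_mul_div_left _ _ hp, Nat.div_eq_of_lt (hlt l), zero_add]

section

variable {X Y : Type*} [Ring X] [Ring Y] {f : DW p k A m →+* X} {g : BerthelotD p k fr'.S m →+* Y}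

variable (A fr') in
/-- The pairs of coefficients with the same reduction. -/
def pairs : Subring (W A × L') :=
  RingHom.eqLocus ((WittVector.constantCoeff (R := A)).comp (RingHom.fst (W A) L'))
    (fr'.π.comp (RingHom.snd (W A) L'))

variable (f g) in
/-- The multiplication operators attached to a pair of coefficients. -/
def pairMul : fr'.pairs A →+* X × Y :=
  ((f.comp (mulD p k A m)).prodMap (g.comp (fr'.lmulB m))).comp (fr'.pairs A).subtype

variable (fr f g) in
/-- The pair of operators `∂_l^{[i]}`. -/
def pairDel (l : Fin n) (i : ℕ) : X × Y := (f (fr.opD m l i), g (fr'.delB m l i))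

variable (hf : ∀ P ∈ idealI p k A m 1, f P = 0)
include hf

theorem isDivPow_pairDel (hY : (p : Y) = 0) : IsDivPow (p ^ m) (pairDel fr f g) where
  zero l := Prod.ext ((isDivPow_opD hf).zero l) ((isDivPow_delB hY g).zero l)
  comm l l' i j hi hj := Prod.ext ((isDivPow_opD hf).comm l l' i j hi hj)
    ((isDivPow_delB hY g).comm l l' i j hi hj)
  mul_lt l i j h := Prod.ext ((isDivPow_opD hf).mul_lt l i j h)
    ((isDivPow_delB hY g).mul_lt l i j h)
  mul_ge l i j hi hj h := Prod.ext ((isDivPow_opD hf).mul_ge l i j hi hj h)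
    ((isDivPow_delB hY g).mul_ge l i j hi hj h)

theorem pairDel_mul_pairMul (hT : IsEtaleCoordinates k T) (h : ∀ l, fr.π (fr.S l) = T l)
    (h' : ∀ l, fr'.π (fr'.S l) = T l) (l : Fin n) (i : ℕ) (a : fr'.pairs A) (hi : i ≤ p ^ m) :
    ∃ d : ℕ → fr'.pairs A, pairDel fr f g l i * pairMul f g a = ∑ ij ∈ antidiagonal i,
        pairMul f g (d ij.1) * pairDel fr f g l ij.2 := by
  refine ⟨fun t => ⟨(fr.op l t a.1.1, fr'.del l t a.1.2), ?_⟩, Prod.ext ?_ ?_⟩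
  · obtain ⟨y, hy⟩ := fr.surj (a.1.1.coeff 0)
    exact (coeff_zero_op l t hy).trans (π_del_eq hT h h' (hy.trans a.2) l t)
  · rw [Prod.fst_sum]; exact opD_mul_mulD hf hi a.1.1
  · rw [Prod.snd_sum]; have h1 := congrArg g (delB_mul_lmulB (l := l) hi a.1.2); rw [map_mul, map_sum] at h1
    exact h1.trans (sum_congr rfl fun ij _ => map_mul _ _ _)

theorem pairMul_eq_zero (hY : (p : Y) = 0) {a : fr'.pairs A} (ha : a.1.1.coeff 0 = 0) :
    pairMul f g a = 0 := by
  refine Prod.ext (hf _ (mulD_mem_idealI (mem_filV_one_iff.2 ha))) ?_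
  obtain ⟨b, hb⟩ := fr'.ker_π a.1.2 (a.2.symm.trans ha)
  change g (fr'.lmulB m a.1.2) = 0
  rw [hb, map_mul, map_mul, map_natCast, map_natCast, hY, zero_mul]

theorem exists_ringEquiv_berthelotD (hT : IsEtaleCoordinates k T) (h : ∀ l, fr.π (fr.S l) = T l)
    (h' : ∀ l, fr'.π (fr'.S l) = T l) (hf' : ∀ P, f P = 0 → P ∈ idealI p k A m 1)
    (hfs : Surjective f) (hY : (p : Y) = 0)
    (hg : ∀ P, g P = 0 → P ∈ BerthelotD.idealP p k fr'.S m) (hgs : Surjective g) :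
    ∃ e : X ≃+* Y, (∀ c b, fr'.π b = c.coeff 0 → e (f (mulD p k A m c)) = g (fr'.lmulB m b)) ∧
      ∀ l, ∀ i ≤ p ^ m, e (f (fr.opD m l i)) = g (fr'.delB m l i) := by
  have hq := pow_pos (Fact.out : p.Prime).pos m
  let G : Subring (X × Y) := Subring.closure (Set.range (pairMul f g) ∪
    {z | ∃ l, ∃ i ≤ p ^ m, z = pairDel fr f g l i})
  have hG1 : ∀ a, pairMul f g a ∈ G := fun a => Subring.subset_closure (Or.inl ⟨a, rfl⟩)
  have hG2 : ∀ l, ∀ i ≤ p ^ m, pairDel fr f g l i ∈ G := fun l i hi => Subring.subset_closure (Or.inr ⟨l, i, hi, rfl⟩)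
  have hfst : ∀ (a : fr'.pairs A) K, (pairMul f g a * powBasis (p ^ m) (pairDel fr f g) K).1 =
      f (mulD p k A m a.1.1 * powBasis (p ^ m) (fr.opD m) K) := fun a K => by
    rw [map_mul, map_powBasis f, Prod.fst_mul]; exact congrArg _ (map_powBasis (RingHom.fst X Y) _ _ _)
  have hsnd : ∀ (a : fr'.pairs A) K, (pairMul f g a * powBasis (p ^ m) (pairDel fr f g) K).2 =
      g (fr'.lmulB m a.1.2 * powBasis (p ^ m) (fr'.delB m) K) := fun a K => by
    rw [map_mul, map_powBasis g, Prod.snd_mul]; exact congrArg _ (map_powBasis (RingHom.snd X Y) _ _ _)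
  have hG3 : ∀ a K, pairMul f g a * powBasis (p ^ m) (pairDel fr f g) K ∈ G := fun a K => by
    refine mul_mem (hG1 a) (list_prod_mem fun x hx => ?_)
    obtain ⟨l, rfl⟩ := List.mem_ofFn.1 hx; exact mul_mem (hG2 l _ (Nat.mod_lt _ hq).le) (pow_mem (hG2 l _ le_rfl) _)
  refine (exists_ringEquiv_of_graph G ?_ ?_ ?_).imp fun e he =>
    ⟨fun c b hcb => he _ (hG1 ⟨(c, b), hcb.symm⟩), fun l i hi => he _ (hG2 l i hi)⟩
  · intro x; obtain ⟨P, rfl⟩ := hfs x; obtain ⟨c, -, hc⟩ := exists_basisSum (fr := fr) (idealI_zero (m : ℤ) P) 1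
    have h1 := hf _ hc; rw [map_sub, sub_eq_zero] at h1; rw [h1]
    clear h1 hc
    induction c using Finsupp.induction_linear with
    | zero => exact ⟨0, by rw [map_zero, map_zero]; exact zero_mem G⟩
    | add c c' hc hc' =>
      obtain ⟨y, hy⟩ := hc; obtain ⟨y', hy'⟩ := hc'; exact ⟨y + y', by rw [map_add, map_add]; exact add_mem hy hy'⟩
    | single x a =>
      obtain ⟨o, I⟩ := x; rw [basisSum_single]; by_cases hd : normDen p m (expo p n o) I = 0
      · obtain ⟨K, hK, rfl⟩ := exists_multiindex hd; obtain ⟨b, hb⟩ := fr'.surj (a.coeff 0)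
        refine ⟨(pairMul f g ⟨(a, b), hb.symm⟩ * powBasis (p ^ m) (pairDel fr f g) K).2, ?_⟩
        rw [(basisOp_eq hK a).2, ← hfst ⟨(a, b), hb.symm⟩ K]; exact hG3 _ _
      · refine ⟨0, ?_⟩; rw [hf _ (basisOp_mem_idealI _)]
        · exact zero_mem G
        · rw [Nat.sub_eq_zero_of_le (Nat.one_le_iff_ne_zero.2 hd), filV, mem_ker_truncate]
          exact fun i hi => absurd hi (Nat.not_lt_zero i)
  · intro y; obtain ⟨P, rfl⟩ := hgs y; have h1 : Subring.closure (Set.range (fr'.lmulB m) ∪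
        {z | ∃ l, ∃ i ≤ p ^ m, z = fr'.delB m l i}) ≤ (G.map (RingHom.snd X Y)).comap g := by
      rw [Subring.closure_le]
      rintro _ (⟨b, rfl⟩ | ⟨l, i, hi, rfl⟩)
      · exact ⟨_, hG1 ⟨(teichmuller p (fr'.π b), b), teichmuller_coeff_zero p _⟩, rfl⟩
      · exact ⟨_, hG2 l i hi, rfl⟩
    rw [closure_eq_top] at h1; obtain ⟨z, hz, h2⟩ := h1 (Subring.mem_top P); exact ⟨z.1, by rw [← h2]; exact hz⟩
  · intro z hz; obtain ⟨c, rfl⟩ := (isDivPow_pairDel hf hY).exists_finsupp hq (pairMul f g)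
      (fun l i a hi => pairDel_mul_pairMul hf hT h h' l i a hi) hz
    have h0 : (∀ K, (c K).1.1.coeff 0 = 0) →
        (c.sum fun K a => pairMul f g a * powBasis (p ^ m) (pairDel fr f g) K) = 0 := fun h0 =>
      sum_eq_zero fun K _ => by
        change pairMul f g (c K) * _ = 0; rw [pairMul_eq_zero hf hY (h0 K), zero_mul]
    suffices h3 : ((c.sum fun K a => pairMul f g a * powBasis (p ^ m) (pairDel fr f g) K).1 = 0 →
        ∀ K, (c K).1.1.coeff 0 = 0) ∧
        ((c.sum fun K a => pairMul f g a * powBasis (p ^ m) (pairDel fr f g) K).2 = 0 →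
        ∀ K, (c K).1.1.coeff 0 = 0) from
      ⟨fun h4 => by rw [h0 (h3.1 h4)]; rfl, fun h4 => by rw [h0 (h3.2 h4)]; rfl⟩
    constructor
    · intro h1 K
      choose o ho using fun K => exists_index (p := p) K
      let ix : (Fin n → ℕ) ↪ TermIndex p n m :=
        ⟨fun K => (o K, fun l => K l / p ^ m), fun K K' hK => by
          obtain ⟨h2, h3⟩ := Prod.ext_iff.1 hK
          funext l
          rw [← Nat.mod_add_div (K l) (p ^ m), ← Nat.mod_add_div (K' l) (p ^ m),
            Nat.cast_injective ((ho K l).symm.trans ((congrArg (fun o => expo p n o l) h2).trans (ho K' l))), show K l / p ^ m = K' l / p ^ m from congrFun h3 l]⟩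
      let c' := (c.mapRange (fun a => a.1.1) rfl).embDomain ix
      have h2 : f (fr.basisSum m c') = 0 := by
        rw [← h1, basisSum, Finsupp.liftAddHom_apply, Finsupp.sum_embDomain,
          Finsupp.sum_mapRange_index fun K => map_zero _, Finsupp.sum, map_sum, Finsupp.sum,
          Prod.fst_sum]
        refine sum_congr rfl fun K _ => ?_
        rw [hfst]; exact congrArg f (basisOp_eq (ho K) _).2
      have h3 := mem_filV_of_basisSum_mem (hf' _ h2) (ix K); have h4 : normDen p m (expo p n (ix K).1) (ix K).2 = 0 :=
        (basisOp_eq (fr := fr) (ho K) 0).1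
      rw [h4, Finsupp.embDomain_apply_self, Finsupp.mapRange_apply] at h3; exact mem_filV_one_iff.1 h3
    · intro h1 K; have h2 : g (fr'.sumB m (c.mapRange (fun a => a.1.2) rfl)) = 0 := by
        rw [← h1, sumB_apply, Finsupp.sum_mapRange_index fun K => by rw [map_zero, zero_mul],
          Finsupp.sum, map_sum, Finsupp.sum, Prod.snd_sum]
        exact sum_congr rfl fun K _ => (hsnd _ _).symm
      obtain ⟨b, hb⟩ := dvd_of_sumB_mem (hg _ h2) K; rw [Finsupp.mapRange_apply] at hb; refine (c K).2.trans ?_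
      change fr'.π (c K).1.2 = 0; rw [hb, map_mul, map_natCast, CharP.cast_eq_zero, zero_mul]

end

end

end CoordFrame

section

open MvPolynomial Algebra

theorem card_eq_of_dimension_eq_zero {B A ι σ : Type*} [CommRing B] [CommRing A] [Algebra B A]
    [Finite ι] [Finite σ] (P : PreSubmersivePresentation B A ι σ) (h : P.dimension = 0) :
    Nat.card ι = Nat.card σ :=
  le_antisymm (Nat.sub_eq_zero_iff_le.1 h) P.card_relations_le_card_vars_of_isFinite

theorem exists_etale_lift {B B' A : Type u} [CommRing B] [CommRing B'] [CommRing A] [Algebra B A]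
    [hA : Algebra.Etale B A] (φ : B' →+* B) (hφ : Surjective φ) {q : B'}
    (hq : RingHom.ker φ = Ideal.span {q}) :
    ∃ (L : Type u) (_ : CommRing L) (_ : Algebra B' L) (π : L →+* A), Algebra.Etale B' L ∧
      Surjective π ∧ RingHom.ker π = Ideal.span {algebraMap B' L q} ∧
      ∀ b, π (algebraMap B' L b) = algebraMap B A (φ b) := by
  classical
  obtain ⟨ι, σ, _, _, P, hP⟩ := (Algebra.Etale.iff_isStandardSmoothOfRelativeDimension_zero.1 hA).out
  have := Fintype.ofFinite σ
  choose v hv using fun j => MvPolynomial.map_surjective φ hφ (P.relation j)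
  let P₁ := PreSubmersivePresentation.naive (v := v) P.map P.map_inj
  let B₁ := MvPolynomial ι B' ⧸ Ideal.span (Set.range v)
  let d : B₁ := P₁.jacobian
  let L := Localization.Away d
  have hd : d = Ideal.Quotient.mk _ (P₁.jacobiMatrix.det) := P₁.jacobian_eq_jacobiMatrix_det
  let ev : MvPolynomial ι B' →+* A := (aeval P.val).toRingHom.comp (MvPolynomial.map φ)
  have hker : ∀ g, aeval P.val g = 0 ↔ g ∈ Ideal.span (Set.range P.relation) := fun g => by
    rw [P.span_range_relation_eq_ker, P.ker_eq_ker_aeval_val]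
    rfl
  let π₁ : B₁ →+* A := Ideal.Quotient.lift _ ev fun g hg => by
    refine (RingHom.mem_ker).1 (Ideal.span_le.2 ?_ hg)
    rintro _ ⟨j, rfl⟩
    change aeval P.val (MvPolynomial.map φ (v j)) = 0; rw [hv]; exact (hker _).2 (Ideal.subset_span ⟨j, rfl⟩)
  have hjac : π₁ d = P.jacobian := by
    have h1 : (MvPolynomial.map φ).mapMatrix P₁.jacobiMatrix = P.jacobiMatrix := by
      ext1 i j
      rw [RingHom.mapMatrix_apply, Matrix.map_apply, P.jacobiMatrix_apply,
        PreSubmersivePresentation.jacobiMatrix_naive, ← pderiv_map, hv]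
    rw [hd, P.jacobian_eq_jacobiMatrix_det, ← h1, ← RingHom.map_det, P.algebraMap_eq]
    rfl
  have hu := hjac ▸ P.jacobian_isUnit
  let π : L →+* A := IsLocalization.Away.lift d hu
  have hπ : ∀ g, π (algebraMap B₁ L (Ideal.Quotient.mk _ g)) = ev g := fun g => IsLocalization.Away.lift_eq d hu _
  have hb : ∀ b, algebraMap B' L b = algebraMap B₁ L (Ideal.Quotient.mk _ (C b)) := fun b => rfl
  refine ⟨L, inferInstance, inferInstance, π, ?_, fun a => ?_, le_antisymm (fun x hx => ?_) ?_, fun b => ?_⟩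
  · let P₂ : SubmersivePresentation B' L (Unit ⊕ ι) (Unit ⊕ σ) :=
      { toPreSubmersivePresentation := (PreSubmersivePresentation.localizationAway L d).comp P₁
        jacobian_isUnit := by
          rw [PreSubmersivePresentation.comp_jacobian_eq_jacobian_smul_jacobian,
            PreSubmersivePresentation.localizationAway_jacobian, smul_def]
          exact (IsLocalization.Away.algebraMap_isUnit d).mul (IsLocalization.Away.algebraMap_isUnit d) }
    rw [Algebra.Etale.iff_isStandardSmoothOfRelativeDimension_zero]; refine P₂.isStandardSmoothOfRelativeDimension ?_
    rw [Presentation.dimension, Nat.card_sum, Nat.card_sum,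
      card_eq_of_dimension_eq_zero P.toPreSubmersivePresentation hP, Nat.sub_self]
  · obtain ⟨g, rfl⟩ := (P.aeval_val_surjective.comp (MvPolynomial.map_surjective φ hφ)) a; exact ⟨_, hπ g⟩
  · obtain ⟨N, b, hN⟩ := IsLocalization.Away.surj d x; obtain ⟨g, rfl⟩ := Ideal.Quotient.mk_surjective b
    have h1 : ev g = 0 := by rw [← hπ, ← hN, map_mul, (RingHom.mem_ker).1 hx, zero_mul]
    have h2 := (hker _).1 h1
    have h3 : Ideal.span (Set.range P.relation) = (Ideal.span (Set.range v)).map (MvPolynomial.map φ) := by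
      rw [Ideal.map_span, ← Set.range_comp]
      exact congrArg (fun f => Ideal.span (Set.range f)) (funext fun j => (hv j).symm)
    rw [h3, Ideal.mem_map_iff_of_surjective _ (MvPolynomial.map_surjective φ hφ)] at h2; obtain ⟨g', hg', h4⟩ := h2
    have h5 : g - g' ∈ RingHom.ker (MvPolynomial.map φ) := by simp [*]
    rw [MvPolynomial.ker_map, hq, Ideal.map_span, Set.image_singleton, Ideal.mem_span_singleton] at h5
    obtain ⟨f, hf⟩ := h5
    have h6 : Ideal.Quotient.mk (Ideal.span (Set.range v)) g = Ideal.Quotient.mk _ (C q * f) := by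
      rw [← hf, Ideal.Quotient.eq, sub_sub_cancel]; exact hg'
    rw [← Ideal.mul_unit_mem_iff_mem _ ((IsLocalization.Away.algebraMap_isUnit d).pow N), hN, h6,
      map_mul, map_mul, ← hb, Ideal.mem_span_singleton]
    exact dvd_mul_right _ _
  · rw [Ideal.span_singleton_le_iff_mem, RingHom.mem_ker, hb, hπ]; change aeval P.val (MvPolynomial.map φ (C q)) = 0
    rw [map_C, (RingHom.mem_ker (f := φ)).1 (hq ▸ Ideal.mem_span_singleton_self q), map_zero, map_zero]
  · rw [hb, hπ]; change aeval P.val (MvPolynomial.map φ (C b)) = _; rw [map_C, aeval_C]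

theorem isReduced_of_etale {B A : Type u} [CommRing B] [IsDomain B] [CommRing A] [Algebra B A]
    [Algebra.Etale B A] : IsReduced A := by
  have : IsReduced (TensorProduct B (FractionRing B) A) := FormallyUnramified.isReduced_of_field (FractionRing B) _
  exact isReduced_of_injective
    (Algebra.TensorProduct.includeRight : A →ₐ[B] TensorProduct B (FractionRing B) A)
    (Algebra.TensorProduct.includeRight_injective (IsFractionRing.injective B (FractionRing B)))

end

section

variable {k A L : Type u} [Field k] [CharP k p] [PerfectRing k p]
  [CommRing A] [Algebra k A] [CommRing L] [Algebra (WittVector p k) L] {n : ℕ} {T : Fin n → A}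
  {S : Fin n → L} {π : L →+* A}

theorem exists_isEtaleLift (p : ℕ) [Fact p.Prime] [CharP k p] [PerfectRing k p]
    (hT : IsEtaleCoordinates k T) :
    ∃ (L : Type u) (_ : CommRing L) (_ : Algebra (WittVector p k) L) (S : Fin n → L) (π : L →+* A),
      IsEtaleLift p k T L S π := by
  let a1 : Algebra (MvPolynomial (Fin n) k) A := (MvPolynomial.aeval T).toRingHom.toAlgebra
  have h1 : Algebra.Etale (MvPolynomial (Fin n) k) A := hT
  let φ : MvPolynomial (Fin n) (WittVector p k) →+* MvPolynomial (Fin n) k :=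
    MvPolynomial.map WittVector.constantCoeff
  have hφ : RingHom.ker φ = Ideal.span {(p : MvPolynomial (Fin n) (WittVector p k))} := by
    rw [MvPolynomial.ker_map, WittVector.ker_constantCoeff, Ideal.map_span, Set.image_singleton, map_natCast]
  obtain ⟨L, _, _, π, h2, h3, h4, h5⟩ := exists_etale_lift (A := A) φ
    (MvPolynomial.map_surjective _ (WittVector.constantCoeff_surjective p)) hφ
  let a2 : Algebra (WittVector p k) L := Algebra.compHom L
    (MvPolynomial.C : WittVector p k →+* MvPolynomial (Fin n) (WittVector p k))
  let ψ : MvPolynomial (Fin n) (WittVector p k) →ₐ[WittVector p k] L :=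
    { algebraMap (MvPolynomial (Fin n) (WittVector p k)) L with commutes' := fun r => rfl }
  refine ⟨L, _, a2, fun l => ψ (MvPolynomial.X l), π, ?_, h3, ?_, fun c => ?_, fun l => ?_⟩
  · rw [IsEtaleCoordinates, show MvPolynomial.aeval (fun l => ψ (MvPolynomial.X l)) = ψ from
      (MvPolynomial.aeval_unique ψ).symm]
    exact RingHom.etale_algebraMap.2 h2
  · rw [h4, map_natCast]
  · refine (h5 (MvPolynomial.C c)).trans ?_; rw [MvPolynomial.map_C]; exact MvPolynomial.aeval_C T _
  · refine (h5 (MvPolynomial.X l)).trans ?_; rw [MvPolynomial.map_X]; exact MvPolynomial.aeval_X T l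

theorem IsEtaleCoordinates.isReduced {K : Type u} [Field K] [Algebra K A]
    (hT : IsEtaleCoordinates K T) : IsReduced A := by
  let a1 : Algebra (MvPolynomial (Fin n) K) A := (MvPolynomial.aeval T).toRingHom.toAlgebra
  have h1 : Algebra.Etale (MvPolynomial (Fin n) K) A := hT
  exact isReduced_of_etale (B := MvPolynomial (Fin n) K)

theorem IsEtaleCoordinates.flat {B C : Type u} [CommRing B] [CommRing C] [Algebra B C] {S : Fin n → C}
    (hS : IsEtaleCoordinates B S) : Module.Flat B C := by
  let a1 : Algebra (MvPolynomial (Fin n) B) C := (MvPolynomial.aeval S).toRingHom.toAlgebra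
  have h1 : Algebra.Etale (MvPolynomial (Fin n) B) C := hS
  have h2 : IsScalarTower B (MvPolynomial (Fin n) B) C :=
    IsScalarTower.of_algebraMap_eq fun r => (MvPolynomial.aeval_C S r).symm
  exact Module.Flat.trans B (MvPolynomial (Fin n) B) C

variable (p k) in
theorem charZero_wittVector : CharZero (WittVector p k) := by
  refine charZero_of_inj_zero fun N hN => ?_
  by_contra h
  obtain ⟨e, d, hd, rfl⟩ := Nat.exists_eq_pow_mul_and_not_dvd h p (Fact.out : p.Prime).ne_one
  rw [Nat.cast_mul, cast_pow] at hN
  rcases mul_eq_zero.1 hN with h1 | h1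
  · exact pow_ne_zero e (WittVector.p_nonzero p k) h1
  · have h2 := congrArg WittVector.constantCoeff h1; rw [map_natCast, map_zero, CharP.cast_eq_zero_iff k p] at h2
    exact hd h2

theorem isAddTorsionFree_of_flat [Module.Flat (WittVector p k) L] : IsAddTorsionFree L := by
  have := charZero_wittVector p k
  refine ⟨fun N hN x y h => ?_⟩
  refine Module.Flat.isSMulRegular_of_nonZeroDivisors (r := (N : WittVector p k))
    (mem_nonZeroDivisors_of_ne_zero (Nat.cast_ne_zero.2 hN)) ?_
  simp only [Nat.cast_smul_eq_nsmul]
  exact h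

theorem IsEtaleLift.exists_coordFrame (hL : IsEtaleLift p k T L S π) {R : Type u} [CommRing R]
    [Algebra k R] [Algebra A R] [IsScalarTower k A R] [CharP R p] [PerfectRing R p]
    (inj : Injective (algebraMap A R))
    (dense : ∀ x, ∃ (n : ℕ) (a : A), algebraMap A R a = x ^ p ^ n) :
    ∃ fr : CoordFrame p k A R L n, fr.S = S ∧ fr.π = π := by
  obtain ⟨h1, h2, h3, h4, h5⟩ := hL
  let a1 : Algebra (WittVector p k) (WittVector p R) := (WittVector.map (algebraMap k R)).toAlgebra
  have hq : ∀ (a : A) (z : WittVector p R), algebraMap A R a = z.coeff 0 ↔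
      WittVector.quotientPEquiv.symm (algebraMap A R a) =
        Ideal.Quotient.mk (Ideal.span {(p : WittVector p R)}) z := fun a z => by
    rw [RingEquiv.symm_apply_eq]
    rfl
  obtain ⟨ι, hι, -⟩ := h1.exists_lift (Ideal.span {(p : WittVector p R)})
    ((WittVector.quotientPEquiv).symm.toRingHom.comp ((algebraMap A R).comp π))
    (fun r => by
      refine (hq _ _).1 ?_; rw [h4, ← IsScalarTower.algebraMap_apply]; exact (map_coeff _ _ _).symm)
    (fun l => teichmuller p (algebraMap A R (T l))) fun l => by
      refine ((hq _ _).1 ?_).symm; rw [h5, teichmuller_coeff_zero]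
  exact ⟨{  inj := inj
            dense := dense
            π := π
            surj := h2
            ker_π := fun y hy => by
              rw [← RingHom.mem_ker, h3, Ideal.mem_span_singleton] at hy; exact hy
            ι := ι.toRingHom
            ι_coeff := fun y => ((hq _ _).2 (hι y).symm).symm
            ι_algebraMap := ι.commutes
            S := S
            etale := h1 }, rfl, rfl⟩

end

section

namespace CoordFrame

open WittFrame MvPowerSeries

variable {m : ℕ}
  {L' : Type u} [CommRing L'] [Algebra (WittVector p k) L'] [IsAddTorsionFree L']
  [Module.Flat (WittVector p k) L'] {fr' : CoordFrame p k A R L' n} {T : Fin n → A}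

theorem _root_.TwoSidedIdeal.mk'_eq_mk'_iff {E : Type*} [Ring E] {I : TwoSidedIdeal E} {x y : E} :
    I.ringCon.mk' x = I.ringCon.mk' y ↔ x - y ∈ I := by
  rw [← sub_eq_zero, ← map_sub, ← TwoSidedIdeal.mem_ker, ker_ringCon_mk']

theorem _root_.TwoSidedIdeal.mk'_eq_zero_iff {E : Type*} [Ring E] {I : TwoSidedIdeal E} {x : E} :
    I.ringCon.mk' x = 0 ↔ x ∈ I := by
  rw [← TwoSidedIdeal.mem_ker, ker_ringCon_mk']

theorem _root_.TwoSidedIdeal.sub_mem_ker {E E' : Type*} [Ring E] [Ring E'] (f : E →+* E') {x y : E}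
    (h : f x = f y) : x - y ∈ TwoSidedIdeal.ker f := by
  rw [TwoSidedIdeal.mem_ker, map_sub, h, sub_self]

variable (p k A) in
/-- The map from `D_{W(A)}^{(m)}` to the quotient of its completion by the completion of
`I^{(1)}`. -/
def toQuotient (m : ℤ) : DW p k A m →+* (DHat.ideal p k A m 1).ringCon.Quotient :=
  (DHat.ideal p k A m 1).ringCon.mk'.comp (DHat.of p k A m)

theorem toQuotient_eq_zero_iff {P : DW p k A m} :
    toQuotient p k A m P = 0 ↔ P ∈ idealI p k A m 1 :=
  TwoSidedIdeal.mk'_eq_zero_iff.trans ((TwoSidedIdeal.mem_ker _).trans mk_eq_zero_iff)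

theorem toQuotient_surjective (m : ℤ) : Surjective (toQuotient p k A m) := fun x => by
  obtain ⟨Q, rfl⟩ := (DHat.ideal p k A m 1).ringCon.mk'_surjective x
  obtain ⟨P, hP⟩ := DHat.exists_coe_eq Q 1
  exact ⟨P, TwoSidedIdeal.mk'_eq_mk'_iff.2
    (TwoSidedIdeal.sub_mem_ker (DHat.proj p k A m 1) hP.symm)⟩

set_option maxHeartbeats 1000000 in
theorem exists_ringEquiv_quotient (hT : IsEtaleCoordinates k T) (h : ∀ l, fr.π (fr.S l) = T l)
    (h' : ∀ l, fr'.π (fr'.S l) = T l) :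
    ∃ e : (DHat.ideal p k A m 1).ringCon.Quotient ≃+*
        (BerthelotD.idealP p k fr'.S m).ringCon.Quotient,
      (∀ (c : W A) (b : L') (R : BerthelotD p k fr'.S m), fr'.π b = c.coeff 0 → R.1 = Algebra.lmul (W k) L' b →
        e ((DHat.ideal p k A m 1).ringCon.mk' (DHat.of p k A m (DW.mul p k m c))) =
          (BerthelotD.idealP p k fr'.S m).ringCon.mk' R) ∧
      (∀ del, IsCoordinateHS (W k) fr'.S del → ∀ (l : Fin n) (i : ℕ), i ≤ p ^ m →
        ∀ (P : DW p k A m) (R : BerthelotD p k fr'.S m), P.1 = fr.op l i → R.1 = del l i →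
        e ((DHat.ideal p k A m 1).ringCon.mk' (DHat.of p k A m P)) =
          (BerthelotD.idealP p k fr'.S m).ringCon.mk' R) := by
  have key := exists_ringEquiv_berthelotD
    (X := (DHat.ideal p k A m 1).ringCon.Quotient)
    (Y := (BerthelotD.idealP p k fr'.S m).ringCon.Quotient)
    (g := (BerthelotD.idealP p k fr'.S m).ringCon.mk')
    (fun P hP => toQuotient_eq_zero_iff.2 hP) hT h h' (fun P hP => toQuotient_eq_zero_iff.1 hP)
    (toQuotient_surjective m) ((map_natCast _ p).symm.trans mk_natCast_p) (fun P hP => TwoSidedIdeal.mk'_eq_zero_iff.1 hP) ((BerthelotD.idealP p k fr'.S m).ringCon.mk'_surjective)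
  obtain ⟨e, he, he'⟩ := key
  refine ⟨e, fun c b R hb hR => ?_, fun del hdel l i hi P R hP hR => ?_⟩
  · obtain rfl : R = fr'.lmulB m b := Subtype.ext hR; exact he c b hb
  · have h4 := hdel.unique fr'.etale (isCoordinateHS_del)
    exact (congrArg (fun P => e (toQuotient p k A m P)) (Subtype.ext (hP.trans (opD_coe hi).symm))).trans
      ((he' l i hi).trans (congrArg (BerthelotD.idealP p k fr'.S m).ringCon.mk' (Subtype.ext (hR.trans ((congrFun (congrFun h4 l) i).trans (delB_coe hi).symm))).symm))

end CoordFrame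

end

section

variable {k A L : Type u} [Field k] [CommRing A] [Algebra k A] [CommRing L]
  [Algebra (WittVector p k) L] {n : ℕ} {T : Fin n → A} {S : Fin n → L} {π : L →+* A}

theorem isBasicOperators_trivial [Subsingleton A] (m : ℤ) :
    IsBasicOperators p k T m 0 0 0 0 := by
  have : Subsingleton (WittVector p A) := ⟨fun x y => WittVector.ext fun i => elim _ _⟩
  have h0 : ∀ (x : WittVector p A) (s : ℕ), x = verschiebung^[s] 0 := fun x s => elim _ _
  refine ⟨⟨0, ⟨fun l => ⟨LinearMap.ext fun _ => elim _ _, fun _ _ _ _ => elim _ _⟩, fun _ _ _ => elim _ _,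
    fun _ _ _ _ _ _ => elim _ _⟩, fun l q r => ⟨0, fun x => ?_, fun i hi => ?_,
    fun _ => rfl⟩⟩, fun i a x => ⟨0, h0 _ _, elim _ _⟩, fun I => ?_,
    fun i a x => ⟨0, h0 _ _, elim _ _⟩⟩
  · simp
  · let ψ : PUnit.{u + 1} →+* A :=
      { toFun := fun _ => 0
        map_one' := elim _ _
        map_mul' := fun _ _ => elim _ _
        map_zero' := rfl
        map_add' := fun _ _ => elim _ _ }
    refine ⟨PUnit, inferInstance, inferInstance, ψ, 0, ⟨inferInstance, fun a => ⟨0, elim _ _⟩, Ideal.ext fun x => ?_,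
      fun _ => elim _ _⟩, ⟨LinearMap.ext fun _ => rfl, fun _ _ _ _ => rfl⟩, fun _ _ _ => elim _ _, fun _ _ _ _ _ => rfl⟩
    rw [elim x 0]; exact iff_of_true (zero_mem _) (zero_mem _)
  · exact AddMonoidHom.ext fun _ => elim _ _

theorem IsEtaleLift.subsingleton_quotient [Subsingleton A] (hL : IsEtaleLift p k T L S π) (m : ℕ) :
    Subsingleton (BerthelotD.idealP p k S m).ringCon.Quotient := by
  have h1 : (1 : L) ∈ RingHom.ker π := elim _ _
  rw [hL.2.2.1, Ideal.mem_span_singleton] at h1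
  obtain ⟨b, hb⟩ := h1
  let β : BerthelotD p k S m := ⟨Algebra.lmul (WittVector p k) L b, Algebra.subset_adjoin (Or.inl ⟨b, rfl⟩)⟩
  have h2 : (1 : BerthelotD p k S m) = p * β := by
    refine Subtype.ext (LinearMap.ext fun x => ?_)
    have h3 := congrArg (· * x) hb; rw [one_mul, mul_assoc, ← nsmul_eq_mul] at h3; refine h3.trans ?_
    rw [← nsmul_eq_mul]
    rfl
  have h3 : (1 : (BerthelotD.idealP p k S m).ringCon.Quotient) = 0 := by
    rw [← map_one (BerthelotD.idealP p k S m).ringCon.mk', h2, ← TwoSidedIdeal.mem_ker, ker_ringCon_mk']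
    exact TwoSidedIdeal.mul_mem_right _ _ _ (subset_span rfl)
  exact subsingleton_of_zero_eq_one h3.symm

theorem subsingleton_dHat [Subsingleton A] (m : ℤ) : Subsingleton (DHat p k A m) := by
  have hW : Subsingleton (WittVector p A) := ⟨fun x y => WittVector.ext fun i => elim _ _⟩
  have hE : Subsingleton (End (WittVector p A)) := ⟨fun f g => AddMonoidHom.ext fun _ => elim _ _⟩
  have hX : ∀ N, Subsingleton (idealI p k A m N).ringCon.Quotient := fun N =>
    ((idealI p k A m N).ringCon.mk'_surjective).subsingleton
  exact ⟨fun f g => Subtype.ext (elim _ _)⟩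

theorem isExpansion_trivial [Subsingleton A] {m : ℤ}
    {frac : BasisIndex p n m → WittVector p A → DW p k A m} {pow : (Fin n → ℕ) → DW p k A m}
    {head : (Fin n → ℕ) → WittVector p A → DW p k A m} {Q : DHat p k A m}
    {a : (Fin n → ℕ) → WittVector p A} {α : (Fin n → ℕ) → BasisIndex p n m → WittVector p A}
    {B : (Fin n → ℕ) → DHat p k A m} : IsExpansion p k frac pow head Q a α B := by
  have hD := subsingleton_dHat (p := p) (k := k) (A := A) m
  have h : ∀ {ι : Type} (f : ι → DHat p k A m) (x : DHat p k A m), HasSum f x := fun f x => by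
    rw [elim f fun _ => 0, elim x 0]
    exact hasSum_zero
  exact ⟨fun I => h _ _, h _ _⟩

theorem IsEtaleLift.exists_ringEquiv_trivial [Subsingleton A] (hL : IsEtaleLift p k T L S π)
    (m : ℤ) : ∃ _ : (DHat.ideal p k A m 1).ringCon.Quotient ≃+*
      (BerthelotD.idealP p k S m.toNat).ringCon.Quotient, True := by
  have h1 := hL.subsingleton_quotient m.toNat
  have hD := subsingleton_dHat (p := p) (k := k) (A := A) m
  have hQ := ((DHat.ideal p k A m 1).ringCon.mk'_surjective).subsingleton
  exact ⟨{ toFun := fun _ => 0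
           invFun := fun _ => 0
           left_inv := fun _ => elim _ _
           right_inv := fun _ => elim _ _
           map_mul' := fun _ _ => elim _ _
           map_add' := fun _ _ => elim _ _ }, trivial⟩

end

end

end WittDiff

end

set_option maxHeartbeats 4000000 in
open WittDiff in
theorem mainTheorem12 {p : ℕ} [Fact p.Prime] {k : Type u} [Field k] [CharP k p] [PerfectField k]
    {A : Type u} [CommRing A] [Algebra k A] {n : ℕ} (T : Fin n → A)
    (hT : WittDiff.IsEtaleCoordinates k T) (m : ℤ) :
    (∃ (op : Fin n → ℚ → AddMonoid.End (WittVector p A))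
        (frac : WittDiff.BasisIndex p n m → WittVector p A → WittDiff.DW p k A m)
        (pow : (Fin n → ℕ) → WittDiff.DW p k A m)
        (head : (Fin n → ℕ) → WittVector p A → WittDiff.DW p k A m),
      WittDiff.IsBasicOperators p k T m op frac pow head ∧
      -- existence and uniqueness of the expansion
      (∀ Q : WittDiff.DHat p k A m, ∃ (a : (Fin n → ℕ) → WittVector p A)
          (α : (Fin n → ℕ) → WittDiff.BasisIndex p n m → WittVector p A)
          (B : (Fin n → ℕ) → WittDiff.DHat p k A m),
          WittDiff.IsExpansion p k frac pow head Q a α B ∧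
          (∀ N : ℕ, ∀ᶠ I in cofinite, a I ∈ WittDiff.filV p A N) ∧
          Tendsto B cofinite (𝓝 0) ∧
          ∀ a' α' B', WittDiff.IsExpansion p k frac pow head Q a' α' B' → a' = a ∧ α' = α) ∧
      -- the reduction modulo `I^{(1)}`
      (0 ≤ m → (∃ (L : Type u) (_ : CommRing L) (_ : Algebra (WittVector p k) L) (S : Fin n → L)
          (π : L →+* A), WittDiff.IsEtaleLift p k T L S π) ∧
        ∀ (L : Type u) [CommRing L] [Algebra (WittVector p k) L] (S : Fin n → L) (π : L →+* A),
          WittDiff.IsEtaleLift p k T L S π →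
          ∃ e : (WittDiff.DHat.ideal p k A m 1).ringCon.Quotient ≃+*
              (WittDiff.BerthelotD.idealP p k S m.toNat).ringCon.Quotient,
            (∀ (c : WittVector p A) (b : L) (R : WittDiff.BerthelotD p k S m.toNat),
              π b = c.coeff 0 → R.1 = Algebra.lmul (WittVector p k) L b →
              e ((WittDiff.DHat.ideal p k A m 1).ringCon.mk'
                  (WittDiff.DHat.of p k A m (WittDiff.DW.mul p k m c))) =
                (WittDiff.BerthelotD.idealP p k S m.toNat).ringCon.mk' R) ∧
            (∀ del, WittDiff.IsCoordinateHS (WittVector p k) S del → ∀ (l : Fin n) (i : ℕ), i ≤ p ^ m.toNat →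
              ∀ (P : WittDiff.DW p k A m) (R : WittDiff.BerthelotD p k S m.toNat),
              P.1 = op l i → R.1 = del l i →
              e ((WittDiff.DHat.ideal p k A m 1).ringCon.mk' (WittDiff.DHat.of p k A m P)) =
                (WittDiff.BerthelotD.idealP p k S m.toNat).ringCon.mk' R))) ∧
    -- the action on `W(A)` is faithful
    Function.Injective (WittDiff.DHat.toEnd p k A m) := by
  obtain ⟨L₀, _, _, S₀, π₀, hL₀⟩ := exists_isEtaleLift p hT
  rcases subsingleton_or_nontrivial A with hA | hA
  · have hW : Subsingleton (WittVector p A) := ⟨fun x y => WittVector.ext fun i => Subsingleton.elim _ _⟩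
    have hD := subsingleton_dHat (p := p) (k := k) (A := A) m
    have hE : ∀ Q : DHat p k A m, ∃ (a : (Fin n → ℕ) → WittVector p A)
        (α : (Fin n → ℕ) → BasisIndex p n m → WittVector p A) (B : (Fin n → ℕ) → DHat p k A m),
        IsExpansion p k 0 0 0 Q a α B ∧ (∀ N : ℕ, ∀ᶠ I in cofinite, a I ∈ filV p A N) ∧
        Tendsto B cofinite (𝓝 0) ∧
        ∀ a' α' B', IsExpansion p k 0 0 0 Q a' α' B' → a' = a ∧ α' = α := fun Q =>
      ⟨0, 0, 0, isExpansion_trivial, fun N => Eventually.of_forall fun I => zero_mem _,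
        tendsto_const_nhds, fun a' α' B' _ => ⟨Subsingleton.elim _ _, Subsingleton.elim _ _⟩⟩
    refine ⟨⟨0, 0, 0, 0, isBasicOperators_trivial m, hE, fun hm => ⟨⟨L₀, _, _, S₀, π₀, hL₀⟩, fun L _ _ S π hL => ?_⟩⟩,
      Function.injective_of_subsingleton _⟩
    have h1 := hL.subsingleton_quotient m.toNat; obtain ⟨e, -⟩ := hL.exists_ringEquiv_trivial m
    exact ⟨e, fun _ _ _ _ _ => Subsingleton.elim _ _, fun _ _ _ _ _ _ _ _ _ => Subsingleton.elim _ _⟩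
  · have hchar : CharP A p := charP_of_injective_algebraMap (algebraMap k A).injective p
    have hred : IsReduced A := hT.isReduced
    let a1 : Algebra A (PerfectClosure A p) := (PerfectClosure.of A p).toAlgebra
    let a2 : Algebra k (PerfectClosure A p) := ((PerfectClosure.of A p).comp (algebraMap k A)).toAlgebra
    have hst : IsScalarTower k A (PerfectClosure A p) := IsScalarTower.of_algebraMap_eq fun _ => rfl
    have hinj : Function.Injective (algebraMap A (PerfectClosure A p)) := fun x y h =>
      (PerfectClosure.eq_iff A p (0, x) (0, y)).1 h
    have hdense : ∀ x : PerfectClosure A p, ∃ (n : ℕ) (a : A),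
        algebraMap A (PerfectClosure A p) a = x ^ p ^ n := fun x => by
      obtain ⟨⟨n, a⟩, rfl⟩ := PerfectClosure.mk_surjective A p x; refine ⟨n, a, ?_⟩
      rw [← iterate_frobenius, PerfectClosure.iterate_frobenius_mk]
      rfl
    have hflat := hL₀.1.flat; have htf : IsAddTorsionFree L₀ := isAddTorsionFree_of_flat (p := p) (k := k)
    have hT₀ := hL₀.2.2.2.2; obtain ⟨fr, rfl, rfl⟩ := hL₀.exists_coordFrame hinj hdense
    refine ⟨⟨fr.op, fun i => fr.basisOp m (some i, 0), fr.pow m, fun I => fr.basisOp m (none, I),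
      CoordFrame.isBasicOperators hT₀ m, fun Q => ?_,
      fun hm => ⟨⟨L₀, _, _, _, _, hL₀⟩, fun L _ _ S π hL => ?_⟩⟩, fr.toEnd_injective m⟩
    · obtain ⟨a, α, B, h1, h2, h3⟩ := CoordFrame.exists_isExpansion (fr := fr) Q
      exact ⟨a, α, B, h1, h2, h3, fun a' α' B' h => CoordFrame.isExpansion_unique h1 h⟩
    · obtain ⟨m, rfl⟩ := Int.eq_ofNat_of_zero_le hm; have hflat' := hL.1.flat
      have htf' : IsAddTorsionFree L := isAddTorsionFree_of_flat (p := p) (k := k); have hT' := hL.2.2.2.2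
      obtain ⟨fr', rfl, rfl⟩ := hL.exists_coordFrame hinj hdense
      exact CoordFrame.exists_ringEquiv_quotient hT hT₀ hT'
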